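/- **Setting.** Let $L$ be an even lattice of signature $(b,2)$, $V=L\otimes\mathbb R$ with bilinear form $(\cdot,\cdot)$, $q(x)=(x,x)/2$ and $x^2=(x,x)$. Fix an orthogonal basis $e_1,\dots,e_{b+2}$ of $V$ with $e_j^2=1$ for $j\le b$ and $e_{b+1}^2=e_{b+2}^2=-1$. Let $\mathrm{Gr}(L)$ be the set of negative definite planes in $V$, $z_0=\langle e_{b+1},e_{b+2}\rangle$, and $G=\mathrm{SO}(V)$. For a non-degenerate subspace $W$ write $v_W$ for the orthogonal projection of $v$ to $W$; for $v=(v_1,v_2)\in V^2$ put $q(v)=\tfrac12((v_i,v_j))_{i,j}$ and $v_W=((v_1)_W,(v_2)_W)$, and for $v,\delta\in V^2$ write $(v,\delta)=(v_1,\delta_1)+(v_2,\delta_2)$. Let $e(t)=e^{2\pi i t}$ and let $\mathbb H_2\ni\tau=x+iy$ be the Siegel upper half-space of genus $2$. Suppose that $L$ splits off a hyperbolic plane: let $u,u'\in L$ with $u^2=u'^2=0$, $(u,u')=1$, let $U=\mathbb Zu\oplus\mathbb Zu'$ and $M=L\cap\{u,u'\}^\perp$, so that $L=M\oplus U$. The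 orthogonal projection identifies the discriminant groups $D_L=L'/L\cong D_M=M'/M$, and hence $\mathbb C[D_L^2]$ with $\mathbb C[D_M^2]$. Let $\langle\cdot,\cdot\rangle$ be the standard Hermitian product on this space, conjugate linear in the second argument. **Cusp forms.** Let $k=1+b/2$, and let $f:\mathbb H_2\to\mathbb C[D_L^2]$ be a Siegel cusp form of genus $2$ and weight $k$ with respect to the Weil representation $\rho_{L,2}$ of $\mathrm{Mp}_4(\mathbb Z)$: $f$ is holomorphic, $f(\gamma\tau)=\phi(\tau)^{2k}\rho_{L,2}(\gamma,\phi)f(\tau)$ for all $(\gamma,\phi)\in\mathrm{Mp}_4(\mathbb Z)$ (where $\phi(\tau)^2=\det(C\tau+D)$), and each component $f_\gamma$ has a Fourier expansion $\sum_T a_\gamma(T)\,e(\mathrm{tr}(T\tau))$ over positive definite $T$ such that $T-q(\gamma)$ is symmetric and half-integral. Here $\rho_{L,2}$ is determined on generators by $$\left(\begin{pmatrix}A&0\\0&A^{-t}\end{pmatrix},\det(A)^{1/2}\right)\mathfrak e_\gamma=\det(A)^{(2-b)/2}\,\mathfrak e_{\gamma A^{-1}},\qquad \left(\begin{pmatrix}1&B\\0&1\end{pmatrix},1\right)\mathfrak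 e_\gamma=e(\mathrm{tr}(q(\gamma)B))\,\mathfrak e_\gamma,$$ $$\left(\begin{pmatrix}0&-1\\1&0\end{pmatrix},\det(\tau)^{1/2}\right)\mathfrak e_\gamma=\frac{i^{\,2-b}}{|D_L|}\sum_{\delta\in D_L^2}e(-(\gamma,\delta))\,\mathfrak e_\delta ,$$ where $A\in\mathrm{GL}_2(\mathbb Z)$, $B$ is an integral symmetric matrix, $(-1)^{1/2}=i$, and $\det(\tau)^{1/2}$ is the holomorphic branch on $\mathbb H_2$ with value $i$ at $\tau=i\cdot 1_2$. **Polynomials.** For $\alpha=(\alpha_1,\alpha_2,\beta_1,\beta_2)\in\{1,\dots,b\}^4$ let, in the coordinates $x_{i,j}$ ($1\le i\le b+2$, $j=1,2$) of a pair of vectors, $$P_\alpha=4\sum_{\sigma,\sigma'}\mathrm{sgn}(\sigma)\,\mathrm{sgn}(\sigma')\,x_{\sigma(\alpha_1),1}\,x_{\sigma'(\alpha_2),1}\,x_{\sigma(\beta_1),2}\,x_{\sigma'(\beta_2),2},$$ where $\sigma$ runs over the permutations of the two symbols $\alpha_1,\beta_1$ and $\sigma'$ over those of $\alpha_2,\beta_2$.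 Let $g\in G$ map $z\in\mathrm{Gr}(L)$ to $z_0$. Let $w$ be the orthogonal complement of $u_z$ in $z$, $w^\perp$ the orthogonal complement of $u_{z^\perp}$ in $z^\perp$, and $g_w(v)=g(v_{w^\perp}+v_w)$. Define polynomials $P_{\alpha,g_w,h_1,h_2}$ on $g_w(V)^2$ by $$P_\alpha(g(v))=\sum_{h_1,h_2\ge0}(v_1,u_{z^\perp})^{h_1}(v_2,u_{z^\perp})^{h_2}\,P_{\alpha,g_w,h_1,h_2}(g_w(v)),$$ and put $$\mu=-u'+\frac{u_{z^\perp}}{2u_{z^\perp}^2}+\frac{u_z}{2u_z^2}.$$ **Theta functions.** With $\Delta=(\partial/\partial x)^t(\partial/\partial x)$ the $2\times2$ matrix of Euclidean Laplacians in the coordinates with respect to $(e_j)$, acting on polynomials on $V^2$, respectively on $g_w(V)^2$, define $$\Theta_{L,2}(\tau,g,P)=\det y\sum_{\lambda\in L'^2}\exp\!\Big(\!-\frac{\mathrm{tr}(\Delta y^{-1})}{8\pi}\Big)(P)(g(\lambda))\;e\big(\mathrm{tr}(q(\lambda_{z^\perp})\tau)+\mathrm{tr}(q(\lambda_z)\bar\tau)\big)\,\mathfrak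 e_{\lambda+L^2},$$ $$\Theta_{M,2}(\tau,\delta,0,g_w,P)=(\det y)^{1/2}\sum_{\lambda\in M'^2}\exp\!\Big(\!-\frac{\mathrm{tr}(\Delta y^{-1})}{8\pi}\Big)(P)(g_w(\lambda))\;e\big(\mathrm{tr}(q(\lambda_{w^\perp})\tau)+\mathrm{tr}(q(\lambda_w)\bar\tau)-(\lambda,\delta)\big)\,\mathfrak e_{\lambda+M^2},$$ and $\Theta_{M,2}(\tau,g_w,P)=\Theta_{M,2}(\tau,0,0,g_w,P)$. Let $C_{1,2}\subset\mathrm{Sp}_4(\mathbb Z)$ be the Klingen parabolic subgroup of matrices with last row $(0,0,0,1)$, and define $$h_\alpha(\tau,g)=\frac{(\det y)^k}{2u_{z^\perp}^2}\sum_{r\ge1}\exp\!\Big(\!-\frac{\pi r^2}{2u_{z^\perp}^2}[y^{-1}]_{2,2}\Big)\sum_{h_1,h_2}\Big(\frac r{2i}\Big)^{h_1+h_2}[y^{-1}]_{2,1}^{h_1}[y^{-1}]_{2,2}^{h_2}\,\big\langle f(\tau),\Theta_{M,2}(\tau,(0,r\mu),0,g_w,P_{\alpha,g_w,h_1,h_2})\big\rangle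 .$$ **Theorem.** The theta series above, the series over $r\ge1$ that defines $h_\alpha(\tau,g)$, and the sum over $C_{1,2}\backslash\mathrm{Sp}_4(\mathbb Z)$ below converge absolutely. The function $h_\alpha(\cdot,g)$ is invariant under $C_{1,2}$, that is, $h_\alpha(K\tau,g)=h_\alpha(\tau,g)$ for all $K\in C_{1,2}$ and $\tau\in\mathbb H_2$. Moreover, for all $\tau\in\mathbb H_2$, and all $g\in G$ and $z\in\mathrm{Gr}(L)$ such that $g$ maps $z$ to $z_0$, $$(\det y)^k\big\langle f(\tau),\Theta_{L,2}(\tau,g,P_\alpha)\big\rangle=\frac{(\det y)^k}{2u_{z^\perp}^2}\big\langle f(\tau),\Theta_{M,2}(\tau,g_w,P_{\alpha,g_w,0,0})\big\rangle+\sum_{N\in C_{1,2}\backslash\mathrm{Sp}_4(\mathbb Z)}h_\alpha(N\tau,g).$$ -/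

import Mathlib

open Matrix

noncomputable section

namespace KM2

/-! ### The quadratic space `ℝ^{b,2}` -/

/-- Indices of the orthogonal basis `e_1, …, e_{b+2}`: `inl` for the `b` vectors of norm `1`, `inr`
for the two vectors of norm `-1`. -/
abbrev Idx (b : ℕ) : Type := Fin b ⊕ Fin 2

/-- The real quadratic space of signature `(b,2)` in coordinates with respect to `(e_j)`. -/
abbrev V (b : ℕ) : Type := Idx b → ℝ

/-- The bilinear form `(x, y)` of signature `(b,2)`. The quadratic form is `q(x) = (x, x) / 2`. -/
def form (b : ℕ) : LinearMap.BilinForm ℝ (V b) :=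
  LinearMap.mk₂ ℝ (fun x y => ∑ i : Fin b, x (Sum.inl i) * y (Sum.inl i)
      - ∑ i : Fin 2, x (Sum.inr i) * y (Sum.inr i))
    (fun x x' y => by simp only [Pi.add_apply, add_mul, Finset.sum_add_distrib]; ring)
    (fun c x y => by
      simp only [Pi.smul_apply, smul_eq_mul, mul_assoc, ← Finset.mul_sum]; ring)
    (fun x y y' => by simp only [Pi.add_apply, mul_add, Finset.sum_add_distrib]; ring)
    (fun c x y => by
      simp only [Pi.smul_apply, smul_eq_mul, mul_left_comm _ c, ← Finset.mul_sum]; ring)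

/-- The matrix `q(v) = (v, v) / 2` of a pair `v = (v_1, v_2)`. -/
def qMat {b : ℕ} (v : Fin 2 → V b) : Matrix (Fin 2) (Fin 2) ℝ :=
  Matrix.of fun i j => form b (v i) (v j) / 2

/-- The orthogonal projection `v ↦ v_W` onto a subspace `W` on which the form is non-degenerate
(that is, `W` and its orthogonal complement are complementary). -/
def orthProj {b : ℕ} (W : Submodule ℝ (V b)) : V b →ₗ[ℝ] V b :=
  open Classical in
  if h : IsCompl W ((form b).orthogonal W) then W.projection ((form b).orthogonal W) h else 0

/-- The Grassmannian of negative definite planes. -/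
def Gr (b : ℕ) : Set (Submodule ℝ (V b)) :=
  {z | Module.finrank ℝ z = 2 ∧ ∀ v ∈ z, v ≠ 0 → form b v v < 0}

/-- The base point `z_0`, the plane spanned by `e_{b+1}` and `e_{b+2}`. -/
def basePoint (b : ℕ) : Submodule ℝ (V b) :=
  Submodule.span ℝ (Set.range fun j : Fin 2 => (Pi.single (Sum.inr j) 1 : V b))

/-- The isometry group `G = SO(V)`. -/
def SOV (b : ℕ) : Set (V b ≃ₗ[ℝ] V b) :=
  {g | (∀ x y, form b (g x) (g y) = form b x y) ∧ LinearMap.det (g : V b →ₗ[ℝ] V b) = 1}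

/-! ### Even lattices, discriminant groups, and the splitting of a hyperbolic plane -/

/-- `L` is an even lattice of full rank in `ℝ^{b,2}`. -/
structure IsEvenLattice {b : ℕ} (L : Submodule ℤ (V b)) : Prop where
  exists_basis : ∃ v : Module.Basis (Idx b) ℝ (V b), L = Submodule.span ℤ (Set.range v)
  even : ∀ x ∈ L, ∃ n : ℤ, form b x x = 2 * n

/-- The dual of a lattice `Λ`, formed in its real span. -/
def dualLat {b : ℕ} (Λ : Submodule ℤ (V b)) : Submodule ℤ (V b) :=
  (form b).dualSubmodule Λ ⊓ (Submodule.span ℝ (Λ : Set (V b))).restrictScalars ℤ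

/-- The discriminant group: the dual lattice modulo the lattice. -/
abbrev Disc {b : ℕ} (Λ : Submodule ℤ (V b)) : Type :=
  dualLat Λ ⧸ Λ.submoduleOf (dualLat Λ)

/-- Elements of the group algebra `ℂ[D²]` of the square of the discriminant group, as coefficient
functions with respect to the standard basis. -/
abbrev GroupAlg {b : ℕ} (Λ : Submodule ℤ (V b)) : Type := (Fin 2 → Disc Λ) → ℂ

/-- The standard scalar product of `ℂ[D²]`, conjugate linear in the second argument. The group `D`
is finite, so this is a finite sum. -/
def pairing {b : ℕ} {Λ : Submodule ℤ (V b)} (a c : GroupAlg Λ) : ℂ :=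
  ∑ᶠ γ, a γ * (starRingEnd ℂ) (c γ)

/-- `u`, `u'` is a standard basis of a hyperbolic plane contained in `L`. -/
structure IsHyperbolicPair {b : ℕ} (L : Submodule ℤ (V b)) (u u' : V b) : Prop where
  mem : u ∈ L
  mem' : u' ∈ L
  sq : form b u u = 0
  sq' : form b u' u' = 0
  pair : form b u u' = 1

/-- The orthogonal complement `M` in `L` of the hyperbolic plane `U` spanned by `u` and `u'`. -/
def lorentz {b : ℕ} (L : Submodule ℤ (V b)) (u u' : V b) : Submodule ℤ (V b) where
  carrier := {x | x ∈ L ∧ form b x u = 0 ∧ form b x u' = 0}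
  add_mem' := by
    rintro x y ⟨hx, hx1, hx2⟩ ⟨hy, hy1, hy2⟩
    exact ⟨L.add_mem hx hy, by simp [hx1, hy1], by simp [hx2, hy2]⟩
  zero_mem' := ⟨L.zero_mem, by simp, by simp⟩
  smul_mem' := by
    rintro c x ⟨hx, hx1, hx2⟩
    exact ⟨L.smul_mem c hx, by rw [map_zsmul, LinearMap.smul_apply, hx1, smul_zero],
      by rw [map_zsmul, LinearMap.smul_apply, hx2, smul_zero]⟩

/-- The orthogonal projection of the ambient space onto the complement of the hyperbolic plane. -/
def lorentzProj {b : ℕ} (u u' : V b) : V b →ₗ[ℝ] V b :=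
  LinearMap.id - ((form b).flip u').smulRight u - ((form b).flip u).smulRight u'

theorem lorentzProj_apply {b : ℕ} (u u' x : V b) :
    lorentzProj u u' x = x - form b x u' • u - form b x u • u' := by
  simp [lorentzProj]

theorem form_comm {b : ℕ} (x y : V b) : form b x y = form b y x := by
  simp [form, mul_comm]

theorem IsEvenLattice.integral {b : ℕ} {L : Submodule ℤ (V b)} (hL : IsEvenLattice L)
    {x y : V b} (hx : x ∈ L) (hy : y ∈ L) : ∃ n : ℤ, form b x y = n := by
  obtain ⟨k, hk⟩ := hL.even _ (L.add_mem hx hy)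
  obtain ⟨l, hl⟩ := hL.even _ hx
  obtain ⟨m, hm⟩ := hL.even _ hy
  refine ⟨k - l - m, ?_⟩
  have h := form_comm y x
  simp only [map_add, LinearMap.add_apply] at hk
  push_cast
  linarith

theorem lorentzProj_mem {b : ℕ} {L : Submodule ℤ (V b)} {u u' : V b} (hL : IsEvenLattice L)
    (hU : IsHyperbolicPair L u u') {x : V b} (hx : x ∈ L) :
    lorentzProj u u' x ∈ lorentz L u u' := by
  obtain ⟨m, hm⟩ := hL.integral hx hU.mem'
  obtain ⟨n, hn⟩ := hL.integral hx hU.mem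
  have h1 := hU.sq
  have h2 := hU.sq'
  have h3 := hU.pair
  have h4 : form b u' u = 1 := by rw [form_comm]; exact h3
  rw [lorentzProj_apply]
  refine ⟨?_, ?_, ?_⟩
  · rw [hm, hn, Int.cast_smul_eq_zsmul, Int.cast_smul_eq_zsmul]
    exact L.sub_mem (L.sub_mem hx (L.smul_mem _ hU.mem)) (L.smul_mem _ hU.mem')
  · simp [h1, h4]
  · simp [h2, h3]

/-- The splitting `L = M ⊕ U`. -/
theorem lorentz_sup {b : ℕ} {L : Submodule ℤ (V b)} {u u' : V b} (hL : IsEvenLattice L)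
    (hU : IsHyperbolicPair L u u') :
    L = lorentz L u u' ⊔ Submodule.span ℤ {u, u'} := by
  apply le_antisymm
  · intro x hx
    obtain ⟨m, hm⟩ := hL.integral hx hU.mem'
    obtain ⟨n, hn⟩ := hL.integral hx hU.mem
    refine Submodule.mem_sup.2 ⟨_, lorentzProj_mem hL hU hx, m • u + n • u',
      Submodule.mem_span_pair.2 ⟨m, n, rfl⟩, ?_⟩
    rw [lorentzProj_apply, hm, hn, Int.cast_smul_eq_zsmul, Int.cast_smul_eq_zsmul]
    abel
  · refine sup_le (fun x hx => hx.1) (Submodule.span_le.2 ?_)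
    rintro x (rfl | rfl)
    exacts [hU.mem, hU.mem']

theorem lorentzProj_mem_dual {b : ℕ} {L : Submodule ℤ (V b)} {u u' : V b} (hL : IsEvenLattice L)
    (hU : IsHyperbolicPair L u u') {x : V b} (hx : x ∈ dualLat L) :
    lorentzProj u u' x ∈ dualLat (lorentz L u u') := by
  obtain ⟨hx1, hx2⟩ := hx
  refine ⟨fun m hm => ?_, ?_⟩
  · have h := hx1 m hm.1
    rw [lorentzProj_apply]
    have h1 : form b u m = 0 := by rw [form_comm]; exact hm.2.1
    have h2 : form b u' m = 0 := by rw [form_comm]; exact hm.2.2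
    simpa [h1, h2] using h
  · have hle : Submodule.span ℝ (L : Set (V b)) ≤
        (Submodule.span ℝ (lorentz L u u' : Set (V b))).comap (lorentzProj u u') :=
      Submodule.span_le.2 fun y hy => Submodule.subset_span (lorentzProj_mem hL hU hy)
    exact hle hx2

/-- The map `p : D_L → D_M` of discriminant groups induced by the orthogonal projection. -/
def discProj {b : ℕ} {L : Submodule ℤ (V b)} {u u' : V b} (hL : IsEvenLattice L)
    (hU : IsHyperbolicPair L u u') : Disc L →ₗ[ℤ] Disc (lorentz L u u') :=
  Submodule.mapQ _ _
    (((lorentzProj u u').restrictScalars ℤ).restrict fun _ hx => lorentzProj_mem_dual hL hU hx)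
    fun _ hx => lorentzProj_mem hL hU hx

/-- A `ℂ[D_M²]`-valued quantity regarded as a `ℂ[D_L²]`-valued one, through the identification of
the group algebras induced by `p`. -/
def toGroupAlg {b : ℕ} {L : Submodule ℤ (V b)} {u u' : V b} (hL : IsEvenLattice L)
    (hU : IsHyperbolicPair L u u') (a : GroupAlg (lorentz L u u')) : GroupAlg L :=
  fun γ => a fun j => discProj hL hU (γ j)

/-! ### The Siegel upper half-space, the symplectic group, the Klingen subgroup -/

/-- The Siegel upper half-space of genus `2`. -/
def Siegel : Set (Matrix (Fin 2) (Fin 2) ℂ) :=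
  {τ | τᵀ = τ ∧ (τ.map Complex.im).PosDef}

/-- `Sp_4(ℤ)`. -/
abbrev Sp4 : Type := Matrix.symplecticGroup (Fin 2) ℤ

/-- The entries of an integral matrix as complex numbers. -/
abbrev toC (A : Matrix (Fin 2) (Fin 2) ℤ) : Matrix (Fin 2) (Fin 2) ℂ := A.map fun n => (n : ℂ)

/-- The action `M · τ = (A τ + B) (C τ + D)⁻¹`. -/
def act (M : Sp4) (τ : Matrix (Fin 2) (Fin 2) ℂ) : Matrix (Fin 2) (Fin 2) ℂ :=
  (toC M.val.toBlocks₁₁ * τ + toC M.val.toBlocks₁₂) *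
    (toC M.val.toBlocks₂₁ * τ + toC M.val.toBlocks₂₂)⁻¹

/-- The Klingen parabolic subgroup: the matrices in `Sp_4(ℤ)` with last row `(0, 0, 0, 1)`. -/
def klingen : Subgroup Sp4 where
  carrier := {M | (Pi.single (Sum.inr 1) 1 : Fin 2 ⊕ Fin 2 → ℤ) ᵥ* M.val = Pi.single (Sum.inr 1) 1}
  one_mem' := Matrix.vecMul_one _
  mul_mem' := by
    intro M N hM hN
    change _ ᵥ* (M.val * N.val) = _
    rw [← Matrix.vecMul_vecMul]
    exact (congrArg (· ᵥ* N.val) hM).trans hN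
  inv_mem' := by
    intro M hM
    have h : M.val * (M⁻¹ : Sp4).val = 1 := congrArg Subtype.val (mul_inv_cancel M)
    have h2 := congrArg (· ᵥ* (M⁻¹ : Sp4).val) hM
    simp only [Matrix.vecMul_vecMul, h, Matrix.vecMul_one] at h2
    exact h2.symm

theorem mem_klingen {M : Sp4} : M ∈ klingen ↔
    ∀ j, M.val (Sum.inr 1) j = if j = Sum.inr 1 then 1 else 0 := by
  change (Pi.single (Sum.inr 1) 1 : Fin 2 ⊕ Fin 2 → ℤ) ᵥ* M.val = Pi.single (Sum.inr 1) 1 ↔ _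
  rw [funext_iff]
  simp [Pi.single_apply]

/-- The coset space of the Klingen subgroup acting on `Sp_4(ℤ)` by left multiplication. -/
abbrev KlingenCosets : Type := Quotient (QuotientGroup.rightRel klingen)

/-! ### The Weil representation and Siegel cusp forms -/

/-- `e(t) = exp(2 π i t)`. -/
def e (t : ℂ) : ℂ := Complex.exp (2 * Real.pi * Complex.I * t)

/-- Representatives in the dual lattice of a pair of classes. -/
def rep {b : ℕ} {Λ : Submodule ℤ (V b)} (γ : Fin 2 → Disc Λ) : Fin 2 → V b :=
  fun j => ((γ j).out : dualLat Λ)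

/-- The graph of the genus `2` Weil representation of `Mp_4(ℤ)` on `ℂ[D_L²]`: `IsWeil L M φ ρ` says
that `(M, φ)` lies in `Mp_4(ℤ)`, where `φ` is a holomorphic square root of `det (C τ + D)`, and acts
by `ρ`. It is given on the standard generators and extended multiplicatively. -/
inductive IsWeil {b : ℕ} (L : Submodule ℤ (V b)) :
    Sp4 → (Matrix (Fin 2) (Fin 2) ℂ → ℂ) → (GroupAlg L → GroupAlg L) → Prop
  /-- The element with blocks `A, 0, 0, A^{-t}` sends `𝔢_γ` to a multiple of `𝔢_{γ A⁻¹}`. -/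
  | levi (M : Sp4) (A : GL (Fin 2) ℤ)
      (hM : M.val =
        Matrix.fromBlocks A.val 0 0 (A⁻¹).valᵀ) :
      IsWeil L M (fun _ => (A.val.det : ℂ) ^ (1 / 2 : ℂ))
        (fun a γ => (A.val.det : ℂ) ^ ((2 - (b : ℂ)) / 2) * a fun j => ∑ i, A.val i j • γ i)
  /-- The translation by an integral symmetric matrix `B`. -/
  | transl (M : Sp4) (B : Matrix (Fin 2) (Fin 2) ℤ)
      (hM : M.val = Matrix.fromBlocks 1 B 0 1) :
      IsWeil L M (fun _ => 1)
        (fun a γ => e (((qMat (rep γ)).map (fun x => (x : ℂ)) * toC B).trace) * a γ)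
  /-- The inversion. The holomorphic branch of `(det τ)^{1/2}` is the one with value
  `(-1)^{1/2} = i` at `τ = i`, written with principal square roots in the upper half-plane. -/
  | inversion :
      IsWeil L (SymplecticGroup.symJ (Fin 2) ℤ)
        (fun τ => (τ 0 0) ^ (1 / 2 : ℂ) * (τ.det / τ 0 0) ^ (1 / 2 : ℂ))
        (fun a γ => Complex.I ^ (2 - (b : ℤ)) / (Nat.card (Disc L) : ℂ) *
          ∑ᶠ δ, e (-(∑ j, form b (rep γ j) (rep δ j) : ℝ)) * a δ)
  | mul {M N : Sp4} {φ ψ : Matrix (Fin 2) (Fin 2) ℂ → ℂ} {ρ σ : GroupAlg L → GroupAlg L}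
      (hM : IsWeil L M φ ρ) (hN : IsWeil L N ψ σ) :
      IsWeil L (M * N) (fun τ => φ (act N τ) * ψ τ) (fun a => ρ (σ a))

/-- `T` is a symmetric half-integral matrix. -/
def IsHalfIntegral (T : Matrix (Fin 2) (Fin 2) ℝ) : Prop :=
  Tᵀ = T ∧ (∀ i, ∃ n : ℤ, T i i = n) ∧ ∀ i j, ∃ n : ℤ, 2 * T i j = n

/-- Siegel cusp forms of genus `2` and weight `k = 1 + b/2` with respect to the Weil representation
of `L`. The automorphy factor `det (C τ + D)^k` is `φ(τ)^{2k}`, where `2k = b + 2`. -/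
structure IsSiegelCuspForm {b : ℕ} (L : Submodule ℤ (V b))
    (f : Matrix (Fin 2) (Fin 2) ℂ → GroupAlg L) : Prop where
  holomorphic : ∀ γ, DifferentiableOn ℂ (fun t : Fin 3 → ℂ => f !![t 0, t 1; t 1, t 2] γ)
    {t | !![t 0, t 1; t 1, t 2] ∈ Siegel}
  modular : ∀ M φ ρ, IsWeil L M φ ρ → ∀ τ ∈ Siegel, f (act M τ) = φ τ ^ (b + 2) • ρ (f τ)
  cusp : ∃ a : (Fin 2 → Disc L) → Matrix (Fin 2) (Fin 2) ℝ → ℂ,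
    (∀ γ T, a γ T ≠ 0 → T.PosDef ∧ IsHalfIntegral (T - qMat (rep γ))) ∧
    ∀ τ ∈ Siegel, ∀ γ,
      HasSum (fun T => a γ T * e ((T.map (fun x => (x : ℂ)) * τ).trace)) (f τ γ)

/-! ### Polynomials -/

/-- Complex polynomials in the coordinates `x_{i,j}` of a pair of vectors of `ℝ^{b,2}`. -/
abbrev Pol (b : ℕ) : Type := MvPolynomial (Idx b × Fin 2) ℂ

/-- The value of a polynomial at a pair of vectors. -/
def evalPol {b : ℕ} (P : Pol b) (v : Fin 2 → V b) : ℂ :=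
  MvPolynomial.eval (fun p => ((v p.2 p.1 : ℝ) : ℂ)) P

/-- The operator `tr(Δ Y)`, where `Δ = (∂/∂x)ᵗ (∂/∂x)`. -/
def lapOp {b : ℕ} (Y : Matrix (Fin 2) (Fin 2) ℝ) (P : Pol b) : Pol b :=
  ∑ i : Idx b, ∑ j : Fin 2, ∑ k : Fin 2,
    MvPolynomial.C (Y j k : ℂ) * MvPolynomial.pderiv (i, j) (MvPolynomial.pderiv (i, k) P)

/-- The operator `exp(-tr(Δ Y) / 8π)`. The series is finite: `tr(Δ Y)` lowers degrees by two. -/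
def expLap {b : ℕ} (Y : Matrix (Fin 2) (Fin 2) ℝ) (P : Pol b) : Pol b :=
  ∑ m ∈ Finset.range (P.totalDegree + 1),
    MvPolynomial.C ((((m.factorial : ℝ)⁻¹ * (-1 / (8 * Real.pi)) ^ m : ℝ)) : ℂ) *
      (lapOp Y)^[m] P

/-- The polynomial `P_α`, for `α = (α₁, α₂, β₁, β₂)`. The permutation `σ` permutes `α₁, β₁` and the
permutation `σ'` permutes `α₂, β₂`. -/
def polAlpha {b : ℕ} (α₁ α₂ β₁ β₂ : Fin b) : Pol b :=
  4 * ∑ σ : Equiv.Perm (Fin 2), ∑ σ' : Equiv.Perm (Fin 2),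
    ((Equiv.Perm.sign σ * Equiv.Perm.sign σ' : ℤˣ) : ℤ) •
      (MvPolynomial.X (Sum.inl (![α₁, β₁] (σ 0)), 0) *
        MvPolynomial.X (Sum.inl (![α₂, β₂] (σ' 0)), 0) *
        MvPolynomial.X (Sum.inl (![α₁, β₁] (σ 1)), 1) *
        MvPolynomial.X (Sum.inl (![α₂, β₂] (σ' 1)), 1))

/-! ### The data attached to a plane `z` and an isotropic vector `u` -/

/-- The orthogonal complement of `z`. -/
abbrev perp {b : ℕ} (z : Submodule ℝ (V b)) : Submodule ℝ (V b) := (form b).orthogonal z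

/-- `w`, the orthogonal complement of `u_z` in `z`. -/
def wNeg {b : ℕ} (z : Submodule ℝ (V b)) (u : V b) : Submodule ℝ (V b) :=
  z ⊓ (form b).orthogonal (Submodule.span ℝ {orthProj z u})

/-- `w^⊥`, the orthogonal complement of `u_{z^⊥}` in `z^⊥`. -/
def wPos {b : ℕ} (z : Submodule ℝ (V b)) (u : V b) : Submodule ℝ (V b) :=
  perp z ⊓ (form b).orthogonal (Submodule.span ℝ {orthProj (perp z) u})

/-- The linear map `g_w(v) = g(v_{w^⊥} + v_w)`. -/
def gw {b : ℕ} (g : V b ≃ₗ[ℝ] V b) (z : Submodule ℝ (V b)) (u : V b) : V b →ₗ[ℝ] V b :=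
  (g : V b →ₗ[ℝ] V b) ∘ₗ (orthProj (wPos z u) + orthProj (wNeg z u))

/-- The norm `u_{z^⊥}²`. -/
def normPos {b : ℕ} (z : Submodule ℝ (V b)) (u : V b) : ℝ :=
  form b (orthProj (perp z) u) (orthProj (perp z) u)

/-- The vector `μ = -u' + u_{z^⊥} / 2 u_{z^⊥}² + u_z / 2 u_z²`. -/
def mu {b : ℕ} (z : Submodule ℝ (V b)) (u u' : V b) : V b :=
  -u' + (2 * normPos z u)⁻¹ • orthProj (perp z) u
    + (2 * form b (orthProj z u) (orthProj z u))⁻¹ • orthProj z u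

/-- The polynomial `P_{g_w,h₁,h₂}` in the decomposition
`P(g(v)) = ∑ (v₁, u_{z^⊥})^{h₁} (v₂, u_{z^⊥})^{h₂} P_{g_w,h₁,h₂}(g_w(v))`, for a polynomial `P` which
does not depend on the negative coordinates. It is the coefficient of `S₁^{h₁} S₂^{h₂}` after
substituting `S_j g(u_{z^⊥}) / u_{z^⊥}² + π(x_j)` for `x_j`, where `S_j` stands for the inner product
with `g(u_{z^⊥})` and `π = g_w ∘ g⁻¹` is the orthogonal projection onto the image of `g_w`. As a
polynomial on pairs of vectors it is the pullback under `π` of a polynomial on the image of `g_w`. This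
projection is also orthogonal for the Euclidean metric, so the Laplacian of the pullback is the
pullback of the Laplacian of the image of `g_w`. -/
def polW {b : ℕ} (P : Pol b) (g : V b ≃ₗ[ℝ] V b) (z : Submodule ℝ (V b)) (u : V b) (h₁ h₂ : ℕ) :
    Pol b :=
  MvPolynomial.coeff (Finsupp.single 0 h₁ + Finsupp.single 1 h₂)
    (MvPolynomial.aeval (fun p : Idx b × Fin 2 =>
      (MvPolynomial.C (MvPolynomial.C ((g (orthProj (perp z) u) p.1 / normPos z u : ℝ) : ℂ)) *
          MvPolynomial.X p.2
        + MvPolynomial.C (∑ k : Idx b,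
            MvPolynomial.C ((gw g z u (g.symm (Pi.single k 1)) p.1 : ℝ) : ℂ) *
              MvPolynomial.X (k, p.2)) : MvPolynomial (Fin 2) (Pol b))) P)

/-! ### Siegel theta functions of genus two -/

/-- The summand at `l` of the theta series with polynomial `P`, isometry `G`, and projections `pp`
and `pm` to the positive and the negative part. -/
def thetaTerm {b : ℕ} (G pp pm : V b →ₗ[ℝ] V b) (P : Pol b) (τ : Matrix (Fin 2) (Fin 2) ℂ)
    (δ ν : Fin 2 → V b) (l : Fin 2 → V b) : ℂ :=
  evalPol (expLap (τ.map Complex.im)⁻¹ P) (fun j => G (l j + ν j)) *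
    e (((qMat fun j => pp (l j + ν j)).map (fun x => (x : ℂ)) * τ).trace
      + ((qMat fun j => pm (l j + ν j)).map (fun x => (x : ℂ)) * τ.map (starRingEnd ℂ)).trace
      - ((∑ j, form b (l j + (1 / 2 : ℝ) • ν j) (δ j) : ℝ) : ℂ))

/-- The pairs of vectors of the dual lattice in the class `γ`. -/
abbrev Coset {b : ℕ} (Λ : Submodule ℤ (V b)) (γ : Fin 2 → Disc Λ) : Type :=
  {l : Fin 2 → dualLat Λ // ∀ j, Submodule.Quotient.mk (l j) = γ j}

/-- The summands of the `γ`-component of the theta series attached to the lattice `Λ`. -/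
def thetaSummand {b : ℕ} (Λ : Submodule ℤ (V b)) (G pp pm : V b →ₗ[ℝ] V b) (P : Pol b)
    (τ : Matrix (Fin 2) (Fin 2) ℂ) (δ ν : Fin 2 → V b) (γ : Fin 2 → Disc Λ) (l : Coset Λ γ) : ℂ :=
  thetaTerm G pp pm P τ δ ν fun j => (l.val j : V b)

/-- The genus `2` Siegel theta function of a lattice `Λ` of signature `(b⁺, b⁻)`, with prefactor
`(det y)^s`, where `s = b⁻ / 2`. -/
def theta {b : ℕ} (Λ : Submodule ℤ (V b)) (G pp pm : V b →ₗ[ℝ] V b) (s : ℝ) (P : Pol b)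
    (τ : Matrix (Fin 2) (Fin 2) ℂ) (δ ν : Fin 2 → V b) : GroupAlg Λ :=
  fun γ => (((τ.map Complex.im).det ^ s : ℝ) : ℂ) * ∑' l, thetaSummand Λ G pp pm P τ δ ν γ l

/-- `Θ_{L,2}(τ, δ, ν, g, P)`, for a lattice of signature `(b,2)`, where `g` maps `z` to `z_0`. -/
def thetaL {b : ℕ} (L : Submodule ℤ (V b)) (g : V b ≃ₗ[ℝ] V b) (z : Submodule ℝ (V b))
    (P : Pol b) (τ : Matrix (Fin 2) (Fin 2) ℂ) (δ ν : Fin 2 → V b) : GroupAlg L :=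
  theta L g (orthProj (perp z)) (orthProj z) 1 P τ δ ν

/-- `Θ_{M,2}(τ, δ, ν, g_w, P)`, for the sublattice `M` of signature `(b-1,1)`. -/
def thetaM {b : ℕ} (L : Submodule ℤ (V b)) (u u' : V b) (g : V b ≃ₗ[ℝ] V b)
    (z : Submodule ℝ (V b)) (P : Pol b) (τ : Matrix (Fin 2) (Fin 2) ℂ) (δ ν : Fin 2 → V b) :
    GroupAlg (lorentz L u u') :=
  theta (lorentz L u u') (gw g z u) (orthProj (wPos z u)) (orthProj (wNeg z u)) (1 / 2) P τ δ ν

/-! ### The integrand and its two parts -/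

section Integrand

variable {b : ℕ} {L : Submodule ℤ (V b)} {u u' : V b} (hL : IsEvenLattice L)
  (hU : IsHyperbolicPair L u u') (f : Matrix (Fin 2) (Fin 2) ℂ → GroupAlg L)
  (α₁ α₂ β₁ β₂ : Fin b) (g : V b ≃ₗ[ℝ] V b) (z : Submodule ℝ (V b))
  (τ : Matrix (Fin 2) (Fin 2) ℂ)

/-- `(det y)^k`, where `k = 1 + b/2`. -/
def detPow (b : ℕ) (τ : Matrix (Fin 2) (Fin 2) ℂ) : ℝ :=
  (τ.map Complex.im).det ^ (1 + (b : ℝ) / 2)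

variable (L) in
/-- The integrand `(det y)^k ⟨f(τ), Θ_{L,2}(τ, g, P_α)⟩`. -/
def integrand : ℂ :=
  (detPow b τ : ℂ) * pairing (f τ) (thetaL L g z (polAlpha α₁ α₂ β₁ β₂) τ 0 0)

/-- The first part `(det y)^k / (2 u_{z^⊥}²) ⟨f(τ), Θ_{M,2}(τ, g_w, P_{α,g_w,0,0})⟩`. -/
def firstPart : ℂ :=
  (detPow b τ / (2 * normPos z u) : ℝ) * pairing (f τ) (toGroupAlg hL hU
    (thetaM L u u' g z (polW (polAlpha α₁ α₂ β₁ β₂) g z u 0 0) τ 0 0))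

/-- The `r`-th summand of the series defining `h_α(τ, g)`. The polynomials `P_{α,g_w,h₁,h₂}` vanish
unless `h₁, h₂ ≤ 2`, since `P_α` is of degree `2` in each of its two vector arguments. -/
def hTerm (r : ℕ) : ℂ :=
  (Real.exp (-(Real.pi * r ^ 2 / (2 * normPos z u)) * (τ.map Complex.im)⁻¹ 1 1) : ℂ) *
    ∑ h₁ ∈ Finset.range 3, ∑ h₂ ∈ Finset.range 3,
      ((r : ℂ) / (2 * Complex.I)) ^ (h₁ + h₂) *
        (((τ.map Complex.im)⁻¹ 1 0 : ℝ) : ℂ) ^ h₁ * (((τ.map Complex.im)⁻¹ 1 1 : ℝ) : ℂ) ^ h₂ *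
        pairing (f τ) (toGroupAlg hL hU
          (thetaM L u u' g z (polW (polAlpha α₁ α₂ β₁ β₂) g z u h₁ h₂) τ
            ![0, (r : ℝ) • mu z u u'] 0))

/-- The function `h_α(τ, g)`. -/
def hFun : ℂ :=
  (detPow b τ / (2 * normPos z u) : ℝ) *
    ∑' r : ℕ+, hTerm hL hU f α₁ α₂ β₁ β₂ g z τ r

end Integrand

end KM2

end

open KM2

/-! Deform the theta function of `L` by a characteristic `w = (w₁, w₂)` in `ℝ² × ℝ²`: shift the pair
`λ` by `w₁ u` and insert the phase `e(w₂ · (λ, u))`. Let `Ψ(τ, w)` (`psi`) be the resulting pairing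
with `f`, so that `Ψ(τ, 0)` is the integrand. Since `u` is isotropic, translations, unimodular
substitutions and the Fourier transform act on characteristics linearly, and `Ψ(Mτ, w) = Ψ(τ, wM)`
for every `M` in `Sp_4(ℤ)` (`act_mem_Siegel_and_psi_act`). It suffices to check generators
(`Sp4_induction`). For the inversion this is Poisson summation together with `integral_phi`: the
polynomial is a product of two minors, hence is multiplied by `det(A)²` under `x ↦ xA`, and so the
Schwartz function at `τ` is transformed into a multiple of the one at `-τ⁻¹`. The constant is only
known up to a positive factor, which is forced to be `1` by inverting twice (`psi_inversion`).

Now expand `Ψ` in `w`. With `λ = m + t u + n u'`, where `m` lies in the dual of `M`, the phase is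
`e(w₂ · n)`, and Poisson summation over `t` alone is a Fourier series in `w₁` (`hasSum_lineFT`). So
`Ψ(τ, w) = ∑ c_v(τ) e(-v · w)` over integral `v`, absolutely convergent by a Gaussian bound
(`exists_norm_lineFT_le`). Uniqueness of Fourier coefficients turns the transformation law into
`c_{Mv}(Mτ) = c_v(τ)`. For `v = J r` this reads `ĉ_r(Mτ) = ĉ_{rM}(τ)` (`rowCoeff_act`).

Put `w = 0`. The integrand is the sum of all `ĉ_r(τ)`. The term `r = 0` is the first part. Every
other `r` is uniquely `k (0,0,0,1) N` with `k ≥ 1` and `N` a Klingen coset (`cosetRow_bijective`),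
and its term is `ĉ_{k(0,0,0,1)}(Nτ)`. For such a row `n = 0`, so only vectors orthogonal to `u`
occur. Completing the square on the line through `u` (`quad_add_line`, `integral_phi_line`) leaves
the Gaussian on the complement, and integrating the heat operator removes exactly the Laplacian in
the direction of `u` (`lineHeat_inl`). What remains is the `k`-th summand of `h_α`
(`MapsBase.rowCoeff_smul_lastRow`).

The operators `exp(-tr(Δ y⁻¹)/8π)` are treated as heat operators, determined by their commutation
with multiplication by coordinates (`heat_X_mul`). This yields the semigroup law, the compatibility
with affine substitutions, and the integral of a polynomial against a Gaussian, each by induction on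
the polynomial. -/

namespace KM2

/-! ### Heat operators on polynomials -/

section Heat

variable {κ ι : Type*} [Fintype κ] [Fintype ι]

/-- The operator `∑ A_{pq} ∂_p ∂_q` on polynomials. -/
noncomputable def quadOp (A : Matrix κ κ ℂ) : Module.End ℂ (MvPolynomial κ ℂ) :=
  ∑ p, ∑ q, A p q • ((MvPolynomial.pderiv p : Derivation ℂ _ _).toLinearMap *
    (MvPolynomial.pderiv q : Derivation ℂ _ _).toLinearMap)

theorem quadOp_apply (A : Matrix κ κ ℂ) (Q : MvPolynomial κ ℂ) :
    quadOp A Q = ∑ p, ∑ q, A p q • MvPolynomial.pderiv p (MvPolynomial.pderiv q Q) := by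
  simp [quadOp, LinearMap.sum_apply]

/-- The operator `∑ (A_{pq} + A_{qp}) ∂_q`, the commutator of `quadOp A` with `X_p`. -/
noncomputable def gradOp (A : Matrix κ κ ℂ) (p : κ) : Module.End ℂ (MvPolynomial κ ℂ) :=
  ∑ q, (A p q + A q p) • (MvPolynomial.pderiv q : Derivation ℂ _ _).toLinearMap

theorem gradOp_apply (A : Matrix κ κ ℂ) (p : κ) (Q : MvPolynomial κ ℂ) :
    gradOp A p Q = ∑ q, (A p q + A q p) • MvPolynomial.pderiv q Q := by
  simp [gradOp, LinearMap.sum_apply]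

omit [Fintype κ] in
theorem pderiv_comm' (p q : κ) (Q : MvPolynomial κ ℂ) :
    MvPolynomial.pderiv p (MvPolynomial.pderiv q Q) =
      MvPolynomial.pderiv q (MvPolynomial.pderiv p Q) := by
  classical
  induction Q using MvPolynomial.induction_on with
  | C a => simp
  | add P Q hP hQ => simp [hP, hQ]
  | mul_X P n h =>
    simp only [Derivation.leibniz, MvPolynomial.pderiv_X, map_add, smul_eq_mul, h, Pi.single_apply]
    split_ifs <;> simp <;> ring

theorem quadOp_pderiv (A : Matrix κ κ ℂ) (r : κ) (Q : MvPolynomial κ ℂ) :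
    quadOp A (MvPolynomial.pderiv r Q) = MvPolynomial.pderiv r (quadOp A Q) := by
  simp only [quadOp_apply, map_sum, Derivation.map_smul]
  refine Finset.sum_congr rfl fun p _ => Finset.sum_congr rfl fun q _ => ?_
  rw [pderiv_comm' q r, pderiv_comm' p r]

theorem quadOp_X_mul (A : Matrix κ κ ℂ) (p : κ) (Q : MvPolynomial κ ℂ) :
    quadOp A (MvPolynomial.X p * Q) = MvPolynomial.X p * quadOp A Q + gradOp A p Q := by
  classical
  have h : ∀ r s : κ, MvPolynomial.pderiv r (MvPolynomial.pderiv s (MvPolynomial.X p * Q)) =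
      MvPolynomial.X p * MvPolynomial.pderiv r (MvPolynomial.pderiv s Q) +
      (if r = p then MvPolynomial.pderiv s Q else 0) +
      (if s = p then MvPolynomial.pderiv r Q else 0) := by
    intro r s
    simp only [Derivation.leibniz, MvPolynomial.pderiv_X, map_add, smul_eq_mul, Pi.single_apply]
    by_cases h1 : r = p <;> by_cases h2 : s = p <;>
      simp [h1, h2, eq_comm (a := p) (b := r), eq_comm (a := p) (b := s)]
  simp only [quadOp_apply, gradOp_apply, h, smul_add, Finset.sum_add_distrib, Finset.mul_sum,
    mul_smul_comm, add_smul, smul_ite, smul_zero]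
  rw [add_assoc]
  congr 2
  · rw [Finset.sum_comm]; simp
  · simp

omit [Fintype κ] in
theorem totalDegree_pderiv_le (p : κ) (Q : MvPolynomial κ ℂ) :
    (MvPolynomial.pderiv p Q).totalDegree ≤ Q.totalDegree - 1 := by
  conv_lhs => rw [Q.as_sum, map_sum]
  refine MvPolynomial.totalDegree_finsetSum_le fun s hs => ?_
  rw [MvPolynomial.pderiv_monomial]
  by_cases h : s p = 0
  · simp [h]
  refine (MvPolynomial.totalDegree_monomial_le _ _).trans ?_
  have h1 : s.degree ≤ Q.totalDegree := MvPolynomial.le_totalDegree hs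
  have h2 : (s - Finsupp.single p 1) + Finsupp.single p 1 = s :=
    tsub_add_cancel_of_le (Finsupp.single_le_iff.2 (by omega))
  have h3 := congrArg Finsupp.degree h2
  rw [map_add, Finsupp.degree_single] at h3
  change (s - Finsupp.single p 1).degree ≤ _
  omega

/-- Derivatives lower the degree, so `quadOp A` is nilpotent on each polynomial. The crude loss of
one degree per application is enough. -/
theorem totalDegree_quadOp_iterate (A : Matrix κ κ ℂ) (m : ℕ) (Q : MvPolynomial κ ℂ)
    (h : Q.totalDegree < m) : (quadOp A ^ m) Q = 0 := by
  induction m generalizing Q with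
  | zero => omega
  | succ m ih =>
    rw [pow_succ, Module.End.mul_apply]
    by_cases h0 : Q.totalDegree = 0
    · rw [MvPolynomial.totalDegree_eq_zero_iff_eq_C.1 h0]
      simp [quadOp_apply]
    · apply ih
      have hd : ∀ (p : κ) (R : MvPolynomial κ ℂ), (MvPolynomial.pderiv p R).totalDegree ≤
          R.totalDegree - 1 := fun p R => totalDegree_pderiv_le _ _
      rw [quadOp_apply]
      refine lt_of_le_of_lt (MvPolynomial.totalDegree_finsetSum_le (d := Q.totalDegree - 1)
        fun p _ => MvPolynomial.totalDegree_finsetSum_le fun q _ => ?_) (by omega)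
      refine (MvPolynomial.totalDegree_smul_le _ _).trans ((hd _ _).trans ?_)
      have := hd q Q
      omega

/-- The heat operator `exp (∑ A_{pq} ∂_p ∂_q)` on polynomials. -/
noncomputable def heat (A : Matrix κ κ ℂ) (Q : MvPolynomial κ ℂ) : MvPolynomial κ ℂ :=
  ∑ m ∈ Finset.range (Q.totalDegree + 1), ((m.factorial : ℂ)⁻¹) • (quadOp A ^ m) Q

/-- The exponential series may be truncated anywhere beyond the degree, which allows one common
truncation for several polynomials. -/
theorem heat_eq (A : Matrix κ κ ℂ) (Q : MvPolynomial κ ℂ) (n : ℕ) (h : Q.totalDegree ≤ n) :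
    heat A Q = ∑ m ∈ Finset.range (n + 1), ((m.factorial : ℂ)⁻¹) • (quadOp A ^ m) Q := by
  rw [heat]
  refine Finset.sum_subset (fun m hm => ?_) fun m _ hm => ?_
  · simp only [Finset.mem_range] at hm ⊢; omega
  · rw [totalDegree_quadOp_iterate A m Q (by simpa [Nat.lt_succ_iff] using hm), smul_zero]

@[simp] theorem heat_C (A : Matrix κ κ ℂ) (a : ℂ) :
    heat A (MvPolynomial.C a) = MvPolynomial.C a := by
  simp [heat]

theorem heat_add (A : Matrix κ κ ℂ) (P Q : MvPolynomial κ ℂ) :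
    heat A (P + Q) = heat A P + heat A Q := by
  rw [heat_eq A (P + Q) _ (MvPolynomial.totalDegree_add P Q), heat_eq A P _ (le_max_left _ _),
    heat_eq A Q _ (le_max_right _ _), ← Finset.sum_add_distrib]
  simp

theorem heat_smul (A : Matrix κ κ ℂ) (c : ℂ) (P : MvPolynomial κ ℂ) :
    heat A (c • P) = c • heat A P := by
  rw [heat_eq A (c • P) _ (MvPolynomial.totalDegree_smul_le c P), heat, Finset.smul_sum]
  refine Finset.sum_congr rfl fun m _ => ?_
  rw [map_smul, smul_comm]

theorem heat_sum {σ : Type*} (A : Matrix κ κ ℂ) (s : Finset σ) (P : σ → MvPolynomial κ ℂ) :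
    heat A (∑ i ∈ s, P i) = ∑ i ∈ s, heat A (P i) := by
  classical
  induction s using Finset.induction_on with
  | empty => simpa using heat_C A 0
  | insert i s hi h => rw [Finset.sum_insert hi, Finset.sum_insert hi, heat_add, h]

theorem heat_pderiv (A : Matrix κ κ ℂ) (r : κ) (Q : MvPolynomial κ ℂ) :
    heat A (MvPolynomial.pderiv r Q) = MvPolynomial.pderiv r (heat A Q) := by
  have h : ∀ m : ℕ, (quadOp A ^ m) (MvPolynomial.pderiv r Q) =
      MvPolynomial.pderiv r ((quadOp A ^ m) Q) := by
    intro m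
    induction m with
    | zero => rfl
    | succ m ih => rw [pow_succ', Module.End.mul_apply, ih, quadOp_pderiv, Module.End.mul_apply]
  rw [heat_eq A (MvPolynomial.pderiv r Q) Q.totalDegree
    ((totalDegree_pderiv_le _ _).trans (Nat.sub_le _ _)), heat, map_sum]
  exact Finset.sum_congr rfl fun m _ => by rw [Derivation.map_smul, h]

/-- The commutator `gradOp A p` of `quadOp A` with `X_p` commutes with `quadOp A`, so commuting
`X_p` past a power behaves like differentiating the power. -/
theorem quadOp_pow_X_mul (A : Matrix κ κ ℂ) (p : κ) (Q : MvPolynomial κ ℂ) (m : ℕ) :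
    (quadOp A ^ (m + 1)) (MvPolynomial.X p * Q) = MvPolynomial.X p * (quadOp A ^ (m + 1)) Q +
      ((m : ℂ) + 1) • gradOp A p ((quadOp A ^ m) Q) := by
  have hg : ∀ R, quadOp A (gradOp A p R) = gradOp A p (quadOp A R) := fun R => by
    simp only [gradOp_apply, map_sum, map_smul, quadOp_pderiv]
  induction m with
  | zero => simp [quadOp_X_mul]
  | succ m ih =>
    have h1 : ∀ (n : ℕ) R, (quadOp A ^ (n + 1)) R = quadOp A ((quadOp A ^ n) R) := fun n R => by
      rw [pow_succ', Module.End.mul_apply]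
    rw [h1, ih, map_add, quadOp_X_mul, map_smul, hg, h1 (m + 1), h1 m, add_assoc]
    congr 1
    push_cast
    module

/-- The exponentiated commutator relation `exp(D) X = (X + [D, X]) exp(D)`. Together with linearity
and the values on constants it determines the heat operator, and it drives all later inductions. -/
theorem heat_X_mul (A : Matrix κ κ ℂ) (p : κ) (Q : MvPolynomial κ ℂ) :
    heat A (MvPolynomial.X p * Q) = MvPolynomial.X p * heat A Q + gradOp A p (heat A Q) := by
  have hd : (MvPolynomial.X p * Q).totalDegree ≤ Q.totalDegree + 1 :=
    (MvPolynomial.totalDegree_mul _ _).trans (by rw [MvPolynomial.totalDegree_X]; omega)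
  have h3 : ∀ m : ℕ, (((m + 1).factorial : ℂ)⁻¹) • ((m : ℂ) + 1) • gradOp A p ((quadOp A ^ m) Q) =
      ((m.factorial : ℂ)⁻¹) • gradOp A p ((quadOp A ^ m) Q) := fun m => by
    rw [smul_smul, Nat.factorial_succ]
    congr 1
    have : (m : ℂ) + 1 ≠ 0 := Nat.cast_add_one_ne_zero m
    have := Nat.factorial_ne_zero m
    push_cast
    field_simp
  have h1 : MvPolynomial.X p * heat A Q = MvPolynomial.X p *
      ∑ m ∈ Finset.range (Q.totalDegree + 1 + 1), ((m.factorial : ℂ)⁻¹) • (quadOp A ^ m) Q := by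
    rw [← heat_eq A Q _ (Nat.le_succ _)]
  rw [heat_eq A _ _ hd, h1, heat, Finset.sum_range_succ', Finset.sum_range_succ' _ (Q.totalDegree + 1)]
  simp only [quadOp_pow_X_mul, smul_add, Finset.sum_add_distrib, mul_add, Finset.mul_sum, map_sum,
    map_smul, mul_smul_comm, h3]
  simp
  ring

theorem heat_mul_X (A : Matrix κ κ ℂ) (p : κ) (Q : MvPolynomial κ ℂ) :
    heat A (Q * MvPolynomial.X p) = heat A Q * MvPolynomial.X p + gradOp A p (heat A Q) := by
  rw [mul_comm, heat_X_mul, mul_comm]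

/-- Both sides have the same commutation rule with `X_p`, because `gradOp` is additive in the
matrix. -/
theorem heat_heat (A B : Matrix κ κ ℂ) (Q : MvPolynomial κ ℂ) :
    heat A (heat B Q) = heat (A + B) Q := by
  induction Q using MvPolynomial.induction_on with
  | C a => simp
  | add P Q hP hQ => simp [heat_add, hP, hQ]
  | mul_X P p h =>
    have h4 : heat A (gradOp B p (heat B P)) = gradOp B p (heat A (heat B P)) := by
      simp only [gradOp_apply, heat_sum, heat_smul, heat_pderiv]
    rw [heat_mul_X, heat_add, heat_mul_X, heat_mul_X, ← h, h4]
    simp only [gradOp_apply, Matrix.add_apply, add_smul, Finset.sum_add_distrib]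
    ring

/-- The affine substitution `X_p ↦ ∑ W_{pq} X_q + v_p`. -/
noncomputable def affSubst (W : Matrix κ ι ℂ) (v : κ → ℂ) :
    MvPolynomial κ ℂ →ₐ[ℂ] MvPolynomial ι ℂ :=
  MvPolynomial.aeval fun p => ∑ q, W p q • MvPolynomial.X q + MvPolynomial.C (v p)

omit [Fintype κ] in
theorem affSubst_X (W : Matrix κ ι ℂ) (v : κ → ℂ) (p : κ) :
    affSubst W v (MvPolynomial.X p) = ∑ q, W p q • MvPolynomial.X q + MvPolynomial.C (v p) := by
  simp [affSubst]

omit [Fintype κ] in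
theorem eval_affSubst (W : Matrix κ ι ℂ) (v : κ → ℂ) (x : ι → ℂ) (Q : MvPolynomial κ ℂ) :
    MvPolynomial.eval x (affSubst W v Q) = MvPolynomial.eval (W *ᵥ x + v) Q := by
  induction Q using MvPolynomial.induction_on with
  | C a => simp [affSubst]
  | add P Q hP hQ => simp [hP, hQ]
  | mul_X P p h =>
    simp [affSubst_X, h, Matrix.mulVec, dotProduct]

theorem pderiv_affSubst (W : Matrix κ ι ℂ) (v : κ → ℂ) (s : ι) (Q : MvPolynomial κ ℂ) :
    MvPolynomial.pderiv s (affSubst W v Q) = ∑ q, W q s • affSubst W v (MvPolynomial.pderiv q Q) := by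
  classical
  induction Q using MvPolynomial.induction_on with
  | C a => simp [affSubst]
  | add P Q hP hQ => simp [hP, hQ, Finset.sum_add_distrib]
  | mul_X P p h =>
    simp only [map_mul, Derivation.leibniz, h, affSubst_X, map_add, map_sum, Derivation.map_smul,
      MvPolynomial.pderiv_X, smul_eq_mul, Pi.single_apply, MvPolynomial.pderiv_C, add_zero,
      smul_add, Finset.sum_add_distrib, Finset.mul_sum, apply_ite (affSubst W v), mul_ite,
      map_zero, smul_ite, smul_zero, mul_zero, mul_one, Finset.sum_ite_eq, Finset.sum_ite_eq',
      Finset.mem_univ, if_true, mul_smul_comm]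

/-- By the chain rule, `W B Wᵗ` is the second order operator that becomes `B` after substituting
along `W`. Applied below to inclusions of coordinates, to lines, to projections, and to `x ↦ xA`. -/
theorem affSubst_heat (W : Matrix κ ι ℂ) (v : κ → ℂ) (B : Matrix ι ι ℂ) (Q : MvPolynomial κ ℂ) :
    affSubst W v (heat (W * B * Wᵀ) Q) = heat B (affSubst W v Q) := by
  induction Q using MvPolynomial.induction_on with
  | C a => simp [affSubst]
  | add P Q hP hQ => simp [heat_add, hP, hQ]
  | mul_X P p h =>
    have h1 : affSubst W v (gradOp (W * B * Wᵀ) p (heat (W * B * Wᵀ) P)) =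
        ∑ r, W p r • gradOp B r (heat B (affSubst W v P)) := by
      rw [← h]
      simp only [gradOp_apply, map_sum, map_smul, pderiv_affSubst, Finset.smul_sum, smul_smul]
      have h5 : ∀ q, (W * B * Wᵀ) p q + (W * B * Wᵀ) q p =
          ∑ r, ∑ s, W p r * (B r s + B s r) * W q s := by
        intro q
        simp only [Matrix.mul_apply, Matrix.transpose_apply, Finset.sum_mul, mul_add, add_mul,
          Finset.sum_add_distrib]
        congr 1
        · rw [Finset.sum_comm]
        · refine Finset.sum_congr rfl fun _ _ => Finset.sum_congr rfl fun _ _ => ?_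
          ring
      simp only [h5, Finset.sum_smul]
      rw [Finset.sum_comm]
      refine Finset.sum_congr rfl fun r _ => ?_
      rw [Finset.sum_comm]
      refine Finset.sum_congr rfl fun s _ => Finset.sum_congr rfl fun q _ => ?_
      rw [mul_assoc]
    rw [heat_mul_X, map_add, h1, map_mul, map_mul, h, affSubst_X, mul_add, mul_add, heat_add,
      mul_comm _ (MvPolynomial.C (v p)), mul_comm _ (MvPolynomial.C (v p)),
      ← MvPolynomial.smul_eq_C_mul, ← MvPolynomial.smul_eq_C_mul, heat_smul, Finset.mul_sum,
      Finset.mul_sum, heat_sum]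
    simp only [mul_smul_comm, heat_smul, heat_mul_X, smul_add, Finset.sum_add_distrib]
    ring

theorem quadOp_smul (c : ℂ) (A : Matrix κ κ ℂ) : quadOp (c • A) = c • quadOp A := by
  simp [quadOp, Finset.smul_sum, smul_smul]

end Heat

/-- The matrix of the operator `-tr(Δ Y) / 8π` for pairs of vectors with coordinates in `I`. -/
noncomputable def lapMat (I : Type*) [DecidableEq I] (Y : Matrix (Fin 2) (Fin 2) ℂ) :
    Matrix (I × Fin 2) (I × Fin 2) ℂ :=
  kroneckerMap (· * ·) (1 : Matrix I I ℂ) ((-1 / (8 * Real.pi) : ℂ) • Y)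

theorem expLap_eq_heat {b : ℕ} (Y : Matrix (Fin 2) (Fin 2) ℝ) (P : Pol b) :
    expLap Y P = heat (lapMat (Idx b) (Y.map fun x => (x : ℂ))) P := by
  have h1 : ∀ Q : Pol b, lapOp Y Q =
      quadOp (kroneckerMap (· * ·) (1 : Matrix (Idx b) (Idx b) ℂ) (Y.map fun x => (x : ℂ))) Q := by
    intro Q
    simp only [lapOp, quadOp_apply, Fintype.sum_prod_type, kroneckerMap_apply, Matrix.one_apply,
      Matrix.map_apply, ite_mul, one_mul, zero_mul, ite_smul, zero_smul]
    refine Finset.sum_congr rfl fun i _ => Finset.sum_congr rfl fun j _ => ?_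
    rw [Finset.sum_comm]
    refine Finset.sum_congr rfl fun k _ => ?_
    rw [Finset.sum_ite_eq, if_pos (Finset.mem_univ _), MvPolynomial.smul_eq_C_mul]
  have h2 : ∀ m : ℕ, (lapOp Y)^[m] P = (quadOp (kroneckerMap (· * ·) (1 : Matrix (Idx b) (Idx b) ℂ)
      (Y.map fun x => (x : ℂ))) ^ m) P := by
    intro m
    induction m with
    | zero => rfl
    | succ m ih =>
      rw [Function.iterate_succ_apply', ih, h1, pow_succ', Module.End.mul_apply]
  have h3 : lapMat (Idx b) (Y.map fun x => (x : ℂ)) = (-1 / (8 * Real.pi) : ℂ) •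
      kroneckerMap (· * ·) (1 : Matrix (Idx b) (Idx b) ℂ) (Y.map fun x => (x : ℂ)) := by
    ext p q; simp [lapMat]; ring
  rw [expLap, heat, h3]
  refine Finset.sum_congr rfl fun m _ => ?_
  rw [h2, quadOp_smul, smul_pow, LinearMap.smul_apply, smul_smul, MvPolynomial.smul_eq_C_mul]
  push_cast
  rfl

end KM2

namespace KM2

/-! ### Polynomials times Gaussians -/

section Gauss

open MeasureTheory

variable {κ : Type*} [Fintype κ]

/-- An arbitrarily weak Gaussian growth dominates any polynomial. In the induction half of the rate
is spent on the factor `X_p`. -/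
theorem norm_eval_le_exp (Q : MvPolynomial κ ℂ) {δ : ℝ} (hδ : 0 < δ) :
    ∃ C : ℝ, 0 ≤ C ∧ ∀ x : κ → ℂ,
      ‖MvPolynomial.eval x Q‖ ≤ C * Real.exp (δ * ∑ p, ‖x p‖ ^ 2) := by
  induction Q using MvPolynomial.induction_on generalizing δ with
  | C a =>
    refine ⟨‖a‖, norm_nonneg _, fun x => ?_⟩
    rw [MvPolynomial.eval_C]
    exact le_mul_of_one_le_right (norm_nonneg _) (Real.one_le_exp (by positivity))
  | add P Q hP hQ =>
    obtain ⟨C, hC, h1⟩ := hP hδ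
    obtain ⟨D, hD, h2⟩ := hQ hδ
    refine ⟨C + D, by positivity, fun x => ?_⟩
    rw [map_add, add_mul]
    exact (norm_add_le _ _).trans (add_le_add (h1 x) (h2 x))
  | mul_X P p h =>
    obtain ⟨C, hC, h1⟩ := h (half_pos hδ)
    refine ⟨C * (1 + 2 / δ), by positivity, fun x => ?_⟩
    rw [map_mul, MvPolynomial.eval_X, norm_mul]
    -- From `|x| ≤ 1 + |x|²` and `1 + s ≤ exp s` with `s = δ/2 ∑ |x_q|²`; the factor `2/δ` restores
    -- the coefficient of the sum.
    have h2 : ‖x p‖ ≤ (1 + 2 / δ) * Real.exp (δ / 2 * ∑ q, ‖x q‖ ^ 2) := by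
      have h3 : ‖x p‖ ^ 2 ≤ ∑ q, ‖x q‖ ^ 2 :=
        Finset.single_le_sum (f := fun q => ‖x q‖ ^ 2) (fun _ _ => by positivity)
          (Finset.mem_univ p)
      have h4 := Real.add_one_le_exp (δ / 2 * ∑ q, ‖x q‖ ^ 2)
      have h5 : ‖x p‖ ≤ 1 + ‖x p‖ ^ 2 := by nlinarith [sq_nonneg (‖x p‖ - 1)]
      have h6 : (1 + 2 / δ) * (δ / 2 * ∑ q, ‖x q‖ ^ 2 + 1) =
          1 + ∑ q, ‖x q‖ ^ 2 + 2 / δ + δ / 2 * ∑ q, ‖x q‖ ^ 2 := by field_simp; ring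
      have h7 : (1 + 2 / δ) * (δ / 2 * ∑ q, ‖x q‖ ^ 2 + 1) ≤
          (1 + 2 / δ) * Real.exp (δ / 2 * ∑ q, ‖x q‖ ^ 2) := by gcongr
      have h8 : 0 ≤ 2 / δ + δ / 2 * ∑ q, ‖x q‖ ^ 2 := by positivity
      linarith
    calc _ ≤ (C * Real.exp (δ / 2 * ∑ q, ‖x q‖ ^ 2)) *
          ((1 + 2 / δ) * Real.exp (δ / 2 * ∑ q, ‖x q‖ ^ 2)) := by gcongr; exact h1 x
      _ = C * (1 + 2 / δ) * (Real.exp (δ / 2 * ∑ q, ‖x q‖ ^ 2 + δ / 2 * ∑ q, ‖x q‖ ^ 2)) := by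
        rw [Real.exp_add]; ring
      _ = _ := by ring_nf

/-- Gaussian decay of a function on a real coordinate space. -/
def GaussDecay (F : (κ → ℝ) → ℂ) : Prop :=
  ∃ C ε : ℝ, 0 < ε ∧ ∀ x, ‖F x‖ ≤ C * Real.exp (-ε * ∑ p, x p ^ 2)

theorem integrable_exp_neg_sq {ε : ℝ} (hε : 0 < ε) :
    Integrable fun x : κ → ℝ => Real.exp (-ε * ∑ p, x p ^ 2) := by
  have h : (fun x : κ → ℝ => Real.exp (-ε * ∑ p, x p ^ 2)) =
      fun x => ∏ p, Real.exp (-ε * x p ^ 2) := by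
    funext x
    rw [Finset.mul_sum, Real.exp_sum]
  rw [h]
  exact Integrable.fintype_prod (f := fun _ (t : ℝ) => Real.exp (-ε * t ^ 2))
    fun _ => integrable_exp_neg_mul_sq hε

theorem GaussDecay.integrable {F : (κ → ℝ) → ℂ} (hF : GaussDecay F) (hc : Continuous F) :
    Integrable F := by
  obtain ⟨C, ε, hε, h⟩ := hF
  exact ((integrable_exp_neg_sq hε).const_mul C).mono' hc.aestronglyMeasurable
    (Filter.Eventually.of_forall h)

/-- The vector of complex numbers underlying a real vector. -/
def cvec (t : κ → ℝ) : κ → ℂ := fun p => (t p : ℂ)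

/-- The function `exp(-π tᵗ S t + 2π ℓᵗ t)`. -/
noncomputable def gexp (S : Matrix κ κ ℂ) (l : κ → ℂ) (t : κ → ℝ) : ℂ :=
  Complex.exp (-Real.pi * (cvec t ⬝ᵥ S *ᵥ cvec t) + 2 * Real.pi * (l ⬝ᵥ cvec t))

theorem continuous_gexp (S : Matrix κ κ ℂ) (l : κ → ℂ) : Continuous (gexp S l) := by
  unfold gexp cvec
  simp only [Matrix.mulVec, dotProduct]
  fun_prop

omit [Fintype κ] in
theorem continuous_eval_cvec (Q : MvPolynomial κ ℂ) :
    Continuous fun t : κ → ℝ => MvPolynomial.eval (cvec t) Q :=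
  (MvPolynomial.continuous_eval Q).comp (by unfold cvec; fun_prop)

/-- The bound is uniform for `l` in a bounded set, as needed to differentiate under the integral
sign with respect to `l`. -/
theorem norm_gexp_le {S : Matrix κ κ ℂ} {ε : ℝ} (hε : 0 < ε)
    (hS : ∀ t : κ → ℝ, ε * ∑ p, t p ^ 2 ≤ (cvec t ⬝ᵥ S *ᵥ cvec t).re) (Q : MvPolynomial κ ℂ)
    (M : ℝ) : ∃ C : ℝ, ∀ l : κ → ℂ, (∀ p, ‖l p‖ ≤ M) → ∀ t : κ → ℝ,
      ‖MvPolynomial.eval (cvec t) Q * gexp S l t‖ ≤ C * Real.exp (-ε * ∑ p, t p ^ 2) := by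
  obtain ⟨C, hC, h⟩ := norm_eval_le_exp Q (half_pos hε)
  refine ⟨C * Real.exp (Fintype.card κ * (2 * Real.pi ^ 2 * M ^ 2 / ε)), fun l hl t => ?_⟩
  have h1 := h (cvec t)
  have h2 : ∑ p, ‖cvec t p‖ ^ 2 = ∑ p, t p ^ 2 := by simp [cvec]
  rw [h2] at h1
  have h3 : (l ⬝ᵥ cvec t).re ≤ ∑ p, M * |t p| := by
    refine (Complex.re_le_norm _).trans ((norm_sum_le _ _).trans (Finset.sum_le_sum fun p _ => ?_))
    rw [norm_mul]
    simp only [cvec, Complex.norm_real, Real.norm_eq_abs]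
    gcongr
    exact hl p
  have h4 : 2 * Real.pi * ∑ p, M * |t p| ≤
      ε / 2 * ∑ p, t p ^ 2 + Fintype.card κ * (2 * Real.pi ^ 2 * M ^ 2 / ε) := by
    rw [Finset.mul_sum, Finset.mul_sum, ← nsmul_eq_mul, ← Finset.card_univ, ← Finset.sum_const,
      ← Finset.sum_add_distrib]
    refine Finset.sum_le_sum fun p _ => ?_
    have h5 : ε / 2 * t p ^ 2 + 2 * Real.pi ^ 2 * M ^ 2 / ε - 2 * Real.pi * (M * |t p|) =
        (ε * |t p| - 2 * Real.pi * M) ^ 2 / (2 * ε) := by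
      rw [← sq_abs (t p)]; field_simp; ring
    have h6 : 0 ≤ (ε * |t p| - 2 * Real.pi * M) ^ 2 / (2 * ε) := by positivity
    linarith
  rw [norm_mul, gexp, Complex.norm_exp]
  have h7 : (-(Real.pi : ℂ) * (cvec t ⬝ᵥ S *ᵥ cvec t) + 2 * Real.pi * (l ⬝ᵥ cvec t)).re =
      -Real.pi * (cvec t ⬝ᵥ S *ᵥ cvec t).re + 2 * Real.pi * (l ⬝ᵥ cvec t).re := by
    simp [Complex.add_re, Complex.mul_re]
  rw [h7]
  have h8 := hS t
  have h9 : 0 ≤ ε * ∑ p, t p ^ 2 := mul_nonneg hε.le (Finset.sum_nonneg fun p _ => sq_nonneg _)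
  have hpi := Real.pi_gt_three
  set A := ∑ p, t p ^ 2
  set K := (Fintype.card κ : ℝ) * (2 * Real.pi ^ 2 * M ^ 2 / ε)
  -- Since `π > 3`, the quadratic form gives decay at least `2εA`. The linear term and the
  -- polynomial each use up `εA/2`, and `εA` remains.
  have h10 : -Real.pi * (cvec t ⬝ᵥ S *ᵥ cvec t).re + 2 * Real.pi * (l ⬝ᵥ cvec t).re ≤
      -2 * (ε * A) + (ε / 2 * A + K) := by
    have h11 : 2 * Real.pi * (l ⬝ᵥ cvec t).re ≤ 2 * Real.pi * ∑ p, M * |t p| := by gcongr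
    nlinarith
  calc _ ≤ (C * Real.exp (ε / 2 * A)) * Real.exp (-2 * (ε * A) + (ε / 2 * A + K)) := by
        gcongr
    _ = C * (Real.exp (ε / 2 * A) * Real.exp (-2 * (ε * A) + (ε / 2 * A + K))) := by ring
    _ = C * (Real.exp K * Real.exp (-ε * A)) := by
      rw [← Real.exp_add, ← Real.exp_add]
      congr 2
      ring
    _ = _ := by ring

theorem gaussDecay_eval_mul_gexp {S : Matrix κ κ ℂ} {ε : ℝ} (hε : 0 < ε)
    (hS : ∀ t : κ → ℝ, ε * ∑ p, t p ^ 2 ≤ (cvec t ⬝ᵥ S *ᵥ cvec t).re) (Q : MvPolynomial κ ℂ)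
    (l : κ → ℂ) : GaussDecay fun t => MvPolynomial.eval (cvec t) Q * gexp S l t := by
  obtain ⟨C, h⟩ := norm_gexp_le hε hS Q (∑ p, ‖l p‖)
  exact ⟨C, ε, hε, h l fun p =>
    Finset.single_le_sum (f := fun q => ‖l q‖) (fun _ _ => norm_nonneg _) (Finset.mem_univ p)⟩

theorem hasDerivAt_eval_line (R : MvPolynomial κ ℂ) (a d : κ → ℂ) :
    HasDerivAt (fun z : ℂ => MvPolynomial.eval (a + z • d) R)
      (∑ q, d q * MvPolynomial.eval a (MvPolynomial.pderiv q R)) 0 := by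
  classical
  induction R using MvPolynomial.induction_on with
  | C a => simpa using hasDerivAt_const (0 : ℂ) a
  | add P Q hP hQ => simpa [mul_add, Finset.sum_add_distrib] using hP.fun_add hQ
  | mul_X P p h =>
    have h1 : HasDerivAt (fun z : ℂ => (a + z • d) p) (d p) 0 := by
      simpa using ((hasDerivAt_id (0 : ℂ)).mul_const (d p)).const_add (a p)
    have h2 := h.fun_mul h1
    simp only [map_mul, MvPolynomial.eval_X, Derivation.leibniz, MvPolynomial.pderiv_X, smul_eq_mul,
      map_add, Pi.single_apply, mul_add, Finset.sum_add_distrib, apply_ite (MvPolynomial.eval a),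
      map_zero, mul_ite, mul_one, mul_zero, Finset.sum_ite_eq, Finset.mem_univ, if_true]
    refine h2.congr_deriv ?_
    simp only [zero_smul, add_zero, Finset.sum_mul]
    rw [add_comm, mul_comm (d p)]
    congr 1
    exact Finset.sum_congr rfl fun _ _ => by ring

theorem hasDerivAt_integral_of_bound {F F' : ℂ → (κ → ℝ) → ℂ} {bound : (κ → ℝ) → ℝ}
    (hF : ∀ z, Continuous (F z)) (hi : Integrable (F 0)) (hF' : Continuous (F' 0))
    (hb : ∀ z ∈ Metric.ball (0 : ℂ) 1, ∀ t, ‖F' z t‖ ≤ bound t) (hbi : Integrable bound)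
    (hd : ∀ t z, HasDerivAt (fun z => F z t) (F' z t) z) :
    HasDerivAt (fun z => ∫ t, F z t) (∫ t, F' 0 t) 0 :=
  (hasDerivAt_integral_of_dominated_loc_of_deriv_le (𝕜 := ℂ) (μ := volume) (F := F) (F' := F')
    (Metric.ball_mem_nhds (0 : ℂ) one_pos)
    (Filter.Eventually.of_forall fun z => (hF z).aestronglyMeasurable) hi
    hF'.aestronglyMeasurable (Filter.Eventually.of_forall fun t z hz => hb z hz t) hbi
    (Filter.Eventually.of_forall fun t z _ => hd t z)).2

/-- Multiplying the integrand by `X_p` amounts to `(2π)⁻¹ ∂/∂l_p`. On the right the derivative of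
the exponential gives `(T l)_p`, and that of the polynomial gives the gradient term of `heat_mul_X`.
Only the Gaussian integral without polynomial is assumed known. -/
theorem integral_eval_mul_gexp {S T : Matrix κ κ ℂ} {ε : ℝ} (hε : 0 < ε)
    (hS : ∀ t : κ → ℝ, ε * ∑ p, t p ^ 2 ≤ (cvec t ⬝ᵥ S *ᵥ cvec t).re) (hT : Tᵀ = T) (c : ℂ)
    (hc : ∀ l : κ → ℂ, ∫ t, gexp S l t = c * Complex.exp (Real.pi * (l ⬝ᵥ T *ᵥ l)))
    (Q : MvPolynomial κ ℂ) (l : κ → ℂ) :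
    ∫ t, MvPolynomial.eval (cvec t) Q * gexp S l t = c * Complex.exp (Real.pi * (l ⬝ᵥ T *ᵥ l)) *
      MvPolynomial.eval (T *ᵥ l) (heat ((1 / (4 * Real.pi) : ℂ) • T) Q) := by
  classical
  induction Q using MvPolynomial.induction_on generalizing l with
  | C a =>
    simp only [MvPolynomial.eval_C, integral_const_mul, hc, heat_C]
    ring
  | add P Q hP hQ =>
    simp only [map_add, add_mul, heat_add, mul_add]
    rw [integral_add, hP, hQ]
    · exact (gaussDecay_eval_mul_gexp hε hS P l).integrable
        ((continuous_eval_cvec P).mul (continuous_gexp S l))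
    · exact (gaussDecay_eval_mul_gexp hε hS Q l).integrable
        ((continuous_eval_cvec Q).mul (continuous_gexp S l))
  | mul_X P p ih =>
    set R := heat ((1 / (4 * Real.pi) : ℂ) • T) P with hR
    obtain ⟨C, hC⟩ := norm_gexp_le hε hS (MvPolynomial.C (2 * Real.pi : ℂ) * MvPolynomial.X p * P)
      (∑ p, ‖l p‖ + 1)
    have hl : ∀ z ∈ Metric.ball (0 : ℂ) 1, ∀ q, ‖(l + z • Pi.single p 1 : κ → ℂ) q‖ ≤
        ∑ p, ‖l p‖ + 1 := by
      intro z hz q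
      refine (norm_add_le _ _).trans (add_le_add (Finset.single_le_sum (f := fun q => ‖l q‖)
        (fun _ _ => norm_nonneg _) (Finset.mem_univ q)) ?_)
      rw [Metric.mem_ball, dist_zero_right] at hz
      rw [Pi.smul_apply, Pi.single_apply]
      split_ifs <;> simp [hz.le]
    have hd : ∀ (t : κ → ℝ) (z : ℂ), HasDerivAt
        (fun z : ℂ => MvPolynomial.eval (cvec t) P * gexp S (l + z • Pi.single p 1) t)
        (MvPolynomial.eval (cvec t) (MvPolynomial.C (2 * Real.pi : ℂ) * MvPolynomial.X p * P) *
          gexp S (l + z • Pi.single p 1) t) z := by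
      intro t z
      unfold gexp
      simp only [add_dotProduct, smul_dotProduct, single_dotProduct, one_mul]
      have h1 : HasDerivAt (fun z : ℂ => -(Real.pi : ℂ) * (cvec t ⬝ᵥ S *ᵥ cvec t) +
          2 * Real.pi * (l ⬝ᵥ cvec t + z • cvec t p)) (2 * Real.pi * cvec t p) z := by
        simpa using ((((hasDerivAt_id z).mul_const (cvec t p)).const_add
          (l ⬝ᵥ cvec t)).const_mul (2 * Real.pi : ℂ)).const_add
            (-(Real.pi : ℂ) * (cvec t ⬝ᵥ S *ᵥ cvec t))
      refine (h1.cexp.const_mul (MvPolynomial.eval (cvec t) P)).congr_deriv ?_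
      simp only [map_mul, MvPolynomial.eval_C, MvPolynomial.eval_X]
      ring
    obtain ⟨G, hG⟩ : ∃ G : MvPolynomial κ ℂ → ℂ → (κ → ℝ) → ℂ, ∀ R z t, G R z t =
      MvPolynomial.eval (cvec t) R * gexp S (l + z • Pi.single p 1) t := ⟨_, fun _ _ _ => rfl⟩
    have hGc : ∀ R z, Continuous (G R z) := fun R z => by
      rw [funext (hG R z)]
      exact (continuous_eval_cvec R).mul (continuous_gexp S _)
    have hGi : Integrable (G P 0) := by
      rw [funext (hG P 0)]
      exact (gaussDecay_eval_mul_gexp hε hS P _).integrable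
        ((continuous_eval_cvec P).mul (continuous_gexp S _))
    simp only [← hG] at hd
    have hGb : ∀ z ∈ Metric.ball (0 : ℂ) 1, ∀ t, ‖G (MvPolynomial.C (2 * Real.pi : ℂ) *
        MvPolynomial.X p * P) z t‖ ≤ C * Real.exp (-ε * ∑ p, t p ^ 2) := fun z hz t => by
      rw [hG]; exact hC _ (hl z hz) t
    have key := hasDerivAt_integral_of_bound (hGc P) hGi (hGc _ 0) hGb
      ((integrable_exp_neg_sq hε).const_mul C) hd
    simp only [hG] at key
    simp only [ih] at key
    have h2 : HasDerivAt (fun z : ℂ => (l + z • Pi.single p 1) ⬝ᵥ T *ᵥ (l + z • Pi.single p 1))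
        (2 * (T *ᵥ l) p) 0 := by
      have h3 : ∀ z : ℂ, (l + z • Pi.single p 1) ⬝ᵥ T *ᵥ (l + z • Pi.single p 1) =
          l ⬝ᵥ T *ᵥ l + (z * (2 * (T *ᵥ l) p) + z ^ 2 * T p p) := by
        intro z
        have h4 : l ⬝ᵥ T *ᵥ Pi.single p 1 = (T *ᵥ l) p := by
          rw [dotProduct_mulVec, dotProduct_single, mul_one, ← mulVec_transpose, hT]
        simp only [mulVec_add, mulVec_smul, add_dotProduct, dotProduct_add, smul_dotProduct,
          dotProduct_smul, h4, single_dotProduct, one_mul, smul_eq_mul]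
        have h5 : (T *ᵥ Pi.single p 1) p = T p p := by simp
        rw [h5]
        ring
      simp only [h3]
      simpa using (((hasDerivAt_id (0 : ℂ)).mul_const (2 * (T *ᵥ l) p)).add
        (((hasDerivAt_id (0 : ℂ)).pow 2).mul_const (T p p))).const_add (l ⬝ᵥ T *ᵥ l)
    have h6 : HasDerivAt (fun z : ℂ => MvPolynomial.eval (T *ᵥ (l + z • Pi.single p 1)) R)
        (∑ q, T q p * MvPolynomial.eval (T *ᵥ l) (MvPolynomial.pderiv q R)) 0 := by
      have := hasDerivAt_eval_line R (T *ᵥ l) (T *ᵥ Pi.single p 1)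
      simpa [mulVec_add, mulVec_smul] using this
    have h7 := ((h2.const_mul (Real.pi : ℂ)).cexp.const_mul c).mul h6
    -- Both sides of the induction hypothesis have been differentiated at `l` in the direction of
    -- the `p`-th coordinate; comparing the derivatives evaluates the integral with the extra
    -- factor.
    have h8 := key.unique h7
    simp only [zero_smul, add_zero] at h8
    have hpi : (Real.pi : ℂ) ≠ 0 := by exact_mod_cast Real.pi_ne_zero
    have h9 : ∫ t, MvPolynomial.eval (cvec t) (P * MvPolynomial.X p) * gexp S l t =
        (2 * Real.pi : ℂ)⁻¹ * ∫ t, MvPolynomial.eval (cvec t) (MvPolynomial.C (2 * Real.pi : ℂ) *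
          MvPolynomial.X p * P) * gexp S l t := by
      rw [← integral_const_mul]
      congr 1 with t
      simp only [map_mul, MvPolynomial.eval_C]
      field_simp
    rw [h9, h8, heat_mul_X, ← hR, map_add, map_mul, MvPolynomial.eval_X, gradOp_apply, map_sum]
    simp only [MvPolynomial.smul_eval, Matrix.smul_apply, smul_eq_mul]
    have h10 : ∀ q, T p q = T q p := fun q => congrFun (congrFun hT q) p
    simp only [h10, mul_add, Finset.mul_sum, ← two_mul]
    congr 1
    · field_simp
    · refine Finset.sum_congr rfl fun q _ => ?_
      field_simp
      ring

end Gauss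

end KM2

namespace KM2

/-! ### Poisson summation on `ℤ^κ` -/

section Poisson

open MeasureTheory

variable {κ : Type*} [Fintype κ]

/-- The Gaussian factors over the coordinates, and a finite set of integral vectors lies in the
product of its coordinate projections. Hence partial sums are bounded by a product of
one-dimensional sums. -/
theorem summable_exp_neg_sq_int {ε : ℝ} (hε : 0 < ε) :
    Summable fun n : κ → ℤ => Real.exp (-ε * ∑ p, (n p : ℝ) ^ 2) := by
  classical
  have h1 : Summable fun n : ℤ => Real.exp (-ε * (n : ℝ) ^ 2) := by
    have h2 : Summable fun n : ℕ => Real.exp (-ε * (n : ℝ) ^ 2) := by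
      refine Summable.of_nonneg_of_le (fun _ => (Real.exp_pos _).le) (fun n => ?_)
        (summable_geometric_of_lt_one (Real.exp_pos (-ε)).le (by simpa using hε))
      rw [← Real.exp_nat_mul]
      apply Real.exp_le_exp.2
      have : (n : ℝ) ≤ (n : ℝ) ^ 2 := by exact_mod_cast Nat.le_self_pow two_ne_zero n
      nlinarith
    refine Summable.of_nat_of_neg (by simpa using h2) (by simpa using h2)
  refine summable_of_sum_le (c := ∏ _p : κ, ∑' n : ℤ, Real.exp (-ε * (n : ℝ) ^ 2))
    (fun _ => (Real.exp_pos _).le) fun u => ?_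
  calc ∑ n ∈ u, Real.exp (-ε * ∑ p, (n p : ℝ) ^ 2)
      ≤ ∑ n ∈ Fintype.piFinset fun p => u.image fun n : κ → ℤ => n p,
          Real.exp (-ε * ∑ p, (n p : ℝ) ^ 2) := by
        refine Finset.sum_le_sum_of_subset_of_nonneg (fun n hn => ?_) fun _ _ _ => (Real.exp_pos _).le
        exact Fintype.mem_piFinset.2 fun p => Finset.mem_image_of_mem _ hn
    _ = ∏ p, ∑ n ∈ u.image fun n : κ → ℤ => n p, Real.exp (-ε * (n : ℝ) ^ 2) := by
        rw [Finset.prod_univ_sum]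
        refine Finset.sum_congr rfl fun n _ => ?_
        rw [Finset.mul_sum, Real.exp_sum]
    _ ≤ _ := Finset.prod_le_prod (fun _ _ => Finset.sum_nonneg fun _ _ => (Real.exp_pos _).le)
        fun p _ => h1.sum_le_tsum _ fun _ _ => (Real.exp_pos _).le

/-- The real vector underlying an integral one. -/
def rvec (n : κ → ℤ) : κ → ℝ := fun p => (n p : ℝ)

theorem e_add (s t : ℂ) : e (s + t) = e s * e t := by
  rw [e, e, e, ← Complex.exp_add]; ring_nf

theorem e_zero : e 0 = 1 := by simp [e]

theorem e_int (n : ℤ) : e n = 1 := by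
  rw [e, mul_comm]; exact Complex.exp_int_mul_two_pi_mul_I n

theorem norm_e_real (t : ℝ) : ‖e t‖ = 1 := by
  rw [e, show (2 * Real.pi * Complex.I * t : ℂ) = ((2 * Real.pi * t : ℝ) : ℂ) * Complex.I by
    push_cast; ring]
  exact Complex.norm_exp_ofReal_mul_I _

theorem conj_e (t : ℂ) : (starRingEnd ℂ) (e t) = e (-(starRingEnd ℂ) t) := by
  rw [e, e, ← Complex.exp_conj]
  congr 1
  simp only [map_mul, Complex.conj_ofReal, Complex.conj_I, map_ofNat]
  ring

theorem continuous_e : Continuous e := by unfold e; fun_prop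

theorem mFourier_coe (n : κ → ℤ) (x : κ → ℝ) :
    UnitAddTorus.mFourier n (fun p => (x p : UnitAddCircle)) = e ((rvec n ⬝ᵥ x : ℝ) : ℂ) := by
  simp only [UnitAddTorus.mFourier, ContinuousMap.coe_mk, fourier_coe_apply]
  rw [← Complex.exp_sum, e]
  congr 1
  simp only [dotProduct, rvec, Complex.ofReal_sum, Finset.mul_sum]
  refine Finset.sum_congr rfl fun p _ => ?_
  push_cast
  ring

/-- The Fourier transform `∫ F(x) e(-ξ x) dx`. -/
noncomputable def ft (F : (κ → ℝ) → ℂ) (ξ : κ → ℝ) : ℂ :=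
  ∫ x, F x * e (-((ξ ⬝ᵥ x : ℝ) : ℂ))

/-- From `|n|² ≤ 2|x + n|² + 2|x|²`. The bound is locally uniform in `x` and decays in `n`, and so
is a majorant for sums over translates. -/
theorem GaussDecay.translate_bound {F : (κ → ℝ) → ℂ} (hF : GaussDecay F) :
    ∃ C ε : ℝ, 0 < ε ∧ ∀ x n, ‖F (x + n)‖ ≤
      C * Real.exp (ε * ∑ p, x p ^ 2) * Real.exp (-(ε / 2) * ∑ p, n p ^ 2) := by
  obtain ⟨C, ε, hε, h⟩ := hF
  have hC : 0 ≤ C := by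
    have := (norm_nonneg _).trans (h 0)
    simpa using this
  refine ⟨C, ε, hε, fun x n => (h _).trans ?_⟩
  rw [mul_assoc, ← Real.exp_add]
  gcongr
  have : ∑ p, n p ^ 2 ≤ 2 * ∑ p, (x + n) p ^ 2 + 2 * ∑ p, x p ^ 2 := by
    rw [Finset.mul_sum, Finset.mul_sum, ← Finset.sum_add_distrib]
    refine Finset.sum_le_sum fun p _ => ?_
    simp only [Pi.add_apply]
    nlinarith [sq_nonneg (2 * x p + n p)]
  nlinarith

theorem GaussDecay.summable_translate {F : (κ → ℝ) → ℂ} (hF : GaussDecay F) (x : κ → ℝ) :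
    Summable fun n : κ → ℤ => F (x + rvec n) := by
  obtain ⟨C, ε, hε, h⟩ := hF.translate_bound
  exact Summable.of_norm_bounded ((summable_exp_neg_sq_int (half_pos hε)).mul_left _)
    fun n => h x (rvec n)

theorem GaussDecay.continuous_tsum {F : (κ → ℝ) → ℂ} (hF : GaussDecay F) (hc : Continuous F) :
    Continuous fun x => ∑' n : κ → ℤ, F (x + rvec n) := by
  obtain ⟨C, ε, hε, h⟩ := hF.translate_bound
  have hC : 0 ≤ C := by
    have := (norm_nonneg _).trans (h 0 0)
    simpa using this
  rw [continuous_iff_continuousAt]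
  intro x₀
  have hs : {x : κ → ℝ | ∑ p, x p ^ 2 < ∑ p, x₀ p ^ 2 + 1} ∈ nhds x₀ :=
    (isOpen_lt (by fun_prop) continuous_const).mem_nhds (by simp)
  refine ContinuousOn.continuousAt (continuousOn_tsum (fun n => ?_)
    ((summable_exp_neg_sq_int (half_pos hε)).mul_left
      (C * Real.exp (ε * (∑ p, x₀ p ^ 2 + 1)))) fun n x hx => (h x (rvec n)).trans ?_) hs
  · exact (hc.comp (continuous_id.add continuous_const)).continuousOn
  · have hx' : ∑ p, x p ^ 2 ≤ ∑ p, x₀ p ^ 2 + 1 := le_of_lt hx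
    simp only [rvec]
    gcongr

omit [Fintype κ] in
theorem isOpenQuotientMap_torus :
    IsOpenQuotientMap fun (x : κ → ℝ) (p : κ) => (x p : UnitAddCircle) :=
  IsOpenQuotientMap.piMap fun _ => QuotientAddGroup.isOpenQuotientMap_mk

/-- The box `∏ (n_p, n_p + 1]`. -/
def ibox (n : κ → ℤ) : Set (κ → ℝ) := {x | ∀ p, x p ∈ Set.Ioc (n p : ℝ) (n p + 1)}

theorem measurableSet_ibox (n : κ → ℤ) : MeasurableSet (ibox n) :=
  MeasurableSet.univ_pi' fun _ => measurableSet_Ioc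

/-- The half-open boxes tile the space; this is the unfolding step of Poisson summation. -/
theorem hasSum_integral_ibox {E : Type*} [NormedAddCommGroup E] [NormedSpace ℝ E]
    {F : (κ → ℝ) → E} (hF : Integrable F) :
    HasSum (fun n : κ → ℤ => ∫ x in ibox 0, F (x + rvec n)) (∫ x, F x) := by
  have hU : ⋃ n : κ → ℤ, ibox n = Set.univ := by
    refine Set.eq_univ_of_forall fun x => Set.mem_iUnion.2 ⟨fun p => ⌈x p⌉ - 1, fun p => ?_⟩
    constructor
    · push_cast; linarith [Int.ceil_lt_add_one (x p)]
    · push_cast; linarith [Int.le_ceil (x p)]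
  have hd : Pairwise (Function.onFun Disjoint (ibox (κ := κ))) := by
    intro m n hmn
    refine Set.disjoint_left.2 fun x hm hn => hmn ?_
    funext p
    have h1 := hm p
    have h2 := hn p
    have h3 : (m p : ℝ) < n p + 1 := h1.1.trans_le h2.2
    have h4 : (n p : ℝ) < m p + 1 := h2.1.trans_le h1.2
    have h5 : m p < n p + 1 := by exact_mod_cast h3
    have h6 : n p < m p + 1 := by exact_mod_cast h4
    omega
  have h := hasSum_integral_iUnion (measurableSet_ibox (κ := κ)) hd
    (μ := volume) (f := F) hF.integrableOn
  rw [hU, setIntegral_univ] at h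
  refine h.congr_fun fun n => ?_
  rw [← integral_indicator (measurableSet_ibox n), ← integral_indicator (measurableSet_ibox 0),
    ← integral_add_right_eq_self ((ibox n).indicator F) (rvec n)]
  congr 1 with x
  by_cases hx : x ∈ ibox 0
  · rw [Set.indicator_of_mem hx, Set.indicator_of_mem]
    intro p
    have := hx p
    simp only [Pi.zero_apply, Int.cast_zero, zero_add, Set.mem_Ioc] at this
    simp only [Pi.add_apply, rvec, Set.mem_Ioc]
    constructor <;> linarith
  · rw [Set.indicator_of_notMem hx, Set.indicator_of_notMem]
    intro h'
    refine hx fun p => ?_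
    have := h' p
    simp only [Pi.add_apply, rvec, Set.mem_Ioc] at this
    simp only [Pi.zero_apply, Int.cast_zero, zero_add, Set.mem_Ioc]
    constructor <;> linarith

/-- The periodization of `F` descends to a continuous function on the torus whose Fourier
coefficients, by unfolding, are the values of the Fourier transform. As these are summable, the
Fourier series converges to the periodization at every point. -/
theorem hasSum_poisson {F : (κ → ℝ) → ℂ} (hF : GaussDecay F) (hc : Continuous F)
    (hs : Summable fun n : κ → ℤ => ft F (rvec n)) (x : κ → ℝ) :
    HasSum (fun n : κ → ℤ => ft F (rvec n) * e ((rvec n ⬝ᵥ x : ℝ) : ℂ))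
      (∑' n : κ → ℤ, F (x + rvec n)) := by
  set Φ : (κ → ℝ) → ℂ := fun x => ∑' n : κ → ℤ, F (x + rvec n) with hΦ
  have hΦc : Continuous Φ := hF.continuous_tsum hc
  have hper : ∀ (x : κ → ℝ) (m : κ → ℤ), Φ (x + rvec m) = Φ x := by
    intro x m
    simp only [hΦ]
    rw [← (Equiv.addLeft m).tsum_eq fun n => F (x + rvec n)]
    refine tsum_congr fun n => ?_
    congr 1
    funext p
    simp [rvec, add_assoc]
  have hlift : ∀ x y : κ → ℝ, (fun p => (x p : UnitAddCircle)) = (fun p => (y p : UnitAddCircle)) →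
      Φ x = Φ y := by
    intro x y hxy
    have h1 : ∀ p, ∃ k : ℤ, x p = y p + k := by
      intro p
      have h2 := congrFun hxy p
      rw [QuotientAddGroup.eq_iff_sub_mem, AddSubgroup.mem_zmultiples_iff] at h2
      obtain ⟨k, hk⟩ := h2
      refine ⟨k, ?_⟩
      rw [zsmul_one] at hk
      linarith
    choose k hk using h1
    rw [show x = y + rvec k from funext hk, hper]
  have hq := isOpenQuotientMap_torus (κ := κ)
  -- The function on the torus is read off on arbitrary lifts. Periodicity makes the choice
  -- immaterial, and continuity follows because the covering is a quotient map.
  let g : C(UnitAddTorus κ, ℂ) := ⟨fun t => Φ (Function.surjInv hq.surjective t), by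
    refine hq.isQuotientMap.continuous_iff.2 ?_
    convert hΦc using 1
    funext x
    exact hlift _ _ (Function.surjInv_eq hq.surjective _)⟩
  have hg : ∀ x : κ → ℝ, g (fun p => (x p : UnitAddCircle)) = Φ x := fun x =>
    hlift _ _ (Function.surjInv_eq hq.surjective _)
  have hcoef : ∀ m : κ → ℤ, UnitAddTorus.mFourierCoeff g m = ft F (rvec m) := by
    intro m
    rw [UnitAddTorus.mFourierCoeff_eq_integral g m 0]
    have hbox : {x : κ → ℝ | ∀ i, x i ∈ Set.Ioc ((0 : κ → ℝ) i) ((0 : κ → ℝ) i + 1)} = ibox 0 := by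
      ext x; simp [ibox]
    rw [hbox]
    set H : (κ → ℝ) → ℂ := fun x => F x * e (-((rvec m ⬝ᵥ x : ℝ) : ℂ)) with hH
    have hHi : Integrable H := by
      refine Integrable.mono' (hF.integrable hc).norm ?_ (Filter.Eventually.of_forall fun x => ?_)
      · refine (hc.mul (continuous_e.comp ?_)).aestronglyMeasurable
        simp only [dotProduct]
        fun_prop
      · rw [hH]
        simp only
        rw [norm_mul, ← Complex.ofReal_neg, norm_e_real, mul_one]
    -- The character is invariant under integral translations, so it factors out of the sum over
    -- translates.
    have hHp : ∀ (n : κ → ℤ) x, H (x + rvec n) = F (x + rvec n) * e (-((rvec m ⬝ᵥ x : ℝ) : ℂ)) := by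
      intro n x
      have h3 : (((rvec m ⬝ᵥ rvec n : ℝ)) : ℂ) = ((∑ p, m p * n p : ℤ) : ℂ) := by
        simp [dotProduct, rvec]
      simp only [hH]
      rw [dotProduct_add, Complex.ofReal_add, neg_add, e_add, h3, ← Int.cast_neg, e_int, mul_one]
    have hsum := hasSum_integral_ibox hHi
    rw [ft, ← hsum.tsum_eq, integral_tsum_of_summable_integral_norm]
    · refine integral_congr_ae (Filter.Eventually.of_forall fun x => ?_)
      simp only
      rw [hg, mFourier_coe, smul_eq_mul, hΦ, mul_comm]
      simp only [hHp]
      rw [tsum_mul_right]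
      congr 3
      simp [dotProduct, rvec]
    · exact fun n => (hHi.comp_add_right (rvec n)).integrableOn
    · exact (hasSum_integral_ibox hHi.norm).summable
  have hsg : Summable (UnitAddTorus.mFourierCoeff g) := by
    rw [funext hcoef]; exact hs
  have h := UnitAddTorus.hasSum_mFourier_series_apply_of_summable hsg fun p => (x p : UnitAddCircle)
  rw [hg] at h
  refine h.congr_fun fun n => ?_
  rw [hcoef, mFourier_coe, smul_eq_mul]

/-- Summability makes the series converge uniformly, hence in `L²`, where the inner product with the
`m`-th character isolates `c m`. -/
theorem fourier_series_unique {c : (κ → ℤ) → ℂ} (hc : Summable c)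
    (h0 : ∀ x : κ → ℝ, ∑' n, c n * e ((rvec n ⬝ᵥ x : ℝ) : ℂ) = 0) (m : κ → ℤ) : c m = 0 := by
  have hs : Summable fun n => c n • UnitAddTorus.mFourier n := by
    refine Summable.of_norm ?_
    simpa only [norm_smul, UnitAddTorus.mFourier_norm, mul_one] using hc.norm
  have h1 : ∑' n, c n • UnitAddTorus.mFourier n = 0 := by
    ext t
    obtain ⟨x, rfl⟩ := isOpenQuotientMap_torus.surjective t
    have h2 := (ContinuousMap.hasSum_apply hs.hasSum fun p => (x p : UnitAddCircle)).tsum_eq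
    rw [← h2]
    simpa only [ContinuousMap.coe_smul, Pi.smul_apply, mFourier_coe, smul_eq_mul,
      ContinuousMap.zero_apply] using h0 x
  have h2 := hs.hasSum
  rw [h1] at h2
  -- The characters are orthonormal for the Haar probability measure, so this is the measure taken
  -- on each circle.
  let : MeasureSpace UnitAddCircle := ⟨AddCircle.haarAddCircle⟩
  have : IsProbabilityMeasure (volume : Measure UnitAddCircle) :=
    inferInstanceAs (IsProbabilityMeasure AddCircle.haarAddCircle)
  have h3 := (UnitAddTorus.orthonormal_mFourier (d := κ))
  have h4 := h2.mapL (ContinuousMap.toLp (E := ℂ) 2 (volume : Measure (UnitAddTorus κ)) ℂ)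
  have h5 := h4.mapL (innerSL ℂ (UnitAddTorus.mFourierLp (d := κ) 2 m))
  have h6 := h5.unique (hasSum_single m fun n hn => ?_)
  · rw [map_zero, map_zero, map_smul, innerSL_apply_apply, inner_smul_right] at h6
    rw [orthonormal_iff_ite.1 h3 m m, if_pos rfl, mul_one] at h6
    exact h6.symm
  · rw [map_smul, innerSL_apply_apply, inner_smul_right]
    rw [orthonormal_iff_ite.1 h3 m n, if_neg hn.symm, mul_zero]

end Poisson

end KM2

namespace KM2

/-! ### Gaussian integrals in block form -/

section GaussInt

open MeasureTheory

/-! ### The Siegel upper half-space: coordinates and positivity -/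

theorem siegel_symm {τ : Matrix (Fin 2) (Fin 2) ℂ} (h : τ ∈ Siegel) : τ 1 0 = τ 0 1 :=
  congrFun (congrFun h.1 0) 1

theorem siegel_im_pos {τ : Matrix (Fin 2) (Fin 2) ℂ} (h : τ ∈ Siegel) :
    0 < (τ 0 0).im ∧ 0 < (τ 1 1).im ∧ 0 < (τ 0 0).im * (τ 1 1).im - (τ 0 1).im ^ 2 := by
  refine ⟨?_, ?_, ?_⟩
  · simpa using h.2.diag_pos (i := 0)
  · simpa using h.2.diag_pos (i := 1)
  · have := h.2.det_pos
    rw [Matrix.det_fin_two] at this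
    simp only [Matrix.map_apply, (siegel_symm h)] at this
    nlinarith

/-- Sylvester's criterion for the imaginary part. -/
theorem mem_Siegel_iff {τ : Matrix (Fin 2) (Fin 2) ℂ} : τ ∈ Siegel ↔ τ 1 0 = τ 0 1 ∧
    0 < (τ 0 0).im ∧ 0 < (τ 0 0).im * (τ 1 1).im - (τ 0 1).im ^ 2 := by
  refine ⟨fun h => ⟨(siegel_symm h), (siegel_im_pos h).1, (siegel_im_pos h).2.2⟩, fun ⟨h1, h2, h3⟩ => ⟨?_, ?_⟩⟩
  · ext i j
    fin_cases i <;> fin_cases j <;> simp [h1]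
  · refine Matrix.PosDef.of_dotProduct_mulVec_pos ?_ fun x hx => ?_
    · ext i j
      fin_cases i <;> fin_cases j <;> simp [h1]
    · simp only [star_trivial, dotProduct, Matrix.mulVec, Fin.sum_univ_two, Matrix.map_apply, h1]
      have h4 : 0 < x 0 ^ 2 + x 1 ^ 2 := by
        by_contra h
        apply hx
        funext i
        fin_cases i <;> simp <;> nlinarith [sq_nonneg (x 0), sq_nonneg (x 1)]
      by_cases h5 : x 1 = 0
      · rw [h5] at h4 ⊢
        nlinarith
      · have h6 : 0 < x 1 ^ 2 := by positivity
        have : 0 < (τ 0 0).im * ((x 0 * ((τ 0 0).im * x 0 + (τ 0 1).im * x 1) +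
            x 1 * ((τ 0 1).im * x 0 + (τ 1 1).im * x 1))) := by
          nlinarith [sq_nonneg ((τ 0 0).im * x 0 + (τ 0 1).im * x 1), mul_pos h3 h6]
        exact (mul_pos_iff_of_pos_left h2).1 this

theorem siegel_re_quad {τ : Matrix (Fin 2) (Fin 2) ℂ} (t : Fin 2 → ℝ) :
    (cvec t ⬝ᵥ ((-Complex.I) • τ) *ᵥ cvec t).re = t ⬝ᵥ (τ.map Complex.im) *ᵥ t := by
  simp [cvec, dotProduct, Matrix.mulVec, Fin.sum_univ_two, Complex.add_re, Complex.mul_re]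
  ring

theorem siegel_exists_quad_ge {τ : Matrix (Fin 2) (Fin 2) ℂ} (h : τ ∈ Siegel) :
    ∃ ε : ℝ, 0 < ε ∧ ∀ t : Fin 2 → ℝ, ε * ∑ p, t p ^ 2 ≤ t ⬝ᵥ (τ.map Complex.im) *ᵥ t := by
  obtain ⟨h1, h2, h3⟩ := (siegel_im_pos h)
  -- Determinant over trace bounds the smallest eigenvalue of the imaginary part from below.
  refine ⟨((τ 0 0).im * (τ 1 1).im - (τ 0 1).im ^ 2) / ((τ 0 0).im + (τ 1 1).im), by positivity,
    fun t => ?_⟩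
  rw [div_mul_eq_mul_div, div_le_iff₀ (by positivity)]
  simp only [dotProduct, Matrix.mulVec, Fin.sum_univ_two, Matrix.map_apply, (siegel_symm h)]
  nlinarith [sq_nonneg ((τ 0 0).im * t 0 + (τ 0 1).im * t 1),
    sq_nonneg ((τ 0 1).im * t 0 + (τ 1 1).im * t 1)]

theorem siegel_ne_zero {τ : Matrix (Fin 2) (Fin 2) ℂ} (h : τ ∈ Siegel) : τ 0 0 ≠ 0 := fun h0 => by
  have := (siegel_im_pos h).1
  simp [h0] at this

/-- `det τ / τ₀₀ = τ₁₁ - τ₀₁²/τ₀₀` is the coefficient of the second variable after completing the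
square in the first. Its lying in the upper half-plane keeps the principal roots off their cut. -/
theorem siegel_im_det_div {τ : Matrix (Fin 2) (Fin 2) ℂ} (h : τ ∈ Siegel) :
    0 < (τ.det / τ 0 0).im := by
  obtain ⟨h1, h2, h3⟩ := (siegel_im_pos h)
  have h0 : 0 < Complex.normSq (τ 0 0) := Complex.normSq_pos.2 (siegel_ne_zero h)
  rw [Matrix.det_fin_two, (siegel_symm h), Complex.div_im, div_sub_div_same]
  apply div_pos _ h0
  refine (mul_pos_iff_of_pos_left h1).1 ?_
  simp only [Complex.sub_re, Complex.sub_im, Complex.mul_re, Complex.mul_im]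
  have h4 : 0 < (τ 0 0).re ^ 2 + (τ 0 0).im ^ 2 := by positivity
  nlinarith [mul_pos h3 h4, sq_nonneg ((τ 0 1).im * (τ 0 0).re - (τ 0 1).re * (τ 0 0).im)]

theorem siegel_det_ne_zero {τ : Matrix (Fin 2) (Fin 2) ℂ} (h : τ ∈ Siegel) : τ.det ≠ 0 := fun h0 => by
  have := (siegel_im_det_div h)
  simp [h0] at this

/-- The value at `0` of the Fourier transform of `exp(π i tᵗ τ t)`. -/
noncomputable def gaussConst (τ : Matrix (Fin 2) (Fin 2) ℂ) : ℂ :=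
  ((-Complex.I * τ 0 0) ^ (1 / 2 : ℂ) * (-Complex.I * (τ.det / τ 0 0)) ^ (1 / 2 : ℂ))⁻¹

theorem cpow_half_inv {z : ℂ} (hz : 0 < z.re) : (z⁻¹) ^ (1 / 2 : ℂ) = (z ^ (1 / 2 : ℂ))⁻¹ := by
  refine Complex.inv_cpow _ _ fun h => ?_
  rw [Complex.arg_eq_pi_iff] at h
  linarith [h.1]

theorem re_neg_I_mul (z : ℂ) : (-Complex.I * z).re = z.im := by simp

/-- Two successive one-dimensional complex Gaussian integrals, with parameters `τ₀₀` and `det τ /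
τ₀₀`. This order of integration accounts for the product of principal roots in `gaussConst`. -/
theorem integral_gexp_siegel {τ : Matrix (Fin 2) (Fin 2) ℂ} (h : τ ∈ Siegel) (l : Fin 2 → ℂ) :
    ∫ t, gexp ((-Complex.I) • τ) l t =
      gaussConst τ * Complex.exp (Real.pi * (l ⬝ᵥ (Complex.I • τ⁻¹) *ᵥ l)) := by
  obtain ⟨ε, hε, hq⟩ := (siegel_exists_quad_ge h)
  have hi : Integrable (gexp ((-Complex.I) • τ) l) := by
    have := (gaussDecay_eval_mul_gexp hε (S := (-Complex.I) • τ) (fun t => by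
      rw [siegel_re_quad]; exact hq t) 1 l).integrable
        ((continuous_eval_cvec 1).mul (continuous_gexp _ l))
    simpa using this
  have hpi : (Real.pi : ℂ) ≠ 0 := by exact_mod_cast Real.pi_ne_zero
  have h0 := (siegel_ne_zero h)
  have hd0 := (siegel_det_ne_zero h)
  have hI := Complex.I_ne_zero
  have hmp := (volume_preserving_finTwoArrow ℝ).symm
  rw [← hmp.integral_comp (MeasurableEquiv.measurableEmbedding _), Measure.volume_eq_prod,
    integral_prod_symm]
  swap
  · rw [← Measure.volume_eq_prod]
    exact (hmp.integrable_comp_emb (MeasurableEquiv.measurableEmbedding _)).2 hi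
  have h1 : ∀ y x : ℝ, gexp ((-Complex.I) • τ) l (MeasurableEquiv.finTwoArrow.symm (x, y)) =
      Complex.exp (Real.pi * Complex.I * τ 0 0 * (x : ℂ) ^ 2 +
        (2 * Real.pi * (Complex.I * τ 0 1 * y + l 0)) * x +
        (Real.pi * Complex.I * τ 1 1 * (y : ℂ) ^ 2 + 2 * Real.pi * l 1 * y)) := by
    intro y x
    rw [gexp]
    congr 1
    simp only [cvec, dotProduct, Matrix.mulVec, Fin.sum_univ_two, Matrix.smul_apply, smul_eq_mul,
      (siegel_symm h)]
    change -(Real.pi : ℂ) * ((x : ℂ) * (-Complex.I * τ 0 0 * x + -Complex.I * τ 0 1 * y) +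
      y * (-Complex.I * τ 0 1 * x + -Complex.I * τ 1 1 * y)) + 2 * Real.pi * (l 0 * x + l 1 * y) = _
    ring
  simp only [h1]
  have hb : (Real.pi * Complex.I * τ 0 0 : ℂ).re < 0 := by
    have := mul_pos Real.pi_pos (siegel_im_pos h).1
    simpa [Complex.mul_re, mul_assoc] using this
  have hb2 : (Real.pi * Complex.I * (τ.det / τ 0 0) : ℂ).re < 0 := by
    have := mul_pos Real.pi_pos (siegel_im_det_div h)
    rw [mul_assoc, Complex.re_ofReal_mul]
    simpa using this
  have h2 : ∀ y : ℝ, ∫ x : ℝ, Complex.exp (Real.pi * Complex.I * τ 0 0 * (x : ℂ) ^ 2 +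
        (2 * Real.pi * (Complex.I * τ 0 1 * y + l 0)) * x +
        (Real.pi * Complex.I * τ 1 1 * (y : ℂ) ^ 2 + 2 * Real.pi * l 1 * y)) =
      ((-Complex.I * τ 0 0) ^ (1 / 2 : ℂ))⁻¹ * Complex.exp
        (Real.pi * Complex.I * (τ.det / τ 0 0) * (y : ℂ) ^ 2 +
        (2 * Real.pi * (l 1 - τ 0 1 * l 0 / τ 0 0)) * y + Real.pi * Complex.I * l 0 ^ 2 / τ 0 0) := by
    intro y
    rw [integral_cexp_quadratic hb]
    congr 1
    · rw [← cpow_half_inv (by rw [re_neg_I_mul]; exact (siegel_im_pos h).1)]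
      congr 1
      field_simp
    · congr 1
      rw [Matrix.det_fin_two, (siegel_symm h)]
      field_simp
      ring_nf
      simp only [Complex.I_sq]
      ring
  simp only [h2]
  rw [integral_const_mul, integral_cexp_quadratic hb2, ← mul_assoc, gaussConst, mul_inv]
  congr 1
  · congr 1
    rw [← cpow_half_inv (by rw [re_neg_I_mul]; exact (siegel_im_det_div h))]
    congr 1
    field_simp
  · congr 1
    rw [Matrix.inv_def, Ring.inverse_eq_inv', Matrix.adjugate_fin_two]
    simp only [dotProduct, Matrix.mulVec, Fin.sum_univ_two, Matrix.smul_apply, smul_eq_mul,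
      (siegel_symm h), Matrix.of_apply, Matrix.cons_val', Matrix.cons_val_zero, Matrix.cons_val_one,
      Matrix.cons_val_fin_one]
    have h5 : τ.det = τ 0 0 * τ 1 1 - τ 0 1 ^ 2 := by rw [Matrix.det_fin_two, (siegel_symm h)]; ring
    have h6 : τ 1 1 = (τ.det + τ 0 1 ^ 2) / τ 0 0 := by rw [h5]; field_simp; ring
    rw [h6]
    generalize τ.det = D at *
    field_simp
    ring_nf
    simp only [Complex.I_sq]
    ring

theorem neg_conj_mem_Siegel {τ : Matrix (Fin 2) (Fin 2) ℂ} (h : τ ∈ Siegel) :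
    -τ.map (starRingEnd ℂ) ∈ Siegel := by
  rw [mem_Siegel_iff] at h ⊢
  simp only [Matrix.neg_apply, Matrix.map_apply, h.1, Complex.neg_im, Complex.conj_im, neg_neg]
  exact ⟨trivial, h.2⟩

/-- Conjugation commutes with the principal root in the right half-plane. Needed for the negative
coordinates, whose Gaussian is that of `-τ̄`. -/
theorem gaussConst_neg_conj {τ : Matrix (Fin 2) (Fin 2) ℂ} (h : τ ∈ Siegel) :
    gaussConst (-τ.map (starRingEnd ℂ)) = (starRingEnd ℂ) (gaussConst τ) := by
  have hd : (-τ.map (starRingEnd ℂ)).det = (starRingEnd ℂ) τ.det := by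
    simp [Matrix.det_fin_two]
  have hc : ∀ z : ℂ, 0 < z.re →
      ((starRingEnd ℂ) z) ^ (1 / 2 : ℂ) = (starRingEnd ℂ) (z ^ (1 / 2 : ℂ)) := by
    intro z hz
    rw [Complex.conj_cpow]
    · simp only [map_div₀, map_one, map_ofNat]
    · intro h
      rw [Complex.arg_eq_pi_iff] at h
      linarith [h.1]
  rw [gaussConst, gaussConst, hd, map_inv₀, map_mul,
    ← hc _ (by rw [re_neg_I_mul]; exact (siegel_im_pos h).1),
    ← hc _ (by rw [re_neg_I_mul]; exact (siegel_im_det_div h))]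
  simp [div_neg]

/-- The block diagonal matrix with blocks `s i`. -/
def blk {I : Type*} [DecidableEq I] (s : I → Matrix (Fin 2) (Fin 2) ℂ) :
    Matrix (I × Fin 2) (I × Fin 2) ℂ :=
  Matrix.of fun p q => if p.1 = q.1 then s p.1 p.2 q.2 else 0

variable {I : Type*} [Fintype I] [DecidableEq I]

theorem blk_mulVec (s : I → Matrix (Fin 2) (Fin 2) ℂ) (x : I × Fin 2 → ℂ) (i : I) (j : Fin 2) :
    (blk s *ᵥ x) (i, j) = (s i *ᵥ fun k => x (i, k)) j := by
  simp [blk, Matrix.mulVec, dotProduct, Fintype.sum_prod_type, ite_mul, Finset.sum_ite_eq]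

theorem dotProduct_blk (s : I → Matrix (Fin 2) (Fin 2) ℂ) (x : I × Fin 2 → ℂ) :
    x ⬝ᵥ blk s *ᵥ x = ∑ i, (fun k => x (i, k)) ⬝ᵥ s i *ᵥ fun k => x (i, k) := by
  simp only [dotProduct, Fintype.sum_prod_type, blk_mulVec]

theorem measurePreserving_uncurry {I J : Type*} [Fintype I] [Fintype J] :
    MeasurePreserving (fun (f : I → J → ℝ) (p : I × J) => f p.1 p.2) := by
  have hm : Measurable fun (f : I → J → ℝ) (p : I × J) => f p.1 p.2 := by fun_prop
  refine ⟨hm, ?_⟩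
  symm
  refine Measure.pi_eq fun s hs => ?_
  rw [Measure.map_apply hm (MeasurableSet.univ_pi hs)]
  have : (fun (f : I → J → ℝ) (p : I × J) => f p.1 p.2) ⁻¹' Set.univ.pi s =
      Set.univ.pi fun i => Set.univ.pi fun j => s (i, j) := by
    ext f
    simp [Set.mem_pi]
  rw [this, volume_pi_pi, Fintype.prod_prod_type]
  exact Finset.prod_congr rfl fun i _ => volume_pi_pi _

theorem measurableEmbedding_uncurry {I J : Type*} [Finite I] [Finite J] :
    MeasurableEmbedding (fun (f : I → J → ℝ) (p : I × J) => f p.1 p.2) :=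
  MeasurableEquiv.measurableEmbedding
    (⟨(Equiv.curry I J ℝ).symm, by
      change Measurable fun (f : I → J → ℝ) (p : I × J) => f p.1 p.2
      fun_prop, by
      change Measurable fun (f : I × J → ℝ) (i : I) (j : J) => f (i, j)
      fun_prop⟩ : (I → J → ℝ) ≃ᵐ (I × J → ℝ))

/-- Fubini: a block diagonal Gaussian is a product of Gaussians in disjoint sets of variables. -/
theorem integral_gexp_blk (s T : I → Matrix (Fin 2) (Fin 2) ℂ) (c : I → ℂ)
    (h : ∀ i l, ∫ t, gexp (s i) l t = c i * Complex.exp (Real.pi * (l ⬝ᵥ T i *ᵥ l)))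
    (l : I × Fin 2 → ℂ) :
    ∫ t, gexp (blk s) l t = (∏ i, c i) * Complex.exp (Real.pi * (l ⬝ᵥ blk T *ᵥ l)) := by
  rw [← measurePreserving_uncurry.integral_comp measurableEmbedding_uncurry]
  have h1 : ∀ f : I → Fin 2 → ℝ, gexp (blk s) l (fun p : I × Fin 2 => f p.1 p.2) =
      ∏ i, gexp (s i) (fun k => l (i, k)) (f i) := by
    intro f
    simp only [gexp]
    rw [← Complex.exp_sum, Finset.sum_add_distrib, ← Finset.mul_sum, ← Finset.mul_sum,
      dotProduct_blk]
    simp only [dotProduct, Fintype.sum_prod_type]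
    rfl
  simp only [h1]
  rw [integral_fintype_prod_volume_eq_prod (f := fun i => gexp (s i) fun k => l (i, k)),
    Finset.prod_congr rfl fun i _ => h i _, Finset.prod_mul_distrib, ← Complex.exp_sum,
    ← Finset.mul_sum, dotProduct_blk]

end GaussInt

end KM2

namespace KM2

/-! ### The imaginary part under the generators of the symplectic group -/

section ImPart

/-- The imaginary part of `τ` as a complex matrix. -/
def cIm (τ : Matrix (Fin 2) (Fin 2) ℂ) : Matrix (Fin 2) (Fin 2) ℂ :=
  (τ.map Complex.im).map fun x => (x : ℂ)

/-- The complex conjugate matrix. -/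
def cconj (τ : Matrix (Fin 2) (Fin 2) ℂ) : Matrix (Fin 2) (Fin 2) ℂ := τ.map (starRingEnd ℂ)

theorem sub_cconj (τ : Matrix (Fin 2) (Fin 2) ℂ) :
    τ - cconj τ = (2 * Complex.I) • cIm τ := by
  ext i j
  simp only [cconj, cIm, Matrix.sub_apply, Matrix.map_apply, Matrix.smul_apply, smul_eq_mul]
  rw [Complex.sub_conj]
  push_cast
  ring

theorem map_ofReal_inv (A : Matrix (Fin 2) (Fin 2) ℝ) :
    (A⁻¹).map (fun x => (x : ℂ)) = (A.map fun x => (x : ℂ))⁻¹ := by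
  have h : (A.map fun x => (x : ℂ)).det = (A.det : ℂ) := by simp [Matrix.det_fin_two]
  rw [Matrix.inv_def, Matrix.inv_def, h, Ring.inverse_eq_inv', Ring.inverse_eq_inv']
  ext i j
  fin_cases i <;> fin_cases j <;> simp [Matrix.adjugate_fin_two]

theorem cIm_inv (τ : Matrix (Fin 2) (Fin 2) ℂ) :
    ((τ.map Complex.im)⁻¹).map (fun x => (x : ℂ)) = (cIm τ)⁻¹ := map_ofReal_inv _

theorem det_cIm (τ : Matrix (Fin 2) (Fin 2) ℂ) : (cIm τ).det = ((τ.map Complex.im).det : ℂ) := by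
  simp [cIm, Matrix.det_fin_two]

theorem det_cconj (τ : Matrix (Fin 2) (Fin 2) ℂ) : (cconj τ).det = (starRingEnd ℂ) τ.det := by
  simp [cconj, Matrix.det_fin_two]

theorem siegel_det_pos {τ : Matrix (Fin 2) (Fin 2) ℂ} (h : τ ∈ Siegel) :
    0 < (τ.map Complex.im).det := h.2.det_pos

theorem siegel_det_cIm_ne {τ : Matrix (Fin 2) (Fin 2) ℂ} (h : τ ∈ Siegel) : (cIm τ).det ≠ 0 := by
  rw [det_cIm]; exact_mod_cast (siegel_det_pos h).ne'

theorem siegel_det_cconj_ne {τ : Matrix (Fin 2) (Fin 2) ℂ} (h : τ ∈ Siegel) :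
    (cconj τ).det ≠ 0 := by
  rw [det_cconj]; simpa using siegel_det_ne_zero h

theorem cconj_neg_inv (τ : Matrix (Fin 2) (Fin 2) ℂ) : cconj (-τ⁻¹) = -(cconj τ)⁻¹ := by
  rw [Matrix.inv_def, Matrix.inv_def, det_cconj, Ring.inverse_eq_inv']
  ext i j
  fin_cases i <;> fin_cases j <;> simp [Matrix.adjugate_fin_two, cconj]

/-- From `τ̄⁻¹ - τ⁻¹ = τ̄⁻¹ (τ - τ̄) τ⁻¹`. -/
theorem cIm_neg_inv {τ : Matrix (Fin 2) (Fin 2) ℂ} (h : τ ∈ Siegel) :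
    cIm (-τ⁻¹) = (cconj τ)⁻¹ * cIm τ * τ⁻¹ := by
  have h1 := sub_cconj (-τ⁻¹)
  have hu : IsUnit τ.det := (siegel_det_ne_zero h).isUnit
  have hu' : IsUnit (cconj τ).det := (siegel_det_cconj_ne h).isUnit
  have h2 : (2 * Complex.I) • ((cconj τ)⁻¹ * cIm τ * τ⁻¹) = -τ⁻¹ + (cconj τ)⁻¹ := by
    rw [← Matrix.smul_mul, ← Matrix.mul_smul, ← sub_cconj, Matrix.mul_sub, Matrix.sub_mul,
      Matrix.mul_assoc, Matrix.mul_nonsing_inv _ hu, Matrix.mul_one, Matrix.nonsing_inv_mul _ hu',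
      Matrix.one_mul]
    abel
  rw [cconj_neg_inv, sub_neg_eq_add] at h1
  rw [h1] at h2
  exact (smul_right_injective _ (by simp : (2 * Complex.I) ≠ 0) h2).symm

theorem inv_cIm_neg_inv {τ : Matrix (Fin 2) (Fin 2) ℂ} (h : τ ∈ Siegel) :
    (cIm (-τ⁻¹))⁻¹ = τ * (cIm τ)⁻¹ * cconj τ := by
  rw [cIm_neg_inv h, Matrix.mul_inv_rev, Matrix.mul_inv_rev,
    Matrix.nonsing_inv_nonsing_inv _ (siegel_det_ne_zero h).isUnit,
    Matrix.nonsing_inv_nonsing_inv _ (siegel_det_cconj_ne h).isUnit, Matrix.mul_assoc]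

theorem det_im_neg_inv {τ : Matrix (Fin 2) (Fin 2) ℂ} (h : τ ∈ Siegel) :
    ((-τ⁻¹).map Complex.im).det = (τ.map Complex.im).det / Complex.normSq τ.det := by
  have h1 := congrArg Matrix.det (cIm_neg_inv h)
  rw [det_cIm, Matrix.det_mul, Matrix.det_mul, det_cIm, Matrix.det_nonsing_inv,
    Matrix.det_nonsing_inv, Ring.inverse_eq_inv', det_cconj] at h1
  have h2 : (((-τ⁻¹).map Complex.im).det : ℂ) =
      (((τ.map Complex.im).det / Complex.normSq τ.det : ℝ) : ℂ) := by
    rw [h1]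
    push_cast
    rw [Complex.normSq_eq_conj_mul_self, div_eq_mul_inv, mul_inv]
    ring
  exact_mod_cast h2

theorem neg_inv_mem_Siegel {τ : Matrix (Fin 2) (Fin 2) ℂ} (h : τ ∈ Siegel) : -τ⁻¹ ∈ Siegel := by
  have hs := siegel_symm h
  have h01 : (-τ⁻¹) 1 0 = (-τ⁻¹) 0 1 := by
    rw [Matrix.inv_def, Matrix.adjugate_fin_two]; simp [hs]
  rw [mem_Siegel_iff]
  refine ⟨h01, ?_, ?_⟩
  · have h00 : (-τ⁻¹) 0 0 = -(τ 1 1) / τ.det := by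
      rw [Matrix.inv_def, Matrix.adjugate_fin_two, Ring.inverse_eq_inv']
      simp
      ring
    have hn : 0 < Complex.normSq τ.det := Complex.normSq_pos.2 (siegel_det_ne_zero h)
    obtain ⟨h1, h2, h3⟩ := siegel_im_pos h
    rw [h00, Complex.div_im, div_sub_div_same]
    apply div_pos _ hn
    refine (mul_pos_iff_of_pos_left h2).1 ?_
    rw [Matrix.det_fin_two, hs]
    simp only [Complex.sub_re, Complex.sub_im, Complex.mul_re, Complex.mul_im, Complex.neg_re,
      Complex.neg_im]
    have h4 : 0 < (τ 1 1).re ^ 2 + (τ 1 1).im ^ 2 := by positivity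
    nlinarith [mul_pos h3 h4, sq_nonneg ((τ 0 1).im * (τ 1 1).re - (τ 0 1).re * (τ 1 1).im)]
  · have h1 := det_im_neg_inv h
    have h2 : 0 < ((-τ⁻¹).map Complex.im).det := by
      rw [h1]
      exact div_pos (siegel_det_pos h) (Complex.normSq_pos.2 (siegel_det_ne_zero h))
    rw [Matrix.det_fin_two] at h2
    simp only [Matrix.map_apply, h01] at h2
    nlinarith

/-- The entries of a real matrix as complex numbers. -/
abbrev rC (A : Matrix (Fin 2) (Fin 2) ℝ) : Matrix (Fin 2) (Fin 2) ℂ := A.map fun x => (x : ℂ)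

theorem im_congr (A : Matrix (Fin 2) (Fin 2) ℝ) (τ : Matrix (Fin 2) (Fin 2) ℂ) :
    (rC A * τ * (rC A)ᵀ).map Complex.im = A * τ.map Complex.im * Aᵀ := by
  ext i j
  simp [Matrix.mul_apply, Fin.sum_univ_two, Complex.add_im, Complex.mul_im]

theorem congr_mem_Siegel {A : Matrix (Fin 2) (Fin 2) ℝ} (hA : A.det ≠ 0)
    {τ : Matrix (Fin 2) (Fin 2) ℂ} (h : τ ∈ Siegel) : rC A * τ * (rC A)ᵀ ∈ Siegel := by
  refine ⟨?_, ?_⟩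
  · simp [Matrix.transpose_mul, h.1, Matrix.mul_assoc]
  · rw [im_congr]
    have := h.2.mul_mul_conjTranspose_same (B := A)
      (Matrix.vecMul_injective_iff_isUnit.2 ((Matrix.isUnit_iff_isUnit_det A).2 hA.isUnit))
    simpa using this

theorem im_add_real (B : Matrix (Fin 2) (Fin 2) ℝ) (τ : Matrix (Fin 2) (Fin 2) ℂ) :
    (τ + rC B).map Complex.im = τ.map Complex.im := by
  ext i j
  simp

theorem add_mem_Siegel {B : Matrix (Fin 2) (Fin 2) ℝ} (hB : Bᵀ = B)
    {τ : Matrix (Fin 2) (Fin 2) ℂ} (h : τ ∈ Siegel) : τ + rC B ∈ Siegel := by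
  refine ⟨?_, by rw [im_add_real]; exact h.2⟩
  rw [Matrix.transpose_add, h.1, ← Matrix.transpose_map, hB]

end ImPart

end KM2

namespace KM2

/-! ### The Schwartz functions of the theta series -/

section Phi

open MeasureTheory

variable {b : ℕ}

theorem lapMat_eq_blk (I : Type*) [DecidableEq I] (Y : Matrix (Fin 2) (Fin 2) ℂ) :
    lapMat I Y = blk fun _ => (-1 / (8 * Real.pi) : ℂ) • Y := by
  ext p q
  simp [lapMat, blk, kroneckerMap_apply, Matrix.one_apply, ite_mul]

/-- The inclusion of the positive coordinates. -/
def inclMat (b : ℕ) : Matrix (Fin b × Fin 2) (Idx b × Fin 2) ℂ :=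
  Matrix.of fun p q => if q = (Sum.inl p.1, p.2) then 1 else 0

theorem inclMat_mulVec (x : Idx b × Fin 2 → ℂ) (p : Fin b × Fin 2) :
    (inclMat b *ᵥ x) p = x (Sum.inl p.1, p.2) := by
  simp [inclMat, Matrix.mulVec, dotProduct]

/-- A polynomial in the positive coordinates as a polynomial in all coordinates. -/
noncomputable def posPoly (P : MvPolynomial (Fin b × Fin 2) ℂ) : Pol b :=
  affSubst (inclMat b) 0 P

theorem eval_posPoly (P : MvPolynomial (Fin b × Fin 2) ℂ) (x : Idx b × Fin 2 → ℂ) :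
    MvPolynomial.eval x (posPoly P) = MvPolynomial.eval (fun p => x (Sum.inl p.1, p.2)) P := by
  rw [posPoly, eval_affSubst, add_zero]
  congr 1
  exact congrArg _ (funext (inclMat_mulVec x))

/-- A polynomial in the positive coordinates sees only the positive blocks of the operator. -/
theorem heat_posPoly (s : Idx b → Matrix (Fin 2) (Fin 2) ℂ)
    (P : MvPolynomial (Fin b × Fin 2) ℂ) :
    heat (blk s) (posPoly P) = posPoly (heat (blk fun i => s (Sum.inl i)) P) := by
  have h : (blk fun i => s (Sum.inl i)) = inclMat b * blk s * (inclMat b)ᵀ := by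
    ext p q
    simp [inclMat, blk, Matrix.mul_apply, Matrix.transpose_apply]
    rw [Finset.sum_eq_single (Sum.inl p.1, p.2)]
    · simp
    · intro x _ hx
      simp [hx]
    · simp
  rw [posPoly, posPoly, h, affSubst_heat]

/-- The blocks of the quadratic form of the Gaussian attached to `τ`. -/
noncomputable def sB (b : ℕ) (τ : Matrix (Fin 2) (Fin 2) ℂ) : Idx b → Matrix (Fin 2) (Fin 2) ℂ :=
  Sum.elim (fun _ => (-Complex.I) • τ) (fun _ => Complex.I • cconj τ)

/-- The Schwartz function of the theta series with polynomial `P`. -/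
noncomputable def phi (P : MvPolynomial (Fin b × Fin 2) ℂ) (τ : Matrix (Fin 2) (Fin 2) ℂ)
    (x : Idx b × Fin 2 → ℝ) : ℂ :=
  MvPolynomial.eval (cvec x) (heat (lapMat (Idx b) (cIm τ)⁻¹) (posPoly P)) *
    gexp (blk (sB b τ)) 0 x

theorem continuous_phi (P : MvPolynomial (Fin b × Fin 2) ℂ) (τ : Matrix (Fin 2) (Fin 2) ℂ) :
    Continuous (phi P τ) :=
  (continuous_eval_cvec _).mul (continuous_gexp _ _)

theorem sB_quad {τ : Matrix (Fin 2) (Fin 2) ℂ} (h : τ ∈ Siegel) :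
    ∃ ε : ℝ, 0 < ε ∧ ∀ t : Idx b × Fin 2 → ℝ,
      ε * ∑ p, t p ^ 2 ≤ (cvec t ⬝ᵥ blk (sB b τ) *ᵥ cvec t).re := by
  obtain ⟨ε, hε, hq⟩ := siegel_exists_quad_ge h
  refine ⟨ε, hε, fun t => ?_⟩
  rw [dotProduct_blk, Complex.re_sum, Fintype.sum_prod_type, Finset.mul_sum]
  refine Finset.sum_le_sum fun i _ => ?_
  have h1 := hq fun k => t (i, k)
  rcases i with i | i
  · rw [← siegel_re_quad] at h1
    exact h1
  -- The negative block is the positive block of `-τ̄`, which has the same imaginary part as `τ`.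
  · have h2 : (Complex.I • cconj τ) = (-Complex.I) • (-τ.map (starRingEnd ℂ)) := by
      simp [cconj]
    have h3 : (-τ.map (starRingEnd ℂ)).map Complex.im = τ.map Complex.im := by
      ext; simp
    rw [← h3, ← siegel_re_quad, ← h2] at h1
    exact h1

theorem gaussDecay_phi (P : MvPolynomial (Fin b × Fin 2) ℂ) {τ : Matrix (Fin 2) (Fin 2) ℂ}
    (h : τ ∈ Siegel) : GaussDecay (phi P τ) := by
  obtain ⟨ε, hε, hq⟩ := sB_quad (b := b) h
  exact gaussDecay_eval_mul_gexp hε hq _ _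

/-- The form `∑_j (x_j, ξ_j)` on pairs of vectors, in flattened coordinates. -/
def pairForm (x ξ : Idx b × Fin 2 → ℝ) : ℝ :=
  ∑ i, Sum.elim (fun _ => 1) (fun _ => -1) i * ∑ j, x (i, j) * ξ (i, j)

/-- The polynomial `P` is multiplied by `det(A)²` under the substitution `x ↦ x A`. -/
def IsDetSq (P : MvPolynomial (Fin b × Fin 2) ℂ) : Prop :=
  ∀ A : Matrix (Fin 2) (Fin 2) ℂ, affSubst (blk fun _ => A) 0 P = A.det ^ 2 • P

/-- Moves a linear substitution from the argument into the heat operator: conjugation on the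
operator by `affSubst_heat`, the scalar `det(A)²` on the polynomial. -/
theorem eval_isDetSq {P : MvPolynomial (Fin b × Fin 2) ℂ} (hP : IsDetSq P)
    {A : Matrix (Fin 2) (Fin 2) ℂ} (hA : A.det ≠ 0) (C : Matrix (Fin 2) (Fin 2) ℂ)
    (x : Fin b × Fin 2 → ℂ) :
    MvPolynomial.eval (blk (fun _ => A) *ᵥ x) (heat (blk fun _ => C) P) =
      A.det ^ 2 * MvPolynomial.eval x (heat (blk fun _ => A⁻¹ * C * (A⁻¹)ᵀ) P) := by
  have hb : ∀ M N : Matrix (Fin 2) (Fin 2) ℂ, (blk fun _ : Fin b => M) * (blk fun _ => N) =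
      blk fun _ => M * N := by
    intro M N
    ext ⟨i, j⟩ ⟨i', j'⟩
    simp [blk, Matrix.mul_apply, Fintype.sum_prod_type, ite_mul]
  have ht : ∀ M : Matrix (Fin 2) (Fin 2) ℂ, (blk fun _ : Fin b => M)ᵀ = blk fun _ => Mᵀ := by
    intro M
    ext ⟨i, j⟩ ⟨i', j'⟩
    simp [blk, eq_comm]
  have h1 := affSubst_heat (blk fun _ : Fin b => A) 0 (blk fun _ => A⁻¹ * C * (A⁻¹)ᵀ) P
  rw [hP, heat_smul, ht, hb, hb] at h1
  have hu := hA.isUnit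
  have h2 : A * (A⁻¹ * C * (A⁻¹)ᵀ) * Aᵀ = C := by
    rw [Matrix.mul_assoc A⁻¹, Matrix.mul_nonsing_inv_cancel_left _ _ hu, Matrix.mul_assoc,
      ← Matrix.transpose_mul, Matrix.mul_nonsing_inv _ hu, Matrix.transpose_one, Matrix.mul_one]
  rw [h2] at h1
  have h3 := congrArg (MvPolynomial.eval x) h1
  rwa [eval_affSubst, add_zero, MvPolynomial.smul_eval] at h3

/-- The constant in the Fourier transform of `phi`. -/
noncomputable def ftConst (b : ℕ) (τ : Matrix (Fin 2) (Fin 2) ℂ) : ℂ :=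
  gaussConst τ ^ b * (starRingEnd ℂ) (gaussConst τ) ^ 2 * (τ.det ^ 2)⁻¹

/-- The normalization `1/8π` matters here. The operator `iτ⁻¹/4π` created by the Gaussian integral
and the operator `-y⁻¹/8π` of the theta function add up, after conjugation by `τ`, to the operator
at `-τ⁻¹`. The identity behind it is `τ y⁻¹ τ̄ = τ y⁻¹ τ - 2iτ`. -/
theorem conj_heat_block {τ : Matrix (Fin 2) (Fin 2) ℂ} (h : τ ∈ Siegel) :
    (τ⁻¹)⁻¹ * ((1 / (4 * Real.pi) : ℂ) • (Complex.I • τ⁻¹) +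
      (-1 / (8 * Real.pi) : ℂ) • (cIm τ)⁻¹) * ((τ⁻¹)⁻¹)ᵀ =
    (-1 / (8 * Real.pi) : ℂ) • (cIm (-τ⁻¹))⁻¹ := by
  have hpi : (Real.pi : ℂ) ≠ 0 := by exact_mod_cast Real.pi_ne_zero
  have hu := (siegel_det_ne_zero h).isUnit
  rw [inv_cIm_neg_inv h, Matrix.nonsing_inv_nonsing_inv _ hu, h.1]
  have h5 : cconj τ = τ - (2 * Complex.I) • cIm τ := by rw [← sub_cconj]; abel
  have h6 : τ * (cIm τ)⁻¹ * cconj τ = τ * (cIm τ)⁻¹ * τ - (2 * Complex.I) • τ := by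
    rw [h5, Matrix.mul_sub, Matrix.mul_smul, Matrix.mul_assoc τ _ (cIm τ),
      Matrix.nonsing_inv_mul _ (siegel_det_cIm_ne h).isUnit, Matrix.mul_one]
  rw [h6, Matrix.mul_add, Matrix.add_mul, Matrix.mul_smul, Matrix.mul_smul, Matrix.smul_mul,
    Matrix.smul_mul, Matrix.mul_smul, Matrix.smul_mul, Matrix.mul_nonsing_inv _ hu,
    Matrix.one_mul, smul_sub, smul_smul, smul_smul]
  have h7 : (-1 / (8 * Real.pi) * (2 * Complex.I) : ℂ) = -(1 / (4 * Real.pi) * Complex.I) := by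
    field_simp
    ring
  rw [h7, neg_smul, sub_neg_eq_add, add_comm]

-- The Gaussian splits into two-dimensional blocks with parameter `τ` for positive and `-τ̄` for
-- negative coordinates. The polynomial depends on positive coordinates only, where the transform is
-- evaluated at `ξ τ⁻¹`; by `IsDetSq` this costs the factor `det(τ)⁻²` and conjugates the heat
-- operator into the one at `-τ⁻¹`.
set_option maxHeartbeats 800000 in
theorem integral_phi {P : MvPolynomial (Fin b × Fin 2) ℂ} (hP : IsDetSq P)
    {τ : Matrix (Fin 2) (Fin 2) ℂ} (h : τ ∈ Siegel) (ξ : Idx b × Fin 2 → ℝ) :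
    ∫ x, phi P τ x * e (-(pairForm x ξ : ℂ)) = ftConst b τ * phi P (-τ⁻¹) ξ := by
  obtain ⟨ε, hε, hq⟩ := sB_quad (b := b) h
  have hI := Complex.I_ne_zero
  have hpi : (Real.pi : ℂ) ≠ 0 := by exact_mod_cast Real.pi_ne_zero
  have hdet := siegel_det_ne_zero h
  -- The transform is taken with respect to the indefinite form, so the frequency changes sign on
  -- the negative coordinates.
  set sg : Idx b → ℂ := Sum.elim (fun _ => 1) (fun _ => -1) with hsg
  set l : Idx b × Fin 2 → ℂ := fun p => -Complex.I * sg p.1 * ξ p with hl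
  set T : Idx b → Matrix (Fin 2) (Fin 2) ℂ :=
    Sum.elim (fun _ => Complex.I • τ⁻¹) (fun _ => (-Complex.I) • (cconj τ)⁻¹) with hT
  have hsym : (τ⁻¹)ᵀ = τ⁻¹ := by rw [Matrix.transpose_nonsing_inv, h.1]
  have hTsym : (blk T)ᵀ = blk T := by
    have h1 : ∀ i, (T i)ᵀ = T i := by
      rintro (i | i)
      · simp only [hT, Sum.elim_inl, Matrix.transpose_smul, hsym]
      · simp only [hT, Sum.elim_inr, Matrix.transpose_smul, Matrix.transpose_nonsing_inv]
        rw [cconj, ← Matrix.transpose_map, h.1]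
    ext ⟨i, j⟩ ⟨i', j'⟩
    simp only [Matrix.transpose_apply, blk, Matrix.of_apply]
    by_cases hi : i = i'
    · subst hi
      simpa using congrFun (congrFun (h1 i) j) j'
    · rw [if_neg hi, if_neg (Ne.symm hi)]
  have hbase : ∀ l : Idx b × Fin 2 → ℂ, ∫ t, gexp (blk (sB b τ)) l t =
      (gaussConst τ ^ b * (starRingEnd ℂ) (gaussConst τ) ^ 2) *
        Complex.exp (Real.pi * (l ⬝ᵥ blk T *ᵥ l)) := by
    intro l
    have h1 := integral_gexp_blk (sB b τ) T
      (Sum.elim (fun _ => gaussConst τ) (fun _ => (starRingEnd ℂ) (gaussConst τ))) (by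
        rintro (i | i) m
        · exact integral_gexp_siegel h m
        · have h2 := integral_gexp_siegel (neg_conj_mem_Siegel h) m
          rw [gaussConst_neg_conj h] at h2
          have h3 : (-Complex.I) • (-τ.map (starRingEnd ℂ)) = Complex.I • cconj τ := by
            simp [cconj]
          have h4 : Complex.I • (-τ.map (starRingEnd ℂ))⁻¹ = (-Complex.I) • (cconj τ)⁻¹ := by
            have h5 : (-τ.map (starRingEnd ℂ)) = -cconj τ := rfl
            have h6 : (-cconj τ)⁻¹ = -(cconj τ)⁻¹ := by
              refine Matrix.inv_eq_left_inv ?_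
              rw [neg_mul_neg, Matrix.nonsing_inv_mul _ (siegel_det_cconj_ne h).isUnit]
            rw [h5, h6]
            simp
          rw [h3, h4] at h2
          exact h2) l
    rw [h1, Fintype.prod_sum_type]
    simp
  have h1 : ∀ x, phi P τ x * e (-(pairForm x ξ : ℂ)) =
      MvPolynomial.eval (cvec x) (heat (lapMat (Idx b) (cIm τ)⁻¹) (posPoly P)) *
        gexp (blk (sB b τ)) l x := by
    intro x
    rw [phi, mul_assoc]
    congr 1
    rw [gexp, gexp, e, ← Complex.exp_add, zero_dotProduct, mul_zero, add_zero]
    have h2 : (pairForm x ξ : ℂ) = ∑ i, sg i * ∑ j, (x (i, j) : ℂ) * ξ (i, j) := by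
      rw [pairForm, Complex.ofReal_sum]
      refine Finset.sum_congr rfl fun i _ => ?_
      rcases i with i | i <;> simp [hsg]
    have h3 : l ⬝ᵥ cvec x = -Complex.I * ∑ i, sg i * ∑ j, (x (i, j) : ℂ) * ξ (i, j) := by
      simp only [dotProduct, Fintype.sum_prod_type, Finset.mul_sum, hl, cvec]
      refine Finset.sum_congr rfl fun i _ => Finset.sum_congr rfl fun j _ => ?_
      ring
    rw [h2, h3]
    congr 1
    ring
  simp only [h1]
  rw [integral_eval_mul_gexp hε hq hTsym _ hbase, heat_heat, phi, ftConst]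
  have hTl : blk T *ᵥ l = fun p => (Sum.elim (fun _ => τ⁻¹) (fun _ => (cconj τ)⁻¹) p.1 *ᵥ
      fun k => (ξ (p.1, k) : ℂ)) p.2 := by
    funext ⟨i, j⟩
    rw [blk_mulVec]
    rcases i with i | i
    · simp only [hT, hl, hsg, Sum.elim_inl, Matrix.mulVec, dotProduct, Matrix.smul_apply,
        smul_eq_mul]
      refine Finset.sum_congr rfl fun k _ => ?_
      ring_nf
      simp
    · simp only [hT, hl, hsg, Sum.elim_inr, Matrix.mulVec, dotProduct, Matrix.smul_apply,
        smul_eq_mul]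
      refine Finset.sum_congr rfl fun k _ => ?_
      ring_nf
      simp
  have hexp : Complex.exp (Real.pi * (l ⬝ᵥ blk T *ᵥ l)) = gexp (blk (sB b (-τ⁻¹))) 0 ξ := by
    rw [gexp, zero_dotProduct, mul_zero, add_zero]
    congr 1
    rw [dotProduct_blk, dotProduct_blk, Finset.mul_sum, Finset.mul_sum]
    refine Finset.sum_congr rfl fun i _ => ?_
    rcases i with i | i
    · simp only [hT, hl, hsg, sB, Sum.elim_inl, Matrix.mulVec, dotProduct, Matrix.smul_apply,
        smul_eq_mul, cvec, Fin.sum_univ_two, Matrix.neg_apply]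
      ring_nf
      simp only [Complex.I_pow_three]
      ring
    · simp only [hT, hl, hsg, sB, Sum.elim_inr, Matrix.mulVec, dotProduct, Matrix.smul_apply,
        smul_eq_mul, cvec, Fin.sum_univ_two, cconj_neg_inv, Matrix.neg_apply]
      ring_nf
      simp only [Complex.I_pow_three]
      ring
  have hpoly : MvPolynomial.eval (blk T *ᵥ l) (heat ((1 / (4 * Real.pi) : ℂ) • blk T +
      lapMat (Idx b) (cIm τ)⁻¹) (posPoly P)) = (τ.det ^ 2)⁻¹ *
      MvPolynomial.eval (cvec ξ) (heat (lapMat (Idx b) (cIm (-τ⁻¹))⁻¹) (posPoly P)) := by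
    have h2 : (1 / (4 * Real.pi) : ℂ) • blk T + lapMat (Idx b) (cIm τ)⁻¹ =
        blk fun i => (1 / (4 * Real.pi) : ℂ) • T i + (-1 / (8 * Real.pi) : ℂ) • (cIm τ)⁻¹ := by
      rw [lapMat_eq_blk]
      ext p q
      simp [blk]
      split_ifs <;> simp
    rw [h2, lapMat_eq_blk, heat_posPoly, heat_posPoly, eval_posPoly, eval_posPoly]
    have h3 : (fun p : Fin b × Fin 2 => (blk T *ᵥ l) (Sum.inl p.1, p.2)) =
        blk (fun _ => τ⁻¹) *ᵥ fun p : Fin b × Fin 2 => cvec ξ (Sum.inl p.1, p.2) := by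
      rw [hTl]
      funext ⟨i, j⟩
      rw [blk_mulVec]
      rfl
    have hdi : (τ⁻¹).det ≠ 0 := by
      rw [Matrix.det_nonsing_inv, Ring.inverse_eq_inv']; exact inv_ne_zero hdet
    rw [h3]
    simp only [hT, Sum.elim_inl]
    rw [eval_isDetSq hP hdi, Matrix.det_nonsing_inv, Ring.inverse_eq_inv', inv_pow]
    rw [conj_heat_block h]
  rw [hexp, hpoly]
  ring

/-- Replacing `τ` by `A τ Aᵗ` is the substitution `x ↦ xA` in the Gaussian and in the heat operator;
the polynomial differs only by `det(A)²`. -/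
theorem phi_congr {P : MvPolynomial (Fin b × Fin 2) ℂ} (hP : IsDetSq P)
    {A : Matrix (Fin 2) (Fin 2) ℝ} (hA : A.det ≠ 0) (τ : Matrix (Fin 2) (Fin 2) ℂ)
    (x : Idx b × Fin 2 → ℝ) :
    phi P (rC A * τ * (rC A)ᵀ) x =
      ((A.det : ℂ) ^ 2)⁻¹ * phi P τ fun p => ∑ k, x (p.1, k) * A k p.2 := by
  have hdA : (rC A).det = A.det := by simp [rC, Matrix.det_fin_two]
  have hdA' : ((rC A)ᵀ).det ≠ 0 := by rw [Matrix.det_transpose, hdA]; exact_mod_cast hA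
  have hIm : cIm (rC A * τ * (rC A)ᵀ) = rC A * cIm τ * (rC A)ᵀ := by
    rw [cIm, im_congr]
    ext i j
    simp [cIm, Matrix.mul_apply, Fin.sum_univ_two]
  rw [phi, phi, ← mul_assoc]
  congr 1
  · rw [lapMat_eq_blk, lapMat_eq_blk, heat_posPoly, heat_posPoly, eval_posPoly, eval_posPoly]
    have h1 : (fun p : Fin b × Fin 2 => cvec (fun p : Idx b × Fin 2 => ∑ k, x (p.1, k) * A k p.2)
        (Sum.inl p.1, p.2)) = blk (fun _ => (rC A)ᵀ) *ᵥ
        fun p : Fin b × Fin 2 => cvec x (Sum.inl p.1, p.2) := by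
      funext ⟨i, j⟩
      rw [blk_mulVec]
      simp [cvec, Matrix.mulVec, dotProduct, rC, mul_comm]
    rw [h1, eval_isDetSq hP hdA', Matrix.det_transpose, hdA, hIm, ← mul_assoc,
      inv_mul_cancel₀ (pow_ne_zero 2 (by exact_mod_cast hA)), one_mul, Matrix.mul_inv_rev,
      Matrix.mul_inv_rev, Matrix.mul_smul, Matrix.smul_mul, Matrix.transpose_nonsing_inv,
      Matrix.transpose_transpose, ← Matrix.mul_assoc]
  · rw [gexp, gexp]
    simp only [zero_dotProduct, mul_zero, add_zero]
    congr 2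
    rw [dotProduct_blk, dotProduct_blk]
    refine Finset.sum_congr rfl fun i _ => ?_
    rcases i with i | i
    · simp only [sB, Sum.elim_inl, cvec, dotProduct, Matrix.mulVec, Fin.sum_univ_two,
        Matrix.smul_apply, Matrix.mul_apply, Matrix.transpose_apply, Matrix.map_apply, smul_eq_mul]
      push_cast
      ring
    · simp only [sB, Sum.elim_inr, cvec, dotProduct, Matrix.mulVec, Fin.sum_univ_two,
        Matrix.smul_apply, Matrix.mul_apply, Matrix.transpose_apply, Matrix.map_apply, smul_eq_mul,
        cconj, map_add, map_mul, Complex.conj_ofReal]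
      push_cast
      ring

theorem phi_add (P : MvPolynomial (Fin b × Fin 2) ℂ) (B : Matrix (Fin 2) (Fin 2) ℝ)
    (τ : Matrix (Fin 2) (Fin 2) ℂ) (x : Idx b × Fin 2 → ℝ) :
    phi P (τ + rC B) x =
      e ((pairForm x fun p => ∑ k, B p.2 k * x (p.1, k)) / 2 : ℝ) * phi P τ x := by
  have h1 : cIm (τ + rC B) = cIm τ := by rw [cIm, im_add_real]; rfl
  rw [phi, phi, h1, mul_left_comm]
  congr 1
  rw [gexp, gexp, e, ← Complex.exp_add]
  congr 1
  simp only [zero_dotProduct, mul_zero, add_zero]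
  rw [dotProduct_blk, dotProduct_blk, pairForm]
  push_cast
  rw [Finset.mul_sum, Finset.mul_sum, Finset.sum_div, Finset.mul_sum, ← Finset.sum_add_distrib]
  refine Finset.sum_congr rfl fun i _ => ?_
  rcases i with i | i
  · simp only [sB, Sum.elim_inl, cvec, dotProduct, Matrix.mulVec, Fin.sum_univ_two,
      Matrix.smul_apply, Matrix.add_apply, Matrix.map_apply, smul_eq_mul]
    push_cast
    ring
  · simp only [sB, Sum.elim_inr, cvec, dotProduct, Matrix.mulVec, Fin.sum_univ_two,
      Matrix.smul_apply, Matrix.add_apply, Matrix.map_apply, smul_eq_mul,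
      cconj, map_add, Complex.conj_ofReal]
    push_cast
    ring

end Phi

end KM2

namespace KM2

/-! ### The polynomial `P_α` -/

section PolAlpha

open MvPolynomial

variable {b : ℕ}

/-- The polynomial `P_α` in the positive coordinates. -/
noncomputable def polPos (α₁ α₂ β₁ β₂ : Fin b) : MvPolynomial (Fin b × Fin 2) ℂ :=
  4 * ((X (α₁, 0) * X (β₁, 1) - X (β₁, 0) * X (α₁, 1)) *
    (X (α₂, 0) * X (β₂, 1) - X (β₂, 0) * X (α₂, 1)))

theorem posPoly_X (p : Fin b × Fin 2) : posPoly (X p) = X (Sum.inl p.1, p.2) := by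
  rw [posPoly, affSubst_X]
  simp [inclMat]

/-- The two signed sums over permutations separate, which exhibits `P_α` as four times a product of
two `2 × 2` minors. -/
theorem polAlpha_eq (α₁ α₂ β₁ β₂ : Fin b) :
    polAlpha α₁ α₂ β₁ β₂ = posPoly (polPos α₁ α₂ β₁ β₂) := by
  have h1 : posPoly (polPos α₁ α₂ β₁ β₂) = 4 * ((posPoly (X (α₁, 0)) * posPoly (X (β₁, 1)) -
      posPoly (X (β₁, 0)) * posPoly (X (α₁, 1))) * (posPoly (X (α₂, 0)) * posPoly (X (β₂, 1)) -
      posPoly (X (β₂, 0)) * posPoly (X (α₂, 1)))) := by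
    simp only [posPoly, polPos, map_mul, map_sub, map_ofNat]
  have hs : ∀ F : Equiv.Perm (Fin 2) → Pol b, ∑ σ, F σ = F 1 + F (Equiv.swap 0 1) := by
    intro F
    have hu : (Finset.univ : Finset (Equiv.Perm (Fin 2))) = {1, Equiv.swap 0 1} := by decide
    rw [hu, Finset.sum_pair (by decide)]
  rw [h1]
  simp only [posPoly_X, polAlpha, hs]
  simp
  ring

/-- Each of the two minors is multiplied by `det A`. -/
theorem isDetSq_polPos (α₁ α₂ β₁ β₂ : Fin b) : IsDetSq (polPos α₁ α₂ β₁ β₂) := by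
  intro A
  have h : ∀ i j, affSubst (blk fun _ => A) 0 (X (i, j) : MvPolynomial (Fin b × Fin 2) ℂ) =
      C (A j 0) * X (i, 0) + C (A j 1) * X (i, 1) := by
    intro i j
    rw [affSubst_X]
    simp [blk, Fintype.sum_prod_type, ite_smul, Fin.sum_univ_two, MvPolynomial.smul_eq_C_mul]
  simp only [polPos, map_mul, map_sub, map_ofNat, h, MvPolynomial.smul_eq_C_mul,
    Matrix.det_fin_two, map_pow]
  ring

end PolAlpha

/-! ### Orthogonal projections -/

section Geometry

variable {b : ℕ}

theorem form_apply (x y : V b) : form b x y = ∑ i : Fin b, x (Sum.inl i) * y (Sum.inl i) -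
    ∑ i : Fin 2, x (Sum.inr i) * y (Sum.inr i) := rfl

/-- Recognizes a projection from its properties. Nondegeneracy on `W` gives disjointness from the
complement and the decomposition `x = π x + (x - π x)` gives spanning, so the default value `0` in
`orthProj` does not occur. -/
theorem orthProj_eq {W : Submodule ℝ (V b)} {π : V b →ₗ[ℝ] V b} (h1 : ∀ x, π x ∈ W)
    (h2 : ∀ x, ∀ w ∈ W, form b w (x - π x) = 0)
    (h3 : ∀ w ∈ W, (∀ w' ∈ W, form b w' w = 0) → w = 0) : orthProj W = π := by
  have hc : IsCompl W ((form b).orthogonal W) := by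
    refine ⟨?_, ?_⟩
    · rw [Submodule.disjoint_def]
      intro x hx hx'
      exact h3 x hx fun w hw => hx' w hw
    · rw [codisjoint_iff, eq_top_iff]
      intro x _
      refine Submodule.mem_sup.2 ⟨π x, h1 x, x - π x, fun w hw => h2 x w hw, by abel⟩
  rw [orthProj, dif_pos hc]
  refine LinearMap.ext fun x => ?_
  have h4 : W.projection _ hc (π x) = π x := Submodule.projection_apply_of_mem_left hc (h1 x)
  have h5 : W.projection _ hc (x - π x) = 0 :=
    Submodule.projection_apply_of_mem_right hc fun w hw => h2 x w hw
  rw [map_sub, h4, sub_eq_zero] at h5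
  exact h5

/-- The positive coordinates of a vector. -/
def posProj (b : ℕ) : V b →ₗ[ℝ] V b :=
  LinearMap.pi (Sum.elim (fun i => LinearMap.proj (Sum.inl i)) fun _ => 0)

/-- The negative coordinates of a vector. -/
def negProj (b : ℕ) : V b →ₗ[ℝ] V b :=
  LinearMap.pi (Sum.elim (fun _ => 0) fun i => LinearMap.proj (Sum.inr i))

@[simp] theorem posProj_inl (x : V b) (i : Fin b) : posProj b x (Sum.inl i) = x (Sum.inl i) := rfl
@[simp] theorem posProj_inr (x : V b) (i : Fin 2) : posProj b x (Sum.inr i) = 0 := rfl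
@[simp] theorem negProj_inl (x : V b) (i : Fin b) : negProj b x (Sum.inl i) = 0 := rfl
@[simp] theorem negProj_inr (x : V b) (i : Fin 2) : negProj b x (Sum.inr i) = x (Sum.inr i) := rfl

/-- The Euclidean product of the positive coordinates. -/
def dotp (x y : V b) : ℝ := ∑ i : Fin b, x (Sum.inl i) * y (Sum.inl i)

/-- The Euclidean product of the negative coordinates. -/
def dotn (x y : V b) : ℝ := ∑ i : Fin 2, x (Sum.inr i) * y (Sum.inr i)

theorem form_eq (x y : V b) : form b x y = dotp x y - dotn x y := rfl

/-! ### Transport of the plane, its complement and `w` to the base point -/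

theorem mem_basePoint {x : V b} : x ∈ basePoint b ↔ ∀ i, x (Sum.inl i) = 0 := by
  constructor
  · intro hx i
    have : basePoint b ≤ LinearMap.ker (LinearMap.proj (R := ℝ) (φ := fun _ : Idx b => ℝ) (Sum.inl i)) := by
      refine Submodule.span_le.2 ?_
      rintro _ ⟨j, rfl⟩
      simp
    exact this hx
  · intro hx
    have : x = ∑ j : Fin 2, x (Sum.inr j) • (Pi.single (Sum.inr j) 1 : V b) := by
      funext i
      rcases i with i | i
      · simp [hx]
      · simp [Pi.single_apply]
    rw [this]
    exact Submodule.sum_mem _ fun j _ => Submodule.smul_mem _ _ (Submodule.subset_span ⟨j, rfl⟩)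

/-- The isometry `g` maps `z` to the base point. -/
structure MapsBase (g : V b ≃ₗ[ℝ] V b) (z : Submodule ℝ (V b)) : Prop where
  isom : ∀ x y, form b (g x) (g y) = form b x y
  base : z.map (g : V b →ₗ[ℝ] V b) = basePoint b

variable {g : V b ≃ₗ[ℝ] V b} {z : Submodule ℝ (V b)}

theorem MapsBase.mem_iff (h : MapsBase g z) {x : V b} : x ∈ z ↔ ∀ i, g x (Sum.inl i) = 0 := by
  rw [← mem_basePoint, ← h.base]
  constructor
  · exact fun hx => ⟨x, hx, rfl⟩
  · rintro ⟨y, hy, hxy⟩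
    rwa [← g.injective hxy]

theorem MapsBase.mem_perp_iff (h : MapsBase g z) {x : V b} :
    x ∈ perp z ↔ ∀ i, g x (Sum.inr i) = 0 := by
  constructor
  · intro hx i
    have h1 : g.symm (Pi.single (Sum.inr i) 1) ∈ z := by
      rw [h.mem_iff]; simp
    have h2 : form b (g.symm (Pi.single (Sum.inr i) 1)) x = 0 := hx _ h1
    rw [← h.isom, LinearEquiv.apply_symm_apply, form_apply] at h2
    simpa [Pi.single_apply] using h2
  · intro hx y hy
    rw [h.mem_iff] at hy
    change form b y x = 0
    rw [← h.isom, form_apply]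
    simp [hx, hy]

/-- Under `g` the plane becomes the base point, so the projection becomes the projection onto the
negative coordinates. -/
theorem MapsBase.orthProj_z (h : MapsBase g z) :
    orthProj z = g.symm.toLinearMap ∘ₗ negProj b ∘ₗ g.toLinearMap := by
  refine orthProj_eq (fun x => ?_) (fun x w hw => ?_) fun w hw h' => ?_
  · rw [h.mem_iff]; simp
  · rw [h.mem_iff] at hw
    rw [← h.isom, form_apply]
    simp [hw]
  · have h1 := h' (g.symm (negProj b (g w))) (by rw [h.mem_iff]; simp)
    rw [h.mem_iff] at hw
    rw [← h.isom, LinearEquiv.apply_symm_apply, form_apply] at h1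
    simp only [negProj_inl, zero_mul, Finset.sum_const_zero, negProj_inr, zero_sub,
      neg_eq_zero] at h1
    have h2 := (Finset.sum_eq_zero_iff_of_nonneg fun i _ => mul_self_nonneg _).1 h1
    apply g.injective
    rw [map_zero]
    funext i
    rcases i with i | i
    · exact hw i
    · exact mul_self_eq_zero.1 (h2 i (Finset.mem_univ _))

theorem MapsBase.orthProj_perp (h : MapsBase g z) :
    orthProj (perp z) = g.symm.toLinearMap ∘ₗ posProj b ∘ₗ g.toLinearMap := by
  refine orthProj_eq (fun x => ?_) (fun x w hw => ?_) fun w hw h' => ?_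
  · rw [h.mem_perp_iff]; simp
  · rw [h.mem_perp_iff] at hw
    rw [← h.isom, form_apply]
    simp [hw]
  · have h1 := h' (g.symm (posProj b (g w))) (by rw [h.mem_perp_iff]; simp)
    rw [h.mem_perp_iff] at hw
    rw [← h.isom, LinearEquiv.apply_symm_apply, form_apply] at h1
    simp only [posProj_inl, posProj_inr, zero_mul, Finset.sum_const_zero, sub_zero] at h1
    have h2 := (Finset.sum_eq_zero_iff_of_nonneg fun i _ => mul_self_nonneg _).1 h1
    apply g.injective
    rw [map_zero]
    funext i
    rcases i with i | i
    · exact mul_self_eq_zero.1 (h2 i (Finset.mem_univ _))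
    · exact hw i

theorem dotp_eq_form (x y : V b) : dotp x y = form b x (posProj b y) := by
  simp [form_apply, dotp]

theorem dotn_eq_form (x y : V b) : dotn x y = -form b x (negProj b y) := by
  simp [form_apply, dotn]

theorem dotp_self_eq_zero {x : V b} (h : dotp x x = 0) (i : Fin b) : x (Sum.inl i) = 0 :=
  mul_self_eq_zero.1 ((Finset.sum_eq_zero_iff_of_nonneg fun _ _ => mul_self_nonneg _).1 h i
    (Finset.mem_univ _))

theorem dotn_self_eq_zero {x : V b} (h : dotn x x = 0) (i : Fin 2) : x (Sum.inr i) = 0 :=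
  mul_self_eq_zero.1 ((Finset.sum_eq_zero_iff_of_nonneg fun _ _ => mul_self_nonneg _).1 h i
    (Finset.mem_univ _))

/-- The projection of the positive coordinates to the complement of a vector. -/
noncomputable def cutPos (a : V b) : V b →ₗ[ℝ] V b :=
  posProj b - ((form b).flip (posProj b a)).smulRight ((dotp a a)⁻¹ • posProj b a)

/-- The projection of the negative coordinates to the complement of a vector. -/
noncomputable def cutNeg (a : V b) : V b →ₗ[ℝ] V b :=
  negProj b + ((form b).flip (negProj b a)).smulRight ((dotn a a)⁻¹ • negProj b a)

@[simp] theorem cutPos_inl (a x : V b) (i : Fin b) : cutPos a x (Sum.inl i) =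
    x (Sum.inl i) - dotp x a / dotp a a * a (Sum.inl i) := by
  simp [cutPos, ← dotp_eq_form]; ring

@[simp] theorem cutPos_inr (a x : V b) (i : Fin 2) : cutPos a x (Sum.inr i) = 0 := by
  simp [cutPos]

@[simp] theorem cutNeg_inl (a x : V b) (i : Fin b) : cutNeg a x (Sum.inl i) = 0 := by
  simp [cutNeg]

@[simp] theorem cutNeg_inr (a x : V b) (i : Fin 2) : cutNeg a x (Sum.inr i) =
    x (Sum.inr i) - dotn x a / dotn a a * a (Sum.inr i) := by
  simp [cutNeg, dotn_eq_form x a]; ring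

theorem dotp_cutPos {a : V b} (ha : dotp a a ≠ 0) (x : V b) : dotp (cutPos a x) a = 0 := by
  simp only [dotp, cutPos_inl, sub_mul, Finset.sum_sub_distrib, mul_assoc, ← Finset.mul_sum]
  change dotp x a - dotp x a / dotp a a * dotp a a = 0
  field_simp
  ring

theorem dotn_cutNeg {a : V b} (ha : dotn a a ≠ 0) (x : V b) : dotn (cutNeg a x) a = 0 := by
  simp only [dotn, cutNeg_inr, sub_mul, Finset.sum_sub_distrib, mul_assoc, ← Finset.mul_sum]
  change dotn x a - dotn x a / dotn a a * dotn a a = 0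
  field_simp
  ring

theorem MapsBase.mem_wPos_iff (h : MapsBase g z) {u x : V b} :
    x ∈ wPos z u ↔ (∀ i, g x (Sum.inr i) = 0) ∧ dotp (g x) (g u) = 0 := by
  rw [wPos, Submodule.mem_inf, h.mem_perp_iff]
  refine and_congr_right fun _ => ?_
  have hf : form b (orthProj (perp z) u) x = dotp (g x) (g u) := by
    rw [h.orthProj_perp, ← h.isom]
    simp [form_apply, dotp, mul_comm]
  rw [← hf]
  constructor
  · intro hx
    exact hx _ (Submodule.mem_span_singleton_self _)
  · intro hx y hy
    obtain ⟨c, rfl⟩ := Submodule.mem_span_singleton.1 hy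
    change form b _ _ = 0
    rw [map_smul, LinearMap.smul_apply, hx, smul_zero]

theorem MapsBase.mem_wNeg_iff (h : MapsBase g z) {u x : V b} :
    x ∈ wNeg z u ↔ (∀ i, g x (Sum.inl i) = 0) ∧ dotn (g x) (g u) = 0 := by
  rw [wNeg, Submodule.mem_inf, h.mem_iff]
  refine and_congr_right fun _ => ?_
  have hf : form b (orthProj z u) x = -dotn (g x) (g u) := by
    rw [h.orthProj_z, ← h.isom]
    simp [form_apply, dotn, mul_comm]
  rw [← neg_eq_zero, ← hf]
  constructor
  · intro hx
    exact hx _ (Submodule.mem_span_singleton_self _)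
  · intro hx y hy
    obtain ⟨c, rfl⟩ := Submodule.mem_span_singleton.1 hy
    change form b _ _ = 0
    rw [map_smul, LinearMap.smul_apply, hx, smul_zero]

/-- A Gram–Schmidt step in the Euclidean space of positive coordinates, carried back by `g`. -/
theorem MapsBase.orthProj_wPos (h : MapsBase g z) {u : V b} (hu : dotp (g u) (g u) ≠ 0) :
    orthProj (wPos z u) = g.symm.toLinearMap ∘ₗ cutPos (g u) ∘ₗ g.toLinearMap := by
  refine orthProj_eq (fun x => ?_) (fun x w hw => ?_) fun w hw h' => ?_
  · rw [h.mem_wPos_iff]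
    simp [dotp_cutPos hu]
  · rw [h.mem_wPos_iff] at hw
    have h2 := hw.2
    rw [← h.isom, form_apply]
    simp only [map_sub, LinearMap.comp_apply, LinearEquiv.coe_coe, LinearEquiv.apply_symm_apply,
      Pi.sub_apply, cutPos_inl, cutPos_inr, hw.1, sub_sub_cancel, zero_mul,
      Finset.sum_const_zero, sub_zero]
    simp only [mul_left_comm (g w _), ← Finset.mul_sum]
    rw [dotp] at h2
    rw [h2, mul_zero]
  · have h1 := h' w hw
    rw [h.mem_wPos_iff] at hw
    rw [← h.isom, form_eq] at h1
    have h2 : dotn (g w) (g w) = 0 := by simp [dotn, hw.1]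
    rw [h2, sub_zero] at h1
    apply g.injective
    rw [map_zero]
    funext i
    rcases i with i | i
    · exact dotp_self_eq_zero h1 i
    · exact hw.1 i

theorem MapsBase.orthProj_wNeg (h : MapsBase g z) {u : V b} (hu : dotn (g u) (g u) ≠ 0) :
    orthProj (wNeg z u) = g.symm.toLinearMap ∘ₗ cutNeg (g u) ∘ₗ g.toLinearMap := by
  refine orthProj_eq (fun x => ?_) (fun x w hw => ?_) fun w hw h' => ?_
  · rw [h.mem_wNeg_iff]
    simp [dotn_cutNeg hu]
  · rw [h.mem_wNeg_iff] at hw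
    have h2 := hw.2
    rw [← h.isom, form_apply]
    simp only [map_sub, LinearMap.comp_apply, LinearEquiv.coe_coe, LinearEquiv.apply_symm_apply,
      Pi.sub_apply, cutNeg_inl, cutNeg_inr, hw.1, sub_sub_cancel, zero_mul,
      Finset.sum_const_zero, zero_sub]
    simp only [mul_left_comm (g w _), ← Finset.mul_sum]
    rw [dotn] at h2
    rw [h2, mul_zero, neg_zero]
  · have h1 := h' w hw
    rw [h.mem_wNeg_iff] at hw
    rw [← h.isom, form_eq] at h1
    have h2 : dotp (g w) (g w) = 0 := by simp [dotp, hw.1]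
    rw [h2, zero_sub, neg_eq_zero] at h1
    apply g.injective
    rw [map_zero]
    funext i
    rcases i with i | i
    · exact hw.1 i
    · exact dotn_self_eq_zero h1 i

/-- The projection to the complement of the positive and the negative part of a vector. -/
noncomputable def cut (a : V b) : V b →ₗ[ℝ] V b := cutPos a + cutNeg a

@[simp] theorem cut_inl (a x : V b) (i : Fin b) : cut a x (Sum.inl i) =
    x (Sum.inl i) - dotp x a / dotp a a * a (Sum.inl i) := by
  simp [cut]

@[simp] theorem cut_inr (a x : V b) (i : Fin 2) : cut a x (Sum.inr i) =
    x (Sum.inr i) - dotn x a / dotn a a * a (Sum.inr i) := by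
  simp [cut]

theorem MapsBase.gw_eq (h : MapsBase g z) {u : V b} (hp : dotp (g u) (g u) ≠ 0)
    (hn : dotn (g u) (g u) ≠ 0) : gw g z u = cut (g u) ∘ₗ g.toLinearMap := by
  rw [gw, h.orthProj_wPos hp, h.orthProj_wNeg hn]
  refine LinearMap.ext fun x => ?_
  simp [cut]

theorem MapsBase.normPos_eq (h : MapsBase g z) (u : V b) : normPos z u = dotp (g u) (g u) := by
  rw [normPos, h.orthProj_perp, ← h.isom]
  simp [form_apply, dotp]

theorem MapsBase.normNeg_eq (h : MapsBase g z) (u : V b) :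
    form b (orthProj z u) (orthProj z u) = -dotn (g u) (g u) := by
  rw [h.orthProj_z, ← h.isom]
  simp [form_apply, dotn]

/-- The two parts of an isotropic vector have the same Euclidean length. This allows both squares
along the line through `g u` to be completed with one constant. -/
theorem MapsBase.isotropic (h : MapsBase g z) {u : V b} (h0 : form b u u = 0) :
    dotn (g u) (g u) = dotp (g u) (g u) := by
  rw [← h.isom, form_eq] at h0
  linarith

theorem MapsBase.dotp_pos (h : MapsBase g z) {u : V b} (h0 : form b u u = 0) (hu : u ≠ 0) :
    0 < dotp (g u) (g u) := by
  refine lt_of_le_of_ne (Finset.sum_nonneg fun i _ => mul_self_nonneg _) fun h1 => hu ?_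
  apply g.injective
  rw [map_zero]
  funext i
  rcases i with i | i
  · exact dotp_self_eq_zero h1.symm i
  · exact dotn_self_eq_zero ((h.isotropic h0).trans h1.symm) i

/-- For `x` orthogonal to `u'`, pairing with `μ` averages the coefficients of `g x` along the
positive and the negative part of `g u`. That average is the center `ctr` of the Gaussian on the
line `x + ℝu`. -/
theorem MapsBase.form_mu (h : MapsBase g z) {u u' x : V b} (h0 : form b u u = 0)
    (hx : form b x u' = 0) : form b x (mu z u u') =
      (dotp (g x) (g u) / dotp (g u) (g u) + dotn (g x) (g u) / dotp (g u) (g u)) / 2 := by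
  have h1 : form b x (orthProj (perp z) u) = dotp (g x) (g u) := by
    rw [h.orthProj_perp, ← h.isom]
    simp [form_apply, dotp]
  have h2 : form b x (orthProj z u) = -dotn (g x) (g u) := by
    rw [h.orthProj_z, ← h.isom]
    simp [form_apply, dotn]
  rw [mu, h.normNeg_eq, h.normPos_eq, h.isotropic h0, map_add, map_add, map_neg, map_smul,
    map_smul, h1, h2, hx]
  simp only [smul_eq_mul, mul_neg, mul_inv, inv_neg]
  ring

end Geometry

end KM2

namespace KM2

/-! ### The polynomials `P_{α,g_w,h₁,h₂}` -/

section CutPoly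

open MvPolynomial

variable {b : ℕ}

/-- Heat matrices need only be compared on the positive coordinates. -/
theorem heat_posPoly_congr {A B : Matrix (Idx b × Fin 2) (Idx b × Fin 2) ℂ}
    (h : ∀ p q : Fin b × Fin 2, A (Sum.inl p.1, p.2) (Sum.inl q.1, q.2) =
      B (Sum.inl p.1, p.2) (Sum.inl q.1, q.2)) (P : MvPolynomial (Fin b × Fin 2) ℂ) :
    heat A (posPoly P) = heat B (posPoly P) := by
  have h1 : ∀ A : Matrix (Idx b × Fin 2) (Idx b × Fin 2) ℂ, ∀ p q,
      (inclMat b * A * (inclMat b)ᵀ) p q = A (Sum.inl p.1, p.2) (Sum.inl q.1, q.2) := by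
    intro A p q
    simp [inclMat, Matrix.mul_apply, Matrix.transpose_apply]
  have h2 : inclMat b * A * (inclMat b)ᵀ = inclMat b * B * (inclMat b)ᵀ := by
    ext p q
    rw [h1, h1, h]
  rw [posPoly, ← affSubst_heat, ← affSubst_heat, h2]

/-- The substitution whose coefficients are the polynomials `P_{g_w,h₁,h₂}`. -/
noncomputable def cutSub (a : V b) : Pol b →ₐ[ℂ] MvPolynomial (Fin 2) (Pol b) :=
  aeval fun p : Idx b × Fin 2 =>
    C (C ((posProj b a p.1 / dotp a a : ℝ) : ℂ)) * X p.2 +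
      C (∑ k : Idx b, C ((cut a (Pi.single k 1) p.1 : ℝ) : ℂ) * X (k, p.2))

/-- The coefficients of the substitution `cutSub`. -/
noncomputable def polCut (P : Pol b) (a : V b) (h₁ h₂ : ℕ) : Pol b :=
  coeff (Finsupp.single 0 h₁ + Finsupp.single 1 h₂) (cutSub a P)

theorem MapsBase.polW_eq {g : V b ≃ₗ[ℝ] V b} {z : Submodule ℝ (V b)} (h : MapsBase g z) {u : V b}
    (hp : dotp (g u) (g u) ≠ 0) (hn : dotn (g u) (g u) ≠ 0) (P : Pol b) (h₁ h₂ : ℕ) :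
    polW P g z u h₁ h₂ = polCut P (g u) h₁ h₂ := by
  rw [polW, polCut, cutSub, h.gw_eq hp hn, h.normPos_eq, h.orthProj_perp]
  simp

/-- Each minor is linear in each vector, so it has degree at most one in each of `S₁`, `S₂`, and
`P_α` at most two. This justifies the ranges `h₁, h₂ < 3`. -/
theorem degreeOf_cutSub_le (a : V b) (α₁ α₂ β₁ β₂ : Fin b) (j : Fin 2) :
    (cutSub a (polAlpha α₁ α₂ β₁ β₂)).degreeOf j ≤ 2 := by
  have hX : ∀ p : Idx b × Fin 2, (cutSub a (X p)).degreeOf j ≤ if j = p.2 then 1 else 0 := by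
    intro p
    rw [cutSub, aeval_X]
    refine (degreeOf_add_le _ _ _).trans (max_le ((degreeOf_C_mul_le _ _ _).trans ?_) ?_)
    · rw [degreeOf_X]
    · rw [degreeOf_C]; exact Nat.zero_le _
  have h1 : ∀ i k i' k' : Fin b, (cutSub a (X (Sum.inl i, 0)) * cutSub a (X (Sum.inl k, 1)) -
      cutSub a (X (Sum.inl i', 0)) * cutSub a (X (Sum.inl k', 1))).degreeOf j ≤ 1 := by
    have h2 : ∀ i k : Fin b, (cutSub a (X (Sum.inl i, 0)) *
        cutSub a (X (Sum.inl k, 1))).degreeOf j ≤ 1 := by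
      intro i k
      refine (degreeOf_mul_le _ _ _).trans ((add_le_add (hX _) (hX _)).trans ?_)
      fin_cases j <;> simp
    intro i k i' k'
    exact (degreeOf_sub_le _ _ _).trans (max_le (h2 _ _) (h2 _ _))
  have h3 : cutSub a (polAlpha α₁ α₂ β₁ β₂) = C 4 *
      ((cutSub a (X (Sum.inl α₁, 0)) * cutSub a (X (Sum.inl β₁, 1)) -
        cutSub a (X (Sum.inl β₁, 0)) * cutSub a (X (Sum.inl α₁, 1))) *
      (cutSub a (X (Sum.inl α₂, 0)) * cutSub a (X (Sum.inl β₂, 1)) -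
        cutSub a (X (Sum.inl β₂, 0)) * cutSub a (X (Sum.inl α₂, 1)))) := by
    have h4 : polAlpha α₁ α₂ β₁ β₂ = 4 * ((X (Sum.inl α₁, 0) * X (Sum.inl β₁, 1) -
        X (Sum.inl β₁, 0) * X (Sum.inl α₁, 1)) * (X (Sum.inl α₂, 0) * X (Sum.inl β₂, 1) -
        X (Sum.inl β₂, 0) * X (Sum.inl α₂, 1))) := by
      rw [polAlpha_eq]
      have h5 : ∀ p, affSubst (inclMat b) 0 (X p) = X (Sum.inl p.1, p.2) := posPoly_X
      simp only [h5, posPoly, polPos, map_mul, map_sub, map_ofNat]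
    rw [h4]
    simp only [map_mul, map_sub, map_ofNat]
  rw [h3]
  exact (degreeOf_C_mul_le _ _ _).trans ((degreeOf_mul_le _ _ _).trans
    (add_le_add (h1 _ _ _ _) (h1 _ _ _ _)))

theorem eq_sum_of_degreeOf_le {R : Type*} [CommRing R] {F : MvPolynomial (Fin 2) R}
    {n : ℕ} (hF : ∀ j, F.degreeOf j ≤ n) :
    F = ∑ h₁ ∈ Finset.range (n + 1), ∑ h₂ ∈ Finset.range (n + 1),
      C (coeff (Finsupp.single 0 h₁ + Finsupp.single 1 h₂) F) * (X 0 ^ h₁ * X 1 ^ h₂) := by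
  have hd : ∀ d : Fin 2 →₀ ℕ, d = Finsupp.single 0 (d 0) + Finsupp.single 1 (d 1) := by
    intro d
    ext j
    fin_cases j <;> simp
  have hm : ∀ h₁ h₂ : ℕ, ∀ r : R, C r * (X 0 ^ h₁ * X 1 ^ h₂) =
      monomial (Finsupp.single (0 : Fin 2) h₁ + Finsupp.single 1 h₂) r := by
    intro h₁ h₂ r
    rw [X_pow_eq_monomial, X_pow_eq_monomial, monomial_mul, C_mul_monomial, mul_one, mul_one]
  simp only [hm]
  ext d
  simp only [coeff_sum, coeff_monomial]
  have hiff : ∀ h₁ h₂ : ℕ, (Finsupp.single (0 : Fin 2) h₁ + Finsupp.single 1 h₂ = d) ↔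
      h₁ = d 0 ∧ h₂ = d 1 := by
    intro h₁ h₂
    constructor
    · rintro rfl
      simp
    · rintro ⟨rfl, rfl⟩
      exact (hd d).symm
  simp only [hiff]
  by_cases hs : d ∈ F.support
  · have h0 : d 0 < n + 1 := Nat.lt_succ_of_le ((monomial_le_degreeOf 0 hs).trans (hF 0))
    have h1 : d 1 < n + 1 := Nat.lt_succ_of_le ((monomial_le_degreeOf 1 hs).trans (hF 1))
    rw [Finset.sum_eq_single (d 0), Finset.sum_eq_single (d 1)]
    · rw [if_pos ⟨rfl, rfl⟩, ← hd]
    · intro k _ hk; rw [if_neg (fun h => hk h.2)]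
    · intro h; exact absurd (Finset.mem_range.2 h1) h
    · intro k _ hk
      exact Finset.sum_eq_zero fun l _ => if_neg fun h => hk h.1
    · intro h; exact absurd (Finset.mem_range.2 h0) h
  · rw [notMem_support_iff.1 hs]
    symm
    refine Finset.sum_eq_zero fun k _ => Finset.sum_eq_zero fun l _ => ?_
    split_ifs with h
    · rw [h.1, h.2, ← hd, notMem_support_iff.1 hs]
    · rfl

/-- Iterated polynomials as polynomials in two sets of variables. -/
noncomputable def collect {ι : Type*} :
    MvPolynomial (Fin 2) (MvPolynomial ι ℂ) →+* MvPolynomial (Fin 2 ⊕ ι) ℂ :=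
  eval₂Hom (eval₂Hom C fun p => X (Sum.inr p)) fun j => X (Sum.inl j)

theorem collect_C_C {ι : Type*} (r : ℂ) :
    collect (C (C r) : MvPolynomial (Fin 2) (MvPolynomial ι ℂ)) = C r := by
  simp [collect]

theorem collect_C_X {ι : Type*} (p : ι) :
    collect (C (X p) : MvPolynomial (Fin 2) (MvPolynomial ι ℂ)) = X (Sum.inr p) := by
  simp [collect]

theorem collect_X {ι : Type*} (j : Fin 2) :
    collect (X j : MvPolynomial (Fin 2) (MvPolynomial ι ℂ)) = X (Sum.inl j) := by
  simp [collect]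

/-- The matrix of the substitution `cutSub`. -/
noncomputable def cutMat (a : V b) : Matrix (Idx b × Fin 2) (Fin 2 ⊕ (Idx b × Fin 2)) ℂ :=
  Matrix.of fun p => Sum.elim (fun j => if j = p.2 then ((posProj b a p.1 / dotp a a : ℝ) : ℂ) else 0)
    fun q => if q.2 = p.2 then ((cut a (Pi.single q.1 1) p.1 : ℝ) : ℂ) else 0

/-- Presents the substitution that defines the coefficients as one linear substitution in the joint
variables `S_j` and `x`, to which `affSubst_heat` applies. -/
theorem affSubst_cutMat (a : V b) (P : Pol b) :
    affSubst (cutMat a) 0 P = collect (cutSub a P) := by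
  have h : (affSubst (cutMat a) 0 : Pol b →ₐ[ℂ] _).toRingHom =
      (collect).comp (cutSub a).toRingHom := by
    refine MvPolynomial.ringHom_ext (fun r => ?_) fun p => ?_
    · change affSubst (cutMat a) 0 (C r) = collect (cutSub a (C r))
      rw [cutSub, algHom_C]
      change _ = collect (aeval _ (C r))
      rw [algHom_C]
      change C r = collect (C (C r))
      rw [collect_C_C]
    · change affSubst (cutMat a) 0 (X p) = collect (cutSub a (X p))
      rw [affSubst_X, cutSub, aeval_X]
      simp only [map_add, map_mul, map_sum, collect_C_C, collect_X, collect_C_X]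
      have hite : ∀ (c : Prop) [Decidable c] (r : ℂ) (Y : MvPolynomial (Fin 2 ⊕ (Idx b × Fin 2)) ℂ),
          C (if c then r else 0) * Y = if c then C r * Y else 0 := by
        intro c _ r Y
        split_ifs <;> simp
      simp only [Fintype.sum_sum_type, cutMat, Matrix.of_apply, Sum.elim_inl, Sum.elim_inr,
        Pi.zero_apply, map_zero, add_zero, MvPolynomial.smul_eq_C_mul, hite]
      refine congrArg₂ (· + ·) (by simp) ?_
      rw [Fintype.sum_prod_type, Fintype.sum_sum_type]
      exact congrArg₂ (· + ·) (Finset.sum_congr rfl fun k _ => by simp)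
        (Finset.sum_congr rfl fun k _ => by simp)
  exact congrArg (fun F => F P) h

theorem heat_X_mul_of_eq_zero {κ : Type*} [Fintype κ] [DecidableEq κ] {A : Matrix κ κ ℂ} {p : κ}
    (h : ∀ q, A p q = 0) (h' : ∀ q, A q p = 0) (Q : MvPolynomial κ ℂ) :
    heat A (X p * Q) = X p * heat A Q := by
  rw [heat_X_mul, gradOp_apply]
  simp [h, h']

/-- A matrix extended by zero to the first set of variables. -/
def dropBlk {ι : Type*} (A : Matrix ι ι ℂ) : Matrix (Fin 2 ⊕ ι) (Fin 2 ⊕ ι) ℂ :=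
  Matrix.fromBlocks 0 0 0 A

/-- The matrix of the inclusion of the second set of variables. -/
def dropMat (ι : Type*) [DecidableEq ι] : Matrix ι (Fin 2 ⊕ ι) ℂ := Matrix.fromCols 0 1

/-- A heat operator acting only on the inner variables can be applied before or after flattening the
iterated polynomial. -/
theorem heat_collect_C {ι : Type*} [Fintype ι] [DecidableEq ι] (A : Matrix ι ι ℂ)
    (Q : MvPolynomial ι ℂ) :
    heat (dropBlk A)
      (collect (C Q)) = collect (C (heat A Q)) := by
  have h : ∀ Q : MvPolynomial ι ℂ, collect (C Q) =
      affSubst (dropMat ι) 0 Q := by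
    intro Q
    have h : (collect).comp C =
        (affSubst (dropMat ι) 0 :
          MvPolynomial ι ℂ →ₐ[ℂ] _).toRingHom := by
      refine MvPolynomial.ringHom_ext (fun r => ?_) fun p => ?_
      · change collect (C (C r)) = affSubst _ 0 (C r)
        rw [algHom_C, collect_C_C]
        rfl
      · change collect (C (X p)) = affSubst _ 0 (X p)
        rw [affSubst_X, collect_C_X]
        simp [dropMat, Fintype.sum_sum_type, Matrix.one_apply, ite_smul]
    exact congrArg (fun F => F Q) h
  have h2 : dropMat ι * dropBlk A * (dropMat ι)ᵀ =
      A := by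
    rw [dropMat, dropBlk, Matrix.fromCols_mul_fromBlocks, Matrix.transpose_fromCols,
      Matrix.fromCols_mul_fromRows]
    simp
  rw [h, h, ← affSubst_heat, h2]

theorem eval_collect_C {ι : Type*} (Q : MvPolynomial ι ℂ) (s : Fin 2 → ℂ) (x : ι → ℂ) :
    eval (Sum.elim s x) (collect (C Q)) = eval x Q := by
  have h : ((eval (Sum.elim s x)).comp (collect)).comp C = eval x := by
    refine MvPolynomial.ringHom_ext (fun r => ?_) fun p => ?_
    · change eval _ (collect (C (C r))) = _
      simp [collect_C_C]
    · change eval _ (collect (C (X p))) = _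
      simp [collect_C_X]
  exact congrArg (fun F => F Q) h

/-- Evaluation of the heat flow of `P_α` in terms of the heat flows of its coefficients. -/
theorem eval_heat_polCut (a : V b) (α₁ α₂ β₁ β₂ : Fin b)
    (A : Matrix (Idx b × Fin 2) (Idx b × Fin 2) ℂ) (s : Fin 2 → ℂ) (x : Idx b × Fin 2 → ℂ) :
    eval (cutMat a *ᵥ Sum.elim s x)
      (heat (cutMat a * dropBlk A * (cutMat a)ᵀ) (polAlpha α₁ α₂ β₁ β₂)) =
    ∑ h₁ ∈ Finset.range 3, ∑ h₂ ∈ Finset.range 3, s 0 ^ h₁ * s 1 ^ h₂ *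
      eval x (heat A (polCut (polAlpha α₁ α₂ β₁ β₂) a h₁ h₂)) := by
  have h1 := eval_affSubst (cutMat a) 0 (Sum.elim s x)
    (heat (cutMat a * dropBlk A * (cutMat a)ᵀ) (polAlpha α₁ α₂ β₁ β₂))
  rw [add_zero] at h1
  rw [← h1, affSubst_heat, affSubst_cutMat,
    eq_sum_of_degreeOf_le (degreeOf_cutSub_le a α₁ α₂ β₁ β₂)]
  -- The operator has no derivative in the variables `S_j`, so their powers pass through it.
  have hp : ∀ (j : Fin 2) (n : ℕ) (Q : MvPolynomial (Fin 2 ⊕ (Idx b × Fin 2)) ℂ),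
      heat (dropBlk A) (X (Sum.inl j) ^ n * Q) =
        X (Sum.inl j) ^ n * heat (dropBlk A) Q := by
    intro j n Q
    induction n with
    | zero => simp
    | succ n ih =>
      rw [pow_succ', mul_assoc, heat_X_mul_of_eq_zero, ih, mul_assoc]
      · rintro (q | q) <;> simp [dropBlk]
      · rintro (q | q) <;> simp [dropBlk]
  simp only [map_sum, heat_sum, map_mul, map_pow, collect_X]
  refine Finset.sum_congr rfl fun h₁ _ => Finset.sum_congr rfl fun h₂ _ => ?_
  rw [mul_comm, mul_assoc, hp, hp, heat_collect_C, map_mul, map_mul, map_pow, map_pow,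
    eval_collect_C, eval_X, eval_X, ← mul_assoc]
  rfl

end CutPoly

end KM2

namespace KM2

/-! ### Fourier transforms along an isotropic line -/

section PartialFourier

open MeasureTheory

variable {b : ℕ}

/-- The components of a flattened pair of vectors. -/
def col (X : Idx b × Fin 2 → ℝ) (j : Fin 2) : V b := fun i => X (i, j)

/-- A pair of vectors in flattened coordinates. -/
def flat (x : Fin 2 → V b) : Idx b × Fin 2 → ℝ := fun p => x p.2 p.1

/-- The pair of multiples of a vector, in flattened coordinates. -/
def line (a : V b) (t : Fin 2 → ℝ) : Idx b × Fin 2 → ℝ := fun p => t p.2 * a p.1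

/-- The projection of a pair of vectors to the complement of the two parts of a vector. -/
noncomputable def cutF (a : V b) (X : Idx b × Fin 2 → ℝ) : Idx b × Fin 2 → ℝ :=
  flat fun j => cut a (col X j)

/-- The scalar products with a vector. -/
def hgt (a : V b) (X : Idx b × Fin 2 → ℝ) : Fin 2 → ℝ := fun j => form b (col X j) a

/-- The center of the restriction of the Gaussian to a line. -/
noncomputable def ctr (a : V b) (X : Idx b × Fin 2 → ℝ) : Fin 2 → ℝ :=
  fun j => (dotp (col X j) a + dotn (col X j) a) / (2 * dotp a a)

/-- Pythagoras: the cross terms vanish because the components `p` are orthogonal to `α`. -/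
theorem sum_quad_of_orthogonal {ι : Type*} [Fintype ι] {S : Matrix (Fin 2) (Fin 2) ℂ}
    (hS : S 1 0 = S 0 1) (α : ι → ℝ) (p : ι → Fin 2 → ℝ) (r : Fin 2 → ℝ)
    (h0 : ∀ j, ∑ i, p i j * α i = 0) :
    ∑ i, cvec (fun k => p i k + r k * α i) ⬝ᵥ S *ᵥ cvec (fun k => p i k + r k * α i) =
      ∑ i, cvec (p i) ⬝ᵥ S *ᵥ cvec (p i) +
        ((∑ i, α i * α i : ℝ) : ℂ) * (cvec r ⬝ᵥ S *ᵥ cvec r) := by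
  have h1 : ∀ j, ∑ i, ((p i j : ℝ) : ℂ) * ((α i : ℝ) : ℂ) = 0 := fun j => by
    exact_mod_cast h0 j
  have h2 : ∀ i, cvec (fun k => p i k + r k * α i) ⬝ᵥ S *ᵥ cvec (fun k => p i k + r k * α i) =
      cvec (p i) ⬝ᵥ S *ᵥ cvec (p i) + ((α i : ℝ) : ℂ) * ((α i : ℝ) : ℂ) * (cvec r ⬝ᵥ S *ᵥ cvec r) +
      (2 * (r 0 * S 0 0 + r 1 * S 0 1)) * (((p i 0 : ℝ) : ℂ) * ((α i : ℝ) : ℂ)) +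
      (2 * (r 0 * S 0 1 + r 1 * S 1 1)) * (((p i 1 : ℝ) : ℂ) * ((α i : ℝ) : ℂ)) := by
    intro i
    simp only [dotProduct, Matrix.mulVec, Fin.sum_univ_two, cvec, hS]
    push_cast
    ring
  simp only [h2, Finset.sum_add_distrib, ← Finset.mul_sum, ← Finset.sum_mul, h1]
  push_cast
  ring

/-- Let `N = dotp a a`, and let `p`, `n` be the coefficients of `X` along the positive and the
negative part of `a`. The parts contribute `N(-iτ)` at `t + p` and `N(iτ̄)` at `t + n`. Around the
midpoint `ctr = (p + n)/2`, with `hgt = N(p - n)`, the imaginary part of `τ` gives two squares and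
the real part only a term linear in `t`. -/
theorem quad_add_line {a : V b} (hN : 0 < dotp a a) (h0 : dotn a a = dotp a a)
    {τ : Matrix (Fin 2) (Fin 2) ℂ} (hτ : τ ∈ Siegel) (X : Idx b × Fin 2 → ℝ) (t : Fin 2 → ℝ) :
    cvec (X + line a t) ⬝ᵥ blk (sB b τ) *ᵥ cvec (X + line a t) =
      cvec (cutF a X) ⬝ᵥ blk (sB b τ) *ᵥ cvec (cutF a X) +
      (2 * dotp a a : ℂ) * (cvec (t + ctr a X) ⬝ᵥ cIm τ *ᵥ cvec (t + ctr a X)) +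
      (1 / (2 * dotp a a) : ℂ) * (cvec (hgt a X) ⬝ᵥ cIm τ *ᵥ cvec (hgt a X)) -
      2 * Complex.I * (cvec (t + ctr a X) ⬝ᵥ rC (τ.map Complex.re) *ᵥ cvec (hgt a X)) := by
  have hN' : (dotp a a : ℂ) ≠ 0 := by exact_mod_cast hN.ne'
  have hs : τ 1 0 = τ 0 1 := congrFun (congrFun hτ.1 0) 1
  have e1 := sum_quad_of_orthogonal (ι := Fin b) (S := (-Complex.I) • τ) (by simp [hs])
    (fun i => a (Sum.inl i)) (fun i k => cutF a X (Sum.inl i, k))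
    (fun k => t k + dotp (col X k) a / dotp a a)
    (fun j => dotp_cutPos hN.ne' (col X j) |> fun h => by simpa [dotp, cutF, flat] using h)
  have e2 := sum_quad_of_orthogonal (ι := Fin 2) (S := Complex.I • cconj τ) (by simp [cconj, hs])
    (fun i => a (Sum.inr i)) (fun i k => cutF a X (Sum.inr i, k))
    (fun k => t k + dotn (col X k) a / dotn a a)
    (fun j => dotn_cutNeg (h0 ▸ hN.ne') (col X j) |> fun h => by
      simpa [dotn, cutF, flat] using h)
  have f1 : ∀ i k, (X + line a t) (Sum.inl i, k) = cutF a X (Sum.inl i, k) +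
      (t k + dotp (col X k) a / dotp a a) * a (Sum.inl i) := by
    intro i k
    simp [cutF, flat, line, col]
    ring
  have f2 : ∀ i k, (X + line a t) (Sum.inr i, k) = cutF a X (Sum.inr i, k) +
      (t k + dotn (col X k) a / dotn a a) * a (Sum.inr i) := by
    intro i k
    simp [cutF, flat, line, col]
    ring
  have g1 : ∀ i, (fun k => cvec (X + line a t) (Sum.inl i, k)) = cvec (fun k =>
      cutF a X (Sum.inl i, k) + (t k + dotp (col X k) a / dotp a a) * a (Sum.inl i)) := by
    intro i; funext k; simp only [cvec, f1]
  have g2 : ∀ i, (fun k => cvec (X + line a t) (Sum.inr i, k)) = cvec (fun k =>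
      cutF a X (Sum.inr i, k) + (t k + dotn (col X k) a / dotn a a) * a (Sum.inr i)) := by
    intro i; funext k; simp only [cvec, f2]
  have d1 : ∑ i, a (Sum.inl i) * a (Sum.inl i) = dotp a a := rfl
  have d2 : ∑ i, a (Sum.inr i) * a (Sum.inr i) = dotp a a := h0
  rw [d1] at e1
  rw [d2] at e2
  rw [dotProduct_blk, dotProduct_blk, Fintype.sum_sum_type, Fintype.sum_sum_type]
  have g3 : ∀ i : Idx b, (fun k => cvec (cutF a X) (i, k)) = cvec fun k => cutF a X (i, k) :=
    fun _ => rfl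
  simp only [g1, g2, g3]
  simp only [sB, Sum.elim_inl, Sum.elim_inr]
  rw [e1, e2, h0]
  have hτ2 : ∀ i j, τ i j = ((τ i j).re : ℂ) + ((τ i j).im : ℂ) * Complex.I := fun i j =>
    (Complex.re_add_im _).symm
  have key : (dotp a a : ℂ) * (cvec (fun k => t k + dotp (col X k) a / dotp a a) ⬝ᵥ
      ((-Complex.I) • τ) *ᵥ cvec (fun k => t k + dotp (col X k) a / dotp a a)) +
      (dotp a a : ℂ) * (cvec (fun k => t k + dotn (col X k) a / dotp a a) ⬝ᵥ
      (Complex.I • cconj τ) *ᵥ cvec (fun k => t k + dotn (col X k) a / dotp a a)) =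
      (2 * dotp a a : ℂ) * (cvec (t + ctr a X) ⬝ᵥ cIm τ *ᵥ cvec (t + ctr a X)) +
      (1 / (2 * dotp a a) : ℂ) * (cvec (hgt a X) ⬝ᵥ cIm τ *ᵥ cvec (hgt a X)) -
      2 * Complex.I * (cvec (t + ctr a X) ⬝ᵥ rC (τ.map Complex.re) *ᵥ cvec (hgt a X)) := by
    simp only [dotProduct, Matrix.mulVec, Fin.sum_univ_two, cvec, Matrix.smul_apply, cconj, cIm,
      rC, Matrix.map_apply, ctr, hgt, Pi.add_apply, form_eq, smul_eq_mul]
    have hc : ∀ i j, (starRingEnd ℂ) (τ i j) = ((τ i j).re : ℂ) - ((τ i j).im : ℂ) * Complex.I :=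
      fun i j => by rw [Complex.ext_iff]; simp
    simp only [hc]
    simp only [hs]
    have q00 := hτ2 0 0
    have q01 := hτ2 0 1
    have q11 := hτ2 1 1
    generalize (τ 0 0).re = x00 at *
    generalize (τ 0 1).re = x01 at *
    generalize (τ 1 1).re = x11 at *
    generalize (τ 0 0).im = y00 at *
    generalize (τ 0 1).im = y01 at *
    generalize (τ 1 1).im = y11 at *
    rw [q00, q01, q11]
    push_cast
    field_simp
    ring_nf
    simp only [Complex.I_sq]
    ring
  linear_combination key

/-- The point of the Siegel space that governs the Gaussian on a line. -/
noncomputable def lineTau (N : ℝ) (τ : Matrix (Fin 2) (Fin 2) ℂ) : Matrix (Fin 2) (Fin 2) ℂ :=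
  (Complex.I * (2 * N : ℝ)) • cIm τ

theorem lineTau_mem {N : ℝ} (hN : 0 < N) {τ : Matrix (Fin 2) (Fin 2) ℂ} (hτ : τ ∈ Siegel) :
    lineTau N τ ∈ Siegel := by
  have h1 : (lineTau N τ).map Complex.im = (2 * N) • τ.map Complex.im := by
    ext i j
    simp [lineTau, cIm]
  refine ⟨?_, ?_⟩
  · ext i j
    have := congrFun (congrFun hτ.1 i) j
    simp only [Matrix.transpose_apply] at this
    simp [lineTau, cIm, this]
  · rw [h1]
    exact hτ.2.smul (by positivity)

theorem smul_lineTau (N : ℝ) (τ : Matrix (Fin 2) (Fin 2) ℂ) :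
    (-Complex.I) • lineTau N τ = ((2 * N : ℝ) : ℂ) • cIm τ := by
  rw [lineTau, smul_smul, ← mul_assoc, neg_mul, Complex.I_mul_I, neg_neg, one_mul]

theorem smul_lineTau_inv {N : ℝ} (hN : 0 < N) {τ : Matrix (Fin 2) (Fin 2) ℂ} (hτ : τ ∈ Siegel) :
    Complex.I • (lineTau N τ)⁻¹ = ((2 * N : ℝ) : ℂ)⁻¹ • (cIm τ)⁻¹ := by
  have h0 : ((2 * N : ℝ) : ℂ) ≠ 0 := by exact_mod_cast (by positivity : (2 * N : ℝ) ≠ 0)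
  have h1 : (lineTau N τ)⁻¹ = (Complex.I * (2 * N : ℝ))⁻¹ • (cIm τ)⁻¹ := by
    refine Matrix.inv_eq_right_inv ?_
    rw [lineTau, Matrix.smul_mul, Matrix.mul_smul, smul_smul,
      mul_inv_cancel₀ (mul_ne_zero Complex.I_ne_zero h0), one_smul,
      Matrix.mul_nonsing_inv _ (siegel_det_cIm_ne hτ).isUnit]
  rw [h1, smul_smul, mul_inv, ← mul_assoc, mul_inv_cancel₀ Complex.I_ne_zero, one_mul]

/-- The matrix of the inclusion of a line. -/
def lineMat (a : V b) : Matrix (Idx b × Fin 2) (Fin 2) ℂ :=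
  Matrix.of fun p j => if j = p.2 then (a p.1 : ℂ) else 0

/-- The dual variable of a line. -/
def dualVar (τ : Matrix (Fin 2) (Fin 2) ℂ) (a : V b) (X : Idx b × Fin 2 → ℝ) (c : Fin 2 → ℝ) :
    Fin 2 → ℝ := c - τ.map Complex.re *ᵥ hgt a X

/-- The point at which the polynomial of the Fourier transform along a line is evaluated. -/
noncomputable def linePt (τ : Matrix (Fin 2) (Fin 2) ℂ) (a : V b) (X : Idx b × Fin 2 → ℝ)
    (c : Fin 2 → ℝ) : Fin 2 → ℂ :=
  (((2 * dotp a a : ℝ) : ℂ)⁻¹ • (cIm τ)⁻¹) *ᵥ ((-Complex.I) • cvec (dualVar τ a X c)) +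
    ((2 * dotp a a : ℝ) : ℂ)⁻¹ • cvec (hgt a X)

/-- The matrix of the heat operator of the Fourier transform along a line. -/
noncomputable def lineHeat (τ : Matrix (Fin 2) (Fin 2) ℂ) (a : V b) :
    Matrix (Idx b × Fin 2) (Idx b × Fin 2) ℂ :=
  lapMat (Idx b) (cIm τ)⁻¹ + lineMat a * ((1 / (4 * Real.pi) : ℂ) •
    (((2 * dotp a a : ℝ) : ℂ)⁻¹ • (cIm τ)⁻¹)) * (lineMat a)ᵀ

/-- The Fourier transform of `phi` along a line. -/
noncomputable def lineFT (P : MvPolynomial (Fin b × Fin 2) ℂ) (τ : Matrix (Fin 2) (Fin 2) ℂ)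
    (a : V b) (X : Idx b × Fin 2 → ℝ) (c : Fin 2 → ℝ) : ℂ :=
  e ((c ⬝ᵥ ctr a X : ℝ)) * gaussConst (lineTau (dotp a a) τ) *
    Complex.exp (-(Real.pi / (2 * dotp a a)) * (cvec (hgt a X) ⬝ᵥ cIm τ *ᵥ cvec (hgt a X))) *
    Complex.exp (-(Real.pi / (2 * dotp a a)) *
      (cvec (dualVar τ a X c) ⬝ᵥ (cIm τ)⁻¹ *ᵥ cvec (dualVar τ a X c))) *
    gexp (blk (sB b τ)) 0 (cutF a X) *
    MvPolynomial.eval (cvec (cutF a X) + lineMat a *ᵥ linePt τ a X c)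
      (heat (lineHeat τ a) (posPoly P))

/-- By `quad_add_line` the restriction to the line is, after recentering, a polynomial times a
Gaussian with form `2N y`, where `N = dotp a a`. The real part of `τ` enters through the linear term
and shifts the frequency to `dualVar`. -/
theorem integral_phi_line (P : MvPolynomial (Fin b × Fin 2) ℂ) {a : V b} (hN : 0 < dotp a a)
    (h0 : dotn a a = dotp a a) {τ : Matrix (Fin 2) (Fin 2) ℂ} (hτ : τ ∈ Siegel)
    (X : Idx b × Fin 2 → ℝ) (c : Fin 2 → ℝ) :
    ∫ t : Fin 2 → ℝ, phi P τ (X + line a t) * e (-((c ⬝ᵥ t : ℝ) : ℂ)) = lineFT P τ a X c := by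
  have hN' : (dotp a a : ℂ) ≠ 0 := by exact_mod_cast hN.ne'
  set H := heat (lapMat (Idx b) (cIm τ)⁻¹) (posPoly P) with hH
  set S : Matrix (Fin 2) (Fin 2) ℂ := ((2 * dotp a a : ℝ) : ℂ) • cIm τ with hS
  set T : Matrix (Fin 2) (Fin 2) ℂ := ((2 * dotp a a : ℝ) : ℂ)⁻¹ • (cIm τ)⁻¹ with hT
  set v0 : Idx b × Fin 2 → ℂ := cvec (cutF a X) +
    lineMat a *ᵥ (((2 * dotp a a : ℝ) : ℂ)⁻¹ • cvec (hgt a X)) with hv0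
  set l : Fin 2 → ℂ := (-Complex.I) • cvec (dualVar τ a X c) with hl
  -- After the heat operator the polynomial still involves only positive coordinates. The affine
  -- expression with base point `v0` describes the line correctly in those coordinates, and this is
  -- all that is needed.
  have hHpos : ∃ H', H = posPoly H' := by
    rw [hH, lapMat_eq_blk, heat_posPoly]
    exact ⟨_, rfl⟩
  -- the polynomial along the line
  have hpol : ∀ t : Fin 2 → ℝ, MvPolynomial.eval (cvec (X + line a t)) H =
      MvPolynomial.eval (cvec (t + ctr a X)) (affSubst (lineMat a) v0 H) := by
    intro t
    obtain ⟨H', hH'⟩ := hHpos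
    rw [eval_affSubst, hH', eval_posPoly, eval_posPoly]
    congr 2
    funext p
    have h1 : ∀ w : Fin 2 → ℂ, (lineMat a *ᵥ w) (Sum.inl p.1, p.2) = w p.2 * a (Sum.inl p.1) := by
      intro w
      simp [lineMat, Matrix.mulVec, dotProduct, mul_comm]
    simp only [hv0, Pi.add_apply, h1, Pi.smul_apply, smul_eq_mul]
    simp only [cvec, cutF, flat, cut_inl, Pi.add_apply, line, ctr, hgt, form_eq, col]
    push_cast
    field_simp
    ring
  -- the Gaussian along the line
  have hgau : ∀ t : Fin 2 → ℝ, gexp (blk (sB b τ)) 0 (X + line a t) * e (-((c ⬝ᵥ t : ℝ) : ℂ)) =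
      e ((c ⬝ᵥ ctr a X : ℝ)) * Complex.exp (-(Real.pi / (2 * dotp a a)) *
        (cvec (hgt a X) ⬝ᵥ cIm τ *ᵥ cvec (hgt a X))) * gexp (blk (sB b τ)) 0 (cutF a X) *
        gexp S l (t + ctr a X) := by
    intro t
    simp only [gexp, e, zero_dotProduct, mul_zero, add_zero]
    rw [quad_add_line hN h0 hτ, ← Complex.exp_add, ← Complex.exp_add, ← Complex.exp_add,
      ← Complex.exp_add]
    congr 1
    have h1 : cvec (t + ctr a X) ⬝ᵥ S *ᵥ cvec (t + ctr a X) =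
        (2 * dotp a a : ℂ) * (cvec (t + ctr a X) ⬝ᵥ cIm τ *ᵥ cvec (t + ctr a X)) := by
      rw [hS, Matrix.smul_mulVec, dotProduct_smul, smul_eq_mul]
      push_cast
      rfl
    have h2 : l ⬝ᵥ cvec (t + ctr a X) = -Complex.I * ((c ⬝ᵥ t : ℝ) : ℂ) -
        Complex.I * ((c ⬝ᵥ ctr a X : ℝ) : ℂ) + Complex.I *
        (cvec (t + ctr a X) ⬝ᵥ rC (τ.map Complex.re) *ᵥ cvec (hgt a X)) := by
      simp only [hl, dualVar, dotProduct, Matrix.mulVec, Fin.sum_univ_two, cvec, Pi.smul_apply,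
        Pi.sub_apply, Pi.add_apply, smul_eq_mul, Matrix.map_apply, rC]
      push_cast
      ring
    rw [h1, h2]
    field_simp
    ring
  set G : (Fin 2 → ℝ) → ℂ := fun s => (e ((c ⬝ᵥ ctr a X : ℝ)) * Complex.exp (-(Real.pi / (2 * dotp a a)) *
        (cvec (hgt a X) ⬝ᵥ cIm τ *ᵥ cvec (hgt a X))) * gexp (blk (sB b τ)) 0 (cutF a X)) *
        (MvPolynomial.eval (cvec s) (affSubst (lineMat a) v0 H) * gexp S l s) with hG
  have hint : ∀ t : Fin 2 → ℝ, phi P τ (X + line a t) * e (-((c ⬝ᵥ t : ℝ) : ℂ)) =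
      G (t + ctr a X) := by
    intro t
    simp only [hG]
    have h1 := hgau t
    have h2 : phi P τ (X + line a t) = MvPolynomial.eval (cvec (X + line a t)) H *
      gexp (blk (sB b τ)) 0 (X + line a t) := rfl
    rw [h2, hpol, mul_assoc, h1]
    ring
  rw [integral_congr_ae (Filter.Eventually.of_forall hint), integral_add_right_eq_self, hG,
    MeasureTheory.integral_const_mul]
  have hmem := lineTau_mem hN hτ
  obtain ⟨ε, hε, hq⟩ := siegel_exists_quad_ge hmem
  have hS' : (-Complex.I) • lineTau (dotp a a) τ = S := smul_lineTau _ _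
  have hT' : Complex.I • (lineTau (dotp a a) τ)⁻¹ = T := smul_lineTau_inv hN hτ
  have hTs : Tᵀ = T := by
    rw [← hT', Matrix.transpose_smul, Matrix.transpose_nonsing_inv, hmem.1]
  rw [integral_eval_mul_gexp hε (S := S) (T := T) (fun t => by
    rw [← hS', siegel_re_quad]; exact hq t) hTs (gaussConst (lineTau (dotp a a) τ))
    (fun l => by rw [← hS', ← hT']; exact integral_gexp_siegel hmem l)]
  have h5 : MvPolynomial.eval (T *ᵥ l) (heat ((1 / (4 * Real.pi) : ℂ) • T)
      (affSubst (lineMat a) v0 H)) = MvPolynomial.eval (cvec (cutF a X) + lineMat a *ᵥ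
        linePt τ a X c) (heat (lineHeat τ a) (posPoly P)) := by
    rw [← affSubst_heat, eval_affSubst, hH, heat_heat, lineHeat, add_comm (lapMat _ _)]
    congr 2
    rw [hv0, linePt, Matrix.mulVec_add]
    abel
  have h6 : (Real.pi : ℂ) * (l ⬝ᵥ T *ᵥ l) = -(Real.pi / (2 * dotp a a)) *
      (cvec (dualVar τ a X c) ⬝ᵥ (cIm τ)⁻¹ *ᵥ cvec (dualVar τ a X c)) := by
    rw [hl, hT, Matrix.mulVec_smul, Matrix.smul_mulVec, dotProduct_smul, dotProduct_smul,
      smul_dotProduct]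
    simp only [smul_eq_mul]
    have hI : -Complex.I * (-Complex.I) = -1 := by rw [neg_mul_neg, Complex.I_mul_I]
    push_cast
    linear_combination ((Real.pi : ℂ) * (2 * (dotp a a : ℂ))⁻¹ *
      (cvec (dualVar τ a X c) ⬝ᵥ (cIm τ)⁻¹ *ᵥ cvec (dualVar τ a X c))) * hI
  rw [h5, h6, lineFT]
  ring

end PartialFourier

end KM2

namespace KM2

/-! ### Values and bounds of the Fourier transforms along a line -/

section LineValues

open MeasureTheory

variable {b : ℕ}

theorem GaussDecay.comp_add {κ ι : Type*} [Fintype κ] [Fintype ι] {F : (ι → ℝ) → ℂ}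
    (hF : GaussDecay F) {L : (κ → ℝ) → ι → ℝ} {K : ℝ} (hK : 0 < K)
    (hL : ∀ t, ∑ p, t p ^ 2 ≤ K * ∑ q, L t q ^ 2) (X : ι → ℝ) :
    GaussDecay fun t => F (X + L t) := by
  obtain ⟨C, ε, hε, h⟩ := hF.translate_bound
  have hC : 0 ≤ C := by
    have := (norm_nonneg _).trans (h 0 0)
    simpa using this
  refine ⟨C * Real.exp (ε * ∑ p, X p ^ 2), ε / 2 / K, by positivity, fun t => ?_⟩
  refine (h X (L t)).trans (mul_le_mul_of_nonneg_left (Real.exp_le_exp.2 ?_) (by positivity))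
  rw [neg_mul, neg_mul, neg_le_neg_iff, div_mul_eq_mul_div, div_le_iff₀ hK, mul_assoc]
  have := hL t
  rw [mul_comm K] at this
  gcongr

theorem sum_line_sq {a : V b} (h0 : dotn a a = dotp a a) (t : Fin 2 → ℝ) :
    ∑ p, line a t p ^ 2 = 2 * dotp a a * ∑ j, t j ^ 2 := by
  have h1 : ∑ i, a i ^ 2 = 2 * dotp a a := by
    rw [Fintype.sum_sum_type, two_mul]
    nth_rewrite 2 [← h0]
    simp only [dotp, dotn, sq]
  rw [Fintype.sum_prod_type_right, ← h1, Finset.mul_sum]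
  refine Finset.sum_congr rfl fun j _ => ?_
  rw [Finset.sum_mul]
  exact Finset.sum_congr rfl fun i _ => by simp only [line]; ring

theorem gaussDecay_phi_line (P : MvPolynomial (Fin b × Fin 2) ℂ) {a : V b} (hN : 0 < dotp a a)
    (h0 : dotn a a = dotp a a) {τ : Matrix (Fin 2) (Fin 2) ℂ} (hτ : τ ∈ Siegel)
    (X : Idx b × Fin 2 → ℝ) : GaussDecay fun t : Fin 2 → ℝ => phi P τ (X + line a t) := by
  refine (gaussDecay_phi P hτ).comp_add (K := (2 * dotp a a)⁻¹) (by positivity) (fun t => ?_) X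
  rw [sum_line_sq h0, inv_mul_cancel_left₀ (by positivity)]

theorem continuous_phi_line (P : MvPolynomial (Fin b × Fin 2) ℂ) (a : V b)
    (τ : Matrix (Fin 2) (Fin 2) ℂ) (X : Idx b × Fin 2 → ℝ) :
    Continuous fun t : Fin 2 → ℝ => phi P τ (X + line a t) := by
  refine (continuous_phi P τ).comp (continuous_const.add ?_)
  exact continuous_pi fun p => (continuous_apply p.2).mul continuous_const

/-! ### The transform at vectors orthogonal to the line -/

theorem gaussConst_lineTau {N : ℝ} (hN : 0 < N) {τ : Matrix (Fin 2) (Fin 2) ℂ} (hτ : τ ∈ Siegel) :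
    gaussConst (lineTau N τ) =
      (((2 * N)⁻¹ * ((τ.map Complex.im).det ^ (1 / 2 : ℝ))⁻¹ : ℝ) : ℂ) := by
  have hy : 0 < (τ 0 0).im := (siegel_im_pos hτ).1
  have hd : 0 < (τ.map Complex.im).det := hτ.2.det_pos
  have h1 : -Complex.I * lineTau N τ 0 0 = ((2 * N * (τ 0 0).im : ℝ) : ℂ) := by
    have := congrFun (congrFun (smul_lineTau N τ) 0) 0
    simp only [Matrix.smul_apply, smul_eq_mul] at this
    rw [this]
    simp [cIm]
  have h2 : -Complex.I * ((lineTau N τ).det / lineTau N τ 0 0) =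
      ((2 * N * (τ.map Complex.im).det / (τ 0 0).im : ℝ) : ℂ) := by
    have h3 : (lineTau N τ).det = (Complex.I * (2 * N : ℝ)) ^ 2 * ((τ.map Complex.im).det : ℂ) := by
      rw [lineTau, Matrix.det_smul, Fintype.card_fin, det_cIm]
    have h4 : lineTau N τ 0 0 = Complex.I * (2 * N : ℝ) * ((τ 0 0).im : ℂ) := by
      simp [lineTau, cIm]
    have h5 : ((τ 0 0).im : ℂ) ≠ 0 := by exact_mod_cast hy.ne'
    have h6 : (N : ℂ) ≠ 0 := by exact_mod_cast hN.ne'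
    rw [h3, h4]
    push_cast
    field_simp
    linear_combination (-((τ.map Complex.im).det : ℂ)) * Complex.I_sq
  rw [gaussConst, h1, h2]
  have h7 : (1 / 2 : ℂ) = ((1 / 2 : ℝ) : ℂ) := by push_cast; rfl
  rw [h7, ← Complex.ofReal_cpow (by positivity), ← Complex.ofReal_cpow (by positivity),
    ← Complex.ofReal_mul, ← Complex.ofReal_inv, ← Real.mul_rpow (by positivity) (by positivity)]
  congr 1
  rw [← mul_inv]
  congr 1
  have h8 : 2 * N * (τ 0 0).im * (2 * N * (τ.map Complex.im).det / (τ 0 0).im) =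
      (2 * N) ^ 2 * (τ.map Complex.im).det := by
    field_simp
  rw [h8, Real.mul_rpow (by positivity) hd.le, ← Real.sqrt_eq_rpow, Real.sqrt_sq (by positivity)]

theorem exists_posPoly_heat (A : Matrix (Idx b × Fin 2) (Idx b × Fin 2) ℂ)
    (P : MvPolynomial (Fin b × Fin 2) ℂ) : ∃ Q, heat A (posPoly P) = posPoly Q :=
  ⟨_, (affSubst_heat (inclMat b) 0 A P).symm⟩

theorem eval_heat_posPoly_congr (A : Matrix (Idx b × Fin 2) (Idx b × Fin 2) ℂ)
    (P : MvPolynomial (Fin b × Fin 2) ℂ) {x x' : Idx b × Fin 2 → ℂ}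
    (h : ∀ i j, x (Sum.inl i, j) = x' (Sum.inl i, j)) :
    MvPolynomial.eval x (heat A (posPoly P)) = MvPolynomial.eval x' (heat A (posPoly P)) := by
  obtain ⟨Q, hQ⟩ := exists_posPoly_heat A P
  rw [hQ, eval_posPoly, eval_posPoly]
  congr 2
  funext p
  exact h _ _

theorem cut_single_inl (a : V b) (m : Idx b) (i : Fin b) : cut a (Pi.single m 1) (Sum.inl i) =
    (if m = Sum.inl i then 1 else 0) - Sum.elim (fun k => a (Sum.inl k)) 0 m / dotp a a *
      a (Sum.inl i) := by
  rw [cut_inl]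
  rcases m with m | m
  · simp [dotp, Pi.single_apply, eq_comm]
  · simp [dotp]

/-- On positive coordinates `cut a` is a Euclidean orthogonal projection, so its matrix times the
transpose is the projection again. -/
theorem sum_cut_single (a : V b) (hN : dotp a a ≠ 0) (i k : Fin b) :
    ∑ m : Idx b, cut a (Pi.single m 1) (Sum.inl i) * cut a (Pi.single m 1) (Sum.inl k) =
      (if i = k then 1 else 0) - a (Sum.inl i) * a (Sum.inl k) / dotp a a := by
  simp only [cut_single_inl, Fintype.sum_sum_type, Sum.elim_inl, Sum.elim_inr, Sum.inl.injEq,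
    reduceCtorEq, if_false]
  have h1 : ∀ m : Fin b, ((if m = i then 1 else 0) - a (Sum.inl m) / dotp a a * a (Sum.inl i)) *
      ((if m = k then 1 else 0) - a (Sum.inl m) / dotp a a * a (Sum.inl k)) =
      (if m = i then (if m = k then 1 else 0) - a (Sum.inl m) / dotp a a * a (Sum.inl k) else 0) -
      (if m = k then a (Sum.inl m) / dotp a a * a (Sum.inl i) else 0) +
      a (Sum.inl m) * a (Sum.inl m) * (a (Sum.inl i) * a (Sum.inl k) / dotp a a ^ 2) := by
    intro m
    split_ifs <;> field_simp <;> ring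
  have h2 : ∑ m : Fin b, a (Sum.inl m) * a (Sum.inl m) = dotp a a := rfl
  simp only [h1, Finset.sum_add_distrib, Finset.sum_sub_distrib, Finset.sum_ite_eq',
    Finset.mem_univ, if_true, ← Finset.sum_mul, h2, Pi.zero_apply, zero_div, zero_mul, sub_zero,
    Finset.sum_const_zero, add_zero]
  field_simp
  ring

theorem cut_eq_sum (a v : V b) (i : Idx b) :
    cut a v i = ∑ m : Idx b, cut a (Pi.single m 1) i * v m := by
  have h : ∀ m : Idx b, (fun j => if m = j then (1 : ℝ) else 0) = Pi.single m 1 := by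
    intro m
    funext j
    simp [Pi.single_apply, eq_comm]
  rw [LinearMap.pi_apply_eq_sum_univ]
  simp only [Finset.sum_apply, Pi.smul_apply, smul_eq_mul, h, mul_comm]

/-- With `N = dotp a a`, the Gaussian integral adds `(8πN)⁻¹ a aᵗ ⊗ y⁻¹` to `-(8π)⁻¹ 1 ⊗ y⁻¹`. The
sum is `-(8π)⁻¹ (1 - a aᵗ/N) ⊗ y⁻¹`, the Laplacian of the complement of `a`; no derivative along `a`
survives, and the coefficients `polCut` appear with their own heat operator. -/
theorem lineHeat_inl (τ : Matrix (Fin 2) (Fin 2) ℂ) {a : V b} (hN : dotp a a ≠ 0)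
    (p q : Fin b × Fin 2) : lineHeat τ a (Sum.inl p.1, p.2) (Sum.inl q.1, q.2) =
      (cutMat a * dropBlk (lapMat (Idx b) (cIm τ)⁻¹) * (cutMat a)ᵀ)
        (Sum.inl p.1, p.2) (Sum.inl q.1, q.2) := by
  obtain ⟨i, j⟩ := p
  obtain ⟨k, l⟩ := q
  have hc : ∀ x y : ℝ, (x : ℂ) * (y : ℂ) = ((x * y : ℝ) : ℂ) := fun x y => by push_cast; rfl
  have hN' : (dotp a a : ℂ) ≠ 0 := by exact_mod_cast hN
  have hpi : (Real.pi : ℂ) ≠ 0 := by exact_mod_cast Real.pi_ne_zero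
  have h1 : (cutMat a * dropBlk (lapMat (Idx b) (cIm τ)⁻¹) * (cutMat a)ᵀ)
      (Sum.inl i, j) (Sum.inl k, l) = ((∑ m : Idx b, cut a (Pi.single m 1) (Sum.inl i) *
        cut a (Pi.single m 1) (Sum.inl k) : ℝ) : ℂ) * ((-1 / (8 * Real.pi) : ℂ) * (cIm τ)⁻¹ j l) := by
    simp only [Matrix.mul_apply, Fintype.sum_sum_type (α₁ := Fin 2), cutMat, dropBlk,
      Matrix.of_apply, Sum.elim_inl, Sum.elim_inr, Matrix.fromBlocks_apply₁₁,
      Matrix.fromBlocks_apply₁₂, Matrix.fromBlocks_apply₂₁, Matrix.fromBlocks_apply₂₂,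
      Matrix.zero_apply, mul_zero, Finset.sum_const_zero, zero_mul, zero_add, add_zero,
      Matrix.transpose_apply]
    have h2 : ∀ q : Idx b × Fin 2, (∑ r : Idx b × Fin 2,
        (if r.2 = j then ((cut a (Pi.single r.1 1) (Sum.inl i) : ℝ) : ℂ) else 0) *
          lapMat (Idx b) (cIm τ)⁻¹ r q) = ((cut a (Pi.single q.1 1) (Sum.inl i) : ℝ) : ℂ) *
          ((-1 / (8 * Real.pi) : ℂ) * (cIm τ)⁻¹ j q.2) := by
      intro q
      simp [Fintype.sum_prod_type, lapMat, kroneckerMap_apply, Matrix.one_apply, ite_mul]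
    simp only [h2]
    rw [Fintype.sum_prod_type]
    push_cast
    rw [Finset.sum_mul]
    refine Finset.sum_congr rfl fun m _ => ?_
    simp
    ring
  rw [h1, sum_cut_single a hN, lineHeat]
  have h3 : (lineMat a * ((1 / (4 * Real.pi) : ℂ) • (((2 * dotp a a : ℝ) : ℂ)⁻¹ • (cIm τ)⁻¹)) *
      (lineMat a)ᵀ) (Sum.inl i, j) (Sum.inl k, l) = a (Sum.inl i) * a (Sum.inl k) *
      (1 / (4 * Real.pi) * ((2 * dotp a a : ℝ) : ℂ)⁻¹ * (cIm τ)⁻¹ j l) := by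
    simp only [Matrix.mul_apply, lineMat, Matrix.of_apply, Matrix.transpose_apply, mul_ite,
      mul_zero, ite_mul, zero_mul, Finset.sum_ite_eq', Finset.mem_univ, if_true,
      Matrix.smul_apply, smul_eq_mul]
    ring
  rw [Matrix.add_apply, h3]
  simp only [lapMat, kroneckerMap_apply, Matrix.one_apply, Sum.inl.injEq, Matrix.smul_apply,
    smul_eq_mul]
  push_cast
  split_ifs <;> push_cast <;> field_simp <;> ring

theorem cutMat_mulVec_inl {a : V b} (hN : dotp a a ≠ 0) (s : Fin 2 → ℂ) (X : Idx b × Fin 2 → ℝ)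
    (i : Fin b) (j : Fin 2) : (cutMat a *ᵥ Sum.elim s (cvec (cutF a X))) (Sum.inl i, j) =
      s j * (a (Sum.inl i) / dotp a a) + cutF a X (Sum.inl i, j) := by
  have h1 : (cutF a X (Sum.inl i, j) : ℂ) = ((∑ m : Idx b, cut a (Pi.single m 1) (Sum.inl i) *
      cutF a X (m, j) : ℝ) : ℂ) := by
    congr 1
    change _ = ∑ m : Idx b, cut a (Pi.single m 1) (Sum.inl i) * cut a (col X j) m
    rw [← cut_eq_sum, cut_inl]
    have : dotp (cut a (col X j)) a = 0 := by
      have := dotp_cutPos hN (col X j)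
      simpa [dotp] using this
    rw [this]
    simp [cutF, flat]
  rw [h1]
  simp only [Matrix.mulVec, dotProduct, Fintype.sum_sum_type (α₁ := Fin 2), cutMat,
    Matrix.of_apply, Sum.elim_inl, Sum.elim_inr, ite_mul, zero_mul, Finset.sum_ite_eq',
    Finset.mem_univ, if_true, posProj_inl]
  rw [Fintype.sum_prod_type]
  simp [cvec, mul_comm]

theorem lineMat_mulVec (a : V b) (w : Fin 2 → ℂ) (p : Idx b × Fin 2) :
    (lineMat a *ᵥ w) p = w p.2 * a p.1 := by
  simp [lineMat, Matrix.mulVec, dotProduct, mul_comm]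

/-- The Fourier transform along a line at a pair of vectors orthogonal to it. -/
theorem lineFT_of_hgt_eq_zero (α₁ α₂ β₁ β₂ : Fin b) {a : V b} (hN : 0 < dotp a a)
    {τ : Matrix (Fin 2) (Fin 2) ℂ} (hτ : τ ∈ Siegel) {X : Idx b × Fin 2 → ℝ}
    (hX : hgt a X = 0) (c : Fin 2 → ℝ) :
    lineFT (polPos α₁ α₂ β₁ β₂) τ a X c = e ((c ⬝ᵥ ctr a X : ℝ)) *
      (((2 * dotp a a)⁻¹ * ((τ.map Complex.im).det ^ (1 / 2 : ℝ))⁻¹ : ℝ) : ℂ) *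
      Complex.exp (-(Real.pi / (2 * dotp a a)) * (cvec c ⬝ᵥ (cIm τ)⁻¹ *ᵥ cvec c)) *
      ∑ h₁ ∈ Finset.range 3, ∑ h₂ ∈ Finset.range 3,
        (-(Complex.I / 2) * ((cIm τ)⁻¹ *ᵥ cvec c) 0) ^ h₁ *
        (-(Complex.I / 2) * ((cIm τ)⁻¹ *ᵥ cvec c) 1) ^ h₂ *
        (MvPolynomial.eval (cvec (cutF a X)) (heat (lapMat (Idx b) (cIm τ)⁻¹)
          (polCut (polAlpha α₁ α₂ β₁ β₂) a h₁ h₂)) * gexp (blk (sB b τ)) 0 (cutF a X)) := by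
  have hN' : (dotp a a : ℂ) ≠ 0 := by exact_mod_cast hN.ne'
  have hξ : dualVar τ a X c = c := by
    rw [dualVar, hX, Matrix.mulVec_zero, sub_zero]
  -- The value of the inner product variables `S_j`: the point `linePt` along `a`, multiplied by
  -- `dotp a a`. Here `hgt` vanishes and only the frequency contributes.
  set s : Fin 2 → ℂ := fun j => -(Complex.I / 2) * ((cIm τ)⁻¹ *ᵥ cvec c) j with hs
  have hpt : ∀ j, s j = dotp a a * linePt τ a X c j := by
    intro j
    rw [linePt, hξ, hX, hs, Matrix.smul_mulVec, Matrix.mulVec_smul]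
    have : cvec (0 : Fin 2 → ℝ) = 0 := by funext; simp [cvec]
    rw [this, smul_zero, add_zero]
    simp only [Pi.smul_apply, smul_eq_mul]
    push_cast
    field_simp
  have h1 : MvPolynomial.eval (cvec (cutF a X) + lineMat a *ᵥ linePt τ a X c)
      (heat (lineHeat τ a) (posPoly (polPos α₁ α₂ β₁ β₂))) =
      ∑ h₁ ∈ Finset.range 3, ∑ h₂ ∈ Finset.range 3, s 0 ^ h₁ * s 1 ^ h₂ *
        MvPolynomial.eval (cvec (cutF a X)) (heat (lapMat (Idx b) (cIm τ)⁻¹)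
          (polCut (polAlpha α₁ α₂ β₁ β₂) a h₁ h₂)) := by
    rw [← eval_heat_polCut, polAlpha_eq,
      heat_posPoly_congr (fun p q => lineHeat_inl τ hN.ne' p q)]
    refine eval_heat_posPoly_congr _ _ fun i j => ?_
    rw [cutMat_mulVec_inl hN.ne', Pi.add_apply, lineMat_mulVec, hpt]
    simp only [cvec]
    field_simp
    ring
  have h0 : cvec (0 : Fin 2 → ℝ) ⬝ᵥ cIm τ *ᵥ cvec (0 : Fin 2 → ℝ) = 0 := by
    have : cvec (0 : Fin 2 → ℝ) = 0 := by funext; simp [cvec]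
    rw [this, zero_dotProduct]
  rw [lineFT, h1, hX, h0, hξ, mul_zero, Complex.exp_zero, mul_one, gaussConst_lineTau hN hτ]
  simp only [mul_assoc, Finset.mul_sum]
  refine Finset.sum_congr rfl fun h₁ _ => Finset.sum_congr rfl fun h₂ _ => ?_
  simp only [hs]
  ring

/-! ### Gaussian bounds for the transform along the line -/

theorem exists_sum_norm_mulVec_sq_le {κ ι : Type*} [Fintype κ] [Fintype ι] (M : Matrix κ ι ℂ) :
    ∃ K : ℝ, 0 ≤ K ∧ ∀ w : ι → ℝ, ∑ p, ‖(M *ᵥ cvec w) p‖ ^ 2 ≤ K * ∑ q, w q ^ 2 := by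
  refine ⟨∑ p, ∑ q, ‖M p q‖ ^ 2, by positivity, fun w => ?_⟩
  rw [Finset.sum_mul]
  refine Finset.sum_le_sum fun p _ => ?_
  have h1 : ‖(M *ᵥ cvec w) p‖ ≤ ∑ q, ‖M p q‖ * |w q| := by
    refine (norm_sum_le _ _).trans (Finset.sum_le_sum fun q _ => ?_)
    rw [norm_mul, cvec, Complex.norm_real, Real.norm_eq_abs]
  calc ‖(M *ᵥ cvec w) p‖ ^ 2 ≤ (∑ q, ‖M p q‖ * |w q|) ^ 2 := by gcongr
    _ ≤ (∑ q, ‖M p q‖ ^ 2) * ∑ q, |w q| ^ 2 := Finset.sum_mul_sq_le_sq_mul_sq _ _ _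
    _ = _ := by simp only [sq_abs]

/-- The three Gaussian factors decay in the complement `cutF`, in `hgt` and in `dualVar`. The
polynomial is absorbed at half the rate. Finally `c` is the sum of `dualVar` and a linear function
of `hgt`, so decay in these two is decay in `c`. -/
theorem exists_norm_lineFT_le (P : MvPolynomial (Fin b × Fin 2) ℂ) {a : V b} (hN : 0 < dotp a a)
    {τ : Matrix (Fin 2) (Fin 2) ℂ} (hτ : τ ∈ Siegel) :
    ∃ C ε : ℝ, 0 ≤ C ∧ 0 < ε ∧ ∀ X c, ‖lineFT P τ a X c‖ ≤ C * Real.exp (-ε *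
      (∑ p, cutF a X p ^ 2 + ∑ j, hgt a X j ^ 2 + ∑ j, c j ^ 2)) := by
  obtain ⟨ε₁, hε₁, h1⟩ := sB_quad (b := b) hτ
  obtain ⟨ε₂, hε₂, h2⟩ := siegel_exists_quad_ge (lineTau_mem hN hτ)
  obtain ⟨ε₃, hε₃, h3⟩ := siegel_exists_quad_ge (neg_inv_mem_Siegel (lineTau_mem hN hτ))
  obtain ⟨K₁, hK₁, k1⟩ := exists_sum_norm_mulVec_sq_le (lineMat a * ((-Complex.I) •
    (((2 * dotp a a : ℝ) : ℂ)⁻¹ • (cIm τ)⁻¹)))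
  obtain ⟨K₂, hK₂, k2⟩ := exists_sum_norm_mulVec_sq_le (((2 * dotp a a : ℝ) : ℂ)⁻¹ • lineMat a)
  obtain ⟨K₃, hK₃, k3⟩ := exists_sum_norm_mulVec_sq_le (rC (τ.map Complex.re))
  have hN2 : 0 < 2 * dotp a a := by positivity
  have hpi := Real.pi_pos
  set ε₀ := min (Real.pi * ε₁) (min (Real.pi * (ε₂ / (2 * dotp a a) ^ 2)) (Real.pi * ε₃)) with hε₀
  have hε₀pos : 0 < ε₀ := by positivity
  -- The evaluation point is a sum of three terms, which costs a factor `3`; another factor `2`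
  -- leaves half of the decay `ε₀`.
  have hδ : 0 < ε₀ / (6 * (1 + K₁ + K₂)) := by positivity
  obtain ⟨C, hC, hQ⟩ := norm_eval_le_exp (heat (lineHeat τ a) (posPoly P)) hδ
  refine ⟨‖gaussConst (lineTau (dotp a a) τ)‖ * C, ε₀ / 2 / (3 + 2 * K₃), by positivity,
    by positivity, fun X c => ?_⟩
  set n := hgt a X with hn
  set ξ := dualVar τ a X c with hξ
  set p := cutF a X with hp
  set A := ∑ q, p q ^ 2 with hA
  set B := ∑ j, n j ^ 2 with hB
  set D := ∑ j, ξ j ^ 2 with hD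
  have hA0 : 0 ≤ A := Finset.sum_nonneg fun _ _ => sq_nonneg _
  have hB0 : 0 ≤ B := Finset.sum_nonneg fun _ _ => sq_nonneg _
  have hD0 : 0 ≤ D := Finset.sum_nonneg fun _ _ => sq_nonneg _
  -- the Gaussian factors
  have g1 : ‖gexp (blk (sB b τ)) 0 p‖ ≤ Real.exp (-ε₀ * A) := by
    rw [gexp, Complex.norm_exp]
    refine Real.exp_le_exp.2 ?_
    have h := h1 p
    have : (-Real.pi * (cvec p ⬝ᵥ blk (sB b τ) *ᵥ cvec p) + 2 * Real.pi * (0 ⬝ᵥ cvec p) : ℂ).re =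
        -(Real.pi * (cvec p ⬝ᵥ blk (sB b τ) *ᵥ cvec p).re) := by
      rw [zero_dotProduct, mul_zero, add_zero, neg_mul, Complex.neg_re, Complex.re_ofReal_mul]
    rw [this]
    have h4 : ε₀ * A ≤ Real.pi * ε₁ * A := mul_le_mul_of_nonneg_right (min_le_left _ _) hA0
    have h5 := mul_le_mul_of_nonneg_left h hpi.le
    linarith
  have hreal : ∀ (M : Matrix (Fin 2) (Fin 2) ℂ) (w : Fin 2 → ℝ),
      ‖Complex.exp (-(Real.pi / (2 * dotp a a)) * (cvec w ⬝ᵥ M *ᵥ cvec w))‖ =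
        Real.exp (-(Real.pi / (2 * dotp a a)) * (cvec w ⬝ᵥ M *ᵥ cvec w).re) := by
    intro M w
    have : (-(Real.pi / (2 * dotp a a)) : ℂ) = ((-(Real.pi / (2 * dotp a a)) : ℝ) : ℂ) := by
      push_cast; rfl
    rw [Complex.norm_exp, this, Complex.re_ofReal_mul]
  have g2 : ‖Complex.exp (-(Real.pi / (2 * dotp a a)) * (cvec n ⬝ᵥ cIm τ *ᵥ cvec n))‖ ≤
      Real.exp (-ε₀ * B) := by
    rw [hreal]
    refine Real.exp_le_exp.2 ?_
    have h := h2 n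
    rw [← siegel_re_quad, smul_lineTau, Matrix.smul_mulVec, dotProduct_smul, smul_eq_mul,
      Complex.re_ofReal_mul] at h
    have h4 : ε₀ * B ≤ Real.pi * (ε₂ / (2 * dotp a a) ^ 2) * B :=
      mul_le_mul_of_nonneg_right ((min_le_right _ _).trans (min_le_left _ _)) hB0
    have h5 : Real.pi * (ε₂ / (2 * dotp a a) ^ 2) * B ≤
        Real.pi / (2 * dotp a a) * (cvec n ⬝ᵥ cIm τ *ᵥ cvec n).re := by
      have h6 : ε₂ * B / (2 * dotp a a) ≤ (cvec n ⬝ᵥ cIm τ *ᵥ cvec n).re := by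
        rw [div_le_iff₀ hN2, mul_comm]
        rw [mul_comm] at h
        linarith
      calc Real.pi * (ε₂ / (2 * dotp a a) ^ 2) * B =
          Real.pi / (2 * dotp a a) * (ε₂ * B / (2 * dotp a a)) := by ring
        _ ≤ _ := by gcongr
    linarith
  have g3 : ‖Complex.exp (-(Real.pi / (2 * dotp a a)) * (cvec ξ ⬝ᵥ (cIm τ)⁻¹ *ᵥ cvec ξ))‖ ≤
      Real.exp (-ε₀ * D) := by
    rw [hreal]
    refine Real.exp_le_exp.2 ?_
    have h := h3 ξ
    have h7 : (-Complex.I) • (-(lineTau (dotp a a) τ)⁻¹) =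
        (((2 * dotp a a)⁻¹ : ℝ) : ℂ) • (cIm τ)⁻¹ := by
      rw [neg_smul_neg, smul_lineTau_inv hN hτ, Complex.ofReal_inv]
    rw [← siegel_re_quad, h7, Matrix.smul_mulVec, dotProduct_smul, smul_eq_mul,
      Complex.re_ofReal_mul] at h
    have h4 : ε₀ * D ≤ Real.pi * ε₃ * D :=
      mul_le_mul_of_nonneg_right ((min_le_right _ _).trans (min_le_right _ _)) hD0
    have h5 := mul_le_mul_of_nonneg_left h hpi.le
    have h8 : Real.pi / (2 * dotp a a) * (cvec ξ ⬝ᵥ (cIm τ)⁻¹ *ᵥ cvec ξ).re =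
        Real.pi * ((2 * dotp a a)⁻¹ * (cvec ξ ⬝ᵥ (cIm τ)⁻¹ *ᵥ cvec ξ).re) := by ring
    rw [neg_mul, neg_mul, neg_le_neg_iff, h8]
    linarith
  -- the polynomial
  have g4 : ∑ q, ‖(cvec p + lineMat a *ᵥ linePt τ a X c) q‖ ^ 2 ≤ 3 * (A + K₁ * D + K₂ * B) := by
    have e1 : cvec p + lineMat a *ᵥ linePt τ a X c = cvec p + (lineMat a * ((-Complex.I) •
        (((2 * dotp a a : ℝ) : ℂ)⁻¹ • (cIm τ)⁻¹))) *ᵥ cvec ξ +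
        (((2 * dotp a a : ℝ) : ℂ)⁻¹ • lineMat a) *ᵥ cvec n := by
      rw [linePt, Matrix.mulVec_add, Matrix.mulVec_mulVec, Matrix.mulVec_smul, Matrix.mulVec_smul,
        Matrix.mul_smul (lineMat a) (-Complex.I), Matrix.smul_mulVec (-Complex.I),
        Matrix.smul_mulVec (((2 * dotp a a : ℝ) : ℂ)⁻¹) (lineMat a), add_assoc]
    have e2 : ∀ x y w : ℂ, ‖x + y + w‖ ^ 2 ≤ 3 * (‖x‖ ^ 2 + ‖y‖ ^ 2 + ‖w‖ ^ 2) := by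
      intro x y w
      have := norm_add₃_le (a := x) (b := y) (c := w)
      have h0 := norm_nonneg (x + y + w)
      nlinarith [sq_nonneg (‖x‖ - ‖y‖), sq_nonneg (‖x‖ - ‖w‖), sq_nonneg (‖y‖ - ‖w‖)]
    rw [e1]
    refine (Finset.sum_le_sum fun q _ => e2 _ _ _).trans ?_
    rw [← Finset.mul_sum, Finset.sum_add_distrib, Finset.sum_add_distrib]
    have e3 : ∑ q, ‖cvec p q‖ ^ 2 = A := by simp [cvec, hA]
    rw [e3]
    have := k1 ξ
    have := k2 n
    linarith
  have g5 : ‖MvPolynomial.eval (cvec p + lineMat a *ᵥ linePt τ a X c)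
      (heat (lineHeat τ a) (posPoly P))‖ ≤ C * Real.exp (ε₀ / 2 * (A + B + D)) := by
    refine (hQ _).trans (mul_le_mul_of_nonneg_left (Real.exp_le_exp.2 ?_) hC)
    calc ε₀ / (6 * (1 + K₁ + K₂)) * ∑ q, ‖(cvec p + lineMat a *ᵥ linePt τ a X c) q‖ ^ 2 ≤
        ε₀ / (6 * (1 + K₁ + K₂)) * (3 * (A + K₁ * D + K₂ * B)) := by gcongr
      _ ≤ ε₀ / (6 * (1 + K₁ + K₂)) * (3 * ((1 + K₁ + K₂) * (A + B + D))) := by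
        gcongr
        nlinarith [mul_nonneg hK₁ hA0, mul_nonneg hK₁ hB0, mul_nonneg hK₂ hA0, mul_nonneg hK₂ hD0]
      _ = _ := by field_simp; ring
  have g6 : ∑ j, c j ^ 2 ≤ 2 * D + 2 * K₃ * B := by
    have e1 : ∀ j, c j ^ 2 ≤ 2 * ξ j ^ 2 + 2 * ‖(rC (τ.map Complex.re) *ᵥ cvec n) j‖ ^ 2 := by
      intro j
      have e2 : (rC (τ.map Complex.re) *ᵥ cvec n) j =
          (((τ.map Complex.re *ᵥ n) j : ℝ) : ℂ) := by
        simp [Matrix.mulVec, dotProduct, cvec, rC]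
      rw [e2, Complex.norm_real, Real.norm_eq_abs, sq_abs]
      have e3 : c j = ξ j + (τ.map Complex.re *ᵥ n) j := by
        rw [hξ, dualVar]; simp [hn]
      rw [e3]
      nlinarith [sq_nonneg (ξ j - (τ.map Complex.re *ᵥ n) j)]
    refine (Finset.sum_le_sum fun j _ => e1 j).trans ?_
    rw [Finset.sum_add_distrib, ← Finset.mul_sum, ← Finset.mul_sum]
    have := k3 n
    linarith
  have g7 : ε₀ / 2 / (3 + 2 * K₃) * (A + B + ∑ j, c j ^ 2) ≤ ε₀ / 2 * (A + B + D) := by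
    have h9 : A + B + ∑ j, c j ^ 2 ≤ (3 + 2 * K₃) * (A + B + D) := by
      nlinarith [mul_nonneg hK₃ hA0, mul_nonneg hK₃ hD0]
    calc ε₀ / 2 / (3 + 2 * K₃) * (A + B + ∑ j, c j ^ 2) ≤
        ε₀ / 2 / (3 + 2 * K₃) * ((3 + 2 * K₃) * (A + B + D)) := by gcongr
      _ = _ := by field_simp
  have he : ‖e ((c ⬝ᵥ ctr a X : ℝ))‖ = 1 := norm_e_real _
  rw [lineFT, norm_mul, norm_mul, norm_mul, norm_mul, norm_mul, he, one_mul]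
  calc _ ≤ ‖gaussConst (lineTau (dotp a a) τ)‖ * Real.exp (-ε₀ * B) * Real.exp (-ε₀ * D) *
        Real.exp (-ε₀ * A) * (C * Real.exp (ε₀ / 2 * (A + B + D))) := by gcongr
    _ = ‖gaussConst (lineTau (dotp a a) τ)‖ * C * Real.exp (-(ε₀ / 2 * (A + B + D))) := by
      have : Real.exp (-(ε₀ / 2 * (A + B + D))) = Real.exp (-ε₀ * B) * Real.exp (-ε₀ * D) *
          Real.exp (-ε₀ * A) * Real.exp (ε₀ / 2 * (A + B + D)) := by
        rw [← Real.exp_add, ← Real.exp_add, ← Real.exp_add]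
        congr 1
        ring
      rw [this]
      ring
    _ ≤ _ := by
      refine mul_le_mul_of_nonneg_left (Real.exp_le_exp.2 ?_) (by positivity)
      linarith

end LineValues

end KM2

namespace KM2

/-! ### Lattices and their duals -/

section Lattice

open MeasureTheory

variable {b : ℕ}

theorem form_nondegenerate : (form b).Nondegenerate := by
  have h : ∀ x : V b, (∀ y, form b x y = 0) → x = 0 := by
    intro x hx
    funext i
    have h1 := hx (Pi.single i 1)
    rw [form_apply] at h1
    rcases i with i | i
    · simpa [Pi.single_apply] using h1
    · simpa [Pi.single_apply] using h1
  exact ⟨h, fun y hy => h y fun x => by rw [form_comm]; exact hy x⟩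

variable {L : Submodule ℤ (V b)}

theorem span_real_eq_top (hL : IsEvenLattice L) : Submodule.span ℝ (L : Set (V b)) = ⊤ := by
  obtain ⟨v, hv⟩ := hL.exists_basis
  rw [eq_top_iff, ← v.span_eq, hv]
  exact Submodule.span_mono Submodule.subset_span

theorem dualLat_eq_span {v : Module.Basis (Idx b) ℝ (V b)}
    (hv : L = Submodule.span ℤ (Set.range v)) (hL : IsEvenLattice L) :
    dualLat L = Submodule.span ℤ (Set.range ((form b).dualBasis form_nondegenerate v)) := by
  rw [dualLat, span_real_eq_top hL, ← LinearMap.BilinForm.dualSubmodule_span_of_basis]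
  ext x
  simp [hv]

theorem le_dualLat (hL : IsEvenLattice L) : L ≤ dualLat L := by
  intro x hx
  refine ⟨fun y hy => ?_, Submodule.subset_span hx⟩
  obtain ⟨n, hn⟩ := hL.integral hx hy
  rw [hn]
  exact Submodule.mem_one.2 ⟨n, rfl⟩

theorem form_dualLat {Λ : Submodule ℤ (V b)} {x y : V b} (hx : x ∈ dualLat Λ) (hy : y ∈ Λ) :
    ∃ n : ℤ, form b x y = n := by
  obtain ⟨n, hn⟩ := Submodule.mem_one.1 (hx.1 y hy)
  exact ⟨n, hn.symm⟩

theorem mem_dualLat (hL : IsEvenLattice L) {x : V b} (h : ∀ y ∈ L, ∃ n : ℤ, form b x y = n) :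
    x ∈ dualLat L := by
  refine ⟨fun y hy => ?_, ?_⟩
  · obtain ⟨n, hn⟩ := h y hy
    rw [hn]
    exact Submodule.mem_one.2 ⟨n, rfl⟩
  · rw [span_real_eq_top hL]
    trivial

/-- The lattice and its dual are free of the same rank, so the quotient is finite. -/
theorem finite_disc (hL : IsEvenLattice L) : Finite (Disc L) := by
  obtain ⟨v, hv⟩ := hL.exists_basis
  have hd := dualLat_eq_span hv hL
  let B1 := (((form b).dualBasis form_nondegenerate v).restrictScalars ℤ).map
    (LinearEquiv.ofEq _ _ hd.symm)
  let B2 := ((v.restrictScalars ℤ).map (LinearEquiv.ofEq _ _ hv.symm)).map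
    (Submodule.submoduleOfEquivOfLe (le_dualLat hL)).symm
  have : Module.Free ℤ (dualLat L) := Module.Free.of_basis B1
  have : Module.Finite ℤ (dualLat L) := Module.Finite.of_basis B1
  refine Submodule.finiteQuotientOfFreeOfRankEq _ ?_
  rw [Module.finrank_eq_card_basis B1, Module.finrank_eq_card_basis B2]

theorem coset_sub_mem {Λ : Submodule ℤ (V b)} {γ : Fin 2 → Disc Λ} (l : Coset Λ γ) (j : Fin 2) :
    (l.val j : V b) - rep γ j ∈ Λ := by
  have h1 := l.2 j
  have h2 : (Submodule.Quotient.mk (γ j).out : Disc Λ) = γ j := Quotient.out_eq _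
  rw [← h2, Submodule.Quotient.eq] at h1
  exact h1

theorem rep_mem {Λ : Submodule ℤ (V b)} (γ : Fin 2 → Disc Λ) (j : Fin 2) :
    rep γ j ∈ dualLat Λ := ((γ j).out).2

theorem coset_of_sub_mem {Λ : Submodule ℤ (V b)} {γ : Fin 2 → Disc Λ} {l : Fin 2 → dualLat Λ}
    (h : ∀ j, (l j : V b) - rep γ j ∈ Λ) (j : Fin 2) :
    (Submodule.Quotient.mk (l j) : Disc Λ) = γ j := by
  have h2 : (Submodule.Quotient.mk (γ j).out : Disc Λ) = γ j := Quotient.out_eq _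
  rw [← h2, Submodule.Quotient.eq]
  exact h j

/-- Points of `V²` with given coordinates in a basis. -/
noncomputable def ofCoord (v : Module.Basis (Idx b) ℝ (V b)) (x : Idx b × Fin 2 → ℝ) :
    Fin 2 → V b := fun j => v.equivFun.symm fun i => x (i, j)

theorem ofCoord_injective (v : Module.Basis (Idx b) ℝ (V b)) : Function.Injective (ofCoord v) := by
  intro x y h
  funext p
  exact congrFun (v.equivFun.symm.injective (congrFun h p.2)) p.1

theorem ofCoord_add (v : Module.Basis (Idx b) ℝ (V b)) (x y : Idx b × Fin 2 → ℝ) :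
    ofCoord v (x + y) = ofCoord v x + ofCoord v y := by
  funext j
  exact map_add v.equivFun.symm _ _

theorem rvec_injective {κ : Type*} : Function.Injective (rvec : (κ → ℤ) → κ → ℝ) := by
  intro m n h
  funext p
  have := congrFun h p
  simpa [rvec] using this

theorem mem_span_iff_coord (v : Module.Basis (Idx b) ℝ (V b)) (x : V b) :
    x ∈ Submodule.span ℤ (Set.range v) ↔ ∃ n : Idx b → ℤ, v.equivFun.symm (rvec n) = x := by
  rw [Submodule.mem_span_range_iff_exists_fun]
  refine exists_congr fun n => ?_
  simp [rvec, Module.Basis.equivFun_symm_apply, Int.cast_smul_eq_zsmul]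

theorem pairs_mem_span_iff (v : Module.Basis (Idx b) ℝ (V b)) (x : Fin 2 → V b) :
    (∀ j, x j ∈ Submodule.span ℤ (Set.range v)) ↔
      ∃ n : Idx b × Fin 2 → ℤ, ofCoord v (rvec n) = x := by
  constructor
  · intro h
    choose n hn using fun j => (mem_span_iff_coord v (x j)).1 (h j)
    exact ⟨fun p => n p.2 p.1, funext fun j => hn j⟩
  · rintro ⟨n, rfl⟩ j
    exact (mem_span_iff_coord v _).2 ⟨fun i => n (i, j), rfl⟩

/-- A pair of vectors after an isometry, in flattened coordinates. -/
def gflat (g : V b ≃ₗ[ℝ] V b) (x : Fin 2 → V b) : Idx b × Fin 2 → ℝ := flat fun j => g (x j)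

theorem gflat_add (g : V b ≃ₗ[ℝ] V b) (x y : Fin 2 → V b) :
    gflat g (x + y) = gflat g x + gflat g y := by
  funext p
  simp [gflat, flat]

theorem pairForm_gflat {g : V b ≃ₗ[ℝ] V b} (hg : ∀ x y, form b (g x) (g y) = form b x y)
    (x y : Fin 2 → V b) : pairForm (gflat g x) (gflat g y) = ∑ j, form b (x j) (y j) := by
  simp only [← hg (x _), form_apply, pairForm, Fintype.sum_sum_type, Sum.elim_inl, Sum.elim_inr,
    gflat, flat, Finset.mul_sum]
  rw [Finset.sum_sub_distrib, sub_eq_add_neg, Finset.sum_comm, ← Finset.sum_neg_distrib]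
  refine congrArg₂ (· + ·) (by simp) ?_
  rw [Finset.sum_comm]
  simp

/-- The coordinates with respect to an orthogonal basis, in terms of those with respect to a basis
of the lattice. -/
noncomputable def coordEquiv (g : V b ≃ₗ[ℝ] V b) (v : Module.Basis (Idx b) ℝ (V b)) :
    (Idx b × Fin 2 → ℝ) ≃ₗ[ℝ] (Idx b × Fin 2 → ℝ) where
  toFun x := gflat g (ofCoord v x)
  map_add' x y := by rw [ofCoord_add, gflat_add]
  map_smul' c x := by
    funext p
    have : (fun i => (c • x) (i, p.2)) = c • fun i => x (i, p.2) := rfl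
    change g (v.equivFun.symm fun i => (c • x) (i, p.2)) p.1 = _
    rw [this, map_smul, map_smul]
    rfl
  invFun X p := v.equivFun (g.symm (col X p.2)) p.1
  left_inv x := by
    funext p
    have : col (gflat g (ofCoord v x)) p.2 = g (ofCoord v x p.2) := rfl
    change v.equivFun (g.symm (col (gflat g (ofCoord v x)) p.2)) p.1 = _
    rw [this, LinearEquiv.symm_apply_apply, ofCoord, LinearEquiv.apply_symm_apply]
  right_inv X := by
    funext p
    simp only [gflat, flat, ofCoord]
    have : (fun i => v.equivFun (g.symm (col X p.2)) i) = v.equivFun (g.symm (col X p.2)) := rfl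
    rw [this, LinearEquiv.symm_apply_apply, LinearEquiv.apply_symm_apply]
    rfl

theorem exists_sum_sq_le {κ ι : Type*} [Fintype κ] [Fintype ι] (S : (ι → ℝ) →ₗ[ℝ] κ → ℝ) :
    ∃ K : ℝ, 0 < K ∧ ∀ x, ∑ p, S x p ^ 2 ≤ K * ∑ q, x q ^ 2 := by
  classical
  obtain ⟨K, hK, h⟩ := exists_sum_norm_mulVec_sq_le ((LinearMap.toMatrix' S).map fun x => (x : ℂ))
  refine ⟨K + 1, by positivity, fun x => ?_⟩
  have h1 : ∀ p, ‖((LinearMap.toMatrix' S).map (fun x => (x : ℂ)) *ᵥ cvec x) p‖ ^ 2 =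
      S x p ^ 2 := by
    intro p
    have h2 : ((LinearMap.toMatrix' S).map (fun x => (x : ℂ)) *ᵥ cvec x) p =
        ((LinearMap.toMatrix' S *ᵥ x) p : ℝ) := by
      simp [Matrix.mulVec, dotProduct, cvec]
    rw [h2, LinearMap.toMatrix'_mulVec, Complex.norm_real, Real.norm_eq_abs, sq_abs]
  have h3 := h x
  simp only [h1] at h3
  have h4 : 0 ≤ ∑ q, x q ^ 2 := Finset.sum_nonneg fun _ _ => sq_nonneg _
  linarith

theorem GaussDecay.comp_linearEquiv {κ ι : Type*} [Fintype κ] [Fintype ι] {F : (ι → ℝ) → ℂ}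
    (hF : GaussDecay F) (T : (κ → ℝ) ≃ₗ[ℝ] ι → ℝ) (X : ι → ℝ) :
    GaussDecay fun t => F (X + T t) := by
  obtain ⟨K, hK, h⟩ := exists_sum_sq_le (T.symm : (ι → ℝ) →ₗ[ℝ] κ → ℝ)
  refine hF.comp_add (L := T) hK (fun t => ?_) X
  simpa using h (T t)

theorem exists_integral_comp_linearEquiv {ι : Type*} [Fintype ι] (T : (ι → ℝ) ≃ₗ[ℝ] ι → ℝ) :
    ∃ c : ℝ, 0 < c ∧ ∀ F : (ι → ℝ) → ℂ, ∫ x, F (T x) = c * ∫ x, F x := by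
  have hd : LinearMap.det (T : (ι → ℝ) →ₗ[ℝ] ι → ℝ) ≠ 0 := (LinearEquiv.isUnit_det' T).ne_zero
  refine ⟨|(LinearMap.det (T : (ι → ℝ) →ₗ[ℝ] ι → ℝ))⁻¹|, by positivity, fun F => ?_⟩
  have h1 := Real.map_linearMap_volume_pi_eq_smul_volume_pi hd
  have h2 : MeasurableEmbedding T :=
    T.toContinuousLinearEquiv.toHomeomorph.measurableEmbedding
  have h3 := h2.integral_map (μ := volume) F
  rw [← h3]
  have h4 : Measure.map T volume = Measure.map (T : (ι → ℝ) →ₗ[ℝ] ι → ℝ) volume := rfl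
  rw [h4, h1, integral_smul_measure, ENNReal.toReal_ofReal (abs_nonneg _), Complex.real_smul]

/-- Summability of rapidly decreasing functions over the pairs of vectors in the dual lattice. -/
theorem GaussDecay.summable_dualLat (hL : IsEvenLattice L) (g : V b ≃ₗ[ℝ] V b)
    {F : (Idx b × Fin 2 → ℝ) → ℂ} (hF : GaussDecay F) :
    Summable fun l : Fin 2 → dualLat L => F (gflat g fun j => (l j : V b)) := by
  obtain ⟨v, hv⟩ := hL.exists_basis
  have hd := dualLat_eq_span hv hL
  set d := (form b).dualBasis form_nondegenerate v with hdd
  have h1 := (hF.comp_linearEquiv (coordEquiv g d) 0).summable_translate 0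
  have h2 : ∀ l : Fin 2 → dualLat L, ∃ n : Idx b × Fin 2 → ℤ,
      ofCoord d (rvec n) = fun j => (l j : V b) := fun l =>
    (pairs_mem_span_iff d _).1 fun j => by rw [← hd]; exact (l j).2
  choose n hn using h2
  have hinj : Function.Injective n := by
    intro l l' h
    funext j
    refine Subtype.ext ?_
    have := hn l
    rw [h, hn l'] at this
    exact (congrFun this j).symm
  refine (h1.comp_injective hinj).congr fun l => ?_
  simp only [Function.comp_apply, zero_add]
  change F (gflat g (ofCoord d (rvec (n l)))) = _
  rw [hn]

theorem GaussDecay.summable_coset (hL : IsEvenLattice L) (g : V b ≃ₗ[ℝ] V b)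
    {F : (Idx b × Fin 2 → ℝ) → ℂ} (hF : GaussDecay F) (γ : Fin 2 → Disc L) :
    Summable fun l : Coset L γ => F (gflat g fun j => (l.val j : V b)) :=
  (hF.summable_dualLat hL g).comp_injective Subtype.val_injective

/-- Poisson summation for the cosets of a lattice in its dual. -/
theorem exists_poisson_lattice (hL : IsEvenLattice L) {g : V b ≃ₗ[ℝ] V b}
    (hg : ∀ x y, form b (g x) (g y) = form b x y) : ∃ c : ℝ, 0 < c ∧
    ∀ F F' : (Idx b × Fin 2 → ℝ) → ℂ, GaussDecay F → Continuous F → GaussDecay F' →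
      (∀ ξ, ∫ x, F x * e (-(pairForm x ξ : ℝ)) = F' ξ) → ∀ γ : Fin 2 → Disc L,
      ∑' l : Coset L γ, F (gflat g fun j => (l.val j : V b)) =
        c * ∑' η : Fin 2 → dualLat L, F' (gflat g fun j => (η j : V b)) *
          e ((∑ j, form b (η j) (rep γ j) : ℝ)) := by
  obtain ⟨v, hv⟩ := hL.exists_basis
  have hd := dualLat_eq_span hv hL
  set d := (form b).dualBasis form_nondegenerate v with hdd
  -- The Jacobian of passing from orthogonal to lattice coordinates. Only its positivity is
  -- recorded; `psi_inversion` makes its value unnecessary.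
  obtain ⟨c, hc, hint⟩ := exists_integral_comp_linearEquiv (coordEquiv g v)
  refine ⟨c, hc, fun F F' hF hFc hF' hFF' γ => ?_⟩
  set T := coordEquiv g v with hT
  -- the pairing of coordinates
  have hpair : ∀ x ξ : Idx b × Fin 2 → ℝ, ∑ j, form b (ofCoord d ξ j) (ofCoord v x j) =
      ξ ⬝ᵥ x := by
    intro x ξ
    rw [dotProduct, Fintype.sum_prod_type_right]
    refine Finset.sum_congr rfl fun j _ => ?_
    simp only [ofCoord, Module.Basis.equivFun_symm_apply, map_sum, LinearMap.sum_apply, map_smul,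
      LinearMap.smul_apply, hdd, LinearMap.BilinForm.apply_dualBasis_left, smul_eq_mul, mul_ite,
      mul_one, mul_zero, Finset.sum_ite_eq, Finset.mem_univ, if_true]
    exact Finset.sum_congr rfl fun i _ => mul_comm _ _
  have hft : ∀ ξ, ft (fun x => F (T x)) ξ = c * F' (gflat g (ofCoord d ξ)) := by
    intro ξ
    rw [ft, ← hFF', ← hint]
    refine integral_congr_ae (Filter.Eventually.of_forall fun x => ?_)
    change F (T x) * _ = F (T x) * _
    congr 4
    rw [← hpair]
    change _ = pairForm (gflat g (ofCoord v x)) (gflat g (ofCoord d ξ))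
    rw [pairForm_gflat hg]
    exact Finset.sum_congr rfl fun j _ => form_comm _ _
  have hFT : GaussDecay fun x => F (T x) := by
    simpa using hF.comp_linearEquiv T 0
  have hFT' : GaussDecay fun x => F' (coordEquiv g d x) := by
    simpa using hF'.comp_linearEquiv (coordEquiv g d) 0
  -- the coordinates of the representative
  obtain ⟨x, hx⟩ : ∃ x, ofCoord v x = rep γ := by
    refine ⟨fun p => v.equivFun (rep γ p.2) p.1, funext fun j => ?_⟩
    exact v.equivFun.symm_apply_apply (rep γ j)
  have hs : Summable fun n : Idx b × Fin 2 → ℤ => ft (fun x => F (T x)) (rvec n) := by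
    have h1 := (hFT'.summable_translate 0).mul_left (c : ℂ)
    simp only [zero_add] at h1
    exact h1.congr fun n => (hft _).symm
  have hTc : Continuous T := LinearMap.continuous_of_finiteDimensional
    (T : (Idx b × Fin 2 → ℝ) →ₗ[ℝ] Idx b × Fin 2 → ℝ)
  have hP := hasSum_poisson hFT (hFc.comp hTc) hs x
  -- the two index sets
  have hmemL : ∀ n : Idx b × Fin 2 → ℤ, ∀ j, ofCoord v (rvec n) j ∈ L := fun n => by
    rw [hv]; exact (pairs_mem_span_iff v _).2 ⟨n, rfl⟩
  have hmemd : ∀ n : Idx b × Fin 2 → ℤ, ∀ j, ofCoord d (rvec n) j ∈ dualLat L := fun n => by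
    rw [hd]; exact (pairs_mem_span_iff d _).2 ⟨n, rfl⟩
  have e1 : Function.Bijective fun n : Idx b × Fin 2 → ℤ =>
      (⟨fun j => ⟨rep γ j + ofCoord v (rvec n) j,
        (dualLat L).add_mem (rep_mem γ j) (le_dualLat hL (hmemL n j))⟩,
        coset_of_sub_mem fun j => by simpa using hmemL n j⟩ : Coset L γ) := by
    constructor
    · intro m n h
      refine rvec_injective (ofCoord_injective v (funext fun j => ?_))
      have := congrArg (fun l : Coset L γ => (l.val j : V b)) h
      simpa using this
    · intro l
      obtain ⟨n, hn⟩ := (pairs_mem_span_iff v fun j => (l.val j : V b) - rep γ j).1 fun j => by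
        rw [← hv]; exact coset_sub_mem l j
      refine ⟨n, Subtype.ext (funext fun j => Subtype.ext ?_)⟩
      simp [hn]
  have e2 : Function.Bijective fun n : Idx b × Fin 2 → ℤ =>
      (fun j => ⟨ofCoord d (rvec n) j, hmemd n j⟩ : Fin 2 → dualLat L) := by
    constructor
    · intro m n h
      refine rvec_injective (ofCoord_injective d (funext fun j => ?_))
      exact congrArg (fun l : Fin 2 → dualLat L => (l j : V b)) h
    · intro l
      obtain ⟨n, hn⟩ := (pairs_mem_span_iff d fun j => (l j : V b)).1 fun j => by
        rw [← hd]; exact (l j).2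
      exact ⟨n, funext fun j => Subtype.ext (congrFun hn j)⟩
  rw [← (Equiv.ofBijective _ e1).tsum_eq, ← (Equiv.ofBijective _ e2).tsum_eq, ← tsum_mul_left]
  have hl : ∀ n, F (gflat g fun j => (((Equiv.ofBijective _ e1) n).val j : V b)) =
      F (T (x + rvec n)) := by
    intro n
    change _ = F (gflat g (ofCoord v (x + rvec n)))
    rw [ofCoord_add, hx]
    rfl
  simp only [hl]
  rw [← hP.tsum_eq]
  refine tsum_congr fun n => ?_
  rw [hft, ← hpair, hx, mul_assoc]
  rfl

end Lattice

end KM2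

namespace KM2

/-! ### The splitting of a hyperbolic plane on cosets -/

section Splitting

variable {b : ℕ} {L : Submodule ℤ (V b)} {u u' : V b}

theorem IsHyperbolicPair.pair' (hU : IsHyperbolicPair L u u') : form b u' u = 1 := by
  rw [form_comm]; exact hU.pair

theorem IsHyperbolicPair.ne_zero (hU : IsHyperbolicPair L u u') : u ≠ 0 := by
  rintro rfl
  simpa using hU.pair

/-- The dual lattice is formed inside the real span of `M`, which is orthogonal to `u` and `u'`. -/
theorem form_dual_lorentz {x : V b} (hx : x ∈ dualLat (lorentz L u u')) :
    form b x u = 0 ∧ form b x u' = 0 := by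
  have h : Submodule.span ℝ (lorentz L u u' : Set (V b)) ≤
      LinearMap.ker ((form b).flip u) ⊓ LinearMap.ker ((form b).flip u') :=
    Submodule.span_le.2 fun y hy => ⟨hy.2.1, hy.2.2⟩
  exact h hx.2

/-- An element of the dual of `M` pairs with a vector of `L` as it pairs with the projection of that
vector to `M`. -/
theorem dual_lorentz_le (hL : IsEvenLattice L) (hU : IsHyperbolicPair L u u') {x : V b}
    (hx : x ∈ dualLat (lorentz L u u')) : x ∈ dualLat L := by
  refine mem_dualLat hL fun y hy => ?_
  obtain ⟨n, hn⟩ := form_dualLat hx (lorentzProj_mem hL hU hy)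
  refine ⟨n, ?_⟩
  rw [lorentzProj_apply] at hn
  simpa [form_dual_lorentz hx] using hn

/-- The pair of vectors with components `m + t u + n u'`. -/
def splitVec (u u' : V b) (m : Fin 2 → V b) (n t : Fin 2 → ℤ) : Fin 2 → V b :=
  fun j => m j + (t j : ℝ) • u + (n j : ℝ) • u'

theorem splitVec_mem (hL : IsEvenLattice L) (hU : IsHyperbolicPair L u u') {γ : Fin 2 → Disc L}
    (m : Coset (lorentz L u u') fun j => discProj hL hU (γ j)) (n t : Fin 2 → ℤ) (j : Fin 2) :
    splitVec u u' (fun j => (m.val j : V b)) n t j ∈ dualLat L := by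
  simp only [splitVec, Int.cast_smul_eq_zsmul]
  exact (dualLat L).add_mem ((dualLat L).add_mem (dual_lorentz_le hL hU (m.val j).2)
    ((dualLat L).smul_mem _ (le_dualLat hL hU.mem)))
    ((dualLat L).smul_mem _ (le_dualLat hL hU.mem'))

theorem lorentz_le : lorentz L u u' ≤ L := fun _ hx => hx.1

theorem splitVec_sub_rep_mem (hL : IsEvenLattice L) (hU : IsHyperbolicPair L u u')
    {γ : Fin 2 → Disc L} (m : Coset (lorentz L u u') fun j => discProj hL hU (γ j))
    (n t : Fin 2 → ℤ) (j : Fin 2) :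
    splitVec u u' (fun j => (m.val j : V b)) n t j - rep γ j ∈ L := by
  have h1 : (m.val j : V b) - lorentzProj u u' (rep γ j) ∈ lorentz L u u' := by
    have h2 : (Submodule.Quotient.mk (γ j).out : Disc L) = γ j := Quotient.out_eq _
    have h3 : (Submodule.Quotient.mk (m.val j) : Disc (lorentz L u u')) =
      discProj hL hU (γ j) := m.2 j
    rw [← h2] at h3
    change Submodule.Quotient.mk _ = Submodule.Quotient.mk (⟨lorentzProj u u' (rep γ j),
      lorentzProj_mem_dual hL hU (rep_mem γ j)⟩ : dualLat (lorentz L u u')) at h3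
    rw [Submodule.Quotient.eq] at h3
    exact h3
  obtain ⟨k, hk⟩ := form_dualLat (rep_mem γ j) hU.mem
  obtain ⟨l, hl⟩ := form_dualLat (rep_mem γ j) hU.mem'
  have h4 : splitVec u u' (fun j => (m.val j : V b)) n t j - rep γ j =
      ((m.val j : V b) - lorentzProj u u' (rep γ j)) + (t j - l) • u + (n j - k) • u' := by
    rw [lorentzProj_apply, hk, hl, splitVec]
    simp only [Int.cast_smul_eq_zsmul, sub_smul]
    abel
  rw [h4]
  exact L.add_mem (L.add_mem (lorentz_le h1) (L.smul_mem _ hU.mem)) (L.smul_mem _ hU.mem')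

/-- A pair in the coset of `M'`, together with the coefficients of `u` and `u'`, as a pair in the
coset of `L'`. -/
def splitMap (hL : IsEvenLattice L) (hU : IsHyperbolicPair L u u') (γ : Fin 2 → Disc L)
    (p : (Coset (lorentz L u u') fun j => discProj hL hU (γ j)) × (Fin 2 → ℤ) × (Fin 2 → ℤ)) :
    Coset L γ :=
  ⟨fun j => ⟨_, splitVec_mem hL hU p.1 p.2.1 p.2.2 j⟩,
    coset_of_sub_mem fun j => splitVec_sub_rep_mem hL hU p.1 p.2.1 p.2.2 j⟩

/-- The hyperbolic plane is unimodular, so the dual of `L` is the dual of `M` plus `U`. The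
coefficients are recovered as `n = (l, u)` and `t = (l, u')`. -/
theorem splitMap_bijective (hL : IsEvenLattice L) (hU : IsHyperbolicPair L u u')
    (γ : Fin 2 → Disc L) : Function.Bijective (splitMap hL hU γ) := by
  constructor
  · rintro ⟨m, n, t⟩ ⟨m', n', t'⟩ h
    have h1 : ∀ j, splitVec u u' (fun j => (m.val j : V b)) n t j =
        splitVec u u' (fun j => (m'.val j : V b)) n' t' j := fun j =>
      congrArg (fun l : Coset L γ => (l.val j : V b)) h
    have hm := fun j => form_dual_lorentz (m.val j).2
    have hm' := fun j => form_dual_lorentz (m'.val j).2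
    have ht : t = t' := by
      funext j
      have := congrArg (fun x => form b x u') (h1 j)
      simpa [splitVec, hm, hm', hU.pair, hU.sq'] using this
    have hn : n = n' := by
      funext j
      have := congrArg (fun x => form b x u) (h1 j)
      simpa [splitVec, hm, hm', hU.pair', hU.sq] using this
    subst ht hn
    have hmm : m = m' := by
      refine Subtype.ext (funext fun j => Subtype.ext ?_)
      simpa [splitVec] using h1 j
    rw [hmm]
  · intro l
    choose n hn using fun j => form_dualLat (l.val j).2 hU.mem
    choose t ht using fun j => form_dualLat (l.val j).2 hU.mem'
    refine ⟨⟨⟨fun j => ⟨lorentzProj u u' (l.val j), lorentzProj_mem_dual hL hU (l.val j).2⟩,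
      fun j => ?_⟩, n, t⟩, ?_⟩
    · exact congrArg (discProj hL hU) (l.2 j)
    · refine Subtype.ext (funext fun j => Subtype.ext ?_)
      change splitVec u u' (fun j => lorentzProj u u' (l.val j)) n t j = (l.val j : V b)
      simp only [splitVec, lorentzProj_apply, hn, ht]
      abel

end Splitting

end KM2

namespace KM2

/-! ### Theta functions with characteristics -/

section ThetaChar

open MeasureTheory

variable {b : ℕ}

theorem pairForm_comm (x y : Idx b × Fin 2 → ℝ) : pairForm x y = pairForm y x := by
  simp only [pairForm, mul_comm (x _)]

theorem pairForm_add (x y w : Idx b × Fin 2 → ℝ) :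
    pairForm x (y + w) = pairForm x y + pairForm x w := by
  simp only [pairForm, Pi.add_apply, mul_add, Finset.sum_add_distrib]

theorem pairForm_add_left (x y w : Idx b × Fin 2 → ℝ) :
    pairForm (x + y) w = pairForm x w + pairForm y w := by
  rw [pairForm_comm, pairForm_add, pairForm_comm w, pairForm_comm w]

theorem pairForm_neg (x y : Idx b × Fin 2 → ℝ) : pairForm x (-y) = -pairForm x y := by
  simp only [pairForm, Pi.neg_apply, mul_neg, Finset.sum_neg_distrib]

theorem pairForm_eq_sum (x y : Idx b × Fin 2 → ℝ) :
    pairForm x y = ∑ j, form b (col x j) (col y j) := by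
  simp only [form_apply, pairForm, Fintype.sum_sum_type, Sum.elim_inl, Sum.elim_inr, col,
    Finset.mul_sum]
  rw [Finset.sum_sub_distrib, sub_eq_add_neg, Finset.sum_comm, ← Finset.sum_neg_distrib]
  refine congrArg₂ (· + ·) (by simp) ?_
  rw [Finset.sum_comm]
  simp

theorem col_line (a : V b) (t : Fin 2 → ℝ) (j : Fin 2) : col (line a t) j = t j • a := by
  funext i
  simp [col, line]

theorem col_add (x y : Idx b × Fin 2 → ℝ) (j : Fin 2) : col (x + y) j = col x j + col y j := rfl

theorem pairForm_line (a : V b) (x : Idx b × Fin 2 → ℝ) (t : Fin 2 → ℝ) :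
    pairForm x (line a t) = t ⬝ᵥ hgt a x := by
  simp [pairForm_eq_sum, col_line, hgt, dotProduct]

/-- The summand of the theta function with characteristic `w` along a vector. -/
noncomputable def charFn (P : MvPolynomial (Fin b × Fin 2) ℂ) (a : V b)
    (τ : Matrix (Fin 2) (Fin 2) ℂ) (w : Fin 2 ⊕ Fin 2 → ℝ) (X : Idx b × Fin 2 → ℝ) : ℂ :=
  phi P τ (X + line a (w ∘ Sum.inl)) * e (((w ∘ Sum.inr) ⬝ᵥ hgt a X : ℝ))

theorem gaussDecay_charFn (P : MvPolynomial (Fin b × Fin 2) ℂ) (a : V b)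
    {τ : Matrix (Fin 2) (Fin 2) ℂ} (hτ : τ ∈ Siegel) (w : Fin 2 ⊕ Fin 2 → ℝ) :
    GaussDecay (charFn P a τ w) := by
  obtain ⟨C, ε, hε, h⟩ := (gaussDecay_phi P hτ).comp_add (L := fun x => x) one_pos
    (fun t => by rw [one_mul]) (line a (w ∘ Sum.inl))
  refine ⟨C, ε, hε, fun x => ?_⟩
  rw [charFn, norm_mul, norm_e_real, mul_one, add_comm x]
  exact h x

theorem continuous_charFn (P : MvPolynomial (Fin b × Fin 2) ℂ) (a : V b)
    (τ : Matrix (Fin 2) (Fin 2) ℂ) (w : Fin 2 ⊕ Fin 2 → ℝ) : Continuous (charFn P a τ w) := by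
  refine ((continuous_phi P τ).comp (continuous_id.add continuous_const)).mul
    (continuous_e.comp (Complex.continuous_ofReal.comp ?_))
  simp only [dotProduct, hgt, form_apply, col]
  fun_prop

/-- The row vector `w M`, for an integral matrix `M`. -/
def rowMul (w : Fin 2 ⊕ Fin 2 → ℝ) (M : Matrix (Fin 2 ⊕ Fin 2) (Fin 2 ⊕ Fin 2) ℤ) :
    Fin 2 ⊕ Fin 2 → ℝ := w ᵥ* M.map fun n => (n : ℝ)

theorem hgt_add (a : V b) (x y : Idx b × Fin 2 → ℝ) : hgt a (x + y) = hgt a x + hgt a y := by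
  funext j
  simp [hgt, col_add]

theorem hgt_line {a : V b} (h0 : form b a a = 0) (t : Fin 2 → ℝ) : hgt a (line a t) = 0 := by
  funext j
  simp [hgt, col_line, h0]

/-- The Fourier transform interchanges translations and characters. Both lie along `a`, and since
`a` is isotropic no constant phase arises, so characteristics transform linearly. -/
theorem integral_charFn {P : MvPolynomial (Fin b × Fin 2) ℂ} (hP : IsDetSq P) {a : V b}
    (h0 : form b a a = 0) {τ : Matrix (Fin 2) (Fin 2) ℂ} (hτ : τ ∈ Siegel)
    (w w' : Fin 2 ⊕ Fin 2 → ℝ) (hl : ∀ j, w' (Sum.inl j) = -w (Sum.inr j)) (hr : ∀ j, w' (Sum.inr j) = w (Sum.inl j))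
    (ξ : Idx b × Fin 2 → ℝ) :
    ∫ x, charFn P a τ w x * e (-(pairForm x ξ : ℝ)) =
      ftConst b τ * charFn P a (-τ⁻¹) w' ξ := by
  have e1 : line a (w' ∘ Sum.inl) = -line a (w ∘ Sum.inr) := by
    funext p
    simp [line, hl]
  have e2 : w' ∘ Sum.inr = w ∘ Sum.inl := funext hr
  set η := ξ - line a (w ∘ Sum.inr) with hη
  have h2 : ∀ x, charFn P a τ w x * e (-(pairForm x ξ : ℝ)) =
      e (((w ∘ Sum.inl) ⬝ᵥ hgt a ξ : ℝ)) * (fun y => phi P τ y * e (-(pairForm y η : ℝ)))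
        (x + line a (w ∘ Sum.inl)) := by
    intro x
    have h3 : pairForm (x + line a (w ∘ Sum.inl)) η = pairForm x ξ - (w ∘ Sum.inr) ⬝ᵥ hgt a x +
        (w ∘ Sum.inl) ⬝ᵥ hgt a ξ := by
      rw [hη, sub_eq_add_neg, pairForm_add, pairForm_neg, pairForm_add_left, pairForm_add_left,
        pairForm_comm _ ξ, pairForm_comm _ ξ, pairForm_line, pairForm_line, pairForm_line,
        hgt_line h0, dotProduct_zero]
      ring
    rw [charFn]
    simp only [h3]
    rw [mul_assoc, mul_left_comm (e _) (phi _ _ _), ← e_add, ← e_add]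
    congr 2
    push_cast
    ring
  simp_rw [h2]
  rw [integral_const_mul,
    integral_add_right_eq_self (fun y => phi P τ y * e (-(pairForm y η : ℝ))),
    integral_phi hP hτ, charFn, e1, e2, ← sub_eq_add_neg]
  ring

variable {L : Submodule ℤ (V b)}

/-- The theta function with characteristic `w` of a coset. -/
noncomputable def thetaChar (L : Submodule ℤ (V b)) (P : MvPolynomial (Fin b × Fin 2) ℂ)
    (g : V b ≃ₗ[ℝ] V b) (u : V b) (τ : Matrix (Fin 2) (Fin 2) ℂ) (w : Fin 2 ⊕ Fin 2 → ℝ) :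
    GroupAlg L :=
  fun γ => ∑' l : Coset L γ, charFn P (g u) τ w (gflat g fun j => (l.val j : V b))

/-- The cosets partition the pairs of vectors of the dual lattice. -/
noncomputable def cosetEquiv (L : Submodule ℤ (V b)) : (Σ γ : Fin 2 → Disc L, Coset L γ) ≃
    (Fin 2 → dualLat L) where
  toFun p := p.2.val
  invFun l := ⟨fun j => Submodule.Quotient.mk (l j), l, fun _ => rfl⟩
  left_inv := by
    rintro ⟨γ, l, h⟩
    obtain rfl : (fun j => Submodule.Quotient.mk (l j)) = γ := funext h
    rfl
  right_inv _ := rfl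

theorem sum_tsum_coset [Fintype (Fin 2 → Disc L)]
    {H : (Fin 2 → dualLat L) → ℂ} (hH : Summable H) :
    ∑ γ, ∑' l : Coset L γ, H l.val = ∑' l, H l := by
  rw [← (cosetEquiv L).tsum_eq, ← tsum_fintype (L := .unconditional _)]
  have h1 : Summable fun p => H (cosetEquiv L p) := (cosetEquiv L).summable_iff.2 hH
  exact h1.tsum_sigma.symm

theorem e_eq_of_sub_int {s t : ℝ} {n : ℤ} (h : s - t = n) : e (s : ℂ) = e (t : ℂ) := by
  have : (s : ℂ) = t + (n : ℂ) := by
    have h2 : s = t + n := by linarith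
    rw [h2]
    push_cast
    rfl
  rw [this, e_add, e_int, mul_one]

theorem e_form_coset {δ : Fin 2 → Disc L} (l : Coset L δ) (x : Fin 2 → V b)
    (hx : ∀ j, x j ∈ dualLat L) :
    e ((∑ j, form b (l.val j) (x j) : ℝ)) = e ((∑ j, form b (rep δ j) (x j) : ℝ)) := by
  choose n hn using fun j => form_dualLat (hx j) (coset_sub_mem l j)
  refine e_eq_of_sub_int (n := ∑ j, n j) ?_
  rw [← Finset.sum_sub_distrib]
  push_cast
  refine Finset.sum_congr rfl fun j _ => ?_
  rw [← hn j, form_comm (x j)]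
  simp

/-- The theta inversion formula. -/
theorem exists_thetaChar_inversion (hL : IsEvenLattice L) [Fintype (Fin 2 → Disc L)]
    {g : V b ≃ₗ[ℝ] V b} (hg : ∀ x y, form b (g x) (g y) = form b x y) {u : V b}
    (h0 : form b u u = 0) : ∃ c : ℝ, 0 < c ∧
    ∀ P : MvPolynomial (Fin b × Fin 2) ℂ, IsDetSq P → ∀ τ ∈ Siegel,
      ∀ w w' : Fin 2 ⊕ Fin 2 → ℝ, (∀ j, w' (Sum.inl j) = -w (Sum.inr j)) →
      (∀ j, w' (Sum.inr j) = w (Sum.inl j)) → ∀ γ, thetaChar L P g u τ w γ =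
        c * ftConst b τ * ∑ δ, e ((∑ j, form b (rep δ j) (rep γ j) : ℝ)) *
          thetaChar L P g u (-τ⁻¹) w' δ := by
  obtain ⟨c, hc, h⟩ := exists_poisson_lattice hL hg
  refine ⟨c, hc, fun P hP τ hτ w w' hl hr γ => ?_⟩
  have ha : form b (g u) (g u) = 0 := by rw [hg, h0]
  have hτ' := neg_inv_mem_Siegel hτ
  have hd := gaussDecay_charFn P (g u) hτ' w'
  have hF' : GaussDecay fun ξ => ftConst b τ * charFn P (g u) (-τ⁻¹) w' ξ := by
    obtain ⟨C, ε, hε, hC⟩ := hd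
    refine ⟨‖ftConst b τ‖ * C, ε, hε, fun x => ?_⟩
    rw [norm_mul, mul_assoc]
    exact mul_le_mul_of_nonneg_left (hC x) (norm_nonneg _)
  rw [thetaChar, h _ _ (gaussDecay_charFn P (g u) hτ w) (continuous_charFn P (g u) τ w) hF'
    (fun ξ => integral_charFn hP ha hτ w w' hl hr ξ)]
  have hs : Summable fun η : Fin 2 → dualLat L => charFn P (g u) (-τ⁻¹) w'
      (gflat g fun j => (η j : V b)) * e ((∑ j, form b (η j) (rep γ j) : ℝ)) := by
    refine Summable.of_norm ?_
    refine ((hd.summable_dualLat hL g).norm).congr fun η => ?_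
    rw [norm_mul, norm_e_real, mul_one]
  have h2 : ∀ η : Fin 2 → dualLat L, ftConst b τ * charFn P (g u) (-τ⁻¹) w'
      (gflat g fun j => (η j : V b)) * e ((∑ j, form b (η j) (rep γ j) : ℝ)) =
      ftConst b τ * (charFn P (g u) (-τ⁻¹) w'
      (gflat g fun j => (η j : V b)) * e ((∑ j, form b (η j) (rep γ j) : ℝ))) :=
    fun η => mul_assoc _ _ _
  simp only [h2]
  rw [tsum_mul_left, ← mul_assoc, ← sum_tsum_coset hs]
  congr 1
  refine Finset.sum_congr rfl fun δ _ => ?_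
  rw [thetaChar, ← tsum_mul_left]
  refine tsum_congr fun l => ?_
  rw [e_form_coset l _ (rep_mem γ), mul_comm]

end ThetaChar

end KM2

namespace KM2

/-! ### The theta integrand with characteristics under translations and unimodular substitutions -/

section Psi

variable {b : ℕ} {L : Submodule ℤ (V b)}

/-- The pairing of a form with the theta function with characteristic `w`. -/
noncomputable def psi (f : Matrix (Fin 2) (Fin 2) ℂ → GroupAlg L)
    (P : MvPolynomial (Fin b × Fin 2) ℂ) (g : V b ≃ₗ[ℝ] V b) (u : V b)
    (τ : Matrix (Fin 2) (Fin 2) ℂ) (w : Fin 2 ⊕ Fin 2 → ℝ) : ℂ :=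
  detPow b τ * pairing (f τ) fun γ =>
    (((τ.map Complex.im).det : ℝ) : ℂ) * thetaChar L P g u τ w γ

variable {f : Matrix (Fin 2) (Fin 2) ℂ → GroupAlg L} {P : MvPolynomial (Fin b × Fin 2) ℂ}
  {g : V b ≃ₗ[ℝ] V b} {u : V b}

theorem GroupAlg.exists_norm_le (hL : IsEvenLattice L) (a : GroupAlg L) : ∃ C, ∀ γ, ‖a γ‖ ≤ C := by
  have := finite_disc hL
  obtain ⟨C, hC⟩ := (Set.finite_range fun γ => ‖a γ‖).bddAbove
  exact ⟨C, fun γ => hC ⟨γ, rfl⟩⟩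

/-- Collecting all cosets into one sum over the dual lattice lets unimodular substitutions act by
reindexing. -/
theorem psi_eq_tsum (hL : IsEvenLattice L) {τ : Matrix (Fin 2) (Fin 2) ℂ} (hτ : τ ∈ Siegel)
    (w : Fin 2 ⊕ Fin 2 → ℝ) : psi f P g u τ w =
      detPow b τ * (((τ.map Complex.im).det : ℝ) : ℂ) * ∑' l : Fin 2 → dualLat L,
        f τ (fun j => Submodule.Quotient.mk (l j)) *
          (starRingEnd ℂ) (charFn P (g u) τ w (gflat g fun j => (l j : V b))) := by
  have := finite_disc hL
  have := Fintype.ofFinite (Fin 2 → Disc L)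
  obtain ⟨C, hC⟩ := GroupAlg.exists_norm_le hL (f τ)
  have hs : Summable fun l : Fin 2 → dualLat L => f τ (fun j => Submodule.Quotient.mk (l j)) *
      (starRingEnd ℂ) (charFn P (g u) τ w (gflat g fun j => (l j : V b))) := by
    refine Summable.of_norm_bounded
      (((gaussDecay_charFn P (g u) hτ w).summable_dualLat hL g).norm.mul_left C) fun l => ?_
    rw [norm_mul, RCLike.norm_conj]
    exact mul_le_mul_of_nonneg_right (hC _) (norm_nonneg _)
  rw [← sum_tsum_coset hs, psi, pairing, finsum_eq_sum_of_fintype, mul_assoc]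
  congr 1
  rw [Finset.mul_sum]
  refine Finset.sum_congr rfl fun γ _ => ?_
  rw [map_mul, Complex.conj_ofReal, thetaChar, Complex.conj_tsum, ← tsum_mul_left, ← tsum_mul_left,
    ← tsum_mul_left]
  refine tsum_congr fun l => ?_
  have : (fun j => (Submodule.Quotient.mk (l.val j) : Disc L)) = γ := funext l.2
  rw [this]
  ring

theorem rowMul_fromBlocks (w : Fin 2 ⊕ Fin 2 → ℝ) (A B C D : Matrix (Fin 2) (Fin 2) ℤ) :
    rowMul w (Matrix.fromBlocks A B C D) =
      Sum.elim ((w ∘ Sum.inl) ᵥ* A.map (fun n => (n : ℝ)) + (w ∘ Sum.inr) ᵥ* C.map fun n => (n : ℝ))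
        ((w ∘ Sum.inl) ᵥ* B.map (fun n => (n : ℝ)) + (w ∘ Sum.inr) ᵥ* D.map fun n => (n : ℝ)) := by
  rw [rowMul, Matrix.fromBlocks_map, Matrix.vecMul_fromBlocks]

theorem toC_eq (A : Matrix (Fin 2) (Fin 2) ℤ) : toC A = rC (A.map fun n => (n : ℝ)) := by
  ext i j
  simp

/-! ### Translations -/

theorem transl_symm {M : Sp4} {B : Matrix (Fin 2) (Fin 2) ℤ} (hM : M.val = Matrix.fromBlocks 1 B 0 1) :
    Bᵀ = B := by
  have h := M.2
  rw [SymplecticGroup.mem_iff, hM, Matrix.J, Matrix.fromBlocks_transpose,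
    Matrix.fromBlocks_multiply, Matrix.fromBlocks_multiply] at h
  have h1 := (Matrix.fromBlocks_inj.1 h).1
  simp only [Matrix.mul_zero, Matrix.mul_one, Matrix.transpose_one, Matrix.one_mul, zero_add,
    add_zero, Matrix.mul_neg, Matrix.neg_mul] at h1
  rw [add_neg_eq_zero, eq_comm] at h1
  exact h1

theorem act_transl {M : Sp4} {B : Matrix (Fin 2) (Fin 2) ℤ} (hM : M.val = Matrix.fromBlocks 1 B 0 1)
    (τ : Matrix (Fin 2) (Fin 2) ℂ) : act M τ = τ + rC (B.map fun n => (n : ℝ)) := by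
  have h1 : toC 1 = 1 := by ext i j; fin_cases i <;> fin_cases j <;> simp
  have h0 : toC 0 = 0 := by ext i j; simp
  rw [act, hM, Matrix.toBlocks_fromBlocks₁₁, Matrix.toBlocks_fromBlocks₁₂,
    Matrix.toBlocks_fromBlocks₂₁, Matrix.toBlocks_fromBlocks₂₂, h1, h0, ← toC_eq]
  simp

/-- Expanding the quadratic phase at the shifted point, the square of `a` drops out. The cross term
is linear in `hgt` and changes `w₂` by `w₁ B`. -/
theorem charFn_transl {a : V b} (h0 : form b a a = 0) {B : Matrix (Fin 2) (Fin 2) ℝ}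
    (hB : Bᵀ = B) (τ : Matrix (Fin 2) (Fin 2) ℂ) {w w' : Fin 2 ⊕ Fin 2 → ℝ}
    (hl : w' ∘ Sum.inl = w ∘ Sum.inl) (hr : w' ∘ Sum.inr = w ∘ Sum.inr + (w ∘ Sum.inl) ᵥ* B)
    (X : Idx b × Fin 2 → ℝ) : charFn P a (τ + rC B) w X =
      e (((∑ j, ∑ k, B j k * form b (col X j) (col X k)) / 2 : ℝ)) * charFn P a τ w' X := by
  have hs : B 1 0 = B 0 1 := congrFun (congrFun hB 0) 1
  set Y := X + line a (w ∘ Sum.inl) with hY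
  have h1 : pairForm Y (fun p => ∑ k, B p.2 k * Y (p.1, k)) =
      (∑ j, ∑ k, B j k * form b (col X j) (col X k)) + 2 * (((w ∘ Sum.inl) ᵥ* B) ⬝ᵥ hgt a X) := by
    have h2 : ∀ j, col (fun p => ∑ k, B p.2 k * Y (p.1, k)) j = ∑ k, B j k • col Y k := by
      intro j
      funext i
      simp [col, Finset.sum_apply]
    have h3 : ∀ j, col Y j = col X j + w (Sum.inl j) • a := by
      intro j
      rw [hY, col_add, col_line]
      rfl
    have h4 : ∀ x : V b, form b a x = form b x a := fun x => form_comm _ _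
    rw [pairForm_eq_sum]
    simp only [h2]
    simp only [h3, Fin.sum_univ_two, map_add, map_smul, LinearMap.add_apply,
      LinearMap.smul_apply, smul_eq_mul, h0, h4, dotProduct, Matrix.vecMul, hgt, Function.comp_apply,
      hs]
    ring
  rw [charFn, phi_add, ← hY, h1, charFn, hl, ← hY, mul_right_comm, ← e_add,
    mul_comm (phi P τ Y) (e _), ← mul_assoc, ← e_add, hr, add_dotProduct]
  congr 2
  push_cast
  ring

theorem col_gflat (l : Fin 2 → V b) (j : Fin 2) : col (gflat g l) j = g (l j) := rfl

/-- Changing the representative by lattice vectors changes the exponent by an integer, by evenness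
on the diagonal and by integrality of the pairings elsewhere. -/
theorem e_quad_coset (hL : IsEvenLattice L) {B : Matrix (Fin 2) (Fin 2) ℤ} (hB : Bᵀ = B)
    {γ : Fin 2 → Disc L} (l : Coset L γ) :
    e (((∑ j, ∑ k, (B j k : ℝ) * form b (l.val j) (l.val k)) / 2 : ℝ)) =
      e (((qMat (rep γ)).map (fun x => (x : ℂ)) * toC B).trace) := by
  have hs : B 1 0 = B 0 1 := congrFun (congrFun hB 0) 1
  have h1 : ((qMat (rep γ)).map (fun x => (x : ℂ)) * toC B).trace =
      (((∑ j, ∑ k, (B j k : ℝ) * form b (rep γ j) (rep γ k)) / 2 : ℝ) : ℂ) := by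
    have h4 : form b (rep γ 1) (rep γ 0) = form b (rep γ 0) (rep γ 1) := form_comm _ _
    simp only [Matrix.trace, Matrix.diag, Matrix.mul_apply, Fin.sum_univ_two, Matrix.map_apply,
      qMat, Matrix.of_apply, hs, h4]
    push_cast
    ring
  rw [h1]
  set m : Fin 2 → V b := fun j => (l.val j : V b) - rep γ j with hm
  have hmL : ∀ j, m j ∈ L := fun j => coset_sub_mem l j
  have hl : ∀ j, (l.val j : V b) = rep γ j + m j := fun j => (add_sub_cancel _ _).symm
  choose p hp using fun j k => form_dualLat (rep_mem γ j) (hmL k)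
  choose q hq using fun j => hL.even _ (hmL j)
  obtain ⟨r, hr⟩ := hL.integral (hmL 0) (hmL 1)
  have c1 : form b (m 1) (m 0) = r := by rw [form_comm, hr]
  have c2 : form b (rep γ 1) (rep γ 0) = form b (rep γ 0) (rep γ 1) := form_comm _ _
  have c3 : ∀ j k, form b (m k) (rep γ j) = p j k := fun j k => by rw [form_comm, hp]
  refine e_eq_of_sub_int (n := B 0 0 * (p 0 0 + q 0) + B 1 1 * (p 1 1 + q 1) +
    B 0 1 * (p 0 1 + p 1 0 + r)) ?_
  simp only [hl, Fin.sum_univ_two, map_add, LinearMap.add_apply, hs, hp, hq, hr, c1, c2, c3]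
  push_cast
  ring

theorem e_conj_mul (t : ℝ) : e (t : ℂ) * (starRingEnd ℂ) (e (t : ℂ)) = 1 := by
  rw [Complex.mul_conj, Complex.normSq_eq_norm_sq, norm_e_real]
  norm_num

/-- `f` and the theta summand acquire the same unimodular phase, which cancels in the Hermitian
pairing. -/
theorem psi_transl (hL : IsEvenLattice L) (hf : IsSiegelCuspForm L f)
    (hg : ∀ x y, form b (g x) (g y) = form b x y) (h0 : form b u u = 0) {M : Sp4}
    {B : Matrix (Fin 2) (Fin 2) ℤ} (hM : M.val = Matrix.fromBlocks 1 B 0 1)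
    {τ : Matrix (Fin 2) (Fin 2) ℂ} (hτ : τ ∈ Siegel) (w : Fin 2 ⊕ Fin 2 → ℝ) :
    act M τ ∈ Siegel ∧ psi f P g u (act M τ) w = psi f P g u τ (rowMul w M.val) := by
  have hB := transl_symm hM
  have hBr : (B.map fun n => (n : ℝ))ᵀ = B.map fun n => (n : ℝ) := by
    rw [← Matrix.transpose_map, hB]
  have hact := act_transl hM τ
  have hmem : act M τ ∈ Siegel := by rw [hact]; exact add_mem_Siegel hBr hτ
  refine ⟨hmem, ?_⟩
  have him : (act M τ).map Complex.im = τ.map Complex.im := by rw [hact, im_add_real]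
  rw [psi_eq_tsum hL hmem, psi_eq_tsum hL hτ, detPow, detPow, him]
  congr 1
  refine tsum_congr fun l => ?_
  set γ : Fin 2 → Disc L := fun j => Submodule.Quotient.mk (l j) with hγ
  have hfM := congrFun (hf.modular _ _ _ (IsWeil.transl M B hM) τ hτ) γ
  simp only [one_pow, one_smul] at hfM
  have hw : rowMul w M.val = Sum.elim (w ∘ Sum.inl)
      ((w ∘ Sum.inl) ᵥ* B.map (fun n => (n : ℝ)) + w ∘ Sum.inr) := by
    have h1 : (1 : Matrix (Fin 2) (Fin 2) ℤ).map (fun n => (n : ℝ)) = 1 := by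
      ext i j; fin_cases i <;> fin_cases j <;> simp
    have h0 : (0 : Matrix (Fin 2) (Fin 2) ℤ).map (fun n => (n : ℝ)) = 0 := by ext i j; simp
    rw [hM, rowMul_fromBlocks, h1, h0]
    simp
  have hc := charFn_transl (P := P) (a := g u) (by rw [hg, h0]) hBr τ (w := w)
    (w' := rowMul w M.val) (by rw [hw]; rfl) (by rw [hw, add_comm]; rfl)
    (gflat g fun j => (l j : V b))
  simp only [col_gflat, hg, Matrix.map_apply] at hc
  rw [← hact, e_quad_coset hL hB (⟨l, fun _ => rfl⟩ : Coset L γ)] at hc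
  obtain ⟨t, ht⟩ : ∃ t : ℝ, e (((qMat (rep γ)).map (fun x => (x : ℂ)) * toC B).trace) =
      e (t : ℂ) := ⟨_, (e_quad_coset hL hB (⟨l, fun _ => rfl⟩ : Coset L γ)).symm⟩
  rw [hfM, hc, ht, map_mul]
  linear_combination (f τ γ * (starRingEnd ℂ) (charFn P (g u) τ (rowMul w M.val)
    (gflat g fun j => (l j : V b)))) * e_conj_mul t

/-! ### Unimodular substitutions -/

/-- The action of an invertible matrix on pairs. -/
def glEquiv (N : Type*) [AddCommGroup N] (A : GL (Fin 2) ℤ) : (Fin 2 → N) ≃ (Fin 2 → N) where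
  toFun l j := ∑ i, A.val i j • l i
  invFun l j := ∑ i, (A⁻¹).val i j • l i
  left_inv l := by
    have h : A.val * (A⁻¹).val = 1 := A.mul_inv
    funext j
    have h1 : ∀ k, ∑ i, A.val k i * (A⁻¹).val i j = (1 : Matrix (Fin 2) (Fin 2) ℤ) k j := by
      intro k; rw [← h, Matrix.mul_apply]
    simp only [Finset.smul_sum, smul_smul]
    rw [Finset.sum_comm]
    simp only [← Finset.sum_smul, mul_comm ((A⁻¹).val _ j), h1]
    simp [Matrix.one_apply]
  right_inv l := by
    have h : (A⁻¹).val * A.val = 1 := A.inv_mul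
    funext j
    have h1 : ∀ k, ∑ i, (A⁻¹).val k i * A.val i j = (1 : Matrix (Fin 2) (Fin 2) ℤ) k j := by
      intro k; rw [← h, Matrix.mul_apply]
    simp only [Finset.smul_sum, smul_smul]
    rw [Finset.sum_comm]
    simp only [← Finset.sum_smul, mul_comm (A.val _ j), h1]
    simp [Matrix.one_apply]

theorem gl_det (A : GL (Fin 2) ℤ) : A.val.det = 1 ∨ A.val.det = -1 :=
  Int.isUnit_iff.1 ((Matrix.isUnit_iff_isUnit_det _).1 A.isUnit)

theorem map_cast_mul {R : Type*} [CommRing R] (A B : Matrix (Fin 2) (Fin 2) ℤ) :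
    A.map (fun n => (n : R)) * B.map (fun n => (n : R)) = (A * B).map fun n => (n : R) := by
  ext i j
  simp [Matrix.mul_apply]

theorem toC_gl_mul_inv (A : GL (Fin 2) ℤ) : toC A.val * toC (A⁻¹).val = 1 := by
  have h : A.val * (A⁻¹).val = 1 := A.mul_inv
  rw [map_cast_mul, h]
  ext i j; fin_cases i <;> fin_cases j <;> simp

theorem toC_transpose (A : Matrix (Fin 2) (Fin 2) ℤ) : toC Aᵀ = (toC A)ᵀ := rfl

theorem act_levi {M : Sp4} {A : GL (Fin 2) ℤ} (hM : M.val = Matrix.fromBlocks A.val 0 0 (A⁻¹).valᵀ)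
    (τ : Matrix (Fin 2) (Fin 2) ℂ) : act M τ =
      rC (A.val.map fun n => (n : ℝ)) * τ * (rC (A.val.map fun n => (n : ℝ)))ᵀ := by
  have h0 : toC 0 = 0 := by ext i j; simp
  have h1 : (toC (A⁻¹).valᵀ)⁻¹ = (toC A.val)ᵀ := by
    refine Matrix.inv_eq_left_inv ?_
    rw [toC_transpose, ← Matrix.transpose_mul]
    have := toC_gl_mul_inv A⁻¹
    rw [inv_inv] at this
    rw [this, Matrix.transpose_one]
  rw [act, hM, Matrix.toBlocks_fromBlocks₁₁, Matrix.toBlocks_fromBlocks₁₂,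
    Matrix.toBlocks_fromBlocks₂₁, Matrix.toBlocks_fromBlocks₂₂, h0, ← toC_eq, Matrix.zero_mul,
    zero_add, add_zero, h1]

/-- Here `det A = ±1`, so the polynomial and `det y` are unchanged, and reindexing the lattice sum
by `A` matches the permutation of the components of `f`. -/
theorem psi_levi (hL : IsEvenLattice L) (hf : IsSiegelCuspForm L f) (hP : IsDetSq P) {M : Sp4}
    {A : GL (Fin 2) ℤ} (hM : M.val = Matrix.fromBlocks A.val 0 0 (A⁻¹).valᵀ)
    {τ : Matrix (Fin 2) (Fin 2) ℂ} (hτ : τ ∈ Siegel) (w : Fin 2 ⊕ Fin 2 → ℝ) :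
    act M τ ∈ Siegel ∧ psi f P g u (act M τ) w = psi f P g u τ (rowMul w M.val) := by
  set Ar := A.val.map fun n => (n : ℝ) with hAr
  have hdet : Ar.det = (A.val.det : ℝ) := by simp [hAr, Matrix.det_fin_two]
  have hd2 : Ar.det ^ 2 = 1 := by
    rw [hdet]
    rcases gl_det A with h | h <;> simp [h]
  have hd0 : Ar.det ≠ 0 := fun h => by simp [h] at hd2
  have hact := act_levi hM τ
  rw [← hAr] at hact
  have hmem : act M τ ∈ Siegel := by rw [hact]; exact congr_mem_Siegel hd0 hτ
  refine ⟨hmem, ?_⟩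
  have him : ((act M τ).map Complex.im).det = (τ.map Complex.im).det := by
    rw [hact, im_congr, Matrix.det_mul, Matrix.det_mul, Matrix.det_transpose]
    linear_combination (τ.map Complex.im).det * hd2
  rw [psi_eq_tsum hL hmem, psi_eq_tsum hL hτ, detPow, detPow, him]
  congr 1
  rw [← (glEquiv (dualLat L) A).tsum_eq fun l => f τ (fun j => Submodule.Quotient.mk (l j)) *
    (starRingEnd ℂ) (charFn P (g u) τ (rowMul w M.val) (gflat g fun j => (l j : V b)))]
  refine tsum_congr fun l => ?_
  have hfM := congrFun (hf.modular _ _ _ (IsWeil.levi M A hM) τ hτ)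
    fun j => Submodule.Quotient.mk (l j)
  -- The weight and the Weil representation contribute exponents `(b + 2)/2` and `(2 - b)/2`, with
  -- sum `2`; the sign of the determinant disappears.
  have hmul : ((A.val.det : ℂ) ^ (1 / 2 : ℂ)) ^ (b + 2) *
      (A.val.det : ℂ) ^ ((2 - (b : ℂ)) / 2) = 1 := by
    have h0 : (A.val.det : ℂ) ≠ 0 := by
      rcases gl_det A with h | h <;> simp [h]
    rw [← Complex.cpow_nat_mul, ← Complex.cpow_add _ _ h0]
    have : (((b + 2 : ℕ) : ℂ) * (1 / 2) + (2 - (b : ℂ)) / 2) = ((2 : ℕ) : ℂ) := by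
      push_cast; ring
    rw [this, Complex.cpow_natCast]
    rcases gl_det A with h | h <;> simp [h]
  have hf2 : f (act M τ) (fun j => Submodule.Quotient.mk (l j)) =
      f τ (fun j => Submodule.Quotient.mk (glEquiv (dualLat L) A l j)) := by
    rw [hfM]
    simp only [Pi.smul_apply, smul_eq_mul]
    rw [← mul_assoc, hmul, one_mul]
    congr 1
  have hw : rowMul w M.val = Sum.elim ((w ∘ Sum.inl) ᵥ* Ar)
      ((w ∘ Sum.inr) ᵥ* ((A⁻¹).val.map (fun n => (n : ℝ)))ᵀ) := by
    have h0 : (0 : Matrix (Fin 2) (Fin 2) ℤ).map (fun n => (n : ℝ)) = 0 := by ext i j; simp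
    rw [hM, rowMul_fromBlocks, h0, Matrix.vecMul_zero, Matrix.vecMul_zero, add_zero, zero_add]
    rfl
  have hv : ∀ j, g ((glEquiv (dualLat L) A l j : dualLat L) : V b) =
      ∑ i, Ar i j • g (l i : V b) := by
    intro j
    simp only [glEquiv, Equiv.coe_fn_mk, Fin.sum_univ_two, Submodule.coe_add,
      Submodule.coe_smul, map_add, hAr, Matrix.map_apply, Int.cast_smul_eq_zsmul]
    congr 1 <;> exact map_zsmul g _ _
  have hX : (fun p : Idx b × Fin 2 => ∑ k, (gflat g (fun j => (l j : V b)) +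
      line (g u) (w ∘ Sum.inl)) (p.1, k) * Ar k p.2) =
      gflat g (fun j => (glEquiv (dualLat L) A l j : V b)) +
        line (g u) (rowMul w M.val ∘ Sum.inl) := by
    rw [hw]
    funext p
    simp only [Pi.add_apply, gflat, flat, hv, line, Sum.elim_comp_inl, Matrix.vecMul, dotProduct,
      Fin.sum_univ_two, Pi.smul_apply, smul_eq_mul]
    ring
  have hh : hgt (g u) (gflat g fun j => (glEquiv (dualLat L) A l j : V b)) =
      hgt (g u) (gflat g fun j => (l j : V b)) ᵥ* Ar := by
    funext j
    simp only [hgt, col_gflat, hv, Fin.sum_univ_two, map_add, map_smul, LinearMap.add_apply,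
      LinearMap.smul_apply, smul_eq_mul, Matrix.vecMul, dotProduct]
    ring
  have hAA : Ar * (A⁻¹).val.map (fun n => (n : ℝ)) = 1 := by
    have h : A.val * (A⁻¹).val = 1 := A.mul_inv
    rw [hAr, map_cast_mul, h]
    ext i j; fin_cases i <;> fin_cases j <;> simp
  have hone : ((Ar.det : ℂ) ^ 2)⁻¹ = 1 := by
    rw [← Complex.ofReal_pow, hd2]; simp
  have hph : (w ∘ Sum.inr) ⬝ᵥ hgt (g u) (gflat g fun j => (l j : V b)) =
      (rowMul w M.val ∘ Sum.inr) ⬝ᵥ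
        hgt (g u) (gflat g fun j => (glEquiv (dualLat L) A l j : V b)) := by
    rw [hw, hh, Sum.elim_comp_inr, Matrix.vecMul_transpose, dotProduct_comm _ (_ ᵥ* Ar),
      ← Matrix.dotProduct_mulVec, Matrix.mulVec_mulVec, hAA, Matrix.one_mulVec, dotProduct_comm]
  have hchar : charFn P (g u) (act M τ) w (gflat g fun j => (l j : V b)) =
      charFn P (g u) τ (rowMul w M.val) (gflat g fun j => (glEquiv (dualLat L) A l j : V b)) := by
    rw [charFn, charFn, hact, phi_congr hP hd0, hX, hone, one_mul, hph]
  rw [hf2, hchar]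

end Psi

end KM2

namespace KM2

/-! ### The theta integrand with characteristics under the inversion -/

section Inversion

variable {b : ℕ} {L : Submodule ℤ (V b)} {f : Matrix (Fin 2) (Fin 2) ℂ → GroupAlg L}
  {P : MvPolynomial (Fin b × Fin 2) ℂ} {g : V b ≃ₗ[ℝ] V b} {u : V b}

theorem cpow_half_neg_I_mul {z : ℂ} (hz : 0 < z.im) :
    (-Complex.I * z) ^ (1 / 2 : ℂ) = Complex.exp (-(Real.pi / 4 * Complex.I)) * z ^ (1 / 2 : ℂ) := by
  have hz0 : z ≠ 0 := by rintro rfl; simp at hz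
  have hI : -Complex.I ≠ 0 := neg_ne_zero.2 Complex.I_ne_zero
  have harg : 0 < z.arg ∧ z.arg ≤ Real.pi :=
    ⟨lt_of_le_of_ne (Complex.arg_nonneg_iff.2 hz.le) fun h => by
      rw [eq_comm, Complex.arg_eq_zero_iff] at h
      exact hz.ne' h.2, Complex.arg_le_pi z⟩
  have hlog : Complex.log (-Complex.I * z) = Complex.log (-Complex.I) + Complex.log z := by
    refine Complex.log_mul hI hz0 ?_
    rw [Complex.arg_neg_I]
    constructor <;> linarith [Real.pi_pos, harg.1, harg.2]
  rw [Complex.cpow_def_of_ne_zero (mul_ne_zero hI hz0), Complex.cpow_def_of_ne_zero hz0, hlog,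
    Complex.log_neg_I, ← Complex.exp_add]
  congr 1
  ring

/-- The holomorphic square root of the determinant. -/
noncomputable def sqrtDet (τ : Matrix (Fin 2) (Fin 2) ℂ) : ℂ :=
  (τ 0 0) ^ (1 / 2 : ℂ) * (τ.det / τ 0 0) ^ (1 / 2 : ℂ)

theorem sqrtDet_sq {τ : Matrix (Fin 2) (Fin 2) ℂ} (h : τ ∈ Siegel) : sqrtDet τ ^ 2 = τ.det := by
  have h0 := siegel_ne_zero h
  have hs : ∀ z : ℂ, (z ^ (1 / 2 : ℂ)) ^ 2 = z := by
    intro z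
    rw [one_div, ← Nat.cast_ofNat, Complex.cpow_nat_inv_pow _ two_ne_zero]
  rw [sqrtDet, mul_pow, hs, hs, mul_div_cancel₀ _ h0]

/-- Relates the branch in the Gaussian integral to the one chosen in `Mp_4(ℤ)`: each of the two
roots contributes `e^{-iπ/4}`. -/
theorem gaussConst_eq {τ : Matrix (Fin 2) (Fin 2) ℂ} (h : τ ∈ Siegel) :
    gaussConst τ = (-Complex.I * sqrtDet τ)⁻¹ := by
  have h1 := (siegel_im_pos h).1
  have h2 := siegel_im_det_div h
  rw [gaussConst, cpow_half_neg_I_mul h1, cpow_half_neg_I_mul h2, sqrtDet]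
  congr 1
  have h3 : Complex.exp (-(Real.pi / 4 * Complex.I)) * Complex.exp (-(Real.pi / 4 * Complex.I)) =
      -Complex.I := by
    rw [← Complex.exp_add]
    have : -(Real.pi / 4 * Complex.I) + -(Real.pi / 4 * Complex.I) = -(Real.pi / 2 * Complex.I) := by
      ring
    rw [this, Complex.exp_neg, Complex.exp_pi_div_two_mul_I, Complex.inv_I]
  rw [← h3]
  ring

/-- The automorphy factor of `f`, corrected by the change of `(det y)^{k+1}`, is the conjugate of
the multiplier of the theta function. With `φ² = det τ`, this reduces to `|φ|² = φ φ̄` and `i^{2-b}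
i^b = -1`. -/
theorem inversion_const (b : ℕ) {τ : Matrix (Fin 2) (Fin 2) ℂ} (h : τ ∈ Siegel) :
    (detPow b (-τ⁻¹) : ℂ) * ((((-τ⁻¹).map Complex.im).det : ℝ) : ℂ) * sqrtDet τ ^ (b + 2) *
      Complex.I ^ (2 - (b : ℤ)) = detPow b τ * (((τ.map Complex.im).det : ℝ) : ℂ) *
        (starRingEnd ℂ) (ftConst b τ) := by
  have hd : 0 < (τ.map Complex.im).det := h.2.det_pos
  set φ := sqrtDet τ with hφ
  have hφ2 : φ ^ 2 = τ.det := sqrtDet_sq h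
  have hdet0 := siegel_det_ne_zero h
  have hφ0 : φ ≠ 0 := fun h0 => hdet0 (by rw [← hφ2, h0]; simp)
  set n := Complex.normSq φ with hn
  have hn0 : 0 < n := Complex.normSq_pos.2 hφ0
  have hnd : Complex.normSq τ.det = n ^ 2 := by rw [← hφ2, map_pow]
  have h1 : ((-τ⁻¹).map Complex.im).det = (τ.map Complex.im).det / n ^ 2 := by
    rw [det_im_neg_inv h, hnd]
  have h2 : detPow b (-τ⁻¹) = detPow b τ / n ^ (b + 2) := by
    rw [detPow, detPow, h1, Real.div_rpow hd.le (by positivity)]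
    congr 1
    rw [← Real.rpow_natCast n 2, ← Real.rpow_mul hn0.le, ← Real.rpow_natCast]
    congr 1
    push_cast
    ring
  have hnc : (n : ℂ) = φ * (starRingEnd ℂ) φ := by rw [Complex.mul_conj]
  have hc0 : (starRingEnd ℂ) φ ≠ 0 := by simpa using hφ0
  have hI : Complex.I ^ (2 - (b : ℤ)) * Complex.I ^ b = -1 := by
    rw [← zpow_natCast, ← zpow_add₀ Complex.I_ne_zero]
    simp
  have hI0 : Complex.I ^ b ≠ 0 := pow_ne_zero _ Complex.I_ne_zero
  rw [h1, h2, ftConst, gaussConst_eq h, ← hφ, ← hφ2]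
  simp only [map_mul, map_pow, map_inv₀, map_neg, Complex.conj_I, Complex.conj_conj, neg_neg,
    Complex.ofReal_div, Complex.ofReal_pow, hnc]
  have hI2 : Complex.I ^ (2 - (b : ℤ)) = -(Complex.I ^ b)⁻¹ := by
    rw [eq_neg_iff_add_eq_zero]
    field_simp
    linear_combination hI
  rw [hI2]
  have hIb : (Complex.I ^ b)⁻¹ = (-Complex.I) ^ b := by rw [← inv_pow, Complex.inv_I]
  simp only [mul_inv, mul_pow, inv_pow, Complex.inv_I]
  rw [neg_sq, Complex.I_sq, hIb]
  field_simp
  ring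

theorem rowMul_symJ (w : Fin 2 ⊕ Fin 2 → ℝ) :
    rowMul w (SymplecticGroup.symJ (Fin 2) ℤ).val = Sum.elim (w ∘ Sum.inr) (-(w ∘ Sum.inl)) := by
  have h0 : (0 : Matrix (Fin 2) (Fin 2) ℤ).map (fun n => (n : ℝ)) = 0 := by ext i j; simp
  have h1 : (1 : Matrix (Fin 2) (Fin 2) ℤ).map (fun n => (n : ℝ)) = 1 := by
    ext i j; fin_cases i <;> fin_cases j <;> simp
  have h2 : (-1 : Matrix (Fin 2) (Fin 2) ℤ).map (fun n => (n : ℝ)) = -1 := by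
    ext i j; fin_cases i <;> fin_cases j <;> simp
  have hJ : (SymplecticGroup.symJ (Fin 2) ℤ).val = Matrix.fromBlocks 0 (-1) 1 0 := rfl
  rw [hJ, rowMul_fromBlocks, h0, h1, h2]
  simp [Matrix.vecMul_neg]

theorem act_symJ (τ : Matrix (Fin 2) (Fin 2) ℂ) :
    act (SymplecticGroup.symJ (Fin 2) ℤ) τ = -τ⁻¹ := by
  have h0 : toC 0 = 0 := by ext i j; simp
  have h1 : toC 1 = 1 := by ext i j; fin_cases i <;> fin_cases j <;> simp
  have h2 : toC (-1) = -1 := by ext i j; fin_cases i <;> fin_cases j <;> simp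
  have hJ : (SymplecticGroup.symJ (Fin 2) ℤ).val = Matrix.fromBlocks 0 (-1) 1 0 := rfl
  rw [act, hJ, Matrix.toBlocks_fromBlocks₁₁, Matrix.toBlocks_fromBlocks₁₂,
    Matrix.toBlocks_fromBlocks₂₁, Matrix.toBlocks_fromBlocks₂₂, h0, h1, h2]
  simp

/-- Theta inversion and the Weil representation have conjugate kernels, so both sides are the same
double sum over the discriminant group. The undetermined factor is `1/(|D_L| c)` with `c` from
Poisson summation. -/
theorem exists_psi_inversion (hL : IsEvenLattice L) (hf : IsSiegelCuspForm L f) (hP : IsDetSq P)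
    (hg : ∀ x y, form b (g x) (g y) = form b x y) (h0 : form b u u = 0) :
    ∃ κ : ℝ, 0 < κ ∧ ∀ τ ∈ Siegel, ∀ w, psi f P g u (-τ⁻¹) w =
      κ * psi f P g u τ (rowMul w (SymplecticGroup.symJ (Fin 2) ℤ).val) := by
  have := finite_disc hL
  have := Fintype.ofFinite (Fin 2 → Disc L)
  obtain ⟨c, hc, h⟩ := exists_thetaChar_inversion hL hg h0
  have hD' : (0 : ℝ) < Nat.card (Disc L) := by exact_mod_cast Nat.card_pos
  refine ⟨1 / (Nat.card (Disc L) * c), by positivity, fun τ hτ w => ?_⟩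
  set B : (Fin 2 → Disc L) → ℂ := thetaChar L P g u (-τ⁻¹) w with hB
  set S := ∑ γ, ∑ δ, e (-(∑ j, form b (rep γ j) (rep δ j) : ℝ)) * f τ δ * (starRingEnd ℂ) (B γ)
    with hS
  have hA := h P hP τ hτ (rowMul w (SymplecticGroup.symJ (Fin 2) ℤ).val) w
    (fun j => by rw [rowMul_symJ]; simp) (fun j => by rw [rowMul_symJ]; simp)
  have hcc : (c : ℂ) ≠ 0 := by exact_mod_cast hc.ne'
  have hD : (Nat.card (Disc L) : ℂ) ≠ 0 := by
    exact_mod_cast Nat.card_pos.ne'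
  have hf' : ∀ γ, f (-τ⁻¹) γ = sqrtDet τ ^ (b + 2) * (Complex.I ^ (2 - (b : ℤ)) /
      (Nat.card (Disc L) : ℂ) * ∑ δ, e (-(∑ j, form b (rep γ j) (rep δ j) : ℝ)) * f τ δ) := by
    intro γ
    have h1 := congrFun (hf.modular _ _ _ (IsWeil.inversion (L := L)) τ hτ) γ
    rw [act_symJ, Pi.smul_apply, smul_eq_mul, finsum_eq_sum_of_fintype] at h1
    exact h1
  have h1 : psi f P g u (-τ⁻¹) w = (detPow b (-τ⁻¹) : ℂ) *
      ((((-τ⁻¹).map Complex.im).det : ℝ) : ℂ) * sqrtDet τ ^ (b + 2) *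
      Complex.I ^ (2 - (b : ℤ)) / Nat.card (Disc L) * S := by
    rw [psi, pairing, finsum_eq_sum_of_fintype, hS, Finset.mul_sum, Finset.mul_sum]
    refine Finset.sum_congr rfl fun γ _ => ?_
    rw [hf', map_mul, Complex.conj_ofReal, ← Finset.sum_mul]
    ring
  have h2 : psi f P g u τ (rowMul w (SymplecticGroup.symJ (Fin 2) ℤ).val) =
      (detPow b τ * (((τ.map Complex.im).det : ℝ) : ℂ) * (starRingEnd ℂ) (ftConst b τ)) * c * S := by
    rw [psi, pairing, finsum_eq_sum_of_fintype, hS, Finset.sum_comm, Finset.mul_sum,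
      Finset.mul_sum]
    refine Finset.sum_congr rfl fun δ _ => ?_
    have h3 : ∀ γ : Fin 2 → Disc L, (starRingEnd ℂ) (e ((∑ j, form b (rep γ j) (rep δ j) : ℝ))) =
        e (-(∑ j, form b (rep γ j) (rep δ j) : ℝ)) := by
      intro γ
      rw [conj_e, Complex.conj_ofReal]
    rw [hA, map_mul, map_mul, map_mul, map_sum, Complex.conj_ofReal, Complex.conj_ofReal]
    simp only [map_mul, h3, ← hB, Finset.mul_sum]
    refine Finset.sum_congr rfl fun γ _ => ?_
    ring
  rw [h1, h2, inversion_const b hτ]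
  push_cast
  field_simp

theorem rowMul_rowMul (w : Fin 2 ⊕ Fin 2 → ℝ) (M N : Matrix (Fin 2 ⊕ Fin 2) (Fin 2 ⊕ Fin 2) ℤ) :
    rowMul (rowMul w M) N = rowMul w (M * N) := by
  rw [rowMul, rowMul, rowMul, Matrix.vecMul_vecMul]
  congr 1
  ext i j
  simp [Matrix.mul_apply]

/-- The matrix `-1` is a unimodular substitution that fixes `τ`. -/
theorem psi_neg (hL : IsEvenLattice L) (hf : IsSiegelCuspForm L f) (hP : IsDetSq P)
    {τ : Matrix (Fin 2) (Fin 2) ℂ} (hτ : τ ∈ Siegel) (w : Fin 2 ⊕ Fin 2 → ℝ) :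
    psi f P g u τ (-w) = psi f P g u τ w := by
  set M : Sp4 := SymplecticGroup.symJ (Fin 2) ℤ * SymplecticGroup.symJ (Fin 2) ℤ with hMdef
  have hJ : M.val = Matrix.fromBlocks (-1) 0 0 (-1) := by
    change Matrix.fromBlocks 0 (-1) 1 0 * Matrix.fromBlocks 0 (-1) 1 0 = _
    rw [Matrix.fromBlocks_multiply]
    simp
  have hM : M.val = Matrix.fromBlocks (-1 : GL (Fin 2) ℤ).val 0 0
      ((-1 : GL (Fin 2) ℤ)⁻¹).valᵀ := by
    rw [inv_neg, inv_one, Units.val_neg, Units.val_one, Matrix.transpose_neg, Matrix.transpose_one,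
      hJ]
  have h := (psi_levi (P := P) (g := g) (u := u) hL hf hP hM hτ w).2
  have h1 : (-1 : Matrix (Fin 2) (Fin 2) ℤ).map (fun n => (n : ℝ)) = -1 := by
    ext i j; fin_cases i <;> fin_cases j <;> simp
  have h2 : act M τ = τ := by
    rw [act_levi hM]
    have : rC (-1) = -1 := by ext i j; fin_cases i <;> fin_cases j <;> simp
    rw [Units.val_neg, Units.val_one, h1, this]
    simp
  have h3 : rowMul w M.val = -w := by
    have h4 : (0 : Matrix (Fin 2) (Fin 2) ℤ).map (fun n => (n : ℝ)) = 0 := by ext i j; simp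
    rw [hJ, rowMul_fromBlocks, h1, h4]
    ext (i | i) <;> simp [Matrix.vecMul_neg]
  rw [h2, h3] at h
  exact h.symm

/-- Inverting twice sends `w` to `-w`, so `κ² Ψ = Ψ`. Where `Ψ` does not vanish, the positive number
`κ` equals `1`; elsewhere there is nothing to prove. This replaces the comparison of the covolume of
`L` with `|D_L|`. -/
theorem psi_inversion (hL : IsEvenLattice L) (hf : IsSiegelCuspForm L f) (hP : IsDetSq P)
    (hg : ∀ x y, form b (g x) (g y) = form b x y) (h0 : form b u u = 0)
    {τ : Matrix (Fin 2) (Fin 2) ℂ} (hτ : τ ∈ Siegel) (w : Fin 2 ⊕ Fin 2 → ℝ) :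
    psi f P g u (-τ⁻¹) w = psi f P g u τ (rowMul w (SymplecticGroup.symJ (Fin 2) ℤ).val) := by
  obtain ⟨κ, hκ, h⟩ := exists_psi_inversion (f := f) (P := P) (g := g) (u := u) hL hf hP hg h0
  have hJJ : ∀ v, rowMul (rowMul v (SymplecticGroup.symJ (Fin 2) ℤ).val)
      (SymplecticGroup.symJ (Fin 2) ℤ).val = -v := by
    intro v
    rw [rowMul_symJ, rowMul_symJ]
    ext (i | i) <;> simp
  have h2 : ∀ v, psi f P g u τ v = (κ : ℂ) ^ 2 * psi f P g u τ v := by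
    intro v
    have h3 := h _ (neg_inv_mem_Siegel hτ) v
    have hu : IsUnit τ.det := (siegel_det_ne_zero hτ).isUnit
    have hinv : -(-τ⁻¹)⁻¹ = τ := by
      refine neg_eq_iff_eq_neg.2 (Matrix.inv_eq_right_inv ?_)
      rw [neg_mul_neg, Matrix.nonsing_inv_mul _ hu]
    rw [hinv, h τ hτ, hJJ, psi_neg hL hf hP hτ] at h3
    rw [sq, mul_assoc]
    exact h3
  rw [h τ hτ w]
  by_cases hz : psi f P g u τ (rowMul w (SymplecticGroup.symJ (Fin 2) ℤ).val) = 0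
  · rw [hz, mul_zero]
  · have h4 := mul_right_cancel₀ hz ((one_mul _).trans (h2 _))
    have h5 : κ ^ 2 = 1 := by exact_mod_cast h4.symm
    have h6 : κ = 1 := by nlinarith
    rw [h6]
    simp

end Inversion

end KM2

namespace KM2

/-! ### Generators of `Sp_4(ℤ)` -/

/-- The last standard row vector. -/
def lastRow : Fin 2 ⊕ Fin 2 → ℤ := Pi.single (Sum.inr 1) 1

/-- The symplectic matrix with blocks `A, 0, 0, A^{-t}`. -/
def leviSp (A : GL (Fin 2) ℤ) : Sp4 :=
  ⟨Matrix.fromBlocks A.val 0 0 (A⁻¹).valᵀ, by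
    rw [SymplecticGroup.fromBlocks_mem_iff]
    refine ⟨by simp, by simp, ?_⟩
    rw [← Matrix.transpose_mul, A.inv_mul]
    simp⟩

/-- The symplectic translation by a symmetric matrix. -/
def translSp (B : Matrix (Fin 2) (Fin 2) ℤ) (hB : Bᵀ = B) : Sp4 :=
  ⟨Matrix.fromBlocks 1 B 0 1, by
    rw [SymplecticGroup.fromBlocks_mem_iff]
    refine ⟨by simp, by simp [hB], by simp⟩⟩

theorem vecMul_leviSp (A : GL (Fin 2) ℤ) (c d : Fin 2 → ℤ) :
    Sum.elim c d ᵥ* (leviSp A).val = Sum.elim (c ᵥ* A.val) (d ᵥ* (A⁻¹).valᵀ) := by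
  simp [leviSp, Matrix.vecMul_fromBlocks]

theorem vecMul_translSp {B : Matrix (Fin 2) (Fin 2) ℤ} (hB : Bᵀ = B) (c d : Fin 2 → ℤ) :
    Sum.elim c d ᵥ* (translSp B hB).val = Sum.elim c (c ᵥ* B + d) := by
  simp [translSp, Matrix.vecMul_fromBlocks]

theorem vecMul_symJ (c d : Fin 2 → ℤ) :
    Sum.elim c d ᵥ* (SymplecticGroup.symJ (Fin 2) ℤ).val = Sum.elim d (-c) := by
  simp [Matrix.J, Matrix.vecMul_fromBlocks, Matrix.vecMul_neg]

/-! ### The Euclidean algorithm on integral rows -/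

theorem exists_gl_vecMul (x : Fin 2 → ℤ) :
    ∃ A : GL (Fin 2) ℤ, x ᵥ* A.val = ![0, (Int.gcd (x 0) (x 1) : ℤ)] := by
  obtain ⟨s, t, hst⟩ : ∃ s t : ℤ, (Int.gcd (x 0) (x 1) : ℤ) = x 0 * s + x 1 * t :=
    ⟨_, _, Int.gcd_eq_gcd_ab _ _⟩
  obtain ⟨p, hp⟩ := Int.gcd_dvd_left (x 0) (x 1)
  obtain ⟨q, hq⟩ := Int.gcd_dvd_right (x 0) (x 1)
  generalize hn : (Int.gcd (x 0) (x 1) : ℤ) = n at hst hp hq ⊢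
  by_cases h0 : n = 0
  · refine ⟨1, ?_⟩
    rw [h0] at hp hq ⊢
    funext j
    fin_cases j <;> simp [hp, hq]
  · have h1 : p * s + q * t = 1 := by
      apply mul_left_cancel₀ h0
      linear_combination -hst - s * hp - t * hq
    -- The second column is a Bézout pair for the gcd; the first is annihilated by `x = n (p, q)`.
    -- The determinant is `ps + qt = 1`.
    refine ⟨⟨!![q, s; -p, t], !![t, -s; p, q], ?_, ?_⟩, ?_⟩
    · ext i j
      fin_cases i <;> fin_cases j <;> simp [Matrix.mul_apply] <;>
        first | ring1 | linear_combination h1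
    · ext i j
      fin_cases i <;> fin_cases j <;> simp [Matrix.mul_apply] <;>
        first | ring1 | linear_combination h1
    · funext j
      fin_cases j
      · simp [Matrix.vecMul, dotProduct]
        linear_combination q * hp - p * hq
      · simp [Matrix.vecMul, dotProduct]
        linear_combination -hst

theorem exists_gl_vecMul_inv (x : Fin 2 → ℤ) :
    ∃ A : GL (Fin 2) ℤ, x ᵥ* (A⁻¹).valᵀ = ![0, (Int.gcd (x 0) (x 1) : ℤ)] := by
  obtain ⟨A, hA⟩ := exists_gl_vecMul x
  refine ⟨⟨(A⁻¹).valᵀ, A.valᵀ, ?_, ?_⟩, ?_⟩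
  · rw [← Matrix.transpose_mul, A.mul_inv, Matrix.transpose_one]
  · rw [← Matrix.transpose_mul, A.inv_mul, Matrix.transpose_one]
  · change x ᵥ* A.valᵀᵀ = _
    rw [Matrix.transpose_transpose, hA]

/-- The embedding of `SL_2(ℤ)` in the first coordinates. -/
def embSL (γ : Matrix.SpecialLinearGroup (Fin 2) ℤ) : Sp4 :=
  ⟨Matrix.fromBlocks !![γ 0 0, 0; 0, 1] !![γ 0 1, 0; 0, 0] !![γ 1 0, 0; 0, 0] !![γ 1 1, 0; 0, 1], by
    have h := γ.det_coe
    rw [Matrix.det_fin_two] at h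
    rw [SymplecticGroup.fromBlocks_mem_iff]
    refine ⟨?_, ?_, ?_⟩ <;>
    · ext i j
      fin_cases i <;> fin_cases j <;> simp [Matrix.mul_apply] <;> linarith⟩

theorem embSL_mul (γ δ : Matrix.SpecialLinearGroup (Fin 2) ℤ) :
    embSL (γ * δ) = embSL γ * embSL δ := by
  apply Subtype.ext
  change _ = (embSL γ).val * (embSL δ).val
  simp only [embSL, Matrix.fromBlocks_multiply]
  congr 1 <;>
  · ext i j
    fin_cases i <;> fin_cases j <;> simp [Matrix.mul_apply, Fin.sum_univ_two]

/-- Euclid's algorithm on the gcd `n` of the left half of the row. Bring the left half to `(0, n)`,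
reduce the right half modulo `n`, and exchange the halves by `J`; the gcd strictly decreases. When
it is `0`, the right half is brought to its own gcd in the last place. -/
theorem exists_vecMul_eq_lastRow (H : Subgroup Sp4) (hl : ∀ A, leviSp A ∈ H)
    (ht : ∀ B hB, translSp B hB ∈ H)
    (hJ : SymplecticGroup.symJ (Fin 2) ℤ ∈ H) (v : Fin 2 ⊕ Fin 2 → ℤ) :
    ∃ N ∈ H, ∃ r : ℕ, v ᵥ* N.val = (r : ℤ) • lastRow := by
  induction h : Int.gcd (v (Sum.inl 0)) (v (Sum.inl 1)) using Nat.strong_induction_on generalizing v with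
  | _ n ih =>
  obtain ⟨A, hA⟩ := exists_gl_vecMul (v ∘ Sum.inl)
  set d := (v ∘ Sum.inr) ᵥ* (A⁻¹).valᵀ with hd
  have hv : v ᵥ* (leviSp A).val = Sum.elim ![0, (n : ℤ)] d := by
    conv_lhs => rw [← Sum.elim_comp_inl_inr v]
    rw [vecMul_leviSp, hA, Function.comp_apply, Function.comp_apply, h]
  rcases Nat.eq_zero_or_pos n with h0 | hn
  · obtain ⟨A', hA'⟩ := exists_gl_vecMul_inv d
    refine ⟨leviSp A * leviSp A', H.mul_mem (hl _) (hl _), Int.gcd (d 0) (d 1), ?_⟩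
    change v ᵥ* ((leviSp A).val * (leviSp A').val) = _
    rw [← Matrix.vecMul_vecMul, hv, vecMul_leviSp, hA', h0]
    funext i
    rcases i with i | i <;> fin_cases i <;> simp [lastRow, Matrix.vecMul, dotProduct]
  · have hn' : (0 : ℤ) < n := by exact_mod_cast hn
    -- Only the second row of `B` acts on `(0, n)`. It subtracts the multiples of `n` that leave
    -- remainders, and the other off-diagonal entry is then forced by symmetry.
    set B : Matrix (Fin 2) (Fin 2) ℤ := !![0, -(d 0 / n); -(d 0 / n), -(d 1 / n)] with hB
    have hBs : Bᵀ = B := by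
      ext i j
      fin_cases i <;> fin_cases j <;> simp [hB]
    set d' : Fin 2 → ℤ := ![d 0 % n, d 1 % n] with hd'
    have hd2 : ![0, (n : ℤ)] ᵥ* B + d = d' := by
      funext j
      fin_cases j
      · simp [hB, hd', Int.emod_def]
        ring
      · simp [hB, hd', Int.emod_def]
        ring
    set N := leviSp A * translSp B hBs * SymplecticGroup.symJ (Fin 2) ℤ with hN
    have hNH : N ∈ H := H.mul_mem (H.mul_mem (hl _) (ht _ _)) hJ
    have hvN : v ᵥ* N.val = Sum.elim d' (-![0, (n : ℤ)]) := by
      change v ᵥ* ((leviSp A).val * (translSp B hBs).val * _) = _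
      rw [← Matrix.vecMul_vecMul, ← Matrix.vecMul_vecMul, hv, vecMul_translSp, hd2, vecMul_symJ]
    have hlt : Int.gcd (d' 0) (d' 1) < n := by
      have h1 : ∀ x : ℤ, 0 ≤ x % n ∧ x % n < n := fun x =>
        ⟨Int.emod_nonneg _ hn'.ne', Int.emod_lt_of_pos _ hn'⟩
      have e0 : d' 0 = d 0 % n := rfl
      have e1 : d' 1 = d 1 % n := rfl
      have h20 := h1 (d 0)
      have h21 := h1 (d 1)
      rw [← e0] at h20
      rw [← e1] at h21
      by_cases hz : d' 0 = 0
      · rw [hz, Int.gcd_zero_left]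
        omega
      · have := Int.le_of_dvd (lt_of_le_of_ne h20.1 (Ne.symm hz)) (Int.gcd_dvd_left (d' 0) (d' 1))
        omega
    obtain ⟨N', hN', r, hr⟩ := ih _ hlt (Sum.elim d' (-![0, (n : ℤ)])) rfl
    refine ⟨N * N', H.mul_mem hNH hN', r, ?_⟩
    change v ᵥ* (N.val * N'.val) = _
    rw [← Matrix.vecMul_vecMul, hvN, hr]

/-- The Siegel parabolic subgroup is the product of its Levi factor and its translations. -/
theorem mem_of_toBlocks₂₁_eq_zero (H : Subgroup Sp4) (hl : ∀ A, leviSp A ∈ H)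
    (ht : ∀ B hB, translSp B hB ∈ H) {M : Sp4} (h : M.val.toBlocks₂₁ = 0) : M ∈ H := by
  have hM := M.2
  rw [← Matrix.fromBlocks_toBlocks M.val, SymplecticGroup.fromBlocks_mem_iff, h] at hM
  set A := M.val.toBlocks₁₁ with hA
  set B := M.val.toBlocks₁₂ with hB
  set D := M.val.toBlocks₂₂ with hD
  obtain ⟨-, h2, h3⟩ := hM
  simp only [Matrix.transpose_zero, Matrix.zero_mul, sub_zero] at h3
  have h4 : Dᵀ * A = 1 := by
    have := congrArg Matrix.transpose h3
    simpa [Matrix.transpose_mul] using this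
  have h5 : A * Dᵀ = 1 := mul_eq_one_comm.1 h4
  set A' : GL (Fin 2) ℤ := ⟨A, Dᵀ, h5, h4⟩ with hA'
  have hs : (Dᵀ * B)ᵀ = Dᵀ * B := by
    rw [Matrix.transpose_mul, Matrix.transpose_transpose, h2]
  have : M = leviSp A' * translSp (Dᵀ * B) hs := by
    apply Subtype.ext
    change M.val = Matrix.fromBlocks A 0 0 Dᵀᵀ * Matrix.fromBlocks 1 (Dᵀ * B) 0 1
    rw [Matrix.fromBlocks_multiply]
    conv_lhs => rw [← Matrix.fromBlocks_toBlocks M.val, h]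
    simp [← Matrix.mul_assoc, h5, ← hA, ← hB, ← hD]
  rw [this]
  exact H.mul_mem (hl _) (ht _ _)

theorem embSL_mem (H : Subgroup Sp4) (ht : ∀ B hB, translSp B hB ∈ H)
    (hJ : SymplecticGroup.symJ (Fin 2) ℤ ∈ H) (γ : Matrix.SpecialLinearGroup (Fin 2) ℤ) : embSL γ ∈ H := by
  set ι : Matrix.SpecialLinearGroup (Fin 2) ℤ →* Sp4 := MonoidHom.mk' embSL embSL_mul with hι
  set E : Matrix (Fin 2) (Fin 2) ℤ := !![1, 0; 0, 0] with hE
  have hEs : Eᵀ = E := by ext i j; fin_cases i <;> fin_cases j <;> simp [hE]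
  have hT : ι ModularGroup.T = translSp E hEs := by
    apply Subtype.ext
    simp only [hι, MonoidHom.mk'_apply, embSL, translSp, ModularGroup.T, hE]
    congr 1 <;> (ext i j; fin_cases i <;> fin_cases j <;> simp)
  have hTm : ι ModularGroup.T ∈ H := by rw [hT]; exact ht _ _
  have hLm : SymplecticGroup.symJ (Fin 2) ℤ * (ι ModularGroup.T)⁻¹ *
      (SymplecticGroup.symJ (Fin 2) ℤ)⁻¹ ∈ H :=
    H.mul_mem (H.mul_mem hJ (H.inv_mem hTm)) (H.inv_mem hJ)
  -- In `SL_2(ℤ)`, `S` is a product of upper and lower unipotent elements. The lower one is obtained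
  -- by conjugating `T⁻¹` by `J`.
  have hS : ι ModularGroup.S = (ι ModularGroup.T)⁻¹ * (SymplecticGroup.symJ (Fin 2) ℤ *
      (ι ModularGroup.T)⁻¹ * (SymplecticGroup.symJ (Fin 2) ℤ)⁻¹) * (ι ModularGroup.T)⁻¹ := by
    rw [eq_mul_inv_iff_mul_eq, eq_inv_mul_iff_mul_eq, eq_mul_inv_iff_mul_eq, eq_mul_inv_iff_mul_eq,
      hT]
    apply Subtype.ext
    change (translSp E hEs).val * ((embSL ModularGroup.S).val * (translSp E hEs).val) *
      Matrix.fromBlocks 0 (-1) 1 0 * (translSp E hEs).val = Matrix.fromBlocks 0 (-1) 1 0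
    simp only [embSL, translSp, ModularGroup.S, hE, Matrix.fromBlocks_multiply]
    congr 1 <;> (ext i j; fin_cases i <;> fin_cases j <;> simp)
  have hle : (⊤ : Subgroup (Matrix.SpecialLinearGroup (Fin 2) ℤ)) ≤ H.comap ι := by
    rw [← SpecialLinearGroup.SL2Z_generators, Subgroup.closure_le]
    rintro x (rfl | rfl)
    · change ι ModularGroup.S ∈ H
      rw [hS]
      exact H.mul_mem (H.mul_mem (H.inv_mem hTm) hLm) (H.inv_mem hTm)
    · exact hTm
  exact hle (Subgroup.mem_top γ)

/-- The symplectic relation turns the condition on the last row into one on the second column. The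
first row and column of each block then carry an `SL_2(ℤ)`-matrix, and removing it with `embSL`
kills the lower left block. -/
theorem klingen_le (H : Subgroup Sp4) (hl : ∀ A, leviSp A ∈ H)
    (ht : ∀ B hB, translSp B hB ∈ H) (hJ : SymplecticGroup.symJ (Fin 2) ℤ ∈ H) : klingen ≤ H := by
  intro K hK
  have hrow := mem_klingen.1 hK
  have hcol : K.val *ᵥ Pi.single (Sum.inl 1) 1 = Pi.single (Sum.inl 1) 1 := by
    have h1 := SymplecticGroup.mem_iff.1 K.2
    have h2 : (K.val * Matrix.J (Fin 2) ℤ * K.valᵀ) *ᵥ lastRow = Matrix.J (Fin 2) ℤ *ᵥ lastRow := by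
      rw [h1]
    have h3 : K.valᵀ *ᵥ lastRow = lastRow := by
      rw [Matrix.mulVec_transpose]
      exact hK
    have h4 : Matrix.J (Fin 2) ℤ *ᵥ lastRow = -Pi.single (Sum.inl 1) 1 := by
      funext i
      rcases i with i | i <;> fin_cases i <;>
        simp [Matrix.J, lastRow]
    rw [← Matrix.mulVec_mulVec, ← Matrix.mulVec_mulVec, h3, h4, Matrix.mulVec_neg, neg_inj] at h2
    exact h2
  have hc : ∀ i, K.val i (Sum.inl 1) = if i = Sum.inl 1 then 1 else 0 := by
    intro i
    have := congrFun hcol i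
    rwa [Matrix.mulVec_single_one, Matrix.col_apply, Pi.single_apply] at this
  have hM := K.2
  rw [← Matrix.fromBlocks_toBlocks K.val, SymplecticGroup.fromBlocks_mem_iff] at hM
  have hdet := congrFun (congrFun hM.2.2 0) 0
  simp [Matrix.mul_apply, Matrix.toBlocks₁₁, Matrix.toBlocks₁₂, Matrix.toBlocks₂₁,
    Matrix.toBlocks₂₂, hrow] at hdet
  set γ : Matrix.SpecialLinearGroup (Fin 2) ℤ :=
    ⟨!![K.val (Sum.inr 0) (Sum.inr 0), -K.val (Sum.inl 0) (Sum.inr 0);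
      -K.val (Sum.inr 0) (Sum.inl 0), K.val (Sum.inl 0) (Sum.inl 0)], by
      rw [Matrix.det_fin_two_of]; linarith⟩ with hγ
  have h0 : (embSL γ * K).val.toBlocks₂₁ = 0 := by
    change ((embSL γ).val * K.val).toBlocks₂₁ = 0
    ext i j
    fin_cases i <;> fin_cases j <;>
      simp [embSL, hγ, Matrix.toBlocks₂₁, Matrix.mul_apply, hrow, hc]
    ring
  have h1 := H.mul_mem (H.inv_mem (embSL_mem H ht hJ γ)) (mem_of_toBlocks₂₁_eq_zero H hl ht h0)
  rwa [inv_mul_cancel_left] at h1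

/-- Reduce the last row of `M` to `r (0,0,0,1)`. The row of an invertible matrix is primitive, so `r
= 1` and the product lies in the Klingen subgroup. -/
theorem mem_of_generators (H : Subgroup Sp4) (hl : ∀ A, leviSp A ∈ H)
    (ht : ∀ B hB, translSp B hB ∈ H) (hJ : SymplecticGroup.symJ (Fin 2) ℤ ∈ H) (M : Sp4) : M ∈ H := by
  obtain ⟨N, hN, r, hr⟩ := exists_vecMul_eq_lastRow H hl ht hJ (lastRow ᵥ* M.val)
  have h1 : lastRow ᵥ* (M * N).val = (r : ℤ) • lastRow := by
    change lastRow ᵥ* (M.val * N.val) = _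
    rw [← Matrix.vecMul_vecMul, hr]
  have h2 : lastRow = (r : ℤ) • (lastRow ᵥ* ((M * N)⁻¹ : Sp4).val) := by
    rw [← Matrix.smul_vecMul, ← h1, Matrix.vecMul_vecMul]
    have : (M * N).val * ((M * N)⁻¹ : Sp4).val = 1 := congrArg Subtype.val (mul_inv_cancel (M * N))
    rw [this, Matrix.vecMul_one]
  have h3 : (r : ℤ) ∣ 1 := ⟨_, by simpa [lastRow] using congrFun h2 (Sum.inr 1)⟩
  have h4 : r = 1 := by
    have := Int.natCast_dvd_natCast.1 (by simpa using h3 : (r : ℤ) ∣ ((1 : ℕ) : ℤ))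
    exact Nat.dvd_one.1 this
  have h5 : M * N ∈ klingen := by
    rw [h4] at h1
    rw [Nat.cast_one, one_smul] at h1
    exact h1
  have h6 := H.mul_mem (klingen_le H hl ht hJ h5) (H.inv_mem hN)
  rwa [mul_inv_cancel_right] at h6

/-- Inverses of generators are products of generators, in particular `J⁻¹ = J³`, so closure under
products suffices. -/
theorem Sp4_induction {p : Sp4 → Prop} (hl : ∀ A, p (leviSp A)) (ht : ∀ B hB, p (translSp B hB))
    (hJ : p (SymplecticGroup.symJ (Fin 2) ℤ)) (hmul : ∀ M N, p M → p N → p (M * N)) (M : Sp4) :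
    p M := by
  have h1 : (1 : Sp4) = leviSp 1 := by
    apply Subtype.ext
    simp [leviSp]
  have hl' : ∀ A, (leviSp A)⁻¹ = leviSp A⁻¹ := by
    intro A
    rw [inv_eq_iff_mul_eq_one]
    apply Subtype.ext
    change Matrix.fromBlocks _ _ _ _ * Matrix.fromBlocks _ _ _ _ = 1
    rw [Matrix.fromBlocks_multiply, ← Matrix.transpose_mul, A.mul_inv, inv_inv, A.mul_inv]
    simp
  have ht' : ∀ B hB, (translSp B hB)⁻¹ = translSp (-B) (by rw [Matrix.transpose_neg, hB]) := by
    intro B hB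
    rw [inv_eq_iff_mul_eq_one]
    apply Subtype.ext
    change Matrix.fromBlocks _ _ _ _ * Matrix.fromBlocks _ _ _ _ = 1
    rw [Matrix.fromBlocks_multiply]
    simp
  have hJ' : (SymplecticGroup.symJ (Fin 2) ℤ)⁻¹ = SymplecticGroup.symJ (Fin 2) ℤ *
      (SymplecticGroup.symJ (Fin 2) ℤ * SymplecticGroup.symJ (Fin 2) ℤ) := by
    rw [inv_eq_iff_mul_eq_one]
    apply Subtype.ext
    change Matrix.J _ _ * (Matrix.J _ _ * (Matrix.J _ _ * Matrix.J _ _)) = 1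
    rw [Matrix.J_squared, Matrix.mul_neg, Matrix.mul_one, Matrix.mul_neg, Matrix.J_squared, neg_neg]
  let K : Subgroup Sp4 :=
    { carrier := {M | p M ∧ p M⁻¹}
      mul_mem' := fun {a c} ha hc => ⟨hmul _ _ ha.1 hc.1, by
        rw [_root_.mul_inv_rev]; exact hmul _ _ hc.2 ha.2⟩
      one_mem' := ⟨by rw [h1]; exact hl 1, by rw [inv_one, h1]; exact hl 1⟩
      inv_mem' := fun {a} ha => ⟨ha.2, by rw [inv_inv]; exact ha.1⟩ }
  exact (mem_of_generators K (fun A => ⟨hl A, by rw [hl']; exact hl _⟩)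
    (fun B hB => ⟨ht B hB, by rw [ht']; exact ht _ _⟩)
    ⟨hJ, by rw [hJ']; exact hmul _ _ hJ (hmul _ _ hJ hJ)⟩ M).1

end KM2

namespace KM2

/-! ### The theta integrand with characteristics under `Sp_4(ℤ)` -/

/-- The numerator `A τ + B` of the action. -/
noncomputable def actNum (M : Sp4) (τ : Matrix (Fin 2) (Fin 2) ℂ) : Matrix (Fin 2) (Fin 2) ℂ :=
  toC M.val.toBlocks₁₁ * τ + toC M.val.toBlocks₁₂

/-- The denominator `C τ + D` of the action. -/
noncomputable def actDen (M : Sp4) (τ : Matrix (Fin 2) (Fin 2) ℂ) : Matrix (Fin 2) (Fin 2) ℂ :=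
  toC M.val.toBlocks₂₁ * τ + toC M.val.toBlocks₂₂

theorem act_eq (M : Sp4) (τ : Matrix (Fin 2) (Fin 2) ℂ) : act M τ = actNum M τ * (actDen M τ)⁻¹ :=
  rfl

theorem toC_mul (A B : Matrix (Fin 2) (Fin 2) ℤ) : toC (A * B) = toC A * toC B := by
  ext i j
  simp [Matrix.mul_apply]

theorem toC_add (A B : Matrix (Fin 2) (Fin 2) ℤ) : toC (A + B) = toC A + toC B := by
  ext i j
  simp

theorem toBlocks_mul (M N : Sp4) :
    (M * N).val.toBlocks₁₁ = M.val.toBlocks₁₁ * N.val.toBlocks₁₁ + M.val.toBlocks₁₂ * N.val.toBlocks₂₁ ∧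
    (M * N).val.toBlocks₁₂ = M.val.toBlocks₁₁ * N.val.toBlocks₁₂ + M.val.toBlocks₁₂ * N.val.toBlocks₂₂ ∧
    (M * N).val.toBlocks₂₁ = M.val.toBlocks₂₁ * N.val.toBlocks₁₁ + M.val.toBlocks₂₂ * N.val.toBlocks₂₁ ∧
    (M * N).val.toBlocks₂₂ =
      M.val.toBlocks₂₁ * N.val.toBlocks₁₂ + M.val.toBlocks₂₂ * N.val.toBlocks₂₂ := by
  have h : (M * N).val = Matrix.fromBlocks M.val.toBlocks₁₁ M.val.toBlocks₁₂ M.val.toBlocks₂₁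
      M.val.toBlocks₂₂ * Matrix.fromBlocks N.val.toBlocks₁₁ N.val.toBlocks₁₂ N.val.toBlocks₂₁
      N.val.toBlocks₂₂ := by
    rw [Matrix.fromBlocks_toBlocks, Matrix.fromBlocks_toBlocks]
    rfl
  rw [h, Matrix.fromBlocks_multiply]
  simp

theorem actNum_mul (M N : Sp4) (τ : Matrix (Fin 2) (Fin 2) ℂ) : actNum (M * N) τ =
    toC M.val.toBlocks₁₁ * actNum N τ + toC M.val.toBlocks₁₂ * actDen N τ := by
  obtain ⟨h1, h2, -, -⟩ := toBlocks_mul M N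
  simp only [actNum, actDen, h1, h2, toC_mul, toC_add, Matrix.mul_add, Matrix.add_mul,
    Matrix.mul_assoc]
  abel

theorem actDen_mul (M N : Sp4) (τ : Matrix (Fin 2) (Fin 2) ℂ) : actDen (M * N) τ =
    toC M.val.toBlocks₂₁ * actNum N τ + toC M.val.toBlocks₂₂ * actDen N τ := by
  obtain ⟨-, -, h1, h2⟩ := toBlocks_mul M N
  simp only [actNum, actDen, h1, h2, toC_mul, toC_add, Matrix.mul_add, Matrix.add_mul,
    Matrix.mul_assoc]
  abel

theorem actNum_mul_act (M N : Sp4) {τ : Matrix (Fin 2) (Fin 2) ℂ} (h : (actDen N τ).det ≠ 0) :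
    actNum (M * N) τ = actNum M (act N τ) * actDen N τ := by
  rw [actNum_mul, actNum.eq_1 M, act_eq, Matrix.add_mul, Matrix.mul_assoc, Matrix.mul_assoc,
    Matrix.nonsing_inv_mul _ h.isUnit, Matrix.mul_one]

theorem actDen_mul_act (M N : Sp4) {τ : Matrix (Fin 2) (Fin 2) ℂ} (h : (actDen N τ).det ≠ 0) :
    actDen (M * N) τ = actDen M (act N τ) * actDen N τ := by
  rw [actDen_mul, actDen.eq_1 M, act_eq, Matrix.add_mul, Matrix.mul_assoc, Matrix.mul_assoc,
    Matrix.nonsing_inv_mul _ h.isUnit, Matrix.mul_one]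

theorem act_mul_of_det_ne_zero (M N : Sp4) {τ : Matrix (Fin 2) (Fin 2) ℂ}
    (h : (actDen N τ).det ≠ 0) : act (M * N) τ = act M (act N τ) := by
  rw [act_eq, act_eq M, actNum_mul_act M N h, actDen_mul_act M N h, Matrix.mul_inv_rev,
    Matrix.mul_assoc, ← Matrix.mul_assoc (actDen N τ), Matrix.mul_nonsing_inv _ h.isUnit,
    Matrix.one_mul]

/-- The three claims are proved together, since composing actions needs an invertible denominator
and an intermediate point in the half-space. The last claim is the modularity of the integrand with
characteristics, with `Sp_4(ℤ)` acting on `w` from the right. -/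
theorem act_mem_Siegel_and_psi_act {b : ℕ} {L : Submodule ℤ (V b)}
    {f : Matrix (Fin 2) (Fin 2) ℂ → GroupAlg L} {P : MvPolynomial (Fin b × Fin 2) ℂ}
    {g : V b ≃ₗ[ℝ] V b} {u : V b}
    (hL : IsEvenLattice L) (hf : IsSiegelCuspForm L f) (hP : IsDetSq P)
    (hg : ∀ x y, form b (g x) (g y) = form b x y) (h0 : form b u u = 0) (M : Sp4)
    {τ : Matrix (Fin 2) (Fin 2) ℂ} (hτ : τ ∈ Siegel) :
    (actDen M τ).det ≠ 0 ∧ act M τ ∈ Siegel ∧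
      ∀ w, psi f P g u (act M τ) w = psi f P g u τ (rowMul w M.val) := by
  have t0 : toC 0 = 0 := by ext i j; simp
  have t1 : toC 1 = 1 := by ext i j; fin_cases i <;> fin_cases j <;> simp
  induction M using Sp4_induction generalizing τ with
  | hl A =>
    have h := fun w => psi_levi (P := P) (g := g) (u := u) hL hf hP (M := leviSp A) rfl hτ w
    refine ⟨?_, (h 0).1, fun w => (h w).2⟩
    have hd : (A⁻¹).val.det ≠ 0 := by rcases gl_det A⁻¹ with h | h <;> rw [h] <;> norm_num
    have : toC (A⁻¹).valᵀ = ((Int.castRingHom ℂ).mapMatrix (A⁻¹).val)ᵀ := by ext i j; simp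
    simp only [actDen, leviSp, Matrix.toBlocks_fromBlocks₂₁, Matrix.toBlocks_fromBlocks₂₂, t0,
      Matrix.zero_mul, zero_add]
    rw [this, Matrix.det_transpose, ← RingHom.map_det]
    rw [eq_intCast]
    exact_mod_cast hd
  | ht B hB =>
    have h := fun w => psi_transl (P := P) (g := g) (u := u) hL hf hg h0 (M := translSp B hB) rfl hτ w
    refine ⟨?_, (h 0).1, fun w => (h w).2⟩
    simp [actDen, translSp, t0, t1]
  | hJ =>
    have hJ : (SymplecticGroup.symJ (Fin 2) ℤ).val = Matrix.fromBlocks 0 (-1) 1 0 := rfl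
    refine ⟨?_, ?_, fun w => ?_⟩
    · rw [actDen, hJ, Matrix.toBlocks_fromBlocks₂₁, Matrix.toBlocks_fromBlocks₂₂, t0, t1,
        Matrix.one_mul, add_zero]
      exact siegel_det_ne_zero hτ
    · rw [act_symJ]
      exact neg_inv_mem_Siegel hτ
    · rw [act_symJ]
      exact psi_inversion hL hf hP hg h0 hτ w
  | hmul M N hM hN =>
    obtain ⟨n1, n2, n3⟩ := hN hτ
    obtain ⟨m1, m2, m3⟩ := hM n2
    rw [actDen_mul_act M N n1, act_mul_of_det_ne_zero M N n1, Matrix.det_mul]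
    refine ⟨mul_ne_zero m1 n1, m2, fun w => ?_⟩
    rw [m3, n3, rowMul_rowMul]
    rfl

end KM2

namespace KM2

/-! ### Fourier expansion of the theta function in the characteristic -/

section Fourier

variable {b : ℕ} {L : Submodule ℤ (V b)} {u u' : V b}

theorem cut_of_form_eq_zero {a : V b} (h0 : dotn a a = dotp a a) {y : V b} (hy : form b y a = 0) :
    cut a y = y - (dotp y a / dotp a a) • a := by
  have h1 : dotn y a = dotp y a := by rw [form_eq] at hy; linarith
  funext i
  rcases i with i | i
  · rw [cut_inl]; rfl
  · rw [cut_inr, h1, h0]; rfl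

/-- For `x` orthogonal to `u` and `u'`, the vector `x + n u'` is a linear function of `n` and its
projection to the complement of the two parts of `u`. Hence decay in these data is decay in the
lattice vector. -/
theorem exists_sum_sq_le_cut (hU : IsHyperbolicPair L u u') {g : V b ≃ₗ[ℝ] V b}
    (hg : ∀ x y, form b (g x) (g y) = form b x y) (h0 : dotn (g u) (g u) = dotp (g u) (g u)) :
    ∃ K : ℝ, 0 < K ∧ ∀ x : V b, form b x u = 0 ∧ form b x u' = 0 → ∀ n : ℝ,
      ∑ i, g (x + n • u') i ^ 2 ≤ K * (∑ i, cut (g u) (g (x + n • u')) i ^ 2 + n ^ 2) := by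
  -- The reconstruction. `D` removes the contribution of `n u'` from the projection and returns `g x
  -- - s g u` for some `s`. Pairing with `g u'` gives `-s`, which `S` uses to restore `g x`.
  let D : (Idx b ⊕ Unit → ℝ) →ₗ[ℝ] V b := LinearMap.funLeft ℝ ℝ Sum.inl -
    (LinearMap.proj (Sum.inr ())).smulRight (cut (g u) (g u'))
  let S : (Idx b ⊕ Unit → ℝ) →ₗ[ℝ] Idx b → ℝ := D -
    (((form b).flip (g u')).comp D).smulRight (g u) + (LinearMap.proj (Sum.inr ())).smulRight (g u')
  obtain ⟨K, hK, h⟩ := exists_sum_sq_le S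
  refine ⟨K, hK, fun x hx n => ?_⟩
  set y := g x with hy
  have hyu : form b y (g u) = 0 := by rw [hy, hg, hx.1]
  have hyu' : form b y (g u') = 0 := by rw [hy, hg, hx.2]
  set s := dotp y (g u) / dotp (g u) (g u) with hs
  have hc : cut (g u) y = y - s • g u := cut_of_form_eq_zero h0 hyu
  have hX : g (x + n • u') = y + n • g u' := by rw [map_add, map_smul]
  set q : Idx b ⊕ Unit → ℝ := Sum.elim (cut (g u) (g (x + n • u'))) fun _ => n with hq
  have hD : D q = y - s • g u := by
    change cut (g u) (g (x + n • u')) - n • cut (g u) (g u') = _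
    rw [hX, map_add, map_smul, hc]
    abel
  have hS : S q = g (x + n • u') := by
    change D q - form b (D q) (g u') • g u + n • g u' = _
    have : form b (g u) (g u') = 1 := by rw [hg, hU.pair]
    rw [hD, hX, map_sub, map_smul, LinearMap.sub_apply, LinearMap.smul_apply, hyu', this]
    module
  have h1 := h q
  rw [hS, Fintype.sum_sum_type] at h1
  simpa [hq] using h1

/-- The pair of vectors `m + n u'` in coordinates. -/
def splitPt (g : V b ≃ₗ[ℝ] V b) (u' : V b) (m : Fin 2 → V b) (n : Fin 2 → ℤ) :
    Idx b × Fin 2 → ℝ := gflat g fun j => m j + (n j : ℝ) • u'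

theorem gflat_splitVec (g : V b ≃ₗ[ℝ] V b) (m : Fin 2 → V b) (n t : Fin 2 → ℤ) :
    gflat g (splitVec u u' m n t) = splitPt g u' m n + line (g u) (rvec t) := by
  funext p
  simp [gflat, flat, splitPt, splitVec, line, rvec]
  ring

theorem hgt_splitPt (hU : IsHyperbolicPair L u u') {g : V b ≃ₗ[ℝ] V b}
    (hg : ∀ x y, form b (g x) (g y) = form b x y) {m : Fin 2 → V b}
    (hm : ∀ j, form b (m j) u = 0) (n : Fin 2 → ℤ) : hgt (g u) (splitPt g u' m n) = rvec n := by
  funext j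
  change form b (g (m j + (n j : ℝ) • u')) (g u) = n j
  rw [hg]
  simp [hm, hU.pair']

theorem exists_sum_splitPt_sq_le (hU : IsHyperbolicPair L u u') {g : V b ≃ₗ[ℝ] V b}
    (hg : ∀ x y, form b (g x) (g y) = form b x y) (h0 : dotn (g u) (g u) = dotp (g u) (g u)) :
    ∃ K : ℝ, 0 < K ∧ ∀ m : Fin 2 → V b, (∀ j, form b (m j) u = 0 ∧ form b (m j) u' = 0) →
      ∀ n : Fin 2 → ℤ, ∑ q, splitPt g u' m n q ^ 2 ≤
        K * (∑ q, cutF (g u) (splitPt g u' m n) q ^ 2 + ∑ j, (n j : ℝ) ^ 2) := by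
  obtain ⟨K, hK, h⟩ := exists_sum_sq_le_cut hU hg h0
  refine ⟨K, hK, fun m hm n => ?_⟩
  have h1 : ∀ i j, splitPt g u' m n (i, j) = g (m j + (n j : ℝ) • u') i := fun _ _ => rfl
  have h2 : ∀ i j, cutF (g u) (splitPt g u' m n) (i, j) = cut (g u) (g (m j + (n j : ℝ) • u')) i :=
    fun _ _ => rfl
  simp only [Fintype.sum_prod_type_right, h1, h2, ← Finset.sum_add_distrib]
  rw [Finset.mul_sum]
  exact Finset.sum_le_sum fun j _ => h (m j) (hm j) (n j)

theorem summable_exp_splitPt (hL : IsEvenLattice L) (hU : IsHyperbolicPair L u u')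
    {g : V b ≃ₗ[ℝ] V b} (hg : ∀ x y, form b (g x) (g y) = form b x y)
    (h0 : dotn (g u) (g u) = dotp (g u) (g u)) {ε : ℝ} (hε : 0 < ε) (γ : Fin 2 → Disc L) :
    Summable fun p : (Coset (lorentz L u u') fun j => discProj hL hU (γ j)) × (Fin 2 → ℤ) =>
      Real.exp (-ε * (∑ q, cutF (g u) (splitPt g u' (fun j => (p.1.val j : V b)) p.2) q ^ 2 +
        ∑ j, (p.2 j : ℝ) ^ 2)) := by
  obtain ⟨K, hK, h⟩ := exists_sum_splitPt_sq_le hU hg h0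
  set F : (Idx b × Fin 2 → ℝ) → ℂ := fun x => ((Real.exp (-(ε / K) * ∑ q, x q ^ 2) : ℝ) : ℂ) with hF
  have hd : GaussDecay F := ⟨1, ε / K, by positivity, fun x => by
    rw [hF, Complex.norm_real, Real.norm_of_nonneg (Real.exp_pos _).le, one_mul]⟩
  have h1 := (hd.summable_coset hL g γ).norm
  have hinj : Function.Injective fun p : (Coset (lorentz L u u') fun j => discProj hL hU (γ j)) ×
      (Fin 2 → ℤ) => splitMap hL hU γ (p.1, p.2, 0) := by
    intro p q hpq
    have := (splitMap_bijective hL hU γ).1 hpq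
    simp only [Prod.mk.injEq] at this
    exact Prod.ext this.1 this.2.1
  refine Summable.of_nonneg_of_le (fun _ => (Real.exp_pos _).le) (fun p => ?_)
    (h1.comp_injective hinj)
  have h2 : (gflat g fun j => ((splitMap hL hU γ (p.1, p.2, 0)).val j : V b)) =
      splitPt g u' (fun j => (p.1.val j : V b)) p.2 := by
    have := gflat_splitVec (u := u) (u' := u') g (fun j => (p.1.val j : V b)) p.2 0
    rw [show line (g u) (rvec (0 : Fin 2 → ℤ)) = 0 by funext q; simp [line, rvec], add_zero] at this
    exact this
  simp only [Function.comp_apply, h2, hF]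
  rw [Complex.norm_real, Real.norm_of_nonneg (Real.exp_pos _).le, Real.exp_le_exp]
  have h3 := h (fun j => (p.1.val j : V b)) (fun j => form_dual_lorentz (p.1.val j).2) p.2
  rw [neg_mul, neg_mul, neg_le_neg_iff, div_mul_eq_mul_div, div_le_iff₀ hK, mul_assoc,
    mul_comm _ K]
  exact mul_le_mul_of_nonneg_left h3 hε.le

theorem summable_lineFT (hL : IsEvenLattice L) (hU : IsHyperbolicPair L u u')
    (P : MvPolynomial (Fin b × Fin 2) ℂ) {g : V b ≃ₗ[ℝ] V b}
    (hg : ∀ x y, form b (g x) (g y) = form b x y) (h0 : dotn (g u) (g u) = dotp (g u) (g u))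
    (hN : 0 < dotp (g u) (g u)) {τ : Matrix (Fin 2) (Fin 2) ℂ} (hτ : τ ∈ Siegel)
    (γ : Fin 2 → Disc L) :
    Summable fun p : ((Coset (lorentz L u u') fun j => discProj hL hU (γ j)) × (Fin 2 → ℤ)) ×
      (Fin 2 → ℤ) => lineFT P τ (g u) (splitPt g u' (fun j => (p.1.1.val j : V b)) p.1.2)
        (rvec p.2) := by
  obtain ⟨C, ε, hC, hε, h⟩ := exists_norm_lineFT_le P hN hτ
  have h1 := (summable_exp_splitPt hL hU hg h0 hε γ).mul_of_nonneg
    (summable_exp_neg_sq_int (κ := Fin 2) hε) (fun _ => (Real.exp_pos _).le)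
    (fun _ => (Real.exp_pos _).le)
  refine Summable.of_norm_bounded (h1.mul_left C) fun p => (h _ _).trans ?_
  rw [hgt_splitPt hU hg fun j => (form_dual_lorentz (p.1.1.val j).2).1, ← Real.exp_add, ← mul_add]
  rfl

/-- The Fourier coefficients of the theta function in its characteristic. -/
noncomputable def charCoeff (hL : IsEvenLattice L) (hU : IsHyperbolicPair L u u')
    (P : MvPolynomial (Fin b × Fin 2) ℂ) (g : V b ≃ₗ[ℝ] V b) (τ : Matrix (Fin 2) (Fin 2) ℂ)
    (v : Fin 2 ⊕ Fin 2 → ℤ) : GroupAlg L := fun γ =>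
  ∑' m : Coset (lorentz L u u') fun j => discProj hL hU (γ j),
    lineFT P τ (g u) (splitPt g u' (fun j => (m.val j : V b)) (v ∘ Sum.inr)) (rvec (v ∘ Sum.inl))

/-- Poisson summation in the coefficient `t` of `u` only. The height above `u` is the constant `n`,
so `w₂` contributes the fixed phase `e(n · w₂)`. -/
theorem hasSum_lineFT (hU : IsHyperbolicPair L u u')
    (P : MvPolynomial (Fin b × Fin 2) ℂ) {g : V b ≃ₗ[ℝ] V b}
    (hg : ∀ x y, form b (g x) (g y) = form b x y) (h0 : dotn (g u) (g u) = dotp (g u) (g u))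
    (hN : 0 < dotp (g u) (g u)) {τ : Matrix (Fin 2) (Fin 2) ℂ} (hτ : τ ∈ Siegel)
    {m : Fin 2 → V b} (hm : ∀ j, form b (m j) u = 0) (n : Fin 2 → ℤ)
    (hs : Summable fun c : Fin 2 → ℤ => lineFT P τ (g u) (splitPt g u' m n) (rvec c))
    (w : Fin 2 ⊕ Fin 2 → ℝ) :
    HasSum (fun c : Fin 2 → ℤ => lineFT P τ (g u) (splitPt g u' m n) (rvec c) *
        e ((rvec (Sum.elim c n) ⬝ᵥ w : ℝ)))
      (∑' t : Fin 2 → ℤ, charFn P (g u) τ w (gflat g (splitVec u u' m n t))) := by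
  have hu0 : form b (g u) (g u) = 0 := by rw [hg, hU.sq]
  have hft : ∀ c, ft (fun t => phi P τ (splitPt g u' m n + line (g u) t)) c =
      lineFT P τ (g u) (splitPt g u' m n) c :=
    fun c => integral_phi_line P hN h0 hτ (splitPt g u' m n) c
  have h1 := hasSum_poisson (gaussDecay_phi_line P hN h0 hτ (splitPt g u' m n))
    (continuous_phi_line P (g u) τ (splitPt g u' m n)) (by simpa only [hft] using hs) (w ∘ Sum.inl)
  simp only [hft] at h1
  have h2 := h1.mul_right (e ((rvec n ⬝ᵥ (w ∘ Sum.inr) : ℝ)))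
  rw [← tsum_mul_right] at h2
  have h3 : ∀ c, e ((rvec (Sum.elim c n) ⬝ᵥ w : ℝ)) =
      e ((rvec c ⬝ᵥ (w ∘ Sum.inl) : ℝ)) * e ((rvec n ⬝ᵥ (w ∘ Sum.inr) : ℝ)) := by
    intro c
    rw [← e_add, ← Complex.ofReal_add]
    congr 2
    simp [dotProduct, Fintype.sum_sum_type, rvec]
  have h4 : ∀ t, charFn P (g u) τ w (gflat g (splitVec u u' m n t)) =
      phi P τ (splitPt g u' m n + line (g u) (w ∘ Sum.inl + rvec t)) *
        e ((rvec n ⬝ᵥ (w ∘ Sum.inr) : ℝ)) := by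
    intro t
    rw [gflat_splitVec, charFn, hgt_add, hgt_line hu0, add_zero, hgt_splitPt hU hg hm,
      dotProduct_comm _ (rvec n)]
    congr 2
    funext p
    simp [line]
    ring
  simpa only [h3, h4, mul_assoc] using h2

/-- The triple sum over `m`, `n` and the frequency `c` converges absolutely, so it may be grouped by
`v = (c, n)` with inner sum over `m`. -/
theorem hasSum_charCoeff (hL : IsEvenLattice L) (hU : IsHyperbolicPair L u u')
    (P : MvPolynomial (Fin b × Fin 2) ℂ) {g : V b ≃ₗ[ℝ] V b}
    (hg : ∀ x y, form b (g x) (g y) = form b x y) (h0 : dotn (g u) (g u) = dotp (g u) (g u))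
    (hN : 0 < dotp (g u) (g u)) {τ : Matrix (Fin 2) (Fin 2) ℂ} (hτ : τ ∈ Siegel)
    (γ : Fin 2 → Disc L) : (Summable fun v => charCoeff hL hU P g τ v γ) ∧
    ∀ w, HasSum (fun v => charCoeff hL hU P g τ v γ * e ((rvec v ⬝ᵥ w : ℝ)))
      (thetaChar L P g u τ w γ) := by
  set A := Coset (lorentz L u u') fun j => discProj hL hU (γ j) with hA
  set X : A → (Fin 2 → ℤ) → Idx b × Fin 2 → ℝ := fun m n =>
    splitPt g u' (fun j => (m.val j : V b)) n with hX
  have hs := summable_lineFT hL hU P hg h0 hN hτ γ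
  let E : (A × (Fin 2 → ℤ)) × (Fin 2 → ℤ) ≃ (Fin 2 ⊕ Fin 2 → ℤ) × A :=
    { toFun := fun p => (Sum.elim p.2 p.1.2, p.1.1)
      invFun := fun q => ((q.2, q.1 ∘ Sum.inr), q.1 ∘ Sum.inl)
      left_inv := fun p => by simp
      right_inv := fun q => by simp }
  have hs' : Summable fun q : (Fin 2 ⊕ Fin 2 → ℤ) × A =>
      lineFT P τ (g u) (X q.2 (q.1 ∘ Sum.inr)) (rvec (q.1 ∘ Sum.inl)) := by
    rw [← E.summable_iff]
    exact hs
  refine ⟨hs'.prod, fun w => ?_⟩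
  have hsw : Summable fun p : (A × (Fin 2 → ℤ)) × (Fin 2 → ℤ) =>
      lineFT P τ (g u) (X p.1.1 p.1.2) (rvec p.2) * e ((rvec (E p).1 ⬝ᵥ w : ℝ)) := by
    refine Summable.of_norm_bounded hs.norm fun p => ?_
    rw [norm_mul, norm_e_real, mul_one]
  have hsw' : Summable fun q : (Fin 2 ⊕ Fin 2 → ℤ) × A =>
      lineFT P τ (g u) (X q.2 (q.1 ∘ Sum.inr)) (rvec (q.1 ∘ Sum.inl)) *
        e ((rvec q.1 ⬝ᵥ w : ℝ)) := by
    refine Summable.of_norm_bounded hs'.norm fun p => ?_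
    rw [norm_mul, norm_e_real, mul_one]
  have hsum : ∑' p : (A × (Fin 2 → ℤ)) × (Fin 2 → ℤ),
      lineFT P τ (g u) (X p.1.1 p.1.2) (rvec p.2) * e ((rvec (E p).1 ⬝ᵥ w : ℝ)) =
        thetaChar L P g u τ w γ := by
    have h4 : Summable fun p : A × (Fin 2 → ℤ) × (Fin 2 → ℤ) => charFn P (g u) τ w
        (gflat g fun j => ((splitMap hL hU γ p).val j : V b)) :=
      ((gaussDecay_charFn P (g u) hτ w).summable_coset hL g γ).comp_injective
        (splitMap_bijective hL hU γ).1
    have h5 : Summable fun p : (A × (Fin 2 → ℤ)) × (Fin 2 → ℤ) => charFn P (g u) τ w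
        (gflat g fun j => ((splitMap hL hU γ (p.1.1, p.1.2, p.2)).val j : V b)) :=
      (Equiv.prodAssoc _ _ _).summable_iff.2 h4
    rw [hsw.tsum_prod, thetaChar, ← (Equiv.ofBijective _ (splitMap_bijective hL hU γ)).tsum_eq,
      ← (Equiv.prodAssoc _ _ _).tsum_eq]
    refine Eq.trans ?_ h5.tsum_prod.symm
    exact tsum_congr fun p => (hasSum_lineFT hU P hg h0 hN hτ
      (fun j => (form_dual_lorentz (p.1.val j).2).1) p.2 (hs.prod_factor p) w).tsum_eq
  have h6 : ∑' q : (Fin 2 ⊕ Fin 2 → ℤ) × A,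
      lineFT P τ (g u) (X q.2 (q.1 ∘ Sum.inr)) (rvec (q.1 ∘ Sum.inl)) *
        e ((rvec q.1 ⬝ᵥ w : ℝ)) = thetaChar L P g u τ w γ := by
    rw [← hsum, ← E.tsum_eq]
    rfl
  have h7 := (h6 ▸ hsw'.hasSum).prod_fiberwise fun v => (hsw'.prod_factor v).hasSum
  simp only [tsum_mul_right] at h7
  exact h7

end Fourier

end KM2

namespace KM2

/-! ### Fourier coefficients of the integrand in the characteristic -/

section Coefficients

variable {b : ℕ} {L : Submodule ℤ (V b)} {u u' : V b}

/-- The Fourier coefficients of the theta integrand in the characteristic. -/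
noncomputable def psiCoeff (hL : IsEvenLattice L) (hU : IsHyperbolicPair L u u')
    (f : Matrix (Fin 2) (Fin 2) ℂ → GroupAlg L) (P : MvPolynomial (Fin b × Fin 2) ℂ)
    (g : V b ≃ₗ[ℝ] V b) (τ : Matrix (Fin 2) (Fin 2) ℂ) (v : Fin 2 ⊕ Fin 2 → ℤ) : ℂ :=
  detPow b τ * pairing (f τ) fun γ =>
    (((τ.map Complex.im).det : ℝ) : ℂ) * charCoeff hL hU P g τ v γ

/-- The pairing is conjugate linear in the theta function, hence the sign in the exponent. -/
theorem hasSum_psiCoeff (hL : IsEvenLattice L) (hU : IsHyperbolicPair L u u')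
    (f : Matrix (Fin 2) (Fin 2) ℂ → GroupAlg L) (P : MvPolynomial (Fin b × Fin 2) ℂ)
    {g : V b ≃ₗ[ℝ] V b} (hg : ∀ x y, form b (g x) (g y) = form b x y)
    (h0 : dotn (g u) (g u) = dotp (g u) (g u)) (hN : 0 < dotp (g u) (g u))
    {τ : Matrix (Fin 2) (Fin 2) ℂ} (hτ : τ ∈ Siegel) :
    Summable (psiCoeff hL hU f P g τ) ∧ ∀ w, HasSum (fun v => psiCoeff hL hU f P g τ v *
      e (-((rvec v ⬝ᵥ w : ℝ) : ℂ))) (psi f P g u τ w) := by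
  have := finite_disc hL
  have := Fintype.ofFinite (Fin 2 → Disc L)
  have h := fun γ => hasSum_charCoeff hL hU P hg h0 hN hτ γ
  refine ⟨?_, fun w => ?_⟩
  · have h1 : psiCoeff hL hU f P g τ = fun v => (detPow b τ : ℂ) * ∑ γ, f τ γ *
        (starRingEnd ℂ) ((((τ.map Complex.im).det : ℝ) : ℂ) * charCoeff hL hU P g τ v γ) := by
      funext v
      rw [psiCoeff, pairing, finsum_eq_sum_of_fintype]
    rw [h1]
    refine Summable.mul_left _ (summable_sum fun γ _ => Summable.mul_left _ ?_)
    exact (((h γ).1.mul_left _).map (starRingEnd ℂ) Complex.continuous_conj :)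
  · simp only [psiCoeff, psi, pairing, finsum_eq_sum_of_fintype, mul_assoc, Finset.sum_mul]
    refine HasSum.mul_left _ (hasSum_sum fun γ _ => HasSum.mul_left _ ?_)
    have h1 := ((((h γ).2 w).mul_left (((τ.map Complex.im).det : ℝ) : ℂ)).map (starRingEnd ℂ)
      Complex.continuous_conj :)
    have h2 : (fun v => (starRingEnd ℂ) ((((τ.map Complex.im).det : ℝ) : ℂ) *
        charCoeff hL hU P g τ v γ) * e (-((rvec v ⬝ᵥ w : ℝ) : ℂ))) =
        starRingEnd ℂ ∘ fun v => (((τ.map Complex.im).det : ℝ) : ℂ) *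
          (charCoeff hL hU P g τ v γ * e ((rvec v ⬝ᵥ w : ℝ))) := by
      funext v
      rw [Function.comp_apply, ← mul_assoc, map_mul _ _ (e _), conj_e, Complex.conj_ofReal]
    rw [h2]
    exact h1

/-! ### Equivariance of the Fourier coefficients under `Sp_4(ℤ)` -/

theorem rvec_mulVec (M : Matrix (Fin 2 ⊕ Fin 2) (Fin 2 ⊕ Fin 2) ℤ) (v : Fin 2 ⊕ Fin 2 → ℤ)
    (w : Fin 2 ⊕ Fin 2 → ℝ) : rvec (M *ᵥ v) ⬝ᵥ w = rvec v ⬝ᵥ rowMul w M := by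
  have : rvec (M *ᵥ v) = M.map (fun n => (n : ℝ)) *ᵥ rvec v := by
    funext i
    simp [rvec, Matrix.mulVec, dotProduct]
  rw [this, dotProduct_comm, Matrix.dotProduct_mulVec, dotProduct_comm, rowMul]

/-- The action of a symplectic matrix on integral column vectors. -/
def mulVecEquiv (M : Sp4) : (Fin 2 ⊕ Fin 2 → ℤ) ≃ (Fin 2 ⊕ Fin 2 → ℤ) where
  toFun v := M.val *ᵥ v
  invFun v := (M⁻¹ : Sp4).val *ᵥ v
  left_inv v := by
    have : (M⁻¹ : Sp4).val * M.val = 1 := congrArg Subtype.val (inv_mul_cancel M)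
    change (M⁻¹ : Sp4).val *ᵥ (M.val *ᵥ v) = v
    rw [Matrix.mulVec_mulVec, this, Matrix.one_mulVec]
  right_inv v := by
    have : M.val * (M⁻¹ : Sp4).val = 1 := congrArg Subtype.val (mul_inv_cancel M)
    change M.val *ᵥ ((M⁻¹ : Sp4).val *ᵥ v) = v
    rw [Matrix.mulVec_mulVec, this, Matrix.one_mulVec]

/-- Comparison of the Fourier series on the two sides of `Ψ(Mτ, w) = Ψ(τ, wM)`. -/
theorem psiCoeff_act (hL : IsEvenLattice L) (hU : IsHyperbolicPair L u u')
    {f : Matrix (Fin 2) (Fin 2) ℂ → GroupAlg L} (hf : IsSiegelCuspForm L f)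
    {P : MvPolynomial (Fin b × Fin 2) ℂ} (hP : IsDetSq P)
    {g : V b ≃ₗ[ℝ] V b} (hg : ∀ x y, form b (g x) (g y) = form b x y)
    (h0 : dotn (g u) (g u) = dotp (g u) (g u)) (hN : 0 < dotp (g u) (g u))
    {τ : Matrix (Fin 2) (Fin 2) ℂ} (hτ : τ ∈ Siegel) (M : Sp4) (v : Fin 2 ⊕ Fin 2 → ℤ) :
    psiCoeff hL hU f P g (act M τ) (M.val *ᵥ v) = psiCoeff hL hU f P g τ v := by
  obtain ⟨-, hM, hpsi⟩ := act_mem_Siegel_and_psi_act (P := P) (g := g) hL hf hP hg hU.sq M hτ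
  obtain ⟨s1, h1⟩ := hasSum_psiCoeff hL hU f P hg h0 hN hM
  obtain ⟨s2, h2⟩ := hasSum_psiCoeff hL hU f P hg h0 hN hτ
  rw [← sub_eq_zero]
  refine fourier_series_unique (c := fun v => psiCoeff hL hU f P g (act M τ) (mulVecEquiv M v) -
    psiCoeff hL hU f P g τ v) (((mulVecEquiv M).summable_iff.2 s1).sub s2) (fun x => ?_) v
  -- Chosen so that `wM = -x`, which makes both series into series in `e(v · x)`.
  set w := rowMul (-x) (M⁻¹ : Sp4).val with hw
  have hwx : rowMul w M.val = -x := by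
    have h3 : (M⁻¹ : Sp4).val * M.val = 1 := congrArg Subtype.val (inv_mul_cancel M)
    rw [hw, rowMul_rowMul, h3, rowMul]
    have : (1 : Matrix (Fin 2 ⊕ Fin 2) (Fin 2 ⊕ Fin 2) ℤ).map (fun n => (n : ℝ)) = 1 := by
      ext i j
      simp [Matrix.one_apply, apply_ite]
    rw [this, Matrix.vecMul_one]
  have h3 := ((mulVecEquiv M).hasSum_iff.2 (h1 w)).sub (h2 (rowMul w M.val))
  rw [hpsi, sub_self] at h3
  rw [← h3.tsum_eq]
  refine tsum_congr fun v => ?_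
  have h4 : rvec (mulVecEquiv M v) ⬝ᵥ w = rvec v ⬝ᵥ rowMul w M.val := rvec_mulVec _ _ _
  rw [Function.comp_apply, h4, hwx, ← sub_mul, dotProduct_neg, Complex.ofReal_neg, neg_neg]

/-- The Fourier coefficients of the theta integrand, indexed by row vectors. -/
noncomputable def rowCoeff (hL : IsEvenLattice L) (hU : IsHyperbolicPair L u u')
    (f : Matrix (Fin 2) (Fin 2) ℂ → GroupAlg L) (P : MvPolynomial (Fin b × Fin 2) ℂ)
    (g : V b ≃ₗ[ℝ] V b) (τ : Matrix (Fin 2) (Fin 2) ℂ) (r : Fin 2 ⊕ Fin 2 → ℤ) : ℂ :=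
  psiCoeff hL hU f P g τ (Matrix.J (Fin 2) ℤ *ᵥ r)

/-- The relation `M J Mᵗ = J` turns the left action on columns into the right action on rows. -/
theorem rowCoeff_act (hL : IsEvenLattice L) (hU : IsHyperbolicPair L u u')
    {f : Matrix (Fin 2) (Fin 2) ℂ → GroupAlg L} (hf : IsSiegelCuspForm L f)
    {P : MvPolynomial (Fin b × Fin 2) ℂ} (hP : IsDetSq P)
    {g : V b ≃ₗ[ℝ] V b} (hg : ∀ x y, form b (g x) (g y) = form b x y)
    (h0 : dotn (g u) (g u) = dotp (g u) (g u)) (hN : 0 < dotp (g u) (g u))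
    {τ : Matrix (Fin 2) (Fin 2) ℂ} (hτ : τ ∈ Siegel) (M : Sp4) (r : Fin 2 ⊕ Fin 2 → ℤ) :
    rowCoeff hL hU f P g (act M τ) r = rowCoeff hL hU f P g τ (r ᵥ* M.val) := by
  have h : M.val *ᵥ (Matrix.J (Fin 2) ℤ *ᵥ (r ᵥ* M.val)) = Matrix.J (Fin 2) ℤ *ᵥ r := by
    rw [← Matrix.mulVec_transpose, Matrix.mulVec_mulVec, Matrix.mulVec_mulVec,
      SymplecticGroup.mem_iff.1 M.2]
  rw [rowCoeff, ← h, psiCoeff_act hL hU hf hP hg h0 hN hτ]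
  rfl

theorem hasSum_rowCoeff (hL : IsEvenLattice L) (hU : IsHyperbolicPair L u u')
    (f : Matrix (Fin 2) (Fin 2) ℂ → GroupAlg L) (P : MvPolynomial (Fin b × Fin 2) ℂ)
    {g : V b ≃ₗ[ℝ] V b} (hg : ∀ x y, form b (g x) (g y) = form b x y)
    (h0 : dotn (g u) (g u) = dotp (g u) (g u)) (hN : 0 < dotp (g u) (g u))
    {τ : Matrix (Fin 2) (Fin 2) ℂ} (hτ : τ ∈ Siegel) :
    HasSum (rowCoeff hL hU f P g τ) (psi f P g u τ 0) := by
  have h := (hasSum_psiCoeff hL hU f P hg h0 hN hτ).2 0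
  simp only [dotProduct_zero, Complex.ofReal_zero, neg_zero, e_zero, mul_one] at h
  exact (mulVecEquiv (SymplecticGroup.symJ (Fin 2) ℤ)).hasSum_iff.2 h

/-! ### Cosets of the Klingen subgroup -/

/-- A vector pairing to `1` with the row witnesses that the row is primitive. -/
theorem lastRow_vecMul_ne (M : Sp4) : ∃ w : Fin 2 ⊕ Fin 2 → ℤ, (lastRow ᵥ* M.val) ⬝ᵥ w = 1 := by
  refine ⟨(M⁻¹ : Sp4).val *ᵥ lastRow, ?_⟩
  have : M.val * (M⁻¹ : Sp4).val = 1 := congrArg Subtype.val (mul_inv_cancel M)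
  rw [Matrix.dotProduct_mulVec, Matrix.vecMul_vecMul, this, Matrix.vecMul_one]
  simp [lastRow]

theorem klingen_mk_eq {M N : Sp4} :
    (Quotient.mk (QuotientGroup.rightRel klingen) M) = Quotient.mk _ N ↔
      lastRow ᵥ* M.val = lastRow ᵥ* N.val := by
  rw [Quotient.eq, QuotientGroup.rightRel_apply]
  change lastRow ᵥ* (N.val * (M⁻¹ : Sp4).val) = lastRow ↔ _
  have h1 : M.val * (M⁻¹ : Sp4).val = 1 := congrArg Subtype.val (mul_inv_cancel M)
  have h2 : (M⁻¹ : Sp4).val * M.val = 1 := congrArg Subtype.val (inv_mul_cancel M)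
  rw [← Matrix.vecMul_vecMul]
  constructor
  · intro h
    nth_rewrite 1 [← h]
    rw [Matrix.vecMul_vecMul, h2, Matrix.vecMul_one]
  · intro h
    rw [← h, Matrix.vecMul_vecMul, h1, Matrix.vecMul_one]

/-- The non-zero vector attached to a coset of the Klingen subgroup and a multiplicity. -/
noncomputable def cosetRow (p : KlingenCosets × ℕ+) : {r : Fin 2 ⊕ Fin 2 → ℤ // r ≠ 0} :=
  ⟨(p.2 : ℤ) • (lastRow ᵥ* p.1.out.val), by
    obtain ⟨w, hw⟩ := lastRow_vecMul_ne p.1.out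
    intro h
    have h1 := congrArg (· ⬝ᵥ w) h
    simp only [smul_dotProduct, hw, zero_dotProduct, smul_eq_mul, mul_one] at h1
    exact p.2.ne_zero (by exact_mod_cast h1)⟩

/-- A nonzero integral row is uniquely a positive multiple of a primitive one. Primitive rows form a
single orbit, and the stabilizer of the last row is the Klingen subgroup. -/
theorem cosetRow_bijective : Function.Bijective cosetRow := by
  constructor
  · rintro ⟨q, k⟩ ⟨q', k'⟩ h
    have h1 : (k : ℤ) • (lastRow ᵥ* q.out.val) = (k' : ℤ) • (lastRow ᵥ* q'.out.val) :=
      congrArg Subtype.val h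
    obtain ⟨w, hw⟩ := lastRow_vecMul_ne q.out
    obtain ⟨w', hw'⟩ := lastRow_vecMul_ne q'.out
    have h2 := congrArg (· ⬝ᵥ w) h1
    have h3 := congrArg (· ⬝ᵥ w') h1
    simp only [smul_dotProduct, hw, hw', smul_eq_mul, mul_one] at h2 h3
    have hk : k = k' := by
      refine PNat.eq (Nat.dvd_antisymm ?_ ?_)
      · exact Int.natCast_dvd_natCast.1 ⟨_, h3.symm⟩
      · exact Int.natCast_dvd_natCast.1 ⟨_, h2⟩
    subst hk
    have hk0 : (k : ℤ) ≠ 0 := by exact_mod_cast k.ne_zero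
    have h4 := smul_right_injective _ hk0 h1
    rw [← klingen_mk_eq, Quotient.out_eq, Quotient.out_eq] at h4
    rw [h4]
  · rintro ⟨r, hr⟩
    obtain ⟨N, -, k, hk⟩ := exists_vecMul_eq_lastRow ⊤ (fun _ => trivial) (fun _ _ => trivial)
      trivial r
    have h1 : N.val * (N⁻¹ : Sp4).val = 1 := congrArg Subtype.val (mul_inv_cancel N)
    have h2 : r = (k : ℤ) • (lastRow ᵥ* (N⁻¹ : Sp4).val) := by
      rw [← Matrix.smul_vecMul, ← hk, Matrix.vecMul_vecMul, h1, Matrix.vecMul_one]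
    have hk0 : 0 < k := by
      rcases Nat.eq_zero_or_pos k with rfl | h
      · exact absurd (by simpa using h2) hr
      · exact h
    refine ⟨(Quotient.mk _ N⁻¹, ⟨k, hk0⟩), Subtype.ext ?_⟩
    change (k : ℤ) • (lastRow ᵥ* _) = r
    rw [h2]
    congr 1
    rw [← klingen_mk_eq, Quotient.out_eq]

end Coefficients

end KM2

namespace KM2

/-! ### The summands of the theta functions -/

section Terms

variable {b : ℕ}

theorem sum_quad {ι : Type*} [Fintype ι] (S : Matrix (Fin 2) (Fin 2) ℂ) (x : ι → Fin 2 → ℝ) :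
    ∑ i, cvec (x i) ⬝ᵥ S *ᵥ cvec (x i) = ∑ j, ∑ k, S j k * ((∑ i, x i j * x i k : ℝ) : ℂ) := by
  simp only [dotProduct, Matrix.mulVec, Finset.mul_sum, Complex.ofReal_sum]
  rw [Finset.sum_comm]
  refine Finset.sum_congr rfl fun j _ => ?_
  rw [Finset.sum_comm]
  refine Finset.sum_congr rfl fun k _ => Finset.sum_congr rfl fun i _ => ?_
  simp only [cvec]
  push_cast
  ring

theorem quad_blk_sB (τ : Matrix (Fin 2) (Fin 2) ℂ) (x : Idx b × Fin 2 → ℝ) :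
    cvec x ⬝ᵥ blk (sB b τ) *ᵥ cvec x = ∑ j, ∑ k, (-Complex.I * τ j k * dotp (col x j) (col x k) +
      Complex.I * (starRingEnd ℂ) (τ j k) * dotn (col x j) (col x k)) := by
  have h1 := sum_quad ((-Complex.I) • τ) fun (i : Fin b) k => x (Sum.inl i, k)
  have h2 := sum_quad (Complex.I • cconj τ) fun (i : Fin 2) k => x (Sum.inr i, k)
  rw [dotProduct_blk, Fintype.sum_sum_type]
  refine (congrArg₂ (· + ·) h1 h2).trans ?_
  simp only [← Finset.sum_add_distrib]
  rfl

theorem dotp_comm (x y : V b) : dotp x y = dotp y x := by simp [dotp, mul_comm]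

theorem dotn_comm (x y : V b) : dotn x y = dotn y x := by simp [dotn, mul_comm]

/-- When the projections correspond under `G` to the positive and the negative coordinates, the
exponential of the theta summand is the block Gaussian in orthonormal coordinates. Serves both `L`
and `M`. -/
theorem thetaTerm_eq {G pp pm : V b →ₗ[ℝ] V b} (hp : ∀ x y, form b (pp x) (pp y) = dotp (G x) (G y))
    (hm : ∀ x y, form b (pm x) (pm y) = -dotn (G x) (G y)) (P : Pol b)
    (τ : Matrix (Fin 2) (Fin 2) ℂ) (δ l : Fin 2 → V b) :
    thetaTerm G pp pm P τ δ 0 l =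
      MvPolynomial.eval (cvec (flat fun j => G (l j))) (heat (lapMat (Idx b) (cIm τ)⁻¹) P) *
        gexp (blk (sB b τ)) 0 (flat fun j => G (l j)) * e ((-∑ j, form b (l j) (δ j) : ℝ)) := by
  rw [thetaTerm, expLap_eq_heat, cIm_inv, sub_eq_add_neg, e_add, ← mul_assoc]
  simp only [Pi.zero_apply, add_zero, smul_zero]
  congr 2
  · rw [gexp, e, quad_blk_sB]
    have hc : ∀ j, col (flat fun j => G (l j)) j = G (l j) := fun _ => rfl
    simp only [hc, Matrix.trace, Matrix.diag, Matrix.mul_apply, Fin.sum_univ_two, qMat,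
      Matrix.map_apply, Matrix.of_apply, hp, hm, zero_dotProduct]
    congr 1
    rw [dotp_comm (G (l 1)) (G (l 0)), dotn_comm (G (l 1)) (G (l 0))]
    push_cast
    ring
  · push_cast
    rfl

variable {g : V b ≃ₗ[ℝ] V b} {z : Submodule ℝ (V b)}

theorem MapsBase.thetaTerm_eq_phi (h : MapsBase g z) (P : MvPolynomial (Fin b × Fin 2) ℂ)
    (τ : Matrix (Fin 2) (Fin 2) ℂ) (l : Fin 2 → V b) :
    thetaTerm (g : V b →ₗ[ℝ] V b) (orthProj (perp z)) (orthProj z) (posPoly P) τ 0 0 l =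
      phi P τ (gflat g l) := by
  rw [thetaTerm_eq]
  · simp only [Pi.zero_apply, map_zero, Finset.sum_const_zero, neg_zero, Complex.ofReal_zero,
      e_zero, mul_one]
    rfl
  · intro x y
    rw [h.orthProj_perp, ← h.isom]
    simp [form_apply, dotp]
  · intro x y
    rw [h.orthProj_z, ← h.isom]
    simp [form_apply, dotn]

theorem MapsBase.thetaTerm_gw_eq (h : MapsBase g z) {u : V b} (hN : 0 < dotp (g u) (g u))
    (h0 : dotn (g u) (g u) = dotp (g u) (g u)) (P : Pol b)
    (τ : Matrix (Fin 2) (Fin 2) ℂ) (δ l : Fin 2 → V b) :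
    thetaTerm (gw g z u) (orthProj (wPos z u)) (orthProj (wNeg z u)) P τ δ 0 l =
      MvPolynomial.eval (cvec (cutF (g u) (gflat g l))) (heat (lapMat (Idx b) (cIm τ)⁻¹) P) *
        gexp (blk (sB b τ)) 0 (cutF (g u) (gflat g l)) * e ((-∑ j, form b (l j) (δ j) : ℝ)) := by
  have hn : dotn (g u) (g u) ≠ 0 := by rw [h0]; exact hN.ne'
  rw [h.gw_eq hN.ne' hn, thetaTerm_eq]
  · rfl
  · intro x y
    rw [h.orthProj_wPos hN.ne', ← h.isom]
    simp [form_apply, dotp]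
  · intro x y
    rw [h.orthProj_wNeg hn, ← h.isom]
    simp [form_apply, dotn]

variable {L : Submodule ℤ (V b)} {u u' : V b}

theorem splitPt_zero (m : Fin 2 → V b) : splitPt g u' m 0 = gflat g m := by
  simp [splitPt]

/-- On the dual of `M` the map `g_w` is coercive (`exists_sum_splitPt_sq_le` with `n = 0`), so the
sum is dominated by a Gaussian sum over the dual of `L`. -/
theorem MapsBase.summable_thetaSummand_gw (h : MapsBase g z) (hL : IsEvenLattice L)
    (hU : IsHyperbolicPair L u u') (P : Pol b) {τ : Matrix (Fin 2) (Fin 2) ℂ} (hτ : τ ∈ Siegel)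
    (δ : Fin 2 → V b) (γ : Fin 2 → Disc (lorentz L u u')) :
    Summable (thetaSummand (lorentz L u u') (gw g z u) (orthProj (wPos z u)) (orthProj (wNeg z u))
      P τ δ 0 γ) := by
  have hN := h.dotp_pos hU.sq hU.ne_zero
  have h0 := h.isotropic hU.sq
  obtain ⟨ε, hε, hq⟩ := sB_quad (b := b) hτ
  obtain ⟨C, ε, hε, hd⟩ := gaussDecay_eval_mul_gexp hε hq (heat (lapMat (Idx b) (cIm τ)⁻¹) P) 0
  obtain ⟨K, hK, hb⟩ := exists_sum_splitPt_sq_le hU h.isom h0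
  have hC : 0 ≤ C := by
    have h1 := (norm_nonneg _).trans (hd 0)
    simpa using h1
  set F : (Idx b × Fin 2 → ℝ) → ℂ := fun x => ((Real.exp (-(ε / K) * ∑ q, x q ^ 2) : ℝ) : ℂ) with hF
  have hG : GaussDecay F := ⟨1, ε / K, by positivity, fun x => by
    rw [hF, Complex.norm_real, Real.norm_of_nonneg (Real.exp_pos _).le, one_mul]⟩
  have h1 := (hG.summable_dualLat hL g).norm
  let ι : Coset (lorentz L u u') γ → Fin 2 → dualLat L :=
    fun l j => ⟨(l.val j : V b), dual_lorentz_le hL hU (l.val j).2⟩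
  have hι : Function.Injective ι := by
    intro l l' hl
    refine Subtype.ext (funext fun j => Subtype.ext ?_)
    exact congrArg (fun y : Fin 2 → dualLat L => (y j : V b)) hl
  refine Summable.of_norm_bounded ((h1.comp_injective hι).mul_left C) fun l => ?_
  rw [thetaSummand, h.thetaTerm_gw_eq hN h0, norm_mul, norm_e_real, mul_one]
  refine (hd _).trans (mul_le_mul_of_nonneg_left ?_ hC)
  rw [Function.comp_apply, hF, Complex.norm_real, Real.norm_of_nonneg (Real.exp_pos _).le,
    Real.exp_le_exp]
  have h3 := hb (fun j => (l.val j : V b)) (fun j => form_dual_lorentz (l.val j).2) 0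
  simp only [splitPt_zero, Pi.zero_apply, Int.cast_zero, ne_eq, OfNat.ofNat_ne_zero,
    not_false_eq_true, zero_pow, Finset.sum_const_zero, add_zero] at h3
  rw [neg_mul, neg_mul, neg_le_neg_iff, div_mul_eq_mul_div, div_le_iff₀ hK, mul_assoc,
    mul_comm _ K]
  exact mul_le_mul_of_nonneg_left h3 hε.le

end Terms

end KM2

namespace KM2

/-! ### The Fourier coefficients at multiples of the last row -/

section LastRow

variable {b : ℕ} {L : Submodule ℤ (V b)} {u u' : V b} {g : V b ≃ₗ[ℝ] V b}
  {z : Submodule ℝ (V b)}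

/-- For multiples of the last row the component `n` vanishes, so only vectors orthogonal to `u`
contribute; the frequency along `u` is `(0, -k)`. -/
theorem J_mulVec_lastRow (k : ℕ) : (Matrix.J (Fin 2) ℤ *ᵥ ((k : ℤ) • lastRow)) =
    Sum.elim ![0, -(k : ℤ)] 0 := by
  rw [Matrix.mulVec_smul]
  funext i
  rcases i with i | i <;> fin_cases i <;> simp [Matrix.J, lastRow]

/-- Identifies the phase of the theta function of `M` with the phase from recentering the Gaussian;
this is why `μ` occurs. -/
theorem MapsBase.form_smul_mu (h : MapsBase g z) (hU : IsHyperbolicPair L u u') (r : ℝ)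
    {l : Fin 2 → V b} (hl : form b (l 1) u' = 0) :
    -∑ j, form b (l j) ((![0, r • mu z u u'] : Fin 2 → V b) j) =
      ![0, -r] ⬝ᵥ ctr (g u) (gflat g l) := by
  simp only [Fin.sum_univ_two, Matrix.cons_val_zero, Matrix.cons_val_one, map_zero, zero_add,
    map_smul, smul_eq_mul, h.form_mu hU.sq hl, dotProduct, ctr, zero_mul]
  change _ = -r * ((dotp (g (l 1)) (g u) + dotn (g (l 1)) (g u)) / (2 * dotp (g u) (g u)))
  ring

theorem MapsBase.det_mul_charCoeff (h : MapsBase g z) (hL : IsEvenLattice L)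
    (hU : IsHyperbolicPair L u u') (α₁ α₂ β₁ β₂ : Fin b) {τ : Matrix (Fin 2) (Fin 2) ℂ}
    (hτ : τ ∈ Siegel) (r : ℕ) (γ : Fin 2 → Disc L) :
    (((τ.map Complex.im).det : ℝ) : ℂ) * charCoeff hL hU (polPos α₁ α₂ β₁ β₂) g τ
      (Sum.elim ![0, -(r : ℤ)] 0) γ =
    (((2 * normPos z u)⁻¹ : ℝ) : ℂ) *
      ((Real.exp (-(Real.pi * r ^ 2 / (2 * normPos z u)) * (τ.map Complex.im)⁻¹ 1 1) : ℂ) *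
      ∑ h₁ ∈ Finset.range 3, ∑ h₂ ∈ Finset.range 3, (Complex.I * r / 2) ^ (h₁ + h₂) *
        (((τ.map Complex.im)⁻¹ 1 0 : ℝ) : ℂ) ^ h₁ * (((τ.map Complex.im)⁻¹ 1 1 : ℝ) : ℂ) ^ h₂ *
        toGroupAlg hL hU (thetaM L u u' g z (polW (polAlpha α₁ α₂ β₁ β₂) g z u h₁ h₂) τ
            ![0, (r : ℝ) • mu z u u'] 0) γ) := by
  have hN := h.dotp_pos hU.sq hU.ne_zero
  have h0 := h.isotropic hU.sq
  have hd : 0 < (τ.map Complex.im).det := hτ.2.det_pos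
  set δ : Fin 2 → V b := ![0, (r : ℝ) • mu z u u'] with hδ
  set c : Fin 2 → ℝ := ![0, -(r : ℝ)] with hc
  have hrc : rvec ((Sum.elim ![0, -(r : ℤ)] (0 : Fin 2 → ℤ)) ∘ Sum.inl) = c := by
    funext j
    fin_cases j <;> simp [rvec, hc]
  set y := (τ.map Complex.im)⁻¹ with hy
  have hyc : (cIm τ)⁻¹ = y.map fun x => (x : ℂ) := (cIm_inv τ).symm
  have hys : y 0 1 = y 1 0 := by
    have h1 : yᵀ = y := by
      rw [hy, Matrix.transpose_nonsing_inv, ← Matrix.transpose_map, hτ.1]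
    exact congrFun (congrFun h1 1) 0
  have hv : ∀ j, ((cIm τ)⁻¹ *ᵥ cvec c) j = -(r * (y j 1 : ℂ)) := by
    intro j
    rw [hyc]
    simp [Matrix.mulVec, dotProduct, cvec, hc, mul_comm]
  have hq : cvec c ⬝ᵥ (cIm τ)⁻¹ *ᵥ cvec c = r ^ 2 * (y 1 1 : ℂ) := by
    rw [dotProduct, Fin.sum_univ_two, hv, hv]
    simp [cvec, hc]
    ring
  have hterm : ∀ m : Coset (lorentz L u u') fun j => discProj hL hU (γ j),
      lineFT (polPos α₁ α₂ β₁ β₂) τ (g u) (splitPt g u' (fun j => (m.val j : V b)) 0) c =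
      ((((2 * normPos z u)⁻¹ * ((τ.map Complex.im).det ^ (1 / 2 : ℝ))⁻¹ : ℝ) : ℂ) *
        (Real.exp (-(Real.pi * r ^ 2 / (2 * normPos z u)) * y 1 1) : ℂ)) *
      ∑ h₁ ∈ Finset.range 3, ∑ h₂ ∈ Finset.range 3, (Complex.I * r / 2) ^ (h₁ + h₂) *
        (y 1 0 : ℂ) ^ h₁ * (y 1 1 : ℂ) ^ h₂ *
        thetaSummand (lorentz L u u') (gw g z u) (orthProj (wPos z u)) (orthProj (wNeg z u))
          (polW (polAlpha α₁ α₂ β₁ β₂) g z u h₁ h₂) τ δ 0 _ m := by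
    intro m
    have hm := fun j => form_dual_lorentz (m.val j).2
    have hX : hgt (g u) (splitPt g u' (fun j => (m.val j : V b)) 0) = 0 := by
      rw [hgt_splitPt hU h.isom fun j => (hm j).1]
      funext j
      simp [rvec]
    rw [lineFT_of_hgt_eq_zero α₁ α₂ β₁ β₂ hN hτ hX, splitPt_zero, hq, hv, hv, hys, h.normPos_eq,
      mul_comm (e _), mul_assoc, mul_assoc, mul_assoc, mul_left_comm (e _)]
    congr 1
    have hexp : Complex.exp (-(Real.pi / (2 * dotp (g u) (g u))) * (r ^ 2 * (y 1 1 : ℂ))) =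
        (Real.exp (-(Real.pi * r ^ 2 / (2 * dotp (g u) (g u))) * y 1 1) : ℂ) := by
      rw [Complex.ofReal_exp]
      congr 1
      push_cast
      ring
    rw [hexp]
    congr 1
    rw [Finset.mul_sum]
    refine Finset.sum_congr rfl fun h₁ _ => ?_
    rw [Finset.mul_sum]
    refine Finset.sum_congr rfl fun h₂ _ => ?_
    rw [thetaSummand, h.thetaTerm_gw_eq hN h0, h.polW_eq hN.ne' (by rw [h0]; exact hN.ne'), hδ,
      h.form_smul_mu hU r (hm 1).2, pow_add]
    have e1 : ∀ t : ℂ, -(Complex.I / 2) * -(r * t) = Complex.I * r / 2 * t := fun t => by ring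
    rw [e1, e1, mul_pow, mul_pow]
    ring
  have hch : charCoeff hL hU (polPos α₁ α₂ β₁ β₂) g τ (Sum.elim ![0, -(r : ℤ)] 0) γ =
      ∑' m : Coset (lorentz L u u') fun j => discProj hL hU (γ j),
        lineFT (polPos α₁ α₂ β₁ β₂) τ (g u) (splitPt g u' (fun j => (m.val j : V b)) 0) c := by
    rw [← hrc]
    rfl
  have hsum : ∀ h₁ h₂, Summable fun m : Coset (lorentz L u u') fun j => discProj hL hU (γ j) =>
      (Complex.I * r / 2) ^ (h₁ + h₂) * (y 1 0 : ℂ) ^ h₁ * (y 1 1 : ℂ) ^ h₂ *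
        thetaSummand (lorentz L u u') (gw g z u) (orthProj (wPos z u)) (orthProj (wNeg z u))
          (polW (polAlpha α₁ α₂ β₁ β₂) g z u h₁ h₂) τ δ 0 _ m := fun h₁ h₂ =>
    (h.summable_thetaSummand_gw hL hU _ hτ δ _).mul_left _
  -- The integral along the line contributes `(det y)^{-1/2}`, which turns the prefactor `det y` of
  -- the theta function of `L` into that of `M`.
  have hdet : (((τ.map Complex.im).det : ℝ) : ℂ) *
      (((τ.map Complex.im).det ^ (1 / 2 : ℝ))⁻¹ : ℝ) = ((τ.map Complex.im).det ^ (1 / 2 : ℝ) : ℝ) := by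
    rw [← Complex.ofReal_mul]
    congr 1
    rw [mul_inv_eq_iff_eq_mul₀ (by positivity), ← Real.rpow_add hd]
    norm_num
  rw [hch, tsum_congr hterm, tsum_mul_left,
    Summable.tsum_finsetSum fun h₁ _ => summable_sum fun h₂ _ => hsum h₁ h₂, ← mul_assoc,
    ← mul_assoc, Complex.ofReal_mul, mul_left_comm, hdet, mul_assoc, mul_assoc]
  congr 1
  rw [mul_left_comm]
  congr 1
  rw [Finset.mul_sum]
  refine Finset.sum_congr rfl fun h₁ _ => ?_
  rw [Summable.tsum_finsetSum fun h₂ _ => hsum h₁ h₂, Finset.mul_sum]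
  refine Finset.sum_congr rfl fun h₂ _ => ?_
  rw [tsum_mul_left, toGroupAlg, thetaM, theta]
  ring

theorem pairing_mul_left (hL : IsEvenLattice L) (a c : GroupAlg L) (s : ℂ) :
    pairing a (fun γ => s * c γ) = (starRingEnd ℂ) s * pairing a c := by
  have := finite_disc hL
  have := Fintype.ofFinite (Fin 2 → Disc L)
  rw [pairing, pairing, finsum_eq_sum_of_fintype, finsum_eq_sum_of_fintype, Finset.mul_sum]
  refine Finset.sum_congr rfl fun γ _ => ?_
  rw [map_mul]
  ring

theorem pairing_sum (hL : IsEvenLattice L) {ι : Type*} (t : Finset ι) (a : GroupAlg L)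
    (c : ι → GroupAlg L) : pairing a (fun γ => ∑ i ∈ t, c i γ) = ∑ i ∈ t, pairing a (c i) := by
  have := finite_disc hL
  have := Fintype.ofFinite (Fin 2 → Disc L)
  simp only [pairing, finsum_eq_sum_of_fintype]
  rw [Finset.sum_comm]
  refine Finset.sum_congr rfl fun γ _ => ?_
  rw [map_sum, Finset.mul_sum]

/-- The pairing conjugates the theta coefficients, and the conjugate of `ir/2` is `r/(2i)`, the
factor in `h_α`. -/
theorem MapsBase.rowCoeff_smul_lastRow (h : MapsBase g z) (hL : IsEvenLattice L)
    (hU : IsHyperbolicPair L u u') (f : Matrix (Fin 2) (Fin 2) ℂ → GroupAlg L)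
    (α₁ α₂ β₁ β₂ : Fin b) {τ : Matrix (Fin 2) (Fin 2) ℂ} (hτ : τ ∈ Siegel) (r : ℕ) :
    rowCoeff hL hU f (polPos α₁ α₂ β₁ β₂) g τ ((r : ℤ) • lastRow) =
      (detPow b τ / (2 * normPos z u) : ℝ) * hTerm hL hU f α₁ α₂ β₁ β₂ g z τ r := by
  rw [rowCoeff, J_mulVec_lastRow, psiCoeff]
  simp only [h.det_mul_charCoeff hL hU α₁ α₂ β₁ β₂ hτ r]
  rw [pairing_mul_left hL, pairing_mul_left hL, pairing_sum hL, Complex.conj_ofReal,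
    Complex.conj_ofReal, hTerm, div_eq_mul_inv (detPow b τ), Complex.ofReal_mul, mul_assoc]
  congr 3
  refine Finset.sum_congr rfl fun h₁ _ => ?_
  rw [pairing_sum hL]
  refine Finset.sum_congr rfl fun h₂ _ => ?_
  rw [pairing_mul_left hL]
  congr 1
  simp only [map_mul, map_pow, map_div₀, Complex.conj_ofReal, Complex.conj_I, map_natCast,
    map_ofNat]
  congr 3
  rw [div_mul_eq_div_div_swap, Complex.div_I]
  ring

/-- At `r = 0` the Gaussian factor is `1` and only `h₁ = h₂ = 0` survives. -/
theorem MapsBase.firstPart_eq (h : MapsBase g z) (hL : IsEvenLattice L)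
    (hU : IsHyperbolicPair L u u') (f : Matrix (Fin 2) (Fin 2) ℂ → GroupAlg L)
    (α₁ α₂ β₁ β₂ : Fin b) {τ : Matrix (Fin 2) (Fin 2) ℂ} (hτ : τ ∈ Siegel) :
    firstPart hL hU f α₁ α₂ β₁ β₂ g z τ = rowCoeff hL hU f (polPos α₁ α₂ β₁ β₂) g τ 0 := by
  have h1 := h.rowCoeff_smul_lastRow hL hU f α₁ α₂ β₁ β₂ hτ 0
  rw [Nat.cast_zero, zero_smul] at h1
  rw [h1, firstPart, hTerm]
  congr 1
  have h2 : (![0, ((0 : ℕ) : ℝ) • mu z u u'] : Fin 2 → V b) = 0 := by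
    funext j
    fin_cases j <;> simp
  rw [h2]
  simp [Finset.sum_range_succ]

theorem MapsBase.psi_zero (h : MapsBase g z) (f : Matrix (Fin 2) (Fin 2) ℂ → GroupAlg L)
    (α₁ α₂ β₁ β₂ : Fin b) (τ : Matrix (Fin 2) (Fin 2) ℂ) :
    integrand L f α₁ α₂ β₁ β₂ g z τ = psi f (polPos α₁ α₂ β₁ β₂) g u τ 0 := by
  rw [integrand, psi]
  congr 2
  funext γ
  rw [thetaL, theta, Real.rpow_one, thetaChar]
  congr 1
  refine tsum_congr fun l => ?_
  rw [thetaSummand, polAlpha_eq, h.thetaTerm_eq_phi, charFn]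
  have h1 : line (g u) ((0 : Fin 2 ⊕ Fin 2 → ℝ) ∘ Sum.inl) = 0 := by
    funext p
    simp [line]
  have h2 : ((0 : Fin 2 ⊕ Fin 2 → ℝ) ∘ Sum.inr) = 0 := rfl
  rw [h1, h2, add_zero, zero_dotProduct, Complex.ofReal_zero, e_zero, mul_one]

end LastRow

end KM2

namespace KM2

/-! ### The decomposition of the integrand -/

section Decomposition

variable {b : ℕ} {L : Submodule ℤ (V b)} {u u' : V b} {g : V b ≃ₗ[ℝ] V b}
  {z : Submodule ℝ (V b)} {f : Matrix (Fin 2) (Fin 2) ℂ → GroupAlg L}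

theorem MapsBase.act_mem_Siegel (h : MapsBase g z) (hL : IsEvenLattice L)
    (hU : IsHyperbolicPair L u u') (hf : IsSiegelCuspForm L f) (α₁ α₂ β₁ β₂ : Fin b)
    {τ : Matrix (Fin 2) (Fin 2) ℂ} (hτ : τ ∈ Siegel) (M : Sp4) : act M τ ∈ Siegel :=
  (act_mem_Siegel_and_psi_act (g := g) hL hf (isDetSq_polPos α₁ α₂ β₁ β₂) h.isom hU.sq M hτ).2.1

theorem MapsBase.summable_hTerm (h : MapsBase g z) (hL : IsEvenLattice L)
    (hU : IsHyperbolicPair L u u') (f : Matrix (Fin 2) (Fin 2) ℂ → GroupAlg L)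
    (α₁ α₂ β₁ β₂ : Fin b) {τ : Matrix (Fin 2) (Fin 2) ℂ} (hτ : τ ∈ Siegel) :
    Summable fun r : ℕ+ => hTerm hL hU f α₁ α₂ β₁ β₂ g z τ r := by
  have hN := h.dotp_pos hU.sq hU.ne_zero
  have hs := (hasSum_rowCoeff hL hU f (polPos α₁ α₂ β₁ β₂) h.isom (h.isotropic hU.sq) hN hτ).summable
  have hinj : Function.Injective fun r : ℕ+ => ((r : ℕ) : ℤ) • lastRow := by
    intro r r' hr
    have h1 := congrFun hr (Sum.inr 1)
    simp only [lastRow, Pi.smul_apply, Pi.single_eq_same, smul_eq_mul, mul_one] at h1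
    exact PNat.eq (by exact_mod_cast h1)
  have h1 := hs.comp_injective hinj
  have hc : ((detPow b τ / (2 * normPos z u) : ℝ) : ℂ) ≠ 0 := by
    have : 0 < detPow b τ := Real.rpow_pos_of_pos hτ.2.det_pos _
    rw [h.normPos_eq]
    exact_mod_cast (by positivity : detPow b τ / (2 * dotp (g u) (g u)) ≠ 0)
  refine (summable_mul_left_iff hc).1 (h1.congr fun r => ?_)
  exact h.rowCoeff_smul_lastRow hL hU f α₁ α₂ β₁ β₂ hτ r

theorem MapsBase.hFun_act (h : MapsBase g z) (hL : IsEvenLattice L)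
    (hU : IsHyperbolicPair L u u') (hf : IsSiegelCuspForm L f) (α₁ α₂ β₁ β₂ : Fin b)
    {τ : Matrix (Fin 2) (Fin 2) ℂ} (hτ : τ ∈ Siegel) (M : Sp4) :
    hFun hL hU f α₁ α₂ β₁ β₂ g z (act M τ) =
      ∑' r : ℕ+, rowCoeff hL hU f (polPos α₁ α₂ β₁ β₂) g τ (((r : ℕ) : ℤ) • (lastRow ᵥ* M.val)) := by
  have hN := h.dotp_pos hU.sq hU.ne_zero
  rw [hFun, ← tsum_mul_left]
  refine tsum_congr fun r => ?_
  rw [← h.rowCoeff_smul_lastRow hL hU f α₁ α₂ β₁ β₂ (h.act_mem_Siegel hL hU hf α₁ α₂ β₁ β₂ hτ M) r,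
    rowCoeff_act hL hU hf (isDetSq_polPos α₁ α₂ β₁ β₂) h.isom (h.isotropic hU.sq) hN hτ,
    Matrix.smul_vecMul]

/-- An element of the Klingen subgroup fixes the last row, and so every index in the sum for `h_α`.
-/
theorem MapsBase.hFun_act_of_mem_klingen (h : MapsBase g z) (hL : IsEvenLattice L)
    (hU : IsHyperbolicPair L u u') (hf : IsSiegelCuspForm L f) (α₁ α₂ β₁ β₂ : Fin b)
    {τ : Matrix (Fin 2) (Fin 2) ℂ} (hτ : τ ∈ Siegel) {K : Sp4} (hK : K ∈ klingen) :
    hFun hL hU f α₁ α₂ β₁ β₂ g z (act K τ) = hFun hL hU f α₁ α₂ β₁ β₂ g z τ := by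
  have hK' : lastRow ᵥ* K.val = lastRow := hK
  rw [h.hFun_act hL hU hf α₁ α₂ β₁ β₂ hτ, hK', hFun, ← tsum_mul_left]
  exact tsum_congr fun r => h.rowCoeff_smul_lastRow hL hU f α₁ α₂ β₁ β₂ hτ r

/-- The absolutely convergent sum of all `rowCoeff` is split into the zero row and the nonzero rows;
the latter are grouped by Klingen cosets, with the multiplicity as inner index. -/
theorem MapsBase.integrand_eq (h : MapsBase g z) (hL : IsEvenLattice L)
    (hU : IsHyperbolicPair L u u') (hf : IsSiegelCuspForm L f) (α₁ α₂ β₁ β₂ : Fin b)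
    {τ : Matrix (Fin 2) (Fin 2) ℂ} (hτ : τ ∈ Siegel) :
    (Summable fun M : KlingenCosets => hFun hL hU f α₁ α₂ β₁ β₂ g z (act M.out τ)) ∧
      integrand L f α₁ α₂ β₁ β₂ g z τ =
        firstPart hL hU f α₁ α₂ β₁ β₂ g z τ +
          ∑' M : KlingenCosets, hFun hL hU f α₁ α₂ β₁ β₂ g z (act M.out τ) := by
  have hN := h.dotp_pos hU.sq hU.ne_zero
  set F := rowCoeff hL hU f (polPos α₁ α₂ β₁ β₂) g τ with hF
  have hs : HasSum F _ := hasSum_rowCoeff hL hU f (polPos α₁ α₂ β₁ β₂) h.isom (h.isotropic hU.sq) hN hτ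
  have hs1 : Summable fun p => F (cosetRow p).1 :=
    hs.summable.comp_injective (Subtype.val_injective.comp cosetRow_bijective.1)
  have hs2 : Summable fun M : KlingenCosets => ∑' r : ℕ+, F (cosetRow (M, r)).1 := hs1.prod
  have hfun : ∀ M : KlingenCosets, hFun hL hU f α₁ α₂ β₁ β₂ g z (act M.out τ) =
      ∑' r : ℕ+, F (cosetRow (M, r)).1 := fun M => h.hFun_act hL hU hf α₁ α₂ β₁ β₂ hτ M.out
  simp only [hfun]
  refine ⟨hs2, ?_⟩
  rw [h.psi_zero (u := u), ← hs.tsum_eq, h.firstPart_eq hL hU f α₁ α₂ β₁ β₂ hτ, ← hs1.tsum_prod,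
    ← hs.summable.tsum_subtype_add_tsum_subtype_compl {0}, tsum_singleton]
  congr 1
  exact ((Equiv.ofBijective _ cosetRow_bijective).tsum_eq
    fun r : {r : Fin 2 ⊕ Fin 2 → ℤ // r ≠ 0} => F r.1).symm

end Decomposition

end KM2

theorem mainTheorem12 (b : ℕ) (L : Submodule ℤ (V b)) (hL : IsEvenLattice L) (u u' : V b)
    (hU : IsHyperbolicPair L u u')
    (f : Matrix (Fin 2) (Fin 2) ℂ → GroupAlg L) (hf : IsSiegelCuspForm L f)
    (α₁ α₂ β₁ β₂ : Fin b)
    (g : V b ≃ₗ[ℝ] V b) (hg : g ∈ SOV b) (z : Submodule ℝ (V b)) (hz : z ∈ Gr b)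
    (hgz : z.map (g : V b →ₗ[ℝ] V b) = basePoint b) :
    -- the theta series converge absolutely
    (∀ τ ∈ Siegel,
      (∀ γ, Summable (thetaSummand L g (orthProj (perp z)) (orthProj z)
        (polAlpha α₁ α₂ β₁ β₂) τ 0 0 γ)) ∧
      (∀ (r h₁ h₂ : ℕ) γ, Summable (thetaSummand (lorentz L u u') (gw g z u)
        (orthProj (wPos z u)) (orthProj (wNeg z u))
        (polW (polAlpha α₁ α₂ β₁ β₂) g z u h₁ h₂) τ ![0, (r : ℝ) • mu z u u'] 0 γ))) ∧
    -- the series defining `h_α` converges absolutely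
    (∀ τ ∈ Siegel, Summable fun r : ℕ+ => hTerm hL hU f α₁ α₂ β₁ β₂ g z τ r) ∧
    -- `h_α` is invariant under the Klingen subgroup
    (∀ K ∈ klingen, ∀ τ ∈ Siegel,
      hFun hL hU f α₁ α₂ β₁ β₂ g z (act K τ) = hFun hL hU f α₁ α₂ β₁ β₂ g z τ) ∧
    -- the decomposition of the integrand
    (∀ τ ∈ Siegel,
      (Summable fun M : KlingenCosets => hFun hL hU f α₁ α₂ β₁ β₂ g z (act M.out τ)) ∧
      integrand L f α₁ α₂ β₁ β₂ g z τ =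
        firstPart hL hU f α₁ α₂ β₁ β₂ g z τ +
          ∑' M : KlingenCosets, hFun hL hU f α₁ α₂ β₁ β₂ g z (act M.out τ)) := by
  have h : MapsBase g z := ⟨hg.1, hgz⟩
  refine ⟨fun τ hτ => ⟨fun γ => ?_, fun r h₁ h₂ γ => ?_⟩,
    fun τ hτ => h.summable_hTerm hL hU f α₁ α₂ β₁ β₂ hτ,
    fun K hK τ hτ => h.hFun_act_of_mem_klingen hL hU hf α₁ α₂ β₁ β₂ hτ hK,
    fun τ hτ => h.integrand_eq hL hU hf α₁ α₂ β₁ β₂ hτ⟩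
  · refine ((gaussDecay_phi (polPos α₁ α₂ β₁ β₂) hτ).summable_coset hL g γ).congr fun l => ?_
    rw [thetaSummand, polAlpha_eq, h.thetaTerm_eq_phi]
  · exact h.summable_thetaSummand_gw hL hU _ hτ _ γ
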